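/- **Setting.** Let $\Omega\subset\mathbb R^d$ be a bounded open set containing finitely many fractures $D_{f,l}$ of codimension one; each is the image of a bounded open set of $\mathbb R^{d-1}$ under an injective, locally isometric $C^1$ map into $\Omega$ that extends to a $C^1$ map on $\mathbb R^{d-1}$ (for $d=2$: a $C^1$ curve parametrized by arc length). Let $D_m$ be the complement of the fractures, $\nabla_f$ the tangential gradient on the fractures, and let $V$ be the space of pairs $p=(p_1,p_2)$ in the closure of $[C_c^\infty(\Omega)]^2$ in the norm $\sum_i\big(\|p_i\|^2_{H^1(\Omega)}+\sum_l\|p_i\|_{H^1(D_{f,l})}^2\big)$ (so $V=[H^1_0(\Omega)]^2$ if there are no fractures). For $D\subset\Omega$ let $V(D)$ be the closure, in the same norm over $D$, of the restrictions of $V$ to $D$, and let $V_0(D)\subset V$ be the closure of $[C_c^\infty(\Omega\cap\operatorname{int}D)]^2$. Let $\rho,\sigma\ge0$, and let $\kappa_i$ on $\Omega$ and $\kappa_{l,i}$ on $D_{f,l}$ ($i=1,2$) be measurable with values in $[\underline\kappa,\overline\kappa]$, $\underline\kappa>0$. Put $$a_Q(p,v)=\sum_{i}\Big(\int_{D_m}\kappa_i\nabla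 p_i\cdot\nabla v_i\,dx+\sum_l\int_{D_{f,l}}\kappa_{l,i}\nabla_fp_i\cdot\nabla_fv_i\,ds\Big)+\sum_{i,l}\rho\sigma\int_\Omega(p_i-p_l)v_i\,dx ,\qquad \|p\|_{a_Q}^2=a_Q(p,p).$$ Write $u\in D(\mathcal A)$, $\mathcal Au=f$ if $u\in V$, $f\in[L^2(\Omega)]^2$ and $(f,v)_{[L^2(\Omega)]^2}=a_Q(u,v)$ for all $v\in V$. Let $\{K_j\}_{j=1}^N$ be a conforming mesh of $\overline\Omega$ by multilinear images of the unit cube (for $d=2$: quadrilaterals), with multilinear nodal partition of unity $\{\chi_k\}$; the reference maps $F_j$ satisfy $\theta^{-1}H|\xi-\eta|\le|F_j\xi-F_j\eta|\le\theta H|\xi-\eta|$, where $H$ is the mesh size and $\theta\ge1$ the regularity constant. Let $a_Q^{(j)}$ be the form $a_Q$ with all integrals restricted to $K_j$, and $$s^{(j)}(p,v)=\sum_i\Big(\int_{K_j}\kappa_i\sum_k|\nabla\chi_k|^2p_iv_i\,dx+\sum_l\int_{D_{f,l}\cap K_j}\kappa_{l,i}\sum_k|\nabla_f\chi_k|^2p_iv_i\,ds\Big).$$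 Let $\lambda_1^{(j)}\le\lambda_2^{(j)}\le\dots$ be all the eigenvalues, with multiplicity, of $a_Q^{(j)}(\phi,v)=\lambda s^{(j)}(\phi,v)$ for all $v\in V(K_j)$, with $s^{(j)}$-orthogonal eigenfunctions $\phi_k^{(j)}\in V(K_j)$. Given numbers $L_j$, let $V_{aux}^{(j)}=\operatorname{span}\{\phi^{(j)}_k:k\le L_j\}$, $\Lambda=\min_j\lambda^{(j)}_{L_j+1}$, $\lambda_{\max}=\max_{j,\,k\le L_j}\lambda_k^{(j)}$ and $C_\pi=\sup_{j,\,0\neq\nu\in V_{aux}^{(j)}}s^{(j)}(\nu,\nu)/s^{(j)}(B_j\nu,\nu)$, where $B_j$ is the product of the functions $\chi_k$ over the vertices $k$ of $K_j$. Let $K_{j,m}$ be $K_j$ enlarged by $m$ layers of elements. For $k\le L_j$ let $\psi^{(j)}_{k,ms}$ minimize $a_Q(\psi,\psi)$ among the $\psi\in V_0(K_{j,m})$ with $s^{(j')}(\psi,\phi^{(j')}_{k'})=\delta_{jj'}\delta_{kk'}$ for all $j'$ and all $k'\le L_{j'}$. Let $V_{ms}$ be the span of all the $\psi^{(j)}_{k,ms}$,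 and let $R_{ms}u\in V_{ms}$ be defined by $a_Q(R_{ms}u,v)=a_Q(u,v)$ for all $v\in V_{ms}$. **Lemma.** There is a constant $C>0$ depending only on $\Omega$, the fractures and $\theta$, and for all $\underline\kappa,\Lambda_0,M>0$ and $\rho,\sigma\ge0$ there is a constant $c_0>0$ depending only on these numbers, on $\Omega$, the fractures and $\theta$, such that the following holds for every mesh size $H$, every such mesh, all such $\kappa_i,\kappa_{l,i}$ and all $L_j$ with $\Lambda\ge\Lambda_0$, $\lambda_{\max}\le M$ and $C_\pi\le M$: if $m\ge2$ and $m\ge c_0\max\{1,\log(\overline\kappa/H)\}$, then for every $u\in D(\mathcal A)$ $$\|u-R_{ms}u\|_{a_Q}\le C\,H\,\underline\kappa^{-1/2}\Lambda^{-1/2}\,\|\mathcal Au\|_{[L^2(\Omega)]^2},\qquad \|u-R_{ms}u\|_{[L^2(\Omega)]^2}\le C\,H^2\,\underline\kappa^{-1}\Lambda^{-1}\,\|\mathcal Au\|_{[L^2(\Omega)]^2}.$$ -/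

import Mathlib

open MeasureTheory
open scoped ContDiff RealInnerProductSpace

noncomputable section

namespace DualContinuum

/-- The Euclidean space `ℝᵈ`. -/
abbrev Euc (d : ℕ) : Type := EuclideanSpace ℝ (Fin d)

/-- The computational domain `Ω ⊂ ℝᵈ`, `d = n + 1`, together with finitely many fractures.
Fractures have codimension one. The fracture `D_l` is the injective `C¹` image `emb l '' U l` of a
bounded open set `U l ⊂ ℝⁿ`, and `emb l` preserves lengths infinitesimally: for `d = 2` it is the
parametrization of a `C¹` curve by arc length. Hence the surface measure `ds` on `D_l` is the image
of Lebesgue measure on `U l`, and the tangential gradient of `p` on `D_l` is, read in the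
parameter, the gradient of `p ∘ emb l`. -/
structure Geometry (n : ℕ) where
  /-- the domain -/
  Ω : Set (Euc (n + 1))
  isOpen_Ω : IsOpen Ω
  isBounded_Ω : Bornology.IsBounded Ω
  /-- the number of fractures -/
  numFrac : ℕ
  /-- parameter domains of the fractures -/
  U : Fin numFrac → Set (Euc n)
  isOpen_U : ∀ l, IsOpen (U l)
  isBounded_U : ∀ l, Bornology.IsBounded (U l)
  /-- parametrizations of the fractures -/
  emb : Fin numFrac → Euc n → Euc (n + 1)
  contDiff_emb : ∀ l, ContDiff ℝ 1 (emb l)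
  isometric_emb : ∀ l, ∀ t ∈ U l, ∀ v, ‖fderiv ℝ (emb l) t v‖ = ‖v‖
  injOn_emb : ∀ l, Set.InjOn (emb l) (U l)
  mapsTo_emb : ∀ l, Set.MapsTo (emb l) (U l) Ω

variable {n : ℕ}

/-! ### Function spaces -/

/-- A scalar unknown with its derivatives: values and gradient in the bulk, values (traces) and
tangential gradient on each of `k` fractures, the latter read in the parameter. -/
abbrev ScalarField (n k : ℕ) : Type :=
  (Euc (n + 1) → ℝ) × (Euc (n + 1) → Euc (n + 1)) × (Fin k → Euc n → ℝ) × (Fin k → Euc n → Euc n)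

namespace ScalarField

variable {k : ℕ}

/-- bulk values -/
abbrev val (w : ScalarField n k) : Euc (n + 1) → ℝ := w.1

/-- bulk gradient -/
abbrev grad (w : ScalarField n k) : Euc (n + 1) → Euc (n + 1) := w.2.1

/-- traces on the fractures -/
abbrev fval (w : ScalarField n k) : Fin k → Euc n → ℝ := w.2.2.1

/-- tangential gradients on the fractures -/
abbrev fgrad (w : ScalarField n k) : Fin k → Euc n → Euc n := w.2.2.2

end ScalarField

/-- A pair `p = (p₁, p₂)` of unknowns, one for each continuum. -/
abbrev Field (n k : ℕ) : Type := Fin 2 → ScalarField n k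

/-- The field of a smooth function: the function, its gradient, its restrictions to the fractures,
and their tangential gradients. -/
def smoothField (G : Geometry n) (f : Euc (n + 1) → ℝ) : ScalarField n G.numFrac :=
  (f, fun x => gradient f x, fun l t => f (G.emb l t), fun l t => gradient (fun r => f (G.emb l r)) t)

/-- The part of the parameter domain of the fracture `l` that lies in the region `R`. -/
def fracPart (G : Geometry n) (R : Set (Euc (n + 1))) (l : Fin G.numFrac) : Set (Euc n) :=
  G.U l ∩ G.emb l ⁻¹' R

/-- All components of `w` are square integrable over the region `R`. -/
structure SquareIntegrable (G : Geometry n) (R : Set (Euc (n + 1)))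
    (w : ScalarField n G.numFrac) : Prop where
  val : MemLp w.val 2 (volume.restrict R)
  grad : MemLp w.grad 2 (volume.restrict R)
  fval : ∀ l, MemLp (w.fval l) 2 (volume.restrict (fracPart G R l))
  fgrad : ∀ l, MemLp (w.fgrad l) 2 (volume.restrict (fracPart G R l))

/-- All components of `w` have `L²` norm at most `ε` over the region `R`. -/
structure NormLE (G : Geometry n) (R : Set (Euc (n + 1)))
    (w : ScalarField n G.numFrac) (ε : ℝ) : Prop where
  val : eLpNorm w.val 2 (volume.restrict R) ≤ ENNReal.ofReal ε
  grad : eLpNorm w.grad 2 (volume.restrict R) ≤ ENNReal.ofReal ε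
  fval : ∀ l, eLpNorm (w.fval l) 2 (volume.restrict (fracPart G R l)) ≤ ENNReal.ofReal ε
  fgrad : ∀ l, eLpNorm (w.fgrad l) 2 (volume.restrict (fracPart G R l)) ≤ ENNReal.ofReal ε

/-- `w` lies in the closure of `C_c^∞(O)` in the `H¹` norm over the region `R` (bulk and
fractures). -/
def MemClosure (G : Geometry n) (O R : Set (Euc (n + 1))) (w : ScalarField n G.numFrac) : Prop :=
  SquareIntegrable G R w ∧
    ∀ ε : ℝ, 0 < ε → ∃ f : Euc (n + 1) → ℝ, ContDiff ℝ ∞ f ∧ HasCompactSupport f ∧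
      tsupport f ⊆ O ∧ NormLE G R (w - smoothField G f) ε

/-- `p ∈ V = [H₀¹(Ω)]²`. Without fractures this is the usual space; with fractures, the energy
space: `H₀¹` in the bulk and `H¹` on the fractures. -/
def MemV (G : Geometry n) (p : Field n G.numFrac) : Prop :=
  ∀ i, MemClosure G G.Ω G.Ω (p i)

/-- `p ∈ V(D)`: the restrictions of `V` to `D ⊂ Ω`, closed in the `H¹` norm over `D`. -/
def MemVOn (G : Geometry n) (D : Set (Euc (n + 1))) (p : Field n G.numFrac) : Prop :=
  ∀ i, MemClosure G G.Ω D (p i)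

/-- `p ∈ V₀(D)`: zero trace on `∂D`, extended by zero to `Ω`. -/
def MemVZero (G : Geometry n) (D : Set (Euc (n + 1))) (p : Field n G.numFrac) : Prop :=
  ∀ i, MemClosure G (G.Ω ∩ interior D) G.Ω (p i)

/-! ### Coefficients -/

/-- Permeabilities of the two continua, in the bulk and on the fractures, bounded between
`κmin` and `κmax`. -/
structure Permeability (G : Geometry n) (κmin κmax : ℝ) where
  /-- bulk permeability `κ_i` -/
  bulk : Fin 2 → Euc (n + 1) → ℝ
  /-- fracture permeability `κ_{l,i}` -/
  frac : Fin G.numFrac → Fin 2 → Euc (n + 1) → ℝ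
  measurable_bulk : ∀ i, Measurable (bulk i)
  measurable_frac : ∀ l i, Measurable (frac l i)
  bulk_bounds : ∀ i, ∀ x ∈ G.Ω, κmin ≤ bulk i x ∧ bulk i x ≤ κmax
  frac_bounds : ∀ l i, ∀ t ∈ G.U l, κmin ≤ frac l i (G.emb l t) ∧ frac l i (G.emb l t) ≤ κmax

/-! ### The coarse mesh -/

/-- The reference cube `[0,1]ᵈ`. -/
def refCube (d : ℕ) : Set (Euc d) := {ξ | ∀ i, 0 ≤ ξ i ∧ ξ i ≤ 1}

/-- The multilinear shape function of the corner `b` of the reference cube. -/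
def shape {d : ℕ} (b : Fin d → Bool) (ξ : Euc d) : ℝ :=
  ∏ i, if b i then ξ i else 1 - ξ i

/-- A conforming mesh of `Ω` by (multi-)linearly mapped cubes (for `d = 2`: quadrilaterals) of
mesh size `H`, with the multilinear partition of unity of its vertices. The number `θ` bounds the
shape regularity and the quasi-uniformity. -/
structure CoarseMesh (G : Geometry n) (θ H : ℝ) where
  /-- the number of vertices -/
  numVert : ℕ
  /-- the number of elements -/
  numElem : ℕ
  /-- positions of the vertices -/
  pos : Fin numVert → Euc (n + 1)
  /-- the vertices of an element, indexed by the corners of the reference cube -/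
  vert : Fin numElem → (Fin (n + 1) → Bool) → Fin numVert
  /-- the partition of unity -/
  chi : Fin numVert → Euc (n + 1) → ℝ
  bilipschitz : ∀ j, ∀ ξ ∈ refCube (n + 1), ∀ η ∈ refCube (n + 1),
    H / θ * ‖ξ - η‖ ≤ ‖(∑ b, shape b ξ • pos (vert j b)) - ∑ b, shape b η • pos (vert j b)‖ ∧
    ‖(∑ b, shape b ξ • pos (vert j b)) - ∑ b, shape b η • pos (vert j b)‖ ≤ θ * H * ‖ξ - η‖
  cover : ⋃ j, (fun ξ => ∑ b, shape b ξ • pos (vert j b)) '' refCube (n + 1) = closure G.Ω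
  disjoint : ∀ i j, i ≠ j →
    Disjoint (interior ((fun ξ => ∑ b, shape b ξ • pos (vert i b)) '' refCube (n + 1)))
      (interior ((fun ξ => ∑ b, shape b ξ • pos (vert j b)) '' refCube (n + 1)))
  /-- `chi k` is the nodal function of the vertex `k`: it is a sum of shape functions in the
  reference coordinates of each element, consistently on common faces. -/
  chi_eq : ∀ j k, ∀ ξ ∈ refCube (n + 1),
    chi k (∑ b, shape b ξ • pos (vert j b)) = ∑ b, if vert j b = k then shape b ξ else 0

section Mesh

variable {G : Geometry n} {θ H : ℝ} (T : CoarseMesh G θ H)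

/-- The (closed) coarse element `K_j`. -/
def element (j : Fin T.numElem) : Set (Euc (n + 1)) :=
  (fun ξ => ∑ b, shape b ξ • T.pos (T.vert j b)) '' refCube (n + 1)

/-- The part of `K_j` inside `Ω`, over which the local forms are integrated. -/
def cell (j : Fin T.numElem) : Set (Euc (n + 1)) := element T j ∩ G.Ω

/-- The elements of the oversampled region: `m` layers of elements around `K_j`. -/
def layers (j : Fin T.numElem) : ℕ → Set (Fin T.numElem)
  | 0 => {j}
  | m + 1 => {i | ∃ i' ∈ layers j m, (element T i ∩ element T i').Nonempty}

/-- The oversampled region `K_{j,m}`. -/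
def oversampled (j : Fin T.numElem) (m : ℕ) : Set (Euc (n + 1)) :=
  ⋃ i ∈ layers T j m, element T i

/-- The bubble function of `K_j`: the product of the nodal functions of its vertices. -/
def bubble (j : Fin T.numElem) (x : Euc (n + 1)) : ℝ := ∏ b, T.chi (T.vert j b) x

end Mesh

/-! ### Bilinear forms, over a region `R` -/

section Forms

variable {G : Geometry n} {κmin κmax θ H : ℝ}

/-- `a(p,v)` -/
def aForm (κ : Permeability G κmin κmax) (R : Set (Euc (n + 1))) (p v : Field n G.numFrac) : ℝ :=
  ∑ i, ((∫ x in R, κ.bulk i x * ⟪(p i).grad x, (v i).grad x⟫) +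
    ∑ l, ∫ t in fracPart G R l, κ.frac l i (G.emb l t) * ⟪(p i).fgrad l t, (v i).fgrad l t⟫)

/-- `q(p,v)` -/
def qForm (ρ σ : ℝ) (R : Set (Euc (n + 1))) (p v : Field n G.numFrac) : ℝ :=
  ∑ i, ∑ l, ρ * σ * ∫ x in R, ((p i).val x - (p l).val x) * (v i).val x

/-- `a_Q = a + q` -/
def aQForm (κ : Permeability G κmin κmax) (ρ σ : ℝ) (R : Set (Euc (n + 1)))
    (p v : Field n G.numFrac) : ℝ :=
  aForm κ R p v + qForm ρ σ R p v

/-- `s(p,v)`, with the weights `κ_i ∑ₖ |∇χₖ|²` in the bulk and `κ_{l,i} ∑ₖ |∇_f χₖ|²` on the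
fractures -/
def sForm (κ : Permeability G κmin κmax) (T : CoarseMesh G θ H) (R : Set (Euc (n + 1)))
    (p v : Field n G.numFrac) : ℝ :=
  ∑ i, ((∫ x in R, (κ.bulk i x * ∑ k, ‖gradient (T.chi k) x‖ ^ 2) *
      ((p i).val x * (v i).val x)) +
    ∑ l, ∫ t in fracPart G R l,
      (κ.frac l i (G.emb l t) * ∑ k, ‖gradient (fun r => T.chi k (G.emb l r)) t‖ ^ 2) *
        ((p i).fval l t * (v i).fval l t))

/-- `s⁽ʲ⁾(Bν, ν)` with the bubble function `B` of `K_j` -/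
def sBubble (κ : Permeability G κmin κmax) (T : CoarseMesh G θ H) (j : Fin T.numElem)
    (v : Field n G.numFrac) : ℝ :=
  ∑ i, ((∫ x in cell T j, (κ.bulk i x * ∑ k, ‖gradient (T.chi k) x‖ ^ 2) *
      (bubble T j x * (v i).val x * (v i).val x)) +
    ∑ l, ∫ t in fracPart G (cell T j) l,
      (κ.frac l i (G.emb l t) * ∑ k, ‖gradient (fun r => T.chi k (G.emb l r)) t‖ ^ 2) *
        (bubble T j (G.emb l t) * (v i).fval l t * (v i).fval l t))

/-- The energy norm `‖p‖_{a_Q}` on `Ω`. -/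
def aQNorm (κ : Permeability G κmin κmax) (ρ σ : ℝ) (p : Field n G.numFrac) : ℝ :=
  Real.sqrt (aQForm κ ρ σ G.Ω p p)

/-- The norm of `[L²(Ω)]²`. -/
def l2Norm (G : Geometry n) (f : Fin 2 → Euc (n + 1) → ℝ) : ℝ :=
  Real.sqrt (∑ i, ∫ x in G.Ω, f i x ^ 2)

/-! ### The operator `𝒜` -/

/-- `u ∈ D(𝒜)` and `𝒜 u = f`. -/
structure IsOperatorImage (κ : Permeability G κmin κmax) (ρ σ : ℝ) (u : Field n G.numFrac)
    (f : Fin 2 → Euc (n + 1) → ℝ) : Prop where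
  mem : MemV G u
  memLp : ∀ i, MemLp (f i) 2 (volume.restrict G.Ω)
  eq : ∀ v, MemV G v → ∑ i, ∫ x in G.Ω, f i x * (v i).val x = aQForm κ ρ σ G.Ω u v

/-! ### Multiscale spaces -/

/-- `w ∈ V(K_j)` solves the local spectral problem with the number `μ`. -/
def IsEigenpair (κ : Permeability G κmin κmax) (ρ σ : ℝ) (T : CoarseMesh G θ H)
    (j : Fin T.numElem) (μ : ℝ) (w : Field n G.numFrac) : Prop :=
  MemVOn G (cell T j) w ∧
    ∀ v, MemVOn G (cell T j) v →
      aQForm κ ρ σ (cell T j) w v = μ * sForm κ T (cell T j) w v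

/-- `lam 0 ≤ lam 1 ≤ …` are all the eigenvalues of the local spectral problem on `K_j`, with
multiplicity, and `φ 0, φ 1, …` are `s`-orthogonal eigenfunctions. -/
structure IsEigenSequence (κ : Permeability G κmin κmax) (ρ σ : ℝ) (T : CoarseMesh G θ H)
    (j : Fin T.numElem) (lam : ℕ → ℝ) (φ : ℕ → Field n G.numFrac) : Prop where
  monotone : Monotone lam
  eigen : ∀ k, IsEigenpair κ ρ σ T j (lam k) (φ k)
  ne_zero : ∀ k, sForm κ T (cell T j) (φ k) (φ k) ≠ 0
  orthogonal : ∀ k k', k ≠ k' → sForm κ T (cell T j) (φ k) (φ k') = 0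
  /-- no eigenfunction is missing -/
  exhaustive : ∀ μ w, IsEigenpair κ ρ σ T j μ w →
    (∀ k, sForm κ T (cell T j) w (φ k) = 0) → sForm κ T (cell T j) w w = 0

/-- The local auxiliary space, spanned by the first `L` eigenfunctions. -/
def auxSpace {k : ℕ} (L : ℕ) (φ : ℕ → Field n k) : Submodule ℝ (Field n k) :=
  Submodule.span ℝ (φ '' {i | i < L})

/-- `ψ` is `φ_k⁽ʲ⁾`-orthogonal. -/
def IsPhiOrthogonal (κ : Permeability G κmin κmax) (T : CoarseMesh G θ H)
    (L : Fin T.numElem → ℕ) (φ : Fin T.numElem → ℕ → Field n G.numFrac)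
    (j : Fin T.numElem) (k : ℕ) (ψ : Field n G.numFrac) : Prop :=
  ∀ j' k', k' < L j' →
    sForm κ T (cell T j') ψ (φ j' k') = if j' = j ∧ k' = k then 1 else 0

/-- `ψ` is the localized multiscale basis function `ψ_{k,ms}⁽ʲ⁾`: it minimizes the energy among
the `φ_k⁽ʲ⁾`-orthogonal functions of `V₀(K_{j,m})`. -/
structure IsLocalBasis (κ : Permeability G κmin κmax) (ρ σ : ℝ) (T : CoarseMesh G θ H)
    (L : Fin T.numElem → ℕ) (φ : Fin T.numElem → ℕ → Field n G.numFrac) (m : ℕ)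
    (j : Fin T.numElem) (k : ℕ) (ψ : Field n G.numFrac) : Prop where
  mem : MemVZero G (oversampled T j m) ψ
  orthogonal : IsPhiOrthogonal κ T L φ j k ψ
  minimal : ∀ ψ', MemVZero G (oversampled T j m) ψ' → IsPhiOrthogonal κ T L φ j k ψ' →
    aQForm κ ρ σ G.Ω ψ ψ ≤ aQForm κ ρ σ G.Ω ψ' ψ'

/-- The multiscale space `V_ms`, spanned by the localized basis functions `ψ j k`, `k < L j`. -/
def msSpace {N k : ℕ} (L : Fin N → ℕ) (ψ : Fin N → ℕ → Field n k) : Submodule ℝ (Field n k) :=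
  Submodule.span ℝ {w | ∃ j i, i < L j ∧ w = ψ j i}

/-- `r = R_ms u`, the `a_Q`-projection of `u` onto the space `W = V_ms`. -/
def IsProjection (κ : Permeability G κmin κmax) (ρ σ : ℝ)
    (W : Submodule ℝ (Field n G.numFrac)) (u r : Field n G.numFrac) : Prop :=
  r ∈ W ∧ ∀ v ∈ W, aQForm κ ρ σ G.Ω r v = aQForm κ ρ σ G.Ω u v

end Forms

end DualContinuum

end

noncomputable section

namespace DualContinuum

open scoped ENNReal
open ENNReal (ofReal ofReal_mul ofReal_pow ofReal_le_ofReal ofReal_toReal ofReal_le_ofReal_iff toReal_nonneg ofReal_add)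
open Metric (closedBall ball mem_ball isClosed_closedBall cthickening mem_closedBall ball_subset_closedBall ball_mem_nhds mem_closedBall_self mem_ball_self mem_cthickening_of_dist_le isOpen_ball)
open Set (indicator_of_mem indicator_of_notMem univ sdiff_subset mem_iUnion image_mono mem_biUnion inter_comm mem_preimage mem_ofPred_eq indicator_apply preimage_mono piecewise_eq_indicator inter_subset_right inter_subset_left indicator_apply_nonneg disjoint_left)
open Finset (sum_le_sum mul_sum mem_univ sum_nonneg sum_congr sum_eq_zero sum_eq_single_of_mem single_le_sum mem_sdiff sum_add_distrib prod_eq_zero mem_insert_of_mem sum_const card_univ sum_sub_distrib subset_univ prod_nonneg prod_le_one)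
open Real (norm_eq_abs norm_of_nonneg sq_sqrt sqrt_nonneg sqrt_le_left le_norm_self coe_toNNReal)
open Fin (sum_univ_two)
open LinearMap (BilinForm)
open Filter (atTop Tendsto)
open Submodule (coe_smul coe_add coe_sub)
open Function (invFunOn)

/-! ### Positive semidefinite bilinear forms -/

/-- A symmetric positive semidefinite bilinear form. -/
structure SemiInner {V : Type*} [AddCommGroup V] [Module ℝ V] (B : BilinForm ℝ V) : Prop where
  symm : ∀ x y, B x y = B y x
  nonneg : ∀ x, 0 ≤ B x x

/-- Completeness of a set with respect to a bilinear form. -/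
def FormComplete {V : Type*} [AddCommGroup V] [Module ℝ V] (B : BilinForm ℝ V) (C : Set V) : Prop :=
  ∀ x : ℕ → V, (∀ n, x n ∈ C) → (∀ ε > 0, ∃ N, ∀ m ≥ N, ∀ n ≥ N, B (x m - x n) (x m - x n) < ε) →
    ∃ y ∈ C, ∀ ε > 0, ∃ N, ∀ n ≥ N, B (x n - y) (x n - y) < ε

namespace SemiInner

variable {V : Type*} [AddCommGroup V] [Module ℝ V] {B : BilinForm ℝ V}

theorem apply_add_add (h : SemiInner B) (x y : V) :
    B (x + y) (x + y) = B x x + 2 * B x y + B y y := by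
  simp only [map_add, LinearMap.add_apply]; rw [h.symm y x]; ring

theorem apply_sub_sub (h : SemiInner B) (x y : V) :
    B (x - y) (x - y) = B x x - 2 * B x y + B y y := by
  simp only [map_sub, LinearMap.sub_apply]; rw [h.symm y x]; ring

theorem apply_smul_smul (c : ℝ) (x : V) : B (c • x) (c • x) = c ^ 2 * B x x := by
  simp only [map_smul, LinearMap.smul_apply, smul_eq_mul]; ring

theorem cauchy_schwarz (h : SemiInner B) (x y : V) : B x y ^ 2 ≤ B x x * B y y := by
  have key : ∀ t : ℝ, 0 ≤ B y y * (t * t) + (2 * B x y) * t + B x x := by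
    intro t
    have := h.nonneg (x + t • y)
    rw [h.apply_add_add, apply_smul_smul, map_smul, smul_eq_mul] at this
    nlinarith
  have := discrim_le_zero key
  rw [discrim] at this
  nlinarith

theorem abs_apply_le (h : SemiInner B) (x y : V) : |B x y| ≤ √(B x x) * √(B y y) := by
  rw [← Real.sqrt_mul (h.nonneg x), ← Real.sqrt_sq_eq_abs]
  exact Real.sqrt_le_sqrt (h.cauchy_schwarz x y)

theorem apply_le (h : SemiInner B) (x y : V) : B x y ≤ √(B x x) * √(B y y) :=
  (le_abs_self _).trans (h.abs_apply_le x y)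

theorem sqrt_apply_add_le (h : SemiInner B) (x y : V) :
    √(B (x + y) (x + y)) ≤ √(B x x) + √(B y y) := by
  rw [sqrt_le_left (by positivity), h.apply_add_add]
  nlinarith [h.apply_le x y, sq_sqrt (h.nonneg x), sq_sqrt (h.nonneg y)]

theorem apply_add_le (h : SemiInner B) (x y : V) : B (x + y) (x + y) ≤ 2 * B x x + 2 * B y y := by
  have := h.nonneg (x - y)
  rw [h.apply_sub_sub] at this
  rw [h.apply_add_add]; linarith

theorem apply_sub_le (h : SemiInner B) (x y : V) : B (x - y) (x - y) ≤ 2 * B x x + 2 * B y y := by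
  have := h.nonneg (x + y)
  rw [h.apply_add_add] at this
  rw [h.apply_sub_sub]; linarith

theorem apply_neg_neg (x : V) : B (-x) (-x) = B x x := by simp

theorem apply_sub_comm (x y : V) : B (x - y) (x - y) = B (y - x) (y - x) := by
  rw [← neg_sub, apply_neg_neg]

theorem apply_sum_le (h : SemiInner B) {ι : Type*} (s : Finset ι) (x : ι → V) :
    B (∑ i ∈ s, x i) (∑ i ∈ s, x i) ≤ s.card * ∑ i ∈ s, B (x i) (x i) := by
  have h1 : ∀ i j, B (x i) (x j) ≤ (B (x i) (x i) + B (x j) (x j)) / 2 := by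
    intro i j
    have := h.nonneg (x i - x j)
    rw [h.apply_sub_sub] at this
    linarith
  calc B (∑ i ∈ s, x i) (∑ i ∈ s, x i) = ∑ i ∈ s, ∑ j ∈ s, B (x i) (x j) := by
        simp [map_sum, LinearMap.sum_apply]
        exact Finset.sum_comm
    _ ≤ ∑ i ∈ s, ∑ j ∈ s, (B (x i) (x i) + B (x j) (x j)) / 2 :=
        sum_le_sum fun i _ => sum_le_sum fun j _ => h1 i j
    _ = s.card * ∑ i ∈ s, B (x i) (x i) := by
        simp only [add_div, sum_add_distrib, sum_const, nsmul_eq_mul, ← mul_sum, ← Finset.sum_div]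
        ring

/-- The energy-nearest element of an affine space beats its competitors. -/
theorem apply_sub_le_of_orthogonal (h : SemiInner B) {x y z : V} (hxy : B (x - y) (y - z) = 0) :
    B (x - y) (x - y) ≤ B (x - z) (x - z) := by
  have : x - z = (x - y) + (y - z) := by abel
  rw [this, h.apply_add_add, hxy]
  linarith [h.nonneg (y - z)]

/-- If `y` is minimal along the line through `y` in direction `v`, then `B y v = 0`. -/
theorem apply_eq_zero_of_forall_le (h : SemiInner B) {y v : V}
    (hmin : ∀ t : ℝ, B y y ≤ B (y + t • v) (y + t • v)) : B y v = 0 := by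
  have key : ∀ t : ℝ, 0 ≤ B v v * (t * t) + (2 * B y v) * t + 0 := by
    intro t
    have := hmin t
    rw [h.apply_add_add, apply_smul_smul, map_smul, smul_eq_mul] at this
    nlinarith
  have := discrim_le_zero key
  rw [discrim] at this
  nlinarith [sq_nonneg (B y v)]

theorem apply_eq_zero_of_self (h : SemiInner B) {x : V} (hx : B x x = 0) (y : V) : B x y = 0 := by
  have := h.cauchy_schwarz x y
  rw [hx, zero_mul] at this
  exact pow_eq_zero_iff (two_ne_zero) |>.1 (le_antisymm this (sq_nonneg _))

/-- Parallelogram estimate for almost minimal elements. -/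
theorem apply_sub_le_of_midpoint (h : SemiInner B) {x y : V} {d e : ℝ} (hx : B x x ≤ d + e)
    (hy : B y y ≤ d + e) (hxy : d ≤ B ((1 / 2 : ℝ) • (x + y)) ((1 / 2 : ℝ) • (x + y))) :
    B (x - y) (x - y) ≤ 4 * e := by
  rw [apply_smul_smul, h.apply_add_add] at hxy
  rw [h.apply_sub_sub]
  linarith

/-- The direct method: a complete nonempty midpoint-convex set has an element of minimal energy. -/
theorem exists_minimal (h : SemiInner B) {C : Set V} (hne : C.Nonempty)
    (hmid : ∀ x ∈ C, ∀ y ∈ C, (1 / 2 : ℝ) • (x + y) ∈ C) (hC : FormComplete B C) :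
    ∃ y ∈ C, ∀ z ∈ C, B y y ≤ B z z := by
  set S : Set ℝ := (fun x => B x x) '' C
  have hSne : S.Nonempty := hne.image _
  have hSb : BddBelow S := ⟨0, by rintro _ ⟨x, _, rfl⟩; exact h.nonneg x⟩
  have hex : ∀ n : ℕ, ∃ x ∈ C, B x x < sInf S + 1 / (n + 1) := by
    intro n
    obtain ⟨_, ⟨x, hx, rfl⟩, hlt⟩ := exists_lt_of_csInf_lt hSne
      (show sInf S < sInf S + 1 / ((n : ℝ) + 1) by linarith [show (0:ℝ) < 1 / ((n : ℝ) + 1) by positivity])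
    exact ⟨x, hx, hlt⟩
  choose x hxC hx using hex
  have hle : ∀ z ∈ C, sInf S ≤ B z z := fun z hz => csInf_le hSb ⟨z, hz, rfl⟩
  have hcau : ∀ ε > 0, ∃ N, ∀ m ≥ N, ∀ n ≥ N, B (x m - x n) (x m - x n) < ε := by
    intro ε hε
    obtain ⟨N, hN⟩ := exists_nat_one_div_lt (show 0 < ε / 4 by positivity)
    refine ⟨N, fun m hm n hn => ?_⟩
    have mono : ∀ m : ℕ, m ≥ N → B (x m) (x m) ≤ sInf S + 1 / ((N : ℝ) + 1) := by
      intro m hm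
      refine (hx m).le.trans ?_
      have : (N : ℝ) ≤ m := by exact_mod_cast hm
      gcongr
    have := h.apply_sub_le_of_midpoint (mono m hm) (mono n hn) (hle _ (hmid _ (hxC m) _ (hxC n)))
    linarith
  obtain ⟨y, hyC, hy⟩ := hC x hxC hcau
  refine ⟨y, hyC, fun z hz => ?_⟩
  refine le_trans ?_ (hle z hz)
  have hs : √(B y y) ≤ √(sInf S) := by
    refine le_of_forall_pos_le_add fun ε hε => ?_
    obtain ⟨N1, hN1⟩ := hy ((ε / 2) ^ 2) (by positivity)
    obtain ⟨N2, hN2⟩ := exists_nat_one_div_lt (show 0 < (ε / 2) ^ 2 by positivity)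
    set n := max N1 N2
    have h1 := hN1 n (le_max_left _ _)
    have hn : (N2 : ℝ) ≤ n := by exact_mod_cast le_max_right N1 N2
    have h2 : B (x n) (x n) ≤ sInf S + (ε / 2) ^ 2 := by
      refine (hx n).le.trans ?_
      have : 1 / ((n : ℝ) + 1) ≤ 1 / ((N2 : ℝ) + 1) := by gcongr
      linarith
    have h0 : 0 ≤ sInf S := le_csInf hSne (by rintro _ ⟨x, _, rfl⟩; exact h.nonneg x)
    have h3 := h.sqrt_apply_add_le (x n) (y - x n)
    rw [add_sub_cancel, apply_sub_comm] at h3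
    have h4 : √(B (x n - y) (x n - y)) ≤ ε / 2 := by
      rw [sqrt_le_left (by positivity)]; exact h1.le
    have h5 : √(B (x n) (x n)) ≤ √(sInf S) + ε / 2 := by
      rw [sqrt_le_left (by positivity)]
      nlinarith [sq_sqrt h0, sqrt_nonneg (sInf S)]
    linarith
  have h0 : 0 ≤ sInf S := le_csInf hSne (by rintro _ ⟨x, _, rfl⟩; exact h.nonneg x)
  exact (Real.sqrt_le_sqrt_iff h0).1 hs

/-- A bounded sequence has a Cauchy sequence of convex combinations of its tails. -/
theorem exists_cauchy_convexCombination (h : SemiInner B) (x : ℕ → V) {M : ℝ}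
    (hM : ∀ n, B (x n) (x n) ≤ M) :
    ∃ y : ℕ → V, (∀ N, y N ∈ convexHull ℝ (x '' {n | N ≤ n})) ∧
      ∀ ε > 0, ∃ N, ∀ m ≥ N, ∀ n ≥ N, B (y m - y n) (y m - y n) < ε := by
  set C : ℕ → Set V := fun N => convexHull ℝ (x '' {n | N ≤ n})
  set S : ℕ → Set ℝ := fun N => (fun x => B x x) '' C N
  set d : ℕ → ℝ := fun N => sInf (S N)
  have hxC : ∀ N n, N ≤ n → x n ∈ C N := fun N n hn => subset_convexHull _ _ ⟨n, hn, rfl⟩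
  have hSne : ∀ N, (S N).Nonempty := fun N => ⟨_, x N, hxC N N le_rfl, rfl⟩
  have hSb : ∀ N, BddBelow (S N) := fun N => ⟨0, by rintro _ ⟨x, _, rfl⟩; exact h.nonneg x⟩
  have hCmono : ∀ N N', N ≤ N' → C N' ⊆ C N := fun N N' hN =>
    convexHull_mono (image_mono fun n (hn : N' ≤ n) => hN.trans hn)
  have hle : ∀ N, ∀ z ∈ C N, d N ≤ B z z := fun N z hz => csInf_le (hSb N) ⟨z, hz, rfl⟩
  have hmono : Monotone d := fun N N' hN =>
    csInf_le_csInf (hSb N) (hSne N') (image_mono (hCmono N N' hN))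
  have hdM : ∀ N, d N ≤ M := fun N => (hle N _ (hxC N N le_rfl)).trans (hM N)
  have hex : ∀ n : ℕ, ∃ z ∈ C n, B z z < d n + 1 / (n + 1) := by
    intro n
    obtain ⟨_, ⟨x, hx, rfl⟩, hlt⟩ := exists_lt_of_csInf_lt (hSne n)
      (show d n < d n + 1 / ((n : ℝ) + 1) by linarith [show (0:ℝ) < 1 / ((n : ℝ) + 1) by positivity])
    exact ⟨x, hx, hlt⟩
  choose y hyC hy using hex
  refine ⟨y, hyC, fun ε hε => ?_⟩
  have hbdd : BddAbove (Set.range d) := ⟨M, by rintro _ ⟨n, rfl⟩; exact hdM n⟩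
  set D := ⨆ n, d n
  obtain ⟨N1, hN1⟩ := exists_lt_of_lt_ciSup (show D - ε / 16 < ⨆ n, d n by simp only [D]; linarith)
  obtain ⟨N2, hN2⟩ := exists_nat_one_div_lt (show 0 < ε / 16 by positivity)
  refine ⟨max N1 N2, fun m hm n hn => ?_⟩
  have est : ∀ m ≥ max N1 N2, B (y m) (y m) ≤ d (max N1 N2) + ε / 8 := by
    intro m hm
    have hm2 : (N2 : ℝ) ≤ m := by exact_mod_cast (le_max_right N1 N2).trans hm
    have h1 : 1 / ((m : ℝ) + 1) ≤ 1 / ((N2 : ℝ) + 1) := by gcongr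
    have h2 : d m ≤ D := le_ciSup hbdd m
    linarith [hmono (le_max_left N1 N2), hy m]
  have := h.apply_sub_le_of_midpoint (est m hm) (est n hn) (hle _ _ ?_)
  · linarith
  · rw [smul_add]
    exact convex_convexHull ℝ _ (hCmono _ _ hm (hyC m)) (hCmono _ _ hn (hyC n)) (by norm_num)
      (by norm_num) (by norm_num)

end SemiInner

/-! ### Exponential decay of energy minimisers, abstractly -/

/-- A global energy `a` with local energies `e i` and local masses `s i` on finitely many cells,
local constraints `c i`, and submodules `loc i` of elements supported inside one cell. -/
structure LocalizedProblem (V ι : Type*) [AddCommGroup V] [Module ℝ V] [Fintype ι] [DecidableEq ι]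
    (W : ι → Type*) [∀ i, AddCommGroup (W i)] [∀ i, Module ℝ (W i)] where
  a : BilinForm ℝ V
  e : ι → BilinForm ℝ V
  s : ι → BilinForm ℝ V
  c : ∀ i, V →ₗ[ℝ] W i
  loc : ι → Submodule ℝ V
  /-- the spectral bound -/
  Λ : ℝ
  /-- the norm of the local lifts -/
  D : ℝ
  /-- the size of the gradients of cut-off functions -/
  C₁ : ℝ
  /-- the overlap of the cells -/
  N₀ : ℝ
  Λ_pos : 0 < Λ
  D_nonneg : 0 ≤ D
  C₁_nonneg : 0 ≤ C₁
  N₀_nonneg : 0 ≤ N₀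
  a_semi : SemiInner a
  e_semi : ∀ i, SemiInner (e i)
  gap : ∀ i p, c i p = 0 → Λ * s i p p ≤ e i p p
  lift : ∀ i p, ∃ w ∈ loc i, c i w = c i p ∧ a w w ≤ D * s i p p
  constraint_loc : ∀ i, ∀ w ∈ loc i, ∀ i', i' ≠ i → c i' w = 0
  apply_loc : ∀ i, ∀ w ∈ loc i, ∀ p, a p w = e i p w
  orth_loc : ∀ i, ∀ w ∈ loc i, ∀ i', ∀ w' ∈ loc i', i ≠ i' → a w w' = 0
  glob : ∀ p, ∃ g, (∀ i, c i g = c i p) ∧ ∀ v, (∀ i, c i v = 0) → a g v = 0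

namespace LocalizedProblem

variable {V ι : Type*} [AddCommGroup V] [Module ℝ V] [Fintype ι] [DecidableEq ι]
  {W : ι → Type*} [∀ i, AddCommGroup (W i)] [∀ i, Module ℝ (W i)]

/-- Growing sets of cells `J t`, with the energy `o t` outside of them, the elements `V₀ t`
supported in them, and cut-offs between them. -/
structure Layering (P : LocalizedProblem V ι W) (J : ℕ → Finset ι) (V₀ : ℕ → Submodule ℝ V) where
  o : ℕ → V → ℝ
  o_nonneg : ∀ t p, 0 ≤ o t p
  o_zero_le : ∀ p, o 0 p ≤ P.a p p
  o_succ_le : ∀ t p, o (t + 1) p ≤ o t p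
  mono : ∀ t, J t ⊆ J (t + 1)
  loc_le : ∀ t, ∀ i ∈ J t, P.loc i ≤ V₀ t
  cut : ∀ t p, ∃ χ ∈ V₀ (t + 1), (∀ i ∈ J t, P.c i χ = P.c i p) ∧
    (∀ i, i ∉ J (t + 1) → P.c i χ = 0) ∧ (∀ i, P.s i χ χ ≤ P.s i p p) ∧
    (∀ i, P.s i (p - χ) (p - χ) ≤ P.s i p p) ∧
    o (t + 1) p ≤ P.a p (p - χ) + P.C₁ * ∑ i ∈ J (t + 1) \ J t, (P.e i p p + P.s i p p) ∧
    P.a (p - χ) (p - χ) ≤ 2 * o t p + P.C₁ * ∑ i ∈ J (t + 1) \ J t, P.s i p p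
  ring_le : ∀ t p, ∑ i ∈ J (t + 2) \ J (t + 1), P.e i p p ≤ P.N₀ * (o t p - o (t + 2) p)

variable (P : LocalizedProblem V ι W)

/-- The constant in the Caccioppoli inequality. -/
def caccioppoli : ℝ := √(P.D / P.Λ) + P.C₁ * (1 + P.Λ⁻¹)

/-- The decay rate per two layers. -/
def rate : ℝ := P.caccioppoli * P.N₀ / (1 + P.caccioppoli * P.N₀)

/-- The prefactor of the decay estimate. -/
def prefactor : ℝ := 4 + 2 * (P.C₁ + P.D) * P.N₀ / P.Λ

theorem caccioppoli_nonneg : 0 ≤ P.caccioppoli := by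
  have := P.C₁_nonneg; have := P.Λ_pos
  unfold caccioppoli; positivity

theorem rate_nonneg : 0 ≤ P.rate := by
  have := P.caccioppoli_nonneg; have := P.N₀_nonneg
  unfold rate; positivity

theorem prefactor_nonneg : 0 ≤ P.prefactor := by
  have := P.C₁_nonneg; have := P.N₀_nonneg; have := P.D_nonneg; have := P.Λ_pos
  unfold prefactor; positivity

variable {P}

theorem mass_le {i : ι} {p : V} (h : P.c i p = 0) : P.s i p p ≤ P.Λ⁻¹ * P.e i p p := by
  rw [← div_eq_inv_mul, le_div_iff₀ P.Λ_pos, mul_comm]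
  exact P.gap i p h

variable {J : ℕ → Finset ι} {V₀ : ℕ → Submodule ℝ V}

theorem Layering.o_succ_le_ring (Y : P.Layering J V₀) {p : V} (hp : ∀ i, i ∉ J 0 → P.c i p = 0)
    (hmin : ∀ v, (∀ i, P.c i v = 0) → P.a p v = 0) (t : ℕ) :
    Y.o (t + 1) p ≤ P.caccioppoli * ∑ i ∈ J (t + 1) \ J t, P.e i p p := by
  obtain ⟨χ, -, hin, hout, -, hsχ, ho, -⟩ := Y.cut t p
  have hJ0 : J 0 ⊆ J t := monotone_nat_of_le_succ Y.mono (Nat.zero_le t)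
  choose w hwl hwc hwa using fun i => P.lift i (p - χ)
  have hring : ∀ i ∈ J (t + 1) \ J t, P.c i p = 0 := fun i hi =>
    hp i fun h0 => (mem_sdiff.1 hi).2 (hJ0 h0)
  have hz : P.a p ((p - χ) - ∑ i ∈ J (t + 1) \ J t, w i) = 0 := by
    refine hmin _ fun i => ?_
    rw [map_sub, map_sum]
    by_cases hi : i ∈ J (t + 1) \ J t
    · rw [sum_eq_single_of_mem i hi
        fun b _ hb => P.constraint_loc b _ (hwl b) i (Ne.symm hb), hwc, sub_self]
    · rw [sum_eq_zero fun b hb => P.constraint_loc b _ (hwl b) i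
        fun h => hi (h ▸ hb), sub_zero, map_sub]
      by_cases h1 : i ∈ J t
      · rw [hin i h1, sub_self]
      · have h2 : i ∉ J (t + 1) := fun h => hi (mem_sdiff.2 ⟨h, h1⟩)
        rw [hout i h2, hp i fun h0 => h1 (hJ0 h0), sub_zero]
  have h1 : P.a p (p - χ) ≤ √(P.D / P.Λ) * ∑ i ∈ J (t + 1) \ J t, P.e i p p := by
    rw [map_sub, sub_eq_zero, map_sum] at hz
    rw [hz, mul_sum]
    refine sum_le_sum fun i hi => ?_
    rw [P.apply_loc i _ (hwl i)]
    refine ((P.e_semi i).apply_le _ _).trans ?_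
    rw [← P.apply_loc i _ (hwl i)]
    have h3 : P.a (w i) (w i) ≤ P.D / P.Λ * P.e i p p := by
      calc P.a (w i) (w i) ≤ P.D * (P.Λ⁻¹ * P.e i p p) :=
            (hwa i).trans (mul_le_mul_of_nonneg_left ((hsχ i).trans (mass_le (hring i hi)))
              P.D_nonneg)
        _ = _ := by ring
    have h4 := Real.sqrt_le_sqrt h3
    have hDΛ : 0 ≤ P.D / P.Λ := div_nonneg P.D_nonneg P.Λ_pos.le
    rw [Real.sqrt_mul hDΛ] at h4
    calc √(P.e i p p) * √(P.a (w i) (w i)) ≤ √(P.e i p p) * (√(P.D / P.Λ) * √(P.e i p p)) := by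
          gcongr
      _ = √(P.D / P.Λ) * (√(P.e i p p) * √(P.e i p p)) := by ring
      _ = _ := by rw [Real.mul_self_sqrt ((P.e_semi i).nonneg p)]
  have h2 : ∑ i ∈ J (t + 1) \ J t, (P.e i p p + P.s i p p) ≤
      (1 + P.Λ⁻¹) * ∑ i ∈ J (t + 1) \ J t, P.e i p p := by
    rw [mul_sum]
    refine sum_le_sum fun i hi => ?_
    linarith [mass_le (hring i hi)]
  have h3 := mul_le_mul_of_nonneg_left h2 P.C₁_nonneg
  unfold caccioppoli
  linarith

theorem Layering.o_add_two_le (Y : P.Layering J V₀) {p : V} (hp : ∀ i, i ∉ J 0 → P.c i p = 0)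
    (hmin : ∀ v, (∀ i, P.c i v = 0) → P.a p v = 0) (t : ℕ) :
    Y.o (t + 2) p ≤ P.rate * Y.o t p := by
  have h1 := Y.o_succ_le_ring hp hmin (t + 1)
  have h2 := mul_le_mul_of_nonneg_left (Y.ring_le t p) P.caccioppoli_nonneg
  have h3 : 0 ≤ P.caccioppoli * P.N₀ := mul_nonneg P.caccioppoli_nonneg P.N₀_nonneg
  unfold rate
  rw [div_mul_eq_mul_div, le_div_iff₀ (by linarith)]
  have h4 : Y.o (t + 1 + 1) p = Y.o (t + 2) p := rfl
  nlinarith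

theorem Layering.o_two_mul_le (Y : P.Layering J V₀) {p : V} (hp : ∀ i, i ∉ J 0 → P.c i p = 0)
    (hmin : ∀ v, (∀ i, P.c i v = 0) → P.a p v = 0) (q : ℕ) :
    Y.o (2 * q) p ≤ P.rate ^ q * P.a p p := by
  induction q with
  | zero => simpa using Y.o_zero_le p
  | succ q ih =>
    have h1 := Y.o_add_two_le hp hmin (2 * q)
    have h2 := mul_le_mul_of_nonneg_left ih P.rate_nonneg
    rw [pow_succ']
    calc Y.o (2 * (q + 1)) p = Y.o (2 * q + 2) p := rfl
      _ ≤ P.rate * (P.rate ^ q * P.a p p) := h1.trans h2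
      _ = _ := by ring

/-- The localized minimiser is exponentially close to the global one. -/
theorem Layering.apply_sub_le (Y : P.Layering J V₀) {p q : V} {m r : ℕ} (hr : 2 * r + 2 ≤ m)
    (hp : ∀ i, i ∉ J 0 → P.c i p = 0) (hmin : ∀ v, (∀ i, P.c i v = 0) → P.a p v = 0)
    (hq : q ∈ V₀ m) (hcq : ∀ i, P.c i q = P.c i p)
    (hqmin : ∀ v ∈ V₀ m, (∀ i, P.c i v = 0) → P.a q v = 0) :
    P.a (p - q) (p - q) ≤ P.prefactor * P.rate ^ r * P.a p p := by
  obtain ⟨t, rfl⟩ : ∃ t, m = t + 2 := ⟨m - 2, by omega⟩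
  obtain ⟨χ, hχ0, hin, hout, hsχ, -, -, ha⟩ := Y.cut (t + 1) p
  have hJ : Monotone J := monotone_nat_of_le_succ Y.mono
  choose w hwl hwc hwa using fun i => P.lift i χ
  set T := J (t + 2) \ J (t + 1)
  set v := χ - ∑ i ∈ T, w i
  have hring : ∀ i ∈ T, P.c i p = 0 := fun i hi =>
    hp i fun h0 => (mem_sdiff.1 hi).2 (hJ (Nat.zero_le _) h0)
  have hv0 : v ∈ V₀ (t + 2) := sub_mem hχ0 (sum_mem fun i hi =>
    Y.loc_le _ i (mem_sdiff.1 hi).1 (hwl i))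
  have hcv : ∀ i, P.c i v = P.c i p := by
    intro i
    simp only [v]
    rw [map_sub, map_sum]
    by_cases hi : i ∈ T
    · rw [sum_eq_single_of_mem i hi
        fun b _ hb => P.constraint_loc b _ (hwl b) i (Ne.symm hb), hwc, sub_self, hring i hi]
    · rw [sum_eq_zero fun b hb => P.constraint_loc b _ (hwl b) i
        fun h => hi (h ▸ hb), sub_zero]
      by_cases h1 : i ∈ J (t + 1)
      · rw [hin i h1]
      · have h2 : i ∉ J (t + 2) := fun h => hi (mem_sdiff.2 ⟨h, h1⟩)
        rw [hout i h2, hp i fun h0 => h1 (hJ (Nat.zero_le _) h0)]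
  have horth : P.a (p - q) (q - v) = 0 := by
    have hc : ∀ i, P.c i (q - v) = 0 := fun i => by rw [map_sub, hcq, hcv, sub_self]
    rw [P.a.map_sub p q, LinearMap.sub_apply, hmin _ hc, hqmin _ (sub_mem hq hv0) hc, sub_zero]
  refine (P.a_semi.apply_sub_le_of_orthogonal horth).trans ?_
  have hsum : P.a (∑ i ∈ T, w i) (∑ i ∈ T, w i) ≤ P.D / P.Λ * ∑ i ∈ T, P.e i p p := by
    rw [map_sum P.a, LinearMap.sum_apply, mul_sum]
    refine sum_le_sum fun i hi => ?_
    rw [map_sum, sum_eq_single_of_mem i hi fun b _ hb =>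
      P.orth_loc _ _ (hwl _) _ _ (hwl _) (Ne.symm hb)]
    calc P.a (w i) (w i) ≤ P.D * (P.Λ⁻¹ * P.e i p p) :=
          (hwa i).trans (mul_le_mul_of_nonneg_left ((hsχ i).trans (mass_le (hring i hi)))
            P.D_nonneg)
      _ = _ := by ring
  have hpv : p - v = (p - χ) + ∑ i ∈ T, w i := by simp only [v]; abel
  have hms : ∑ i ∈ T, P.s i p p ≤ P.Λ⁻¹ * ∑ i ∈ T, P.e i p p := by
    rw [mul_sum]
    exact sum_le_sum fun i hi => mass_le (hring i hi)
  have hRN : ∑ i ∈ T, P.e i p p ≤ P.N₀ * Y.o t p := by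
    refine (Y.ring_le t p).trans (mul_le_mul_of_nonneg_left ?_ P.N₀_nonneg)
    linarith [Y.o_nonneg (t + 2) p]
  have hot : Y.o t p ≤ P.rate ^ r * P.a p p :=
    (antitone_nat_of_succ_le (f := fun t => Y.o t p) (fun t => Y.o_succ_le t p)
      (show 2 * r ≤ t by omega)).trans (Y.o_two_mul_le hp hmin r)
  have hΛ := P.Λ_pos
  have hC := P.C₁_nonneg
  have hD := P.D_nonneg
  have hN := P.N₀_nonneg
  calc P.a (p - v) (p - v) ≤ 2 * P.a (p - χ) (p - χ) + 2 * P.a (∑ i ∈ T, w i) (∑ i ∈ T, w i) := by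
        rw [hpv]; exact P.a_semi.apply_add_le _ _
    _ ≤ 2 * (2 * Y.o t p + P.C₁ * (P.Λ⁻¹ * (P.N₀ * Y.o t p))) +
          2 * (P.D / P.Λ * (P.N₀ * Y.o t p)) := by
        have h1 := Y.o_succ_le t p
        have h2 : P.C₁ * ∑ i ∈ T, P.s i p p ≤ P.C₁ * (P.Λ⁻¹ * (P.N₀ * Y.o t p)) := by
          refine mul_le_mul_of_nonneg_left (hms.trans ?_) hC
          exact mul_le_mul_of_nonneg_left hRN (by positivity)
        have h3 : P.D / P.Λ * ∑ i ∈ T, P.e i p p ≤ P.D / P.Λ * (P.N₀ * Y.o t p) :=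
          mul_le_mul_of_nonneg_left hRN (by positivity)
        linarith
    _ = P.prefactor * Y.o t p := by unfold prefactor; field_simp; ring
    _ ≤ P.prefactor * (P.rate ^ r * P.a p p) := mul_le_mul_of_nonneg_left hot P.prefactor_nonneg
    _ = _ := by ring

/-- The global minimiser with the constraints of `u`, and its localized approximation. -/
theorem exists_global_approximation {J : ι → ℕ → Finset ι} {V₀ : ι → ℕ → Submodule ℝ V}
    (Y : ∀ j, P.Layering (J j) (V₀ j)) (hJ : ∀ j, J j 0 = {j}) {m r : ℕ} (hr : 2 * r + 2 ≤ m)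
    (u : V) (q : ι → V) (hq : ∀ j, q j ∈ V₀ j m) (hcq : ∀ j, P.c j (q j) = P.c j u)
    (hcq' : ∀ j i, i ≠ j → P.c i (q j) = 0)
    (hqmin : ∀ j, ∀ v ∈ V₀ j m, (∀ i, P.c i v = 0) → P.a (q j) v = 0) :
    ∃ g, (∀ i, P.c i g = P.c i u) ∧ (∀ v, (∀ i, P.c i v = 0) → P.a g v = 0) ∧
      P.a (g - ∑ j, q j) (g - ∑ j, q j) ≤
        Fintype.card ι * (P.prefactor * P.rate ^ r * P.D * ∑ j, P.s j u u) := by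
  choose w hwl hwc hwa using fun i => P.lift i u
  choose g hgc hga using fun j => P.glob (w j)
  have hgj : ∀ j, P.c j (g j) = P.c j u := fun j => by rw [hgc, hwc]
  have hgi : ∀ j i, i ≠ j → P.c i (g j) = 0 := fun j i hi => by
    rw [hgc, P.constraint_loc j _ (hwl j) i hi]
  refine ⟨∑ j, g j, fun i => ?_, fun v hv => ?_, ?_⟩
  · rw [map_sum, sum_eq_single_of_mem i (mem_univ i)
      fun b _ hb => hgi b i (Ne.symm hb), hgj]
  · rw [map_sum, LinearMap.sum_apply]
    exact sum_eq_zero fun j _ => hga j v hv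
  · rw [← sum_sub_distrib]
    refine (P.a_semi.apply_sum_le _ _).trans ?_
    rw [card_univ, mul_sum _ _ (P.prefactor * P.rate ^ r * P.D)]
    refine mul_le_mul_of_nonneg_left (sum_le_sum fun j _ => ?_) (Nat.cast_nonneg (α := ℝ) _)
    have h1 : P.a (g j) (g j) ≤ P.D * P.s j u u := by
      refine le_trans ?_ (hwa j)
      have h2 : P.a (g j) (w j - g j) = 0 := hga j _ fun i => by rw [map_sub, hgc, sub_self]
      have h3 := P.a_semi.apply_add_add (g j) (w j - g j)
      rw [add_sub_cancel, h2] at h3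
      linarith [P.a_semi.nonneg (w j - g j)]
    have h4 := (Y j).apply_sub_le hr (p := g j) (q := q j)
      (fun i hi => hgi j i fun h => hi (by rw [hJ, h]; exact Finset.mem_singleton_self _))
      (hga j) (hq j) (fun i => by
        by_cases h : i = j
        · subst h; rw [hcq, hgj]
        · rw [hcq' j i h, hgi j i h]) (hqmin j)
    refine h4.trans ?_
    rw [mul_assoc _ P.D]
    exact mul_le_mul_of_nonneg_left h1 (mul_nonneg P.prefactor_nonneg (pow_nonneg P.rate_nonneg _))

end LocalizedProblem

/-! ### A trace inequality on convex sets -/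

theorem sq_lintegral_le {α : Type*} [MeasurableSpace α] {μ : Measure α} {f : α → ℝ≥0∞}
    (hf : AEMeasurable f μ) : (∫⁻ x, f x ∂μ) ^ 2 ≤ μ univ * ∫⁻ x, f x ^ 2 ∂μ := by
  have h := ENNReal.lintegral_mul_le_Lp_mul_Lq μ Real.HolderConjugate.two_two
    (aemeasurable_const (b := (1 : ℝ≥0∞))) hf
  simp only [Pi.mul_apply, one_mul, ENNReal.one_rpow, lintegral_const] at h
  calc (∫⁻ x, f x ∂μ) ^ 2
      ≤ (μ univ ^ (1 / 2 : ℝ) * (∫⁻ x, f x ^ (2 : ℝ) ∂μ) ^ (1 / 2 : ℝ)) ^ 2 := by gcongr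
    _ = _ := by
      rw [mul_pow, ← ENNReal.rpow_natCast, ← ENNReal.rpow_natCast, ← ENNReal.rpow_mul,
        ← ENNReal.rpow_mul]
      norm_num

theorem lintegral_comp_add_smul {E : Type*} [NormedAddCommGroup E] [NormedSpace ℝ E]
    [MeasurableSpace E] [BorelSpace E] [FiniteDimensional ℝ E] (μ : Measure E)
    [μ.IsAddHaarMeasure] (f : E → ℝ≥0∞) (v : E) {t : ℝ} (ht : 0 < t) :
    ∫⁻ z, f (v + t • z) ∂μ = ofReal ((t ^ Module.finrank ℝ E)⁻¹) * ∫⁻ y, f y ∂μ := by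
  have h1 := (Homeomorph.smulOfNeZero (α := E) t ht.ne').measurableEmbedding.lintegral_map
    (μ := μ) (fun y => f (v + y))
  have h2 : ⇑(Homeomorph.smulOfNeZero (α := E) t ht.ne') = fun x => t • x := rfl
  rw [h2, Measure.map_addHaar_smul μ ht.ne', lintegral_smul_measure,
    lintegral_add_left_eq_self f v, abs_of_pos (by positivity)] at h1
  rw [← h1, smul_eq_mul]

/-- Poincaré and trace inequality on a convex set `Q`, for a measure `ν` of codimension at most
one. -/
theorem lintegral_lintegral_sub_sq_le {n : ℕ} {Q : Set (Euc (n + 1))} (hQ : Convex ℝ Q)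
    (hQm : MeasurableSet Q) {g : Euc (n + 1) → ℝ} (hg : ContDiff ℝ 1 g)
    (ν : Measure (Euc (n + 1))) [IsFiniteMeasure ν] {A D : ℝ} (hD : 0 < D) (hA : 0 ≤ A)
    (hν : ∀ y, ∀ r > 0, ν (closedBall y r) ≤ ofReal (A * r ^ n))
    (hdiam : ∀ x ∈ Q, ∀ y ∈ Q, dist x y ≤ D) :
    ∫⁻ ξ in Q, ∫⁻ z in Q, ‖g ξ - g z‖ₑ ^ 2 ∂volume ∂ν ≤
      ofReal (4 * A * D ^ (n + 2)) * ∫⁻ x in Q, ‖fderiv ℝ g x‖ₑ ^ 2 := by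
  set h : Euc (n + 1) → ℝ≥0∞ := fun x => ‖fderiv ℝ g x‖ₑ ^ 2 with hh
  have hfc : Continuous (fderiv ℝ g) := hg.continuous_fderiv one_ne_zero
  have hhm : Measurable h := (hfc.enorm.measurable).pow_const 2
  set I : Set ℝ := Set.Ioc 0 1
  -- the pointwise bound along a reparametrized segment
  have hpt : ∀ ξ ∈ Q, ∀ z ∈ Q, ‖g ξ - g z‖ₑ ^ 2 ≤
      ∫⁻ τ in I, ofReal (4 * D ^ 2 * τ ^ 2) * h (ξ + τ ^ 2 • (z - ξ)) := by
    intro ξ hξ z hz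
    set φ' : ℝ → ℝ := fun τ => fderiv ℝ g (ξ + τ ^ 2 • (z - ξ)) ((2 * τ) • (z - ξ))
    have hc : Continuous φ' := by
      refine (hfc.comp (by fun_prop)).clm_apply (by fun_prop)
    have hd : ∀ τ ∈ Set.uIcc (0 : ℝ) 1, HasDerivAt (fun τ : ℝ => g (ξ + τ ^ 2 • (z - ξ)))
        (φ' τ) τ := by
      intro τ _
      have h1 : HasDerivAt (fun τ : ℝ => ξ + τ ^ 2 • (z - ξ)) ((2 * τ) • (z - ξ)) τ := by
        have := ((hasDerivAt_pow 2 τ).smul_const (z - ξ)).const_add ξ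
        simpa using this
      exact ((hg.differentiable one_ne_zero) _).hasFDerivAt.comp_hasDerivAt τ h1
    have h2 := intervalIntegral.integral_eq_sub_of_hasDerivAt hd (hc.intervalIntegrable _ _)
    simp only [one_pow, one_smul, add_sub_cancel, ne_eq, OfNat.ofNat_ne_zero, not_false_eq_true,
      zero_pow, zero_smul, add_zero] at h2
    rw [← enorm_neg, neg_sub, ← h2, intervalIntegral.integral_of_le zero_le_one]
    calc ‖∫ τ in I, φ' τ‖ₑ ^ 2 ≤ (∫⁻ τ in I, ‖φ' τ‖ₑ) ^ 2 := by
          gcongr; exact enorm_integral_le_lintegral_enorm _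
      _ ≤ (volume.restrict I) univ * ∫⁻ τ in I, ‖φ' τ‖ₑ ^ 2 :=
          sq_lintegral_le hc.enorm.measurable.aemeasurable
      _ = ∫⁻ τ in I, ‖φ' τ‖ₑ ^ 2 := by simp [I]
      _ ≤ _ := by
          refine setLIntegral_mono' measurableSet_Ioc fun τ hτ => ?_
          have h3 : ‖φ' τ‖ ≤ ‖fderiv ℝ g (ξ + τ ^ 2 • (z - ξ))‖ * (2 * τ * D) := by
            refine (ContinuousLinearMap.le_opNorm _ _).trans ?_
            gcongr
            rw [norm_smul, norm_of_nonneg (by linarith [hτ.1])]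
            gcongr
            · linarith [hτ.1]
            · rw [← dist_eq_norm]; exact hdiam z hz ξ hξ
          rw [hh]
          simp only
          rw [← ofReal_norm, ← ofReal_norm, ← ofReal_pow (norm_nonneg _),
            ← ofReal_pow (norm_nonneg _), ← ofReal_mul (by positivity)]
          refine ofReal_le_ofReal ?_
          calc ‖φ' τ‖ ^ 2 ≤ (‖fderiv ℝ g (ξ + τ ^ 2 • (z - ξ))‖ * (2 * τ * D)) ^ 2 := by gcongr
            _ = _ := by ring
  have hmeas3 : Measurable fun p : Euc (n + 1) × Euc (n + 1) × ℝ =>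
      ofReal (4 * D ^ 2 * p.2.2 ^ 2) * h (p.1 + p.2.2 ^ 2 • (p.2.1 - p.1)) := by
    refine Measurable.mul (by fun_prop) (hhm.comp (by fun_prop))
  -- the bound at a fixed parameter
  have hfix : ∀ τ ∈ I, ∫⁻ ξ in Q, ∫⁻ z in Q,
      ofReal (4 * D ^ 2 * τ ^ 2) * h (ξ + τ ^ 2 • (z - ξ)) ∂volume ∂ν ≤
      ofReal (4 * A * D ^ (n + 2)) * ∫⁻ x in Q, h x := by
    intro τ hτ
    have ht : 0 < τ ^ 2 := pow_pos hτ.1 2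
    have ht1 : τ ^ 2 ≤ 1 := pow_le_one₀ hτ.1.le hτ.2
    set K : Euc (n + 1) → Euc (n + 1) → ℝ≥0∞ := fun ξ y =>
      (closedBall y (τ ^ 2 * D)).indicator (fun _ => h y) ξ with hK
    have hKm : Measurable (Function.uncurry K) := by
      have : Function.uncurry K = Set.indicator
          {p : Euc (n + 1) × Euc (n + 1) | dist p.1 p.2 ≤ τ ^ 2 * D} (fun p => h p.2) := by
        ext p; simp only [Function.uncurry, hK, Set.indicator, mem_closedBall, mem_ofPred_eq]
      rw [this]
      exact (hhm.comp measurable_snd).indicator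
        (isClosed_le (by fun_prop) continuous_const).measurableSet
    have hin : ∀ ξ ∈ Q, ∫⁻ z in Q, h (ξ + τ ^ 2 • (z - ξ)) ≤
        ofReal (((τ ^ 2) ^ (n + 1))⁻¹) * ∫⁻ y in Q, K ξ y := by
      intro ξ hξ
      have hsub := lintegral_comp_add_smul volume (Q.indicator (K ξ)) (ξ - τ ^ 2 • ξ) ht
      rw [finrank_euclideanSpace, Fintype.card_fin] at hsub
      rw [← lintegral_indicator hQm, ← lintegral_indicator hQm, ← hsub]
      refine lintegral_mono fun z => ?_
      by_cases hz : z ∈ Q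
      · have he : ξ - τ ^ 2 • ξ + τ ^ 2 • z = ξ + τ ^ 2 • (z - ξ) := by rw [smul_sub]; abel
        have hmem : ξ + τ ^ 2 • (z - ξ) ∈ Q := hQ.add_smul_sub_mem hξ hz ⟨ht.le, ht1⟩
        have hd : ξ ∈ closedBall (ξ + τ ^ 2 • (z - ξ)) (τ ^ 2 * D) := by
          rw [mem_closedBall, dist_eq_norm, sub_add_cancel_left, norm_neg, norm_smul,
            norm_of_nonneg ht.le, ← dist_eq_norm]
          exact mul_le_mul_of_nonneg_left (hdiam z hz ξ hξ) ht.le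
        simp only [hz, indicator_of_mem]
        rw [he, indicator_of_mem hmem]
        simp only [hK, indicator_of_mem hd, le_refl]
      · simp [hz]
    calc ∫⁻ ξ in Q, ∫⁻ z in Q, ofReal (4 * D ^ 2 * τ ^ 2) * h (ξ + τ ^ 2 • (z - ξ))
            ∂volume ∂ν
        ≤ ∫⁻ ξ in Q, ofReal (4 * D ^ 2 * τ ^ 2) *
            (ofReal (((τ ^ 2) ^ (n + 1))⁻¹) * ∫⁻ y in Q, K ξ y) ∂ν := by
          refine setLIntegral_mono' hQm fun ξ hξ => ?_
          have hm : Measurable fun z => h (ξ + τ ^ 2 • (z - ξ)) := hhm.comp (by fun_prop)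
          rw [lintegral_const_mul _ hm]
          gcongr
          exact hin ξ hξ
      _ = ofReal (4 * D ^ 2 * τ ^ 2) * (ofReal (((τ ^ 2) ^ (n + 1))⁻¹) *
            ∫⁻ ξ in Q, ∫⁻ y in Q, K ξ y ∂volume ∂ν) := by
          have hm : Measurable fun ξ => ∫⁻ y in Q, K ξ y := hKm.lintegral_prod_right'
          rw [lintegral_const_mul _ (hm.const_mul _), lintegral_const_mul _ hm]
      _ = ofReal (4 * D ^ 2 * τ ^ 2) * (ofReal (((τ ^ 2) ^ (n + 1))⁻¹) *
            ∫⁻ y in Q, ∫⁻ ξ in Q, K ξ y ∂ν ∂volume) := by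
          rw [lintegral_lintegral_swap hKm.aemeasurable]
      _ ≤ ofReal (4 * D ^ 2 * τ ^ 2) * (ofReal (((τ ^ 2) ^ (n + 1))⁻¹) *
            ∫⁻ y in Q, ofReal (A * (τ ^ 2 * D) ^ n) * h y) := by
          gcongr with y
          calc ∫⁻ ξ in Q, K ξ y ∂ν ≤ ∫⁻ ξ, K ξ y ∂ν := setLIntegral_le_lintegral _ _
            _ = h y * ν (closedBall y (τ ^ 2 * D)) := by
              simp only [hK]
              rw [lintegral_indicator_const isClosed_closedBall.measurableSet]
            _ ≤ _ := by
              rw [mul_comm]; gcongr; exact hν _ _ (by positivity)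
      _ = _ := by
          rw [lintegral_const_mul _ hhm, ← mul_assoc, ← mul_assoc,
            ← ofReal_mul (by positivity), ← ofReal_mul (by positivity)]
          congr 2
          have : τ ≠ 0 := hτ.1.ne'
          field_simp
          ring
  calc ∫⁻ ξ in Q, ∫⁻ z in Q, ‖g ξ - g z‖ₑ ^ 2 ∂volume ∂ν
      ≤ ∫⁻ ξ in Q, ∫⁻ z in Q, ∫⁻ τ in I,
          ofReal (4 * D ^ 2 * τ ^ 2) * h (ξ + τ ^ 2 • (z - ξ)) ∂volume ∂volume ∂ν :=
        setLIntegral_mono' hQm fun ξ hξ => setLIntegral_mono' hQm fun z hz => hpt ξ hξ z hz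
    _ = ∫⁻ ξ in Q, ∫⁻ τ in I, ∫⁻ z in Q,
          ofReal (4 * D ^ 2 * τ ^ 2) * h (ξ + τ ^ 2 • (z - ξ)) ∂volume ∂volume ∂ν := by
        refine lintegral_congr fun ξ => lintegral_lintegral_swap ?_
        exact (hmeas3.comp (f := fun p : Euc (n + 1) × ℝ => (ξ, p.1, p.2))
          (by fun_prop)).aemeasurable
    _ = ∫⁻ τ in I, ∫⁻ ξ in Q, ∫⁻ z in Q,
          ofReal (4 * D ^ 2 * τ ^ 2) * h (ξ + τ ^ 2 • (z - ξ)) ∂volume ∂ν ∂volume := by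
        refine lintegral_lintegral_swap (Measurable.aemeasurable ?_)
        exact Measurable.lintegral_prod_right'
          (hmeas3.comp (f := fun p : (Euc (n + 1) × ℝ) × Euc (n + 1) => (p.1.1, p.2, p.1.2))
            (by fun_prop))
    _ ≤ ∫⁻ τ in I, ofReal (4 * A * D ^ (n + 2)) * ∫⁻ x in Q, h x :=
        setLIntegral_mono' measurableSet_Ioc hfix
    _ = _ := by simp [I]

/-- The average form of `lintegral_lintegral_sub_sq_le`. -/
theorem lintegral_sq_le_average {n : ℕ} {Q : Set (Euc (n + 1))} (hQ : Convex ℝ Q)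
    (hQc : IsCompact Q) (hQ0 : volume Q ≠ 0) {g : Euc (n + 1) → ℝ} (hg : ContDiff ℝ 1 g)
    (ν : Measure (Euc (n + 1))) [IsFiniteMeasure ν] {A D : ℝ} (hD : 0 < D) (hA : 0 ≤ A)
    (hν : ∀ y, ∀ r > 0, ν (closedBall y r) ≤ ofReal (A * r ^ n))
    (hdiam : ∀ x ∈ Q, ∀ y ∈ Q, dist x y ≤ D) :
    ∫⁻ ξ in Q, ‖g ξ‖ₑ ^ 2 ∂ν ≤ 2 * ((volume Q)⁻¹ * (ofReal (4 * A * D ^ (n + 2)) *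
        ∫⁻ x in Q, ‖fderiv ℝ g x‖ₑ ^ 2)) +
      2 * ν univ * ((volume Q)⁻¹ * ‖∫ x in Q, g x‖ₑ) ^ 2 := by
  have hQt : volume Q ≠ ⊤ := hQc.measure_lt_top.ne
  have hgc := hg.continuous
  have hgi : IntegrableOn g Q := hgc.continuousOn.integrableOn_compact hQc
  have hpt : ∀ ξ, ‖g ξ‖ₑ ^ 2 ≤ 2 * ((volume Q)⁻¹ * ∫⁻ z in Q, ‖g ξ - g z‖ₑ ^ 2) +
      2 * ((volume Q)⁻¹ * ‖∫ x in Q, g x‖ₑ) ^ 2 := by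
    intro ξ
    have h1 : volume Q * ‖g ξ‖ₑ ≤ (∫⁻ z in Q, ‖g ξ - g z‖ₑ) + ‖∫ x in Q, g x‖ₑ := by
      have h2 : ∫ z in Q, g ξ = (∫ z in Q, (g ξ - g z)) + ∫ z in Q, g z := by
        rw [integral_sub (integrable_const_iff.2 (Or.inr ⟨by simpa using hQt.lt_top⟩)) hgi, sub_add_cancel]
      have h3 : volume Q * ‖g ξ‖ₑ = ‖∫ z in Q, g ξ‖ₑ := by
        rw [setIntegral_const, enorm_smul, Measure.real, Real.enorm_of_nonneg toReal_nonneg,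
          ofReal_toReal hQt]
      rw [h3, h2]
      refine (enorm_add_le _ _).trans ?_
      gcongr
      exact enorm_integral_le_lintegral_enorm _
    have h4 : ‖g ξ‖ₑ ≤ (volume Q)⁻¹ * (∫⁻ z in Q, ‖g ξ - g z‖ₑ) +
        (volume Q)⁻¹ * ‖∫ x in Q, g x‖ₑ := by
      rw [← mul_add, ← ENNReal.div_eq_inv_mul, ENNReal.le_div_iff_mul_le (Or.inl hQ0) (Or.inl hQt),
        mul_comm]
      exact h1
    have h5 : ((volume Q)⁻¹ * (∫⁻ z in Q, ‖g ξ - g z‖ₑ)) ^ 2 ≤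
        (volume Q)⁻¹ * ∫⁻ z in Q, ‖g ξ - g z‖ₑ ^ 2 := by
      have h6 := sq_lintegral_le (μ := volume.restrict Q) (f := fun z => ‖g ξ - g z‖ₑ) (by fun_prop)
      rw [Measure.restrict_apply_univ] at h6
      calc ((volume Q)⁻¹ * (∫⁻ z in Q, ‖g ξ - g z‖ₑ)) ^ 2
          = (volume Q)⁻¹ ^ 2 * (∫⁻ z in Q, ‖g ξ - g z‖ₑ) ^ 2 := mul_pow _ _ _
        _ ≤ (volume Q)⁻¹ ^ 2 * (volume Q * ∫⁻ z in Q, ‖g ξ - g z‖ₑ ^ 2) := by gcongr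
        _ = (volume Q)⁻¹ * ((volume Q)⁻¹ * volume Q) * ∫⁻ z in Q, ‖g ξ - g z‖ₑ ^ 2 := by ring
        _ = _ := by rw [ENNReal.inv_mul_cancel hQ0 hQt, mul_one]
    have h7 : ∀ a b : ℝ≥0∞, (a + b) ^ 2 ≤ 2 * a ^ 2 + 2 * b ^ 2 := by
      intro a b
      rcases eq_or_ne a ⊤ with rfl | ha
      · simp
      rcases eq_or_ne b ⊤ with rfl | hb
      · simp
      lift a to NNReal using ha
      lift b to NNReal using hb
      norm_cast
      rw [← NNReal.coe_le_coe]
      push_cast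
      nlinarith [sq_nonneg ((a : ℝ) - b)]
    calc ‖g ξ‖ₑ ^ 2 ≤ _ := pow_le_pow_left' h4 2
      _ ≤ _ := h7 _ _
      _ ≤ _ := by gcongr
  have hm : Measurable fun ξ => ∫⁻ z in Q, ‖g ξ - g z‖ₑ ^ 2 :=
    Measurable.lintegral_prod_right' (f := fun p : Euc (n + 1) × Euc (n + 1) => ‖g p.1 - g p.2‖ₑ ^ 2)
      (by fun_prop)
  calc ∫⁻ ξ in Q, ‖g ξ‖ₑ ^ 2 ∂ν ≤ ∫⁻ ξ in Q, (2 * ((volume Q)⁻¹ * ∫⁻ z in Q, ‖g ξ - g z‖ₑ ^ 2) +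
      2 * ((volume Q)⁻¹ * ‖∫ x in Q, g x‖ₑ) ^ 2) ∂ν := lintegral_mono fun ξ => hpt ξ
    _ = 2 * ((volume Q)⁻¹ * ∫⁻ ξ in Q, ∫⁻ z in Q, ‖g ξ - g z‖ₑ ^ 2 ∂volume ∂ν) +
        2 * ((volume Q)⁻¹ * ‖∫ x in Q, g x‖ₑ) ^ 2 * ν Q := by
      rw [lintegral_add_right _ measurable_const, lintegral_const_mul _ (hm.const_mul _),
        lintegral_const_mul _ hm, setLIntegral_const]
    _ ≤ _ := by
      have h1 := lintegral_lintegral_sub_sq_le hQ hQc.measurableSet hg ν hD hA hν hdiam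
      rw [mul_assoc 2 (ν univ), mul_comm (ν univ), ← mul_assoc 2 (_ ^ 2)]
      gcongr
      exact Set.subset_univ _

set_option linter.unusedSectionVars false

/-! ### Square integrable functions -/

section SquareIntegrableFunctions

variable {α F : Type*} [MeasurableSpace α] [NormedAddCommGroup F] [InnerProductSpace ℝ F]
  {μ : Measure α}

/-- The inner product of `L²(μ; F)`, on functions. -/
def ip (μ : Measure α) (f g : α → F) : ℝ := ∫ x, ⟪f x, g x⟫ ∂μ

theorem integrable_inner {f g : α → F} (hf : MemLp f 2 μ) (hg : MemLp g 2 μ) :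
    Integrable (fun x => ⟪f x, g x⟫) μ := by
  refine Integrable.mono' (hf.norm.integrable_mul hg.norm)
    (hf.aestronglyMeasurable.inner hg.aestronglyMeasurable) (ae_of_all _ fun x => ?_)
  exact norm_inner_le_norm _ _

theorem integrable_norm_sq {f : α → F} (hf : MemLp f 2 μ) : Integrable (fun x => ‖f x‖ ^ 2) μ :=
  (memLp_two_iff_integrable_sq_norm hf.aestronglyMeasurable).1 hf

theorem ip_comm (f g : α → F) : ip μ f g = ip μ g f := by
  simp only [ip, real_inner_comm]

theorem ip_self (f : α → F) : ip μ f f = ∫ x, ‖f x‖ ^ 2 ∂μ := by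
  simp only [ip, real_inner_self_eq_norm_sq]

theorem ip_self_nonneg (f : α → F) : 0 ≤ ip μ f f := by
  rw [ip_self]; exact integral_nonneg fun x => by positivity

theorem enorm_sq_eq_ofReal (v : F) : ‖v‖ₑ ^ 2 = ofReal (‖v‖ ^ 2) := by
  rw [← ofReal_norm, ofReal_pow (norm_nonneg _)]

theorem eLpNorm_two_sq (f : α → F) : eLpNorm f 2 μ ^ 2 = ∫⁻ x, ‖f x‖ₑ ^ 2 ∂μ := by
  have := eLpNorm_nnreal_pow_eq_lintegral (μ := μ) (f := f) (p := 2) two_ne_zero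
  simpa using this

theorem ofReal_ip_self {f : α → F} (hf : MemLp f 2 μ) :
    ofReal (ip μ f f) = ∫⁻ x, ‖f x‖ₑ ^ 2 ∂μ := by
  rw [ip_self, ofReal_integral_eq_lintegral_ofReal (integrable_norm_sq hf)
    (ae_of_all _ fun x => by positivity)]
  simp only [enorm_sq_eq_ofReal]

theorem eLpNorm_le_iff {f : α → F} (hf : MemLp f 2 μ) {ε : ℝ} (hε : 0 ≤ ε) :
    eLpNorm f 2 μ ≤ ofReal ε ↔ ip μ f f ≤ ε ^ 2 := by
  rw [← ofReal_le_ofReal_iff (by positivity), ofReal_ip_self hf, ← eLpNorm_two_sq, ofReal_pow hε]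
  exact (ENNReal.pow_le_pow_left_iff two_ne_zero).symm

theorem memLp_of_lintegral_lt_top {f : α → F} (hf : AEStronglyMeasurable f μ)
    (h : ∫⁻ x, ‖f x‖ₑ ^ 2 ∂μ < ⊤) : MemLp f 2 μ := by
  refine ⟨hf, ?_⟩
  rw [← eLpNorm_two_sq] at h
  by_contra h'
  rw [not_lt, top_le_iff] at h'
  rw [h'] at h
  simp at h

theorem ip_le_of_norm_le {F' : Type*} [NormedAddCommGroup F'] [InnerProductSpace ℝ F']
    {f : α → F} {g : α → F'} (hg : MemLp g 2 μ) (h : ∀ᵐ x ∂μ, ‖f x‖ ≤ ‖g x‖) :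
    ip μ f f ≤ ip μ g g := by
  rw [ip_self, ip_self]
  refine integral_mono_of_nonneg (ae_of_all _ fun x => by positivity) (integrable_norm_sq hg) ?_
  filter_upwards [h] with x hx
  gcongr

variable {M : Type*} [AddCommGroup M] [Module ℝ M]

/-- The bilinear form `∫ ⟪D p, D q⟫ dμ` on a space of elements `p` with `D p ∈ L²(μ)`. -/
def ipForm (μ : Measure α) (D : M →ₗ[ℝ] (α → F)) (S : Submodule ℝ M)
    (h : ∀ p ∈ S, MemLp (D p) 2 μ) : BilinForm ℝ S :=
  LinearMap.mk₂ ℝ (fun p q => ip μ (D p) (D q)) (fun p p' q => by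
      simp only [ip, coe_add, map_add, Pi.add_apply, inner_add_left]
      exact integral_add (integrable_inner (h _ p.2) (h _ q.2)) (integrable_inner (h _ p'.2) (h _ q.2)))
    (fun c p q => by
      simp only [ip, coe_smul, map_smul, Pi.smul_apply, real_inner_smul_left,
        integral_const_mul, smul_eq_mul])
    (fun p q q' => by
      simp only [ip, coe_add, map_add, Pi.add_apply, inner_add_right]
      exact integral_add (integrable_inner (h _ p.2) (h _ q.2)) (integrable_inner (h _ p.2) (h _ q'.2)))
    (fun c p q => by
      simp only [ip, coe_smul, map_smul, Pi.smul_apply, real_inner_smul_right,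
        integral_const_mul, smul_eq_mul])

@[simp] theorem ipForm_apply (D : M →ₗ[ℝ] (α → F)) (S : Submodule ℝ M)
    (h : ∀ p ∈ S, MemLp (D p) 2 μ) (p q : S) : ipForm μ D S h p q = ip μ (D p) (D q) := rfl

theorem ipForm_semiInner (D : M →ₗ[ℝ] (α → F)) (S : Submodule ℝ M)
    (h : ∀ p ∈ S, MemLp (D p) 2 μ) : SemiInner (ipForm μ D S h) :=
  ⟨fun _ _ => ip_comm _ _, fun _ => ip_self_nonneg _⟩

/-- The submodule of square integrable functions. -/
def l2Sub (μ : Measure α) (F : Type*) [NormedAddCommGroup F] [InnerProductSpace ℝ F] :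
    Submodule ℝ (α → F) where
  carrier := {f | MemLp f 2 μ}
  add_mem' hf hg := hf.add hg
  zero_mem' := MemLp.zero
  smul_mem' c _ hf := hf.const_smul c

/-- The `L²` inner product as a bilinear form. -/
def l2Form (μ : Measure α) (F : Type*) [NormedAddCommGroup F] [InnerProductSpace ℝ F] :
    BilinForm ℝ (l2Sub μ F) :=
  ipForm μ LinearMap.id (l2Sub μ F) fun f (h : MemLp f 2 μ) => h

theorem l2Form_semiInner : SemiInner (l2Form μ F) := ipForm_semiInner _ _ _

theorem ip_add_self_le {f g : α → F} (hf : MemLp f 2 μ) (hg : MemLp g 2 μ) :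
    ip μ (f + g) (f + g) ≤ 2 * ip μ f f + 2 * ip μ g g :=
  (l2Form_semiInner (μ := μ) (F := F)).apply_add_le ⟨f, hf⟩ ⟨g, hg⟩

theorem ip_sub_self_le {f g : α → F} (hf : MemLp f 2 μ) (hg : MemLp g 2 μ) :
    ip μ (f - g) (f - g) ≤ 2 * ip μ f f + 2 * ip μ g g :=
  (l2Form_semiInner (μ := μ) (F := F)).apply_sub_le ⟨f, hf⟩ ⟨g, hg⟩

theorem abs_ip_le {f g : α → F} (hf : MemLp f 2 μ) (hg : MemLp g 2 μ) :
    |ip μ f g| ≤ √(ip μ f f) * √(ip μ g g) :=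
  (l2Form_semiInner (μ := μ) (F := F)).abs_apply_le ⟨f, hf⟩ ⟨g, hg⟩

/-- `L²(μ)` is complete. -/
theorem exists_limit_of_cauchy [CompleteSpace F] {f : ℕ → α → F} (hf : ∀ n, MemLp (f n) 2 μ)
    (hc : ∀ ε > 0, ∃ N, ∀ m ≥ N, ∀ n ≥ N, ip μ (f m - f n) (f m - f n) < ε) :
    ∃ g, MemLp g 2 μ ∧ ∀ ε > 0, ∃ N, ∀ n ≥ N, ip μ (f n - g) (f n - g) < ε := by
  have key : ∀ {u v : α → F} (hu : MemLp u 2 μ) (hv : MemLp v 2 μ),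
      dist (hu.toLp u) (hv.toLp v) ^ 2 = ip μ (u - v) (u - v) := by
    intro u v hu hv
    rw [dist_eq_norm, ← MemLp.toLp_sub, Lp.norm_toLp, ← ENNReal.toReal_pow, eLpNorm_two_sq,
      ← ofReal_ip_self (hu.sub hv), ENNReal.toReal_ofReal (ip_self_nonneg _)]
  have hcau : CauchySeq fun n => (hf n).toLp (f n) := by
    rw [Metric.cauchySeq_iff]
    intro ε hε
    obtain ⟨N, hN⟩ := hc (ε ^ 2) (by positivity)
    refine ⟨N, fun m hm n hn => ?_⟩
    have := hN m hm n hn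
    rw [← key (hf m) (hf n)] at this
    exact lt_of_pow_lt_pow_left₀ 2 hε.le this
  obtain ⟨g, hg⟩ := cauchySeq_tendsto_of_complete hcau
  refine ⟨g, Lp.memLp g, fun ε hε => ?_⟩
  obtain ⟨N, hN⟩ := Metric.tendsto_atTop.1 hg (√ε) (Real.sqrt_pos.2 hε)
  refine ⟨N, fun n hn => ?_⟩
  rw [← key (hf n) (Lp.memLp g), Lp.toLp_coeFn]
  exact (Real.lt_sqrt dist_nonneg).1 (hN n hn)

/-- Pointwise bounds pass to `L²` limits. -/
theorem ae_norm_le_of_limit {f : ℕ → α → F} {g a : α → F} {b : α → ℝ}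
    (hf : ∀ n, MemLp (f n) 2 μ) (hg : MemLp g 2 μ)
    (hlim : ∀ ε > 0, ∃ N, ∀ n ≥ N, ip μ (f n - g) (f n - g) < ε)
    {k : ℕ → α → F} (hk : ∀ᶠ n in atTop, ∀ᵐ x ∂μ, ‖k n x‖ ≤ b x)
    (hkm : ∀ n, MemLp (f n - a - k n) 2 μ)
    (hkl : ∀ ε > 0, ∃ N, ∀ n ≥ N, ip μ (f n - a - k n) (f n - a - k n) < ε) :
    ∀ᵐ x ∂μ, ‖g x - a x‖ ≤ b x := by
  have h1 : Tendsto (fun n => eLpNorm (fun x => ‖f n x - g x‖ + ‖f n x - a x - k n x‖) 2 μ)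
      atTop (nhds 0) := by
    rw [ENNReal.tendsto_atTop_zero]
    intro ε hε
    rcases eq_or_ne ε ⊤ with rfl | ht
    · exact ⟨0, fun n _ => le_top⟩
    have hr : 0 < ε.toReal := ENNReal.toReal_pos hε.ne' ht
    obtain ⟨N1, hN1⟩ := hlim ((ε.toReal / 2) ^ 2) (by positivity)
    obtain ⟨N2, hN2⟩ := hkl ((ε.toReal / 2) ^ 2) (by positivity)
    refine ⟨max N1 N2, fun n hn => ?_⟩
    have e1 := (eLpNorm_le_iff ((hf n).sub hg) (by positivity)).2
      (hN1 n ((le_max_left _ _).trans hn)).le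
    have e2 := (eLpNorm_le_iff (hkm n) (by positivity)).2 (hN2 n ((le_max_right _ _).trans hn)).le
    have m1 := ((hf n).sub hg).norm.aestronglyMeasurable
    have m2 := (hkm n).norm.aestronglyMeasurable
    calc eLpNorm (fun x => ‖f n x - g x‖ + ‖f n x - a x - k n x‖) 2 μ
        ≤ eLpNorm (fun x => ‖f n x - g x‖) 2 μ + eLpNorm (fun x => ‖f n x - a x - k n x‖) 2 μ :=
          eLpNorm_add_le m1 m2 one_le_two
      _ ≤ ofReal (ε.toReal / 2) + ofReal (ε.toReal / 2) :=
          add_le_add ((eLpNorm_norm (f n - g)).trans_le e1)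
            ((eLpNorm_norm (f n - a - k n)).trans_le e2)
      _ = ε := by
        rw [← ofReal_add (by positivity) (by positivity), add_halves, ofReal_toReal ht]
  have h2 : TendstoInMeasure μ (fun n x => ‖f n x - g x‖ + ‖f n x - a x - k n x‖) atTop
      (fun _ => (0 : ℝ)) := by
    refine tendstoInMeasure_of_tendsto_eLpNorm two_ne_zero (fun n => ?_)
      aestronglyMeasurable_const ?_
    · exact ((hf n).sub hg).norm.aestronglyMeasurable.add (hkm n).norm.aestronglyMeasurable
    · refine h1.congr fun n => ?_
      congr 1
      ext x
      simp
  obtain ⟨ns, hns, hae⟩ := h2.exists_seq_tendsto_ae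
  obtain ⟨N, hN⟩ := Filter.eventually_atTop.1 hk
  have hk' : ∀ᵐ x ∂μ, ∀ n ≥ N, ‖k n x‖ ≤ b x := by
    rw [ae_all_iff]
    intro n
    by_cases h : N ≤ n
    · filter_upwards [hN n h] with x hx _ using hx
    · exact ae_of_all _ fun x h' => absurd h' h
  filter_upwards [hae, hk'] with x hx hkx
  have hlim' := hx.const_add (b x)
  rw [add_zero] at hlim'
  refine ge_of_tendsto hlim' ?_
  filter_upwards [hns.tendsto_atTop.eventually_ge_atTop N] with i hi
  have e : g x - a x = (f (ns i) x - a x - k (ns i) x) - (f (ns i) x - g x) + k (ns i) x := by abel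
  rw [e]
  linarith [hkx (ns i) hi,
    norm_add_le ((f (ns i) x - a x - k (ns i) x) - (f (ns i) x - g x)) (k (ns i) x),
    norm_sub_le (f (ns i) x - a x - k (ns i) x) (f (ns i) x - g x)]

end SquareIntegrableFunctions

/-! ### The disjoint union of the bulk and the fractures -/

/-- Points of the bulk or parameters of points of one of `k` fractures. -/
abbrev Pt (n k : ℕ) : Type := Euc (n + 1) ⊕ (Fin k × Euc n)

/-- The points of the bulk and of the fractures of `G`. -/
abbrev Pts {n : ℕ} (G : Geometry n) : Type := Pt n G.numFrac

/-- The scalar fields on the bulk and the fractures of `G`. -/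
abbrev Scalars {n : ℕ} (G : Geometry n) : Type := ScalarField n G.numFrac

/-- The pairs of scalar fields on the bulk and the fractures of `G`. -/
abbrev Fields {n : ℕ} (G : Geometry n) : Type := Field n G.numFrac

/-- Gradients in the bulk or along fractures. -/
abbrev Grd (n : ℕ) : Type := WithLp 2 (Euc (n + 1) × Euc n)

section Points

variable {n k : ℕ}

theorem measurableEmbedding_bulk : MeasurableEmbedding (Sum.inl : Euc (n + 1) → Pt n k) :=
  ⟨Sum.inl_injective, measurable_inl, fun _ hs => measurableSet_inl_image.2 hs⟩

theorem measurableEmbedding_frac (l : Fin k) :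
    MeasurableEmbedding (fun t => Sum.inr (l, t) : Euc n → Pt n k) := by
  have h1 : MeasurableEmbedding (Sum.inr : Fin k × Euc n → Pt n k) :=
    ⟨Sum.inr_injective, measurable_inr, fun _ hs => measurableSet_inr_image.2 hs⟩
  exact h1.comp (MeasurableEmbedding.prodMk_left l MeasurableEmbedding.id)

/-- Values, on the bulk and the fractures. -/
def vl : ScalarField n k →ₗ[ℝ] (Pt n k → ℝ) where
  toFun w := Sum.elim w.val fun q => w.fval q.1 q.2
  map_add' w w' := by ext y; rcases y with x | q <;> rfl
  map_smul' c w := by ext y; rcases y with x | q <;> rfl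

/-- Gradients, on the bulk and the fractures. -/
def gr : ScalarField n k →ₗ[ℝ] (Pt n k → Grd n) where
  toFun w := Sum.elim (fun x => WithLp.toLp 2 (w.grad x, 0))
    fun q => WithLp.toLp 2 (0, w.fgrad q.1 q.2)
  map_add' w w' := by
    refine funext fun y => (WithLp.ofLp_injective 2 ?_)
    rcases y with x | q
    · exact Prod.ext rfl (add_zero (0 : Euc n)).symm
    · exact Prod.ext (add_zero (0 : Euc (n + 1))).symm rfl
  map_smul' c w := by
    refine funext fun y => (WithLp.ofLp_injective 2 ?_)
    rcases y with x | q
    · exact Prod.ext rfl (smul_zero c).symm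
    · exact Prod.ext (smul_zero c).symm rfl

@[simp] theorem vl_inl (w : ScalarField n k) (x) : vl w (Sum.inl x) = w.val x := rfl
@[simp] theorem vl_inr (w : ScalarField n k) (l t) : vl w (Sum.inr (l, t)) = w.fval l t := rfl
@[simp] theorem gr_inl (w : ScalarField n k) (x) :
    gr w (Sum.inl x) = WithLp.toLp 2 (w.grad x, 0) := rfl
@[simp] theorem gr_inr (w : ScalarField n k) (l t) :
    gr w (Sum.inr (l, t)) = WithLp.toLp 2 (0, w.fgrad l t) := rfl

theorem norm_toLp_left (a : Euc (n + 1)) : ‖(WithLp.toLp 2 (a, 0) : Grd n)‖ = ‖a‖ := by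
  rw [← sq_eq_sq₀ (norm_nonneg _) (norm_nonneg _), WithLp.prod_norm_sq_eq_of_L2]
  simp

theorem norm_toLp_right (b : Euc n) : ‖(WithLp.toLp 2 (0, b) : Grd n)‖ = ‖b‖ := by
  rw [← sq_eq_sq₀ (norm_nonneg _) (norm_nonneg _), WithLp.prod_norm_sq_eq_of_L2]
  simp

theorem norm_gr_inl (w : ScalarField n k) (x) : ‖gr w (Sum.inl x)‖ = ‖w.grad x‖ := norm_toLp_left _

theorem norm_gr_inr (w : ScalarField n k) (l t) : ‖gr w (Sum.inr (l, t))‖ = ‖w.fgrad l t‖ :=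
  norm_toLp_right _

theorem inner_gr_inl (w w' : ScalarField n k) (x) :
    ⟪gr w (Sum.inl x), gr w' (Sum.inl x)⟫ = ⟪w.grad x, w'.grad x⟫ := by
  simp [WithLp.prod_inner_apply]

theorem inner_gr_inr (w w' : ScalarField n k) (l t) :
    ⟪gr w (Sum.inr (l, t)), gr w' (Sum.inr (l, t))⟫ = ⟪w.fgrad l t, w'.fgrad l t⟫ := by
  simp [WithLp.prod_inner_apply]

/-- The field with given values and gradients. -/
def ofParts (v : Pt n k → ℝ) (g : Pt n k → Grd n) : ScalarField n k :=
  (fun x => v (Sum.inl x), fun x => (g (Sum.inl x)).fst, fun l t => v (Sum.inr (l, t)),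
    fun l t => (g (Sum.inr (l, t))).snd)

@[simp] theorem vl_ofParts (v : Pt n k → ℝ) (g : Pt n k → Grd n) : vl (ofParts v g) = v := by
  ext y; rcases y with x | ⟨l, t⟩ <;> rfl

theorem norm_gr_sub_ofParts_le (v : Pt n k → ℝ) (g : Pt n k → Grd n) (w : ScalarField n k) (y) :
    ‖gr w y - gr (ofParts v g) y‖ ≤ ‖gr w y - g y‖ := by
  rw [← sq_le_sq₀ (norm_nonneg _) (norm_nonneg _), WithLp.prod_norm_sq_eq_of_L2,
    WithLp.prod_norm_sq_eq_of_L2]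
  rcases y with x | ⟨l, t⟩ <;> simp [ofParts]

end Points

section Measures

variable {n : ℕ} (G : Geometry n)

/-- The position in space of a point of the bulk or the fractures. -/
def pos : Pts G → Euc (n + 1) := Sum.elim id fun q => G.emb q.1 q.2

@[simp] theorem pos_inl (x) : pos G (Sum.inl x) = x := rfl
@[simp] theorem pos_inr (l t) : pos G (Sum.inr (l, t)) = G.emb l t := rfl

theorem continuous_emb (l) : Continuous (G.emb l) := (G.contDiff_emb l).continuous

theorem measurable_pos : Measurable (pos G) := by
  refine Measurable.sumElim measurable_id ?_
  exact measurable_from_prod_countable_right fun l => (continuous_emb G l).measurable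

/-- Volume in the bulk plus surface measure on the fractures, in the region `R`. -/
def mm (R : Set (Euc (n + 1))) : Measure (Pts G) := (volume.restrict R).map Sum.inl +
    Measure.sum fun l => (volume.restrict (fracPart G R l)).map fun t => Sum.inr (l, t)

variable {G} {R : Set (Euc (n + 1))}

theorem measurableSet_fracPart (hR : MeasurableSet R) (l) : MeasurableSet (fracPart G R l) :=
  (G.isOpen_U l).measurableSet.inter ((continuous_emb G l).measurable hR)

theorem fracPart_Ω (l) : fracPart G G.Ω l = G.U l := Set.inter_eq_left.2 (G.mapsTo_emb l)

theorem lintegral_mm (f : Pts G → ℝ≥0∞) : ∫⁻ y, f y ∂mm G R = (∫⁻ x in R, f (Sum.inl x)) +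
      ∑ l, ∫⁻ t in fracPart G R l, f (Sum.inr (l, t)) := by
  rw [mm, lintegral_add_measure, measurableEmbedding_bulk.lintegral_map, lintegral_sum_measure,
    tsum_fintype]
  simp_rw [(measurableEmbedding_frac _).lintegral_map]

theorem ae_mm_iff {p : Pts G → Prop} :
    (∀ᵐ y ∂mm G R, p y) ↔ (∀ᵐ x ∂volume.restrict R, p (Sum.inl x)) ∧
      ∀ l, ∀ᵐ t ∂volume.restrict (fracPart G R l), p (Sum.inr (l, t)) := by
  rw [mm, ae_add_measure_iff, measurableEmbedding_bulk.ae_map_iff, Measure.ae_sum_iff]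
  simp_rw [(measurableEmbedding_frac _).ae_map_iff]

theorem aestronglyMeasurable_mm_iff {F : Type*} [NormedAddCommGroup F] {f : Pts G → F} :
    AEStronglyMeasurable f (mm G R) ↔
      AEStronglyMeasurable (fun x => f (Sum.inl x)) (volume.restrict R) ∧
      ∀ l, AEStronglyMeasurable (fun t => f (Sum.inr (l, t)))
        (volume.restrict (fracPart G R l)) := by
  rw [mm, aestronglyMeasurable_add_measure_iff,
    measurableEmbedding_bulk.aestronglyMeasurable_map_iff, aestronglyMeasurable_sum_measure_iff]
  simp_rw [(measurableEmbedding_frac _).aestronglyMeasurable_map_iff]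
  rfl

theorem memLp_two_iff {α F : Type*} [MeasurableSpace α] [NormedAddCommGroup F]
    [InnerProductSpace ℝ F] {μ : Measure α} {g : α → F} :
    MemLp g 2 μ ↔ AEStronglyMeasurable g μ ∧ ∫⁻ x, ‖g x‖ₑ ^ 2 ∂μ < ⊤ := by
  refine ⟨fun h => ⟨h.1, ?_⟩, fun h => memLp_of_lintegral_lt_top h.1 h.2⟩
  rw [← ofReal_ip_self h]; exact ENNReal.ofReal_lt_top

theorem memLp_mm_iff {F : Type*} [NormedAddCommGroup F] [InnerProductSpace ℝ F] {f : Pts G → F} :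
    MemLp f 2 (mm G R) ↔ MemLp (fun x => f (Sum.inl x)) 2 (volume.restrict R) ∧
      ∀ l, MemLp (fun t => f (Sum.inr (l, t))) 2 (volume.restrict (fracPart G R l)) := by
  simp_rw [memLp_two_iff]
  rw [aestronglyMeasurable_mm_iff, lintegral_mm, ENNReal.add_lt_top, ENNReal.sum_lt_top]
  constructor
  · rintro ⟨⟨h1, h2⟩, h3, h4⟩
    exact ⟨⟨h1, h3⟩, fun l => ⟨h2 l, h4 l (mem_univ l)⟩⟩
  · rintro ⟨⟨h1, h3⟩, h⟩
    exact ⟨⟨h1, fun l => (h l).1⟩, h3, fun l _ => (h l).2⟩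

theorem integral_mm {f : Pts G → ℝ} (hf : Integrable f (mm G R)) :
    ∫ y, f y ∂mm G R = (∫ x in R, f (Sum.inl x)) +
      ∑ l, ∫ t in fracPart G R l, f (Sum.inr (l, t)) := by
  unfold mm at hf ⊢
  have h2 := hf.right_of_add_measure
  rw [integral_add_measure hf.left_of_add_measure h2, measurableEmbedding_bulk.integral_map]
  rw [Measure.sum_fintype] at h2 ⊢
  rw [integral_finsetSum_measure fun l _ => h2.mono_measure
    (single_le_sum (f := fun l => (volume.restrict (fracPart G R l)).map
      fun t => (Sum.inr (l, t) : Pts G)) (fun _ _ => Measure.zero_le _) (mem_univ l))]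
  simp_rw [(measurableEmbedding_frac _).integral_map]

theorem mm_restrict (R : Set (Euc (n + 1))) {R' : Set (Euc (n + 1))} (hR' : MeasurableSet R') :
    (mm G R).restrict (pos G ⁻¹' R') = mm G (R ∩ R') := by
  rw [mm, Measure.restrict_add, measurableEmbedding_bulk.restrict_map,
    Measure.restrict_sum _ (measurable_pos G hR'), mm]
  simp_rw [(measurableEmbedding_frac _).restrict_map]
  rw [Measure.restrict_restrict (by exact hR')]
  congr 2
  · rw [inter_comm]; rfl
  · ext1 l
    have hm : MeasurableSet ((fun t => (Sum.inr (l, t) : Pts G)) ⁻¹' (pos G ⁻¹' R')) :=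
      (continuous_emb G l).measurable hR'
    rw [Measure.restrict_restrict hm]
    congr 2
    ext t
    simp only [fracPart, pos, Set.mem_inter_iff, mem_preimage, Sum.elim_inr]
    tauto

theorem mm_eq_restrict (hR : MeasurableSet R) (hRΩ : R ⊆ G.Ω) :
    mm G R = (mm G G.Ω).restrict (pos G ⁻¹' R) := by
  rw [mm_restrict _ hR, Set.inter_eq_right.2 hRΩ]

theorem mm_le (hR : MeasurableSet R) (hRΩ : R ⊆ G.Ω) : mm G R ≤ mm G G.Ω := by
  rw [mm_eq_restrict hR hRΩ]; exact Measure.restrict_le_self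

theorem ae_mm_pos_mem (hR : MeasurableSet R) : ∀ᵐ y ∂mm G R, pos G y ∈ R := by
  rw [ae_mm_iff]
  exact ⟨ae_restrict_mem hR, fun l =>
    (ae_restrict_mem (measurableSet_fracPart hR l)).mono fun t ht => ht.2⟩

/-- The points that lie in `Ω`, or whose parameters lie in `U`. -/
def legit (G : Geometry n) : Set (Pts G) :=
  {y | Sum.elim (fun x => x ∈ G.Ω) (fun q => q.2 ∈ G.U q.1) y}

theorem ae_mm_legit (hR : MeasurableSet R) (hRΩ : R ⊆ G.Ω) : ∀ᵐ y ∂mm G R, y ∈ legit G := by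
  rw [ae_mm_iff]
  exact ⟨(ae_restrict_mem hR).mono fun x hx => hRΩ hx, fun l =>
    (ae_restrict_mem (measurableSet_fracPart hR l)).mono fun t ht => ht.1⟩

theorem legit_pos {y : Pts G} (hy : y ∈ legit G) : pos G y ∈ G.Ω := by
  rcases y with x | ⟨l, t⟩
  · exact hy
  · exact G.mapsTo_emb l hy

theorem mm_univ_lt_top : mm G G.Ω univ < ⊤ := by
  rw [← lintegral_one, lintegral_mm]
  simp only [lintegral_one, Measure.restrict_apply_univ]
  refine ENNReal.add_lt_top.2 ⟨G.isBounded_Ω.measure_lt_top, ENNReal.sum_lt_top.2 fun l _ => ?_⟩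
  rw [fracPart_Ω]
  exact (G.isBounded_U l).measure_lt_top

instance : IsFiniteMeasure (mm G G.Ω) := ⟨mm_univ_lt_top⟩

end Measures

/-! ### Fields of smooth functions and their closure -/

section Closure

variable {n : ℕ} {G : Geometry n} {O R : Set (Euc (n + 1))}

@[simp] theorem vl_smoothField (f : Euc (n + 1) → ℝ) (y) :
    vl (smoothField G f) y = f (pos G y) := by
  rcases y with x | ⟨l, t⟩ <;> rfl

theorem norm_gradient_eq {E : Type*} [NormedAddCommGroup E] [InnerProductSpace ℝ E]
    [CompleteSpace E] (f : E → ℝ) (x : E) : ‖gradient f x‖ = ‖fderiv ℝ f x‖ := by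
  rw [← toDual_gradient, LinearIsometryEquiv.norm_map]

theorem norm_gr_smoothField_le {g : Euc (n + 1) → ℝ} {L : ℝ} (hL : 0 ≤ L)
    {y : Pts G} (hy : y ∈ legit G)
    (h : ∀ᶠ x in nhds (pos G y), |g x - g (pos G y)| ≤ L * ‖x - pos G y‖) :
    ‖gr (smoothField G g) y‖ ≤ L := by
  rcases y with x | ⟨l, t⟩
  · rw [norm_gr_inl]
    show ‖gradient g x‖ ≤ L
    rw [norm_gradient_eq]
    exact norm_fderiv_le_of_lip' ℝ hL h
  · rw [norm_gr_inr]
    show ‖gradient (fun r => g (G.emb l r)) t‖ ≤ L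
    rw [norm_gradient_eq]
    have ht : t ∈ G.U l := hy
    refine le_of_forall_pos_le_add fun ε hε => ?_
    have hK : ∃ K : NNReal, 1 < K ∧ L * K ≤ L + ε := by
      refine ⟨Real.toNNReal (1 + ε / (L + 1)), ?_, ?_⟩
      · rw [Real.one_lt_toNNReal]
        have : 0 < ε / (L + 1) := by positivity
        linarith
      · rw [coe_toNNReal _ (by positivity)]
        have : L * (ε / (L + 1)) ≤ ε := by
          rw [mul_div_assoc', div_le_iff₀ (by positivity)]; nlinarith
        linarith
    obtain ⟨K, hK1, hK2⟩ := hK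
    have hs := (G.contDiff_emb l).contDiffAt (x := t) |>.hasStrictFDerivAt one_ne_zero
    have hn : ‖fderiv ℝ (G.emb l) t‖₊ < K := by
      refine lt_of_le_of_lt ?_ hK1
      rw [← NNReal.coe_le_coe]
      exact ContinuousLinearMap.opNorm_le_bound _ zero_le_one fun v => by
        rw [G.isometric_emb l t ht v]; simp
    obtain ⟨s, hs, hlip⟩ := hs.exists_lipschitzOnWith_of_nnnorm_lt K hn
    refine norm_fderiv_le_of_lip' ℝ (by positivity) ?_
    filter_upwards [hs, (continuous_emb G l).continuousAt.eventually h] with r hr hgr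
    calc ‖g (G.emb l r) - g (G.emb l t)‖ ≤ L * ‖G.emb l r - G.emb l t‖ := hgr
      _ ≤ L * (K * ‖r - t‖) := by
        gcongr
        have := hlip.dist_le_mul r hr t (mem_of_mem_nhds hs)
        rwa [dist_eq_norm, dist_eq_norm] at this
      _ = (L * K) * ‖r - t‖ := by ring
      _ ≤ _ := by gcongr

theorem gr_smoothField_eq_zero {g : Euc (n + 1) → ℝ} {y : Pts G}
    (h : ∀ᶠ x in nhds (pos G y), g x = g (pos G y)) : gr (smoothField G g) y = 0 := by
  rcases y with x | ⟨l, t⟩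
  · have : gradient g x = 0 := by
      rw [Filter.EventuallyEq.gradient_eq (f := fun _ => g x) (x := x) h, gradient_fun_const]
    rw [← norm_eq_zero, norm_gr_inl]
    exact norm_eq_zero.2 this
  · have h' : ∀ᶠ r in nhds t, g (G.emb l r) = g (G.emb l t) :=
      (continuous_emb G l).continuousAt.eventually h
    have : gradient (fun r => g (G.emb l r)) t = 0 := by
      rw [Filter.EventuallyEq.gradient_eq (f := fun _ => g (G.emb l t)) h', gradient_fun_const]
    rw [← norm_eq_zero, norm_gr_inr]
    exact norm_eq_zero.2 this

theorem measurable_gradient {E : Type*} [NormedAddCommGroup E] [InnerProductSpace ℝ E]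
    [CompleteSpace E] [MeasurableSpace E] [BorelSpace E] [SecondCountableTopology E]
    [SecondCountableTopology (E →L[ℝ] ℝ)] (f : E → ℝ) : Measurable (gradient f) :=
  (InnerProductSpace.toDual ℝ E).symm.continuous.measurable.comp (measurable_fderiv ℝ f)

theorem measurable_gr_smoothField (g : Euc (n + 1) → ℝ) : Measurable (gr (smoothField G g)) := by
  refine Measurable.sumElim ?_ ?_
  · exact (WithLp.prod_continuous_toLp 2 _ _).measurable.comp
      ((measurable_gradient g).prodMk measurable_const)
  · refine measurable_from_prod_countable_right fun l => ?_
    exact (WithLp.prod_continuous_toLp 2 _ _).measurable.comp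
      (measurable_const.prodMk (measurable_gradient fun r => g (G.emb l r)))

theorem smoothField_add {f g : Euc (n + 1) → ℝ} (hf : Differentiable ℝ f)
    (hg : Differentiable ℝ g) :
    smoothField G (f + g) = smoothField G f + smoothField G g := by
  have he := fun l => (G.contDiff_emb l).differentiable one_ne_zero
  refine Prod.ext rfl (Prod.ext ?_ (Prod.ext rfl ?_))
  · funext x
    show gradient (f + g) x = gradient f x + gradient g x
    simp only [gradient]
    rw [fderiv_add (hf x) (hg x), map_add]
  · funext l t
    show gradient (fun r => f (G.emb l r) + g (G.emb l r)) t = _ + _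
    simp only [gradient]
    rw [fderiv_fun_add (f := fun r => f (G.emb l r)) (g := fun r => g (G.emb l r))
      ((hf _).comp t (he l t)) ((hg _).comp t (he l t)), map_add]
    rfl

theorem smoothField_smul (c : ℝ) {f : Euc (n + 1) → ℝ} (hf : Differentiable ℝ f) :
    smoothField G (c • f) = c • smoothField G f := by
  have he := fun l => (G.contDiff_emb l).differentiable one_ne_zero
  refine Prod.ext rfl (Prod.ext ?_ (Prod.ext rfl ?_))
  · funext x
    show gradient (c • f) x = c • gradient f x
    simp only [gradient]
    rw [fderiv_const_smul (hf x), map_smul]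
  · funext l t
    show gradient (fun r => c • f (G.emb l r)) t = c • gradient (fun r => f (G.emb l r)) t
    simp only [gradient]
    rw [fderiv_fun_const_smul (f := fun r => f (G.emb l r)) ((hf _).comp t (he l t)), map_smul]

/-- Smooth functions with compact support in `O`. -/
structure IsTest (O : Set (Euc (n + 1))) (f : Euc (n + 1) → ℝ) : Prop where
  contDiff : ContDiff ℝ ∞ f
  hasCompactSupport : HasCompactSupport f
  tsupport_subset : tsupport f ⊆ O

theorem IsTest.differentiable {f : Euc (n + 1) → ℝ} (h : IsTest O f) : Differentiable ℝ f :=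
  h.contDiff.differentiable (by simp)

theorem IsTest.add {f g : Euc (n + 1) → ℝ} (hf : IsTest O f) (hg : IsTest O g) : IsTest O (f + g) :=
  ⟨hf.1.add hg.1, hf.2.add hg.2, (tsupport_add f g).trans (Set.union_subset hf.3 hg.3)⟩

theorem IsTest.smul {f : Euc (n + 1) → ℝ} (hf : IsTest O f) (c : ℝ) : IsTest O (c • f) := by
  have h : tsupport (c • f) ⊆ tsupport f := closure_mono fun x hx => by
    simp only [Function.mem_support, Pi.smul_apply, smul_eq_mul, ne_eq, mul_eq_zero, not_or] at hx ⊢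
    exact hx.2
  exact ⟨contDiff_const.smul hf.1, hf.2.of_isClosed_subset (isClosed_tsupport _) h, h.trans hf.3⟩

theorem IsTest.zero : IsTest O (0 : Euc (n + 1) → ℝ) :=
  ⟨contDiff_const, HasCompactSupport.zero, by simp [tsupport]⟩

theorem IsTest.exists_bound {f : Euc (n + 1) → ℝ} (hf : IsTest O f) :
    ∃ C : ℝ, 0 ≤ C ∧ (∀ x, |f x| ≤ C) ∧ ∀ y ∈ legit G, ‖gr (smoothField G f) y‖ ≤ C := by
  obtain ⟨C1, h1⟩ := hf.hasCompactSupport.exists_bound_of_continuous hf.contDiff.continuous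
  obtain ⟨C2, h2⟩ := (hf.hasCompactSupport.fderiv ℝ).exists_bound_of_continuous
    (hf.contDiff.continuous_fderiv (by simp))
  have h2' : 0 ≤ C2 := (norm_nonneg _).trans (h2 0)
  refine ⟨max C1 C2, h2'.trans (le_max_right _ _), fun x => (h1 x).trans (le_max_left _ _),
    fun y hy => ?_⟩
  refine (norm_gr_smoothField_le h2' hy (Filter.Eventually.of_forall fun x => ?_)).trans
    (le_max_right _ _)
  exact Convex.norm_image_sub_le_of_norm_fderiv_le (𝕜 := ℝ) (s := univ)
    (fun x _ => hf.differentiable x) (fun x _ => h2 x) convex_univ (Set.mem_univ _)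
    (Set.mem_univ _)

theorem IsTest.memLp_vl {f : Euc (n + 1) → ℝ} (hf : IsTest O f) (hR : MeasurableSet R)
    (hRΩ : R ⊆ G.Ω) : MemLp (vl (smoothField G f)) 2 (mm G R) := by
  obtain ⟨C, -, h, -⟩ := hf.exists_bound (G := G)
  have : MemLp (vl (smoothField G f)) 2 (mm G G.Ω) := by
    refine MemLp.of_bound ?_ C (ae_of_all _ fun y => ?_)
    · have : vl (smoothField G f) = f ∘ pos G := funext fun y => vl_smoothField f y
      rw [this]
      exact (hf.contDiff.continuous.measurable.comp (measurable_pos G)).aestronglyMeasurable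
    · rw [vl_smoothField]; exact h _
  exact this.mono_measure (mm_le hR hRΩ)

theorem IsTest.memLp_gr {f : Euc (n + 1) → ℝ} (hf : IsTest O f) (hR : MeasurableSet R)
    (hRΩ : R ⊆ G.Ω) : MemLp (gr (smoothField G f)) 2 (mm G R) := by
  obtain ⟨C, -, -, h⟩ := hf.exists_bound (G := G)
  have : MemLp (gr (smoothField G f)) 2 (mm G G.Ω) := by
    refine MemLp.of_bound (measurable_gr_smoothField f).aestronglyMeasurable C ?_
    exact (ae_mm_legit G.isOpen_Ω.measurableSet subset_rfl).mono fun y hy => h y hy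
  exact this.mono_measure (mm_le hR hRΩ)

theorem squareIntegrable_iff {w : Scalars G} :
    SquareIntegrable G R w ↔ MemLp (vl w) 2 (mm G R) ∧ MemLp (gr w) 2 (mm G R) := by
  rw [memLp_mm_iff, memLp_mm_iff]
  have e1 : ∀ {α : Type} [MeasurableSpace α] (μ : Measure α) (g : α → Euc (n + 1)),
      MemLp g 2 μ ↔ MemLp (fun x => (WithLp.toLp 2 (g x, 0) : Grd n)) 2 μ := by
    intro α _ μ g
    refine ⟨fun h => ?_, fun h => (WithLp.fstL 2 ℝ (Euc (n + 1)) (Euc n)).comp_memLp' h⟩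
    exact ((WithLp.prodContinuousLinearEquiv 2 ℝ (Euc (n + 1)) (Euc n)).symm.toContinuousLinearMap.comp
      (ContinuousLinearMap.inl ℝ _ _)).comp_memLp' h
  have e2 : ∀ {α : Type} [MeasurableSpace α] (μ : Measure α) (g : α → Euc n),
      MemLp g 2 μ ↔ MemLp (fun x => (WithLp.toLp 2 (0, g x) : Grd n)) 2 μ := by
    intro α _ μ g
    refine ⟨fun h => ?_, fun h => (WithLp.sndL 2 ℝ (Euc (n + 1)) (Euc n)).comp_memLp' h⟩
    exact ((WithLp.prodContinuousLinearEquiv 2 ℝ (Euc (n + 1)) (Euc n)).symm.toContinuousLinearMap.comp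
      (ContinuousLinearMap.inr ℝ _ _)).comp_memLp' h
  constructor
  · rintro ⟨h1, h2, h3, h4⟩
    exact ⟨⟨h1, h3⟩, (e1 _ _).1 h2, fun l => (e2 _ _).1 (h4 l)⟩
  · rintro ⟨⟨h1, h3⟩, h2, h4⟩
    exact ⟨h1, (e1 _ _).2 h2, h3, fun l => (e2 _ _).2 (h4 l)⟩

theorem eLpNorm_le_iff_lintegral {α F : Type*} [MeasurableSpace α] [NormedAddCommGroup F]
    [InnerProductSpace ℝ F] {μ : Measure α} {f : α → F} {c : ℝ≥0∞} :
    eLpNorm f 2 μ ≤ c ↔ ∫⁻ x, ‖f x‖ₑ ^ 2 ∂μ ≤ c ^ 2 := by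
  rw [← eLpNorm_two_sq]
  exact (ENNReal.pow_le_pow_left_iff two_ne_zero).symm

theorem lintegral_vl (w : Scalars G) : ∫⁻ y, ‖vl w y‖ₑ ^ 2 ∂mm G R = (∫⁻ x in R, ‖w.val x‖ₑ ^ 2) +
      ∑ l, ∫⁻ t in fracPart G R l, ‖w.fval l t‖ₑ ^ 2 := lintegral_mm _

theorem lintegral_gr (w : Scalars G) : ∫⁻ y, ‖gr w y‖ₑ ^ 2 ∂mm G R = (∫⁻ x in R, ‖w.grad x‖ₑ ^ 2) +
      ∑ l, ∫⁻ t in fracPart G R l, ‖w.fgrad l t‖ₑ ^ 2 := by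
  rw [lintegral_mm]
  simp only [enorm_sq_eq_ofReal, norm_gr_inl, norm_gr_inr]

theorem normLE_of_lintegral {w : Scalars G} {ε : ℝ}
    (h1 : ∫⁻ y, ‖vl w y‖ₑ ^ 2 ∂mm G R ≤ ofReal ε ^ 2)
    (h2 : ∫⁻ y, ‖gr w y‖ₑ ^ 2 ∂mm G R ≤ ofReal ε ^ 2) : NormLE G R w ε := by
  rw [lintegral_vl] at h1
  rw [lintegral_gr] at h2
  refine ⟨?_, ?_, fun l => ?_, fun l => ?_⟩ <;> rw [eLpNorm_le_iff_lintegral]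
  · exact le_self_add.trans h1
  · exact le_self_add.trans h2
  · exact (single_le_sum (f := fun l => ∫⁻ t in fracPart G R l, ‖w.fval l t‖ₑ ^ 2)
      (fun _ _ => zero_le) (mem_univ l)).trans (le_add_self.trans h1)
  · exact (single_le_sum (f := fun l => ∫⁻ t in fracPart G R l, ‖w.fgrad l t‖ₑ ^ 2)
      (fun _ _ => zero_le) (mem_univ l)).trans (le_add_self.trans h2)

theorem NormLE.lintegral_le {w : Scalars G} {ε : ℝ} (h : NormLE G R w ε) :
    ∫⁻ y, ‖vl w y‖ₑ ^ 2 ∂mm G R ≤ (G.numFrac + 1) * ofReal ε ^ 2 ∧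
    ∫⁻ y, ‖gr w y‖ₑ ^ 2 ∂mm G R ≤ (G.numFrac + 1) * ofReal ε ^ 2 := by
  rw [lintegral_vl, lintegral_gr, add_comm (G.numFrac : ℝ≥0∞), add_mul, one_mul]
  refine ⟨add_le_add (eLpNorm_le_iff_lintegral.1 h.val) ?_,
    add_le_add (eLpNorm_le_iff_lintegral.1 h.grad) ?_⟩
  · refine (sum_le_sum fun l _ => eLpNorm_le_iff_lintegral.1 (h.fval l)).trans ?_
    simp
  · refine (sum_le_sum fun l _ => eLpNorm_le_iff_lintegral.1 (h.fgrad l)).trans ?_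
    simp

/-- Membership in the closure of the test functions, on the disjoint union of bulk and
fractures. -/
theorem memClosure_iff (hR : MeasurableSet R) (hRΩ : R ⊆ G.Ω) {w : Scalars G} :
    MemClosure G O R w ↔ (MemLp (vl w) 2 (mm G R) ∧ MemLp (gr w) 2 (mm G R)) ∧
      ∀ ε > 0, ∃ f, IsTest O f ∧
        ip (mm G R) (vl w - vl (smoothField G f)) (vl w - vl (smoothField G f)) < ε ∧
        ip (mm G R) (gr w - gr (smoothField G f)) (gr w - gr (smoothField G f)) < ε := by
  unfold MemClosure
  rw [squareIntegrable_iff]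
  refine and_congr_right fun ⟨hv, hg⟩ => ⟨fun h ε hε => ?_, fun h ε hε => ?_⟩
  · set δ := √(ε / (2 * (G.numFrac + 1)))
    have hδ : 0 < δ := Real.sqrt_pos.2 (by positivity)
    obtain ⟨f, h1, h2, h3, h4⟩ := h δ hδ
    have hf : IsTest O f := ⟨h1, h2, h3⟩
    have hlt : ((G.numFrac : ℝ≥0∞) + 1) * ofReal δ ^ 2 < ofReal ε := by
      rw [← ofReal_pow hδ.le, sq_sqrt (by positivity),
        show (G.numFrac : ℝ≥0∞) + 1 = ofReal (G.numFrac + 1) by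
          rw [ofReal_add (by positivity) zero_le_one]; simp,
        ← ofReal_mul (by positivity), ENNReal.ofReal_lt_ofReal_iff hε]
      have : (G.numFrac : ℝ) + 1 ≠ 0 := by positivity
      field_simp
      linarith
    refine ⟨f, hf, ?_, ?_⟩
    · rw [← ENNReal.ofReal_lt_ofReal_iff hε, ofReal_ip_self (hv.sub (hf.memLp_vl hR hRΩ)), ← map_sub]
      exact h4.lintegral_le.1.trans_lt hlt
    · rw [← ENNReal.ofReal_lt_ofReal_iff hε, ofReal_ip_self (hg.sub (hf.memLp_gr hR hRΩ)), ← map_sub]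
      exact h4.lintegral_le.2.trans_lt hlt
  · obtain ⟨f, hf, h1, h2⟩ := h (ε ^ 2) (by positivity)
    refine ⟨f, hf.1, hf.2, hf.3, normLE_of_lintegral ?_ ?_⟩
    · rw [map_sub, ← ofReal_ip_self (hv.sub (hf.memLp_vl hR hRΩ)), ← ofReal_pow hε.le]
      exact ofReal_le_ofReal h1.le
    · rw [map_sub, ← ofReal_ip_self (hg.sub (hf.memLp_gr hR hRΩ)), ← ofReal_pow hε.le]
      exact ofReal_le_ofReal h2.le

end Closure

/-! ### Submodules of fields, and their completeness -/

section Submodules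

variable {n : ℕ} {G : Geometry n} {O R : Set (Euc (n + 1))}

/-- `MemClosure` as a submodule. -/
def closureSub (G : Geometry n) (O R : Set (Euc (n + 1))) (hR : MeasurableSet R)
    (hRΩ : R ⊆ G.Ω) : Submodule ℝ (Scalars G) where
  carrier := {w | MemClosure G O R w}
  zero_mem' := by
    refine (memClosure_iff hR hRΩ).2 ⟨⟨by simp, by simp⟩, fun ε hε => ⟨0, IsTest.zero, ?_⟩⟩
    have h : smoothField G (0 : Euc (n + 1) → ℝ) = 0 := by
      have := smoothField_smul (G := G) 0 (f := 0) (IsTest.zero (O := O)).differentiable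
      rwa [smul_zero, zero_smul] at this
    simp [h, ip, hε]
  add_mem' := by
    intro w w' hw hw'
    obtain ⟨⟨h1, h2⟩, h3⟩ := (memClosure_iff hR hRΩ).1 hw
    obtain ⟨⟨h1', h2'⟩, h3'⟩ := (memClosure_iff hR hRΩ).1 hw'
    refine (memClosure_iff hR hRΩ).2 ⟨⟨by rw [map_add]; exact h1.add h1',
      by rw [map_add]; exact h2.add h2'⟩, fun ε hε => ?_⟩
    obtain ⟨f, hf, hf1, hf2⟩ := h3 (ε / 4) (by positivity)
    obtain ⟨f', hf', hf1', hf2'⟩ := h3' (ε / 4) (by positivity)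
    refine ⟨f + f', hf.add hf', ?_, ?_⟩
    · rw [smoothField_add hf.differentiable hf'.differentiable, map_add, map_add, add_sub_add_comm]
      linarith [ip_add_self_le (h1.sub (hf.memLp_vl hR hRΩ)) (h1'.sub (hf'.memLp_vl hR hRΩ))]
    · rw [smoothField_add hf.differentiable hf'.differentiable, map_add, map_add, add_sub_add_comm]
      linarith [ip_add_self_le (h2.sub (hf.memLp_gr hR hRΩ)) (h2'.sub (hf'.memLp_gr hR hRΩ))]
  smul_mem' := by
    intro c w hw
    obtain ⟨⟨h1, h2⟩, h3⟩ := (memClosure_iff hR hRΩ).1 hw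
    refine (memClosure_iff hR hRΩ).2 ⟨⟨by rw [map_smul]; exact h1.const_smul c,
      by rw [map_smul]; exact h2.const_smul c⟩, fun ε hε => ?_⟩
    obtain ⟨f, hf, hf1, hf2⟩ := h3 (ε / (c ^ 2 + 1)) (by positivity)
    have key : ∀ {F : Type} [NormedAddCommGroup F] [InnerProductSpace ℝ F]
        (d : Pts G → F), ip (mm G R) d d < ε / (c ^ 2 + 1) →
        ip (mm G R) (c • d) (c • d) < ε := by
      intro F _ _ d hd
      have e : ip (mm G R) (c • d) (c • d) = c ^ 2 * ip (mm G R) d d := by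
        simp only [ip, Pi.smul_apply, real_inner_smul_left, real_inner_smul_right,
          integral_const_mul]
        ring
      rw [lt_div_iff₀ (by positivity)] at hd
      rw [e]
      nlinarith [ip_self_nonneg (μ := mm G R) d]
    refine ⟨c • f, hf.smul c, ?_, ?_⟩
    · rw [smoothField_smul c hf.differentiable, map_smul, map_smul, ← smul_sub]
      exact key _ hf1
    · rw [smoothField_smul c hf.differentiable, map_smul, map_smul, ← smul_sub]
      exact key _ hf2

theorem mem_closureSub {hR : MeasurableSet R} {hRΩ : R ⊆ G.Ω} {w : Scalars G} :
    w ∈ closureSub G O R hR hRΩ ↔ MemClosure G O R w := Iff.rfl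

theorem MemClosure.memLp_vl (hR : MeasurableSet R) (hRΩ : R ⊆ G.Ω) {w : Scalars G}
    (h : MemClosure G O R w) : MemLp (vl w) 2 (mm G R) := ((memClosure_iff hR hRΩ).1 h).1.1

theorem MemClosure.memLp_gr (hR : MeasurableSet R) (hRΩ : R ⊆ G.Ω) {w : Scalars G}
    (h : MemClosure G O R w) : MemLp (gr w) 2 (mm G R) := ((memClosure_iff hR hRΩ).1 h).1.2

theorem MemClosure.mono {O' : Set (Euc (n + 1))} (hO : O ⊆ O') {w : Scalars G}
    (h : MemClosure G O R w) : MemClosure G O' R w :=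
  ⟨h.1, fun ε hε => let ⟨f, h1, h2, h3, h4⟩ := h.2 ε hε; ⟨f, h1, h2, h3.trans hO, h4⟩⟩

theorem MemClosure.restrict {R' : Set (Euc (n + 1))} (hR : R ⊆ R')
    {w : Scalars G} (h : MemClosure G O R' w) : MemClosure G O R w := by
  have h1 : volume.restrict R ≤ volume.restrict R' := Measure.restrict_mono hR le_rfl
  have h2 : ∀ l, volume.restrict (fracPart G R l) ≤ volume.restrict (fracPart G R' l) := fun l =>
    Measure.restrict_mono (Set.inter_subset_inter_right _ (preimage_mono hR)) le_rfl
  refine ⟨⟨h.1.1.mono_measure h1, h.1.2.mono_measure h1, fun l => (h.1.3 l).mono_measure (h2 l),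
    fun l => (h.1.4 l).mono_measure (h2 l)⟩, fun ε hε => ?_⟩
  obtain ⟨f, e1, e2, e3, e4⟩ := h.2 ε hε
  exact ⟨f, e1, e2, e3, (eLpNorm_mono_measure _ h1).trans e4.1,
    (eLpNorm_mono_measure _ h1).trans e4.2, fun l => (eLpNorm_mono_measure _ (h2 l)).trans (e4.3 l),
    fun l => (eLpNorm_mono_measure _ (h2 l)).trans (e4.4 l)⟩

theorem IsTest.memClosure (hR : MeasurableSet R) (hRΩ : R ⊆ G.Ω) {f : Euc (n + 1) → ℝ}
    (hf : IsTest O f) : MemClosure G O R (smoothField G f) := by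
  refine (memClosure_iff hR hRΩ).2 ⟨⟨hf.memLp_vl hR hRΩ, hf.memLp_gr hR hRΩ⟩, fun ε hε => ?_⟩
  exact ⟨f, hf, by simp [ip, hε], by simp [ip, hε]⟩

/-- The space of fields is complete. -/
theorem exists_limit_memClosure (hR : MeasurableSet R) (hRΩ : R ⊆ G.Ω)
    {w : ℕ → Scalars G} (hw : ∀ m, MemClosure G O R (w m))
    (hv : ∀ ε > 0, ∃ N, ∀ i ≥ N, ∀ j ≥ N, ip (mm G R) (vl (w i - w j)) (vl (w i - w j)) < ε)
    (hg : ∀ ε > 0, ∃ N, ∀ i ≥ N, ∀ j ≥ N, ip (mm G R) (gr (w i - w j)) (gr (w i - w j)) < ε) :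
    ∃ w', MemClosure G O R w' ∧
      (∀ ε > 0, ∃ N, ∀ i ≥ N, ip (mm G R) (vl (w i - w')) (vl (w i - w')) < ε) ∧
      ∀ ε > 0, ∃ N, ∀ i ≥ N, ip (mm G R) (gr (w i - w')) (gr (w i - w')) < ε := by
  simp only [map_sub] at hv hg ⊢
  obtain ⟨v, hvm, hvl⟩ := exists_limit_of_cauchy (fun m => (hw m).memLp_vl hR hRΩ) hv
  obtain ⟨g, hgm, hgl⟩ := exists_limit_of_cauchy (fun m => (hw m).memLp_gr hR hRΩ) hg
  have hgl' : ∀ ε > 0, ∃ N, ∀ i ≥ N,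
      ip (mm G R) (gr (w i) - gr (ofParts v g)) (gr (w i) - gr (ofParts v g)) < ε := by
    intro ε hε
    obtain ⟨N, hN⟩ := hgl ε hε
    refine ⟨N, fun i hi => lt_of_le_of_lt ?_ (hN i hi)⟩
    exact ip_le_of_norm_le (((hw i).memLp_gr hR hRΩ).sub hgm)
      (ae_of_all _ fun y => norm_gr_sub_ofParts_le v g (w i) y)
  have hvl' : ∀ ε > 0, ∃ N, ∀ i ≥ N,
      ip (mm G R) (vl (w i) - vl (ofParts v g)) (vl (w i) - vl (ofParts v g)) < ε := by
    simpa using hvl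
  have hgm' : MemLp (gr (ofParts v g)) 2 (mm G R) := by
    obtain ⟨h1, h2⟩ := memLp_mm_iff.1 hgm
    refine memLp_mm_iff.2 ⟨?_, fun l => ?_⟩
    · exact (((WithLp.prodContinuousLinearEquiv 2 ℝ (Euc (n + 1)) (Euc n)).symm.toContinuousLinearMap.comp
        (ContinuousLinearMap.inl ℝ _ _)).comp (WithLp.fstL 2 ℝ _ _)).comp_memLp' h1
    · exact (((WithLp.prodContinuousLinearEquiv 2 ℝ (Euc (n + 1)) (Euc n)).symm.toContinuousLinearMap.comp
        (ContinuousLinearMap.inr ℝ _ _)).comp (WithLp.sndL 2 ℝ _ _)).comp_memLp' (h2 l)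
  have hvm' : MemLp (vl (ofParts v g)) 2 (mm G R) := by simpa using hvm
  refine ⟨ofParts v g, (memClosure_iff hR hRΩ).2 ⟨⟨hvm', hgm'⟩, fun ε hε => ?_⟩, hvl', hgl'⟩
  obtain ⟨N1, h1⟩ := hvl' (ε / 4) (by positivity)
  obtain ⟨N2, h2⟩ := hgl' (ε / 4) (by positivity)
  set i := max N1 N2
  obtain ⟨f, hf, hf1, hf2⟩ := ((memClosure_iff hR hRΩ).1 (hw i)).2 (ε / 4) (by positivity)
  refine ⟨f, hf, ?_, ?_⟩
  · have := ip_sub_self_le ((((hw i).memLp_vl hR hRΩ)).sub (hf.memLp_vl hR hRΩ))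
      (((hw i).memLp_vl hR hRΩ).sub hvm')
    have e := h1 i (le_max_left _ _)
    rw [sub_sub_sub_cancel_left] at this
    linarith
  · have := ip_sub_self_le ((((hw i).memLp_gr hR hRΩ)).sub (hf.memLp_gr hR hRΩ))
      (((hw i).memLp_gr hR hRΩ).sub hgm')
    have e := h2 i (le_max_right _ _)
    rw [sub_sub_sub_cancel_left] at this
    linarith

end Submodules

/-! ### The dimension of the measure, and Friedrichs' inequality -/

section Dimension

variable {n : ℕ}

theorem exists_volume_inter_closedBall_le {B : Set (Euc (n + 1))} (hB : Bornology.IsBounded B) :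
    ∃ A : ℝ, 0 ≤ A ∧ ∀ x, ∀ r > 0, volume (B ∩ closedBall x r) ≤ ofReal (A * r ^ n) := by
  set c := (volume (ball (0 : Euc (n + 1)) 1)).toReal
  have hc : volume (ball (0 : Euc (n + 1)) 1) = ofReal c :=
    (ofReal_toReal measure_ball_lt_top.ne).symm
  have hBt : volume B ≠ ⊤ := hB.measure_lt_top.ne
  refine ⟨c + (volume B).toReal, by positivity, fun x r hr => ?_⟩
  rcases le_total r 1 with h1 | h1
  · refine (measure_mono inter_subset_right).trans ?_
    rw [Measure.addHaar_closedBall _ _ hr.le, hc, ← ofReal_mul (by positivity)]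
    refine ofReal_le_ofReal ?_
    have hfr : Module.finrank ℝ (Euc (n + 1)) = n + 1 := by simp
    rw [hfr]
    have e : r ^ (n + 1) ≤ r ^ n := pow_le_pow_of_le_one hr.le h1 (Nat.le_succ n)
    have : 0 ≤ c := toReal_nonneg
    have : 0 ≤ (volume B).toReal := toReal_nonneg
    nlinarith [pow_pos hr n]
  · refine (measure_mono inter_subset_left).trans ?_
    rw [← ofReal_toReal hBt]
    refine ofReal_le_ofReal ?_
    rw [ENNReal.toReal_ofReal toReal_nonneg]
    have e : 1 ≤ r ^ n := one_le_pow₀ h1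
    have : 0 ≤ c := toReal_nonneg
    have : 0 ≤ (volume B).toReal := toReal_nonneg
    nlinarith

theorem exists_norm_sub_le_emb (G : Geometry n) (l : Fin G.numFrac) :
    ∃ δ > 0, ∀ t ∈ G.U l, ∀ s, dist s t < δ → ‖s - t‖ ≤ 2 * ‖G.emb l s - G.emb l t‖ := by
  have hcd := G.contDiff_emb l
  have hK : IsCompact (cthickening 1 (G.U l)) :=
    Metric.isCompact_of_isClosed_isBounded Metric.isClosed_cthickening (G.isBounded_U l).cthickening
  have huc := hK.uniformContinuousOn_of_continuous (hcd.continuous_fderiv one_ne_zero).continuousOn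
  obtain ⟨δ, hδ, h⟩ := Metric.uniformContinuousOn_iff.1 huc (1 / 2) (by norm_num)
  refine ⟨min δ 1, by positivity, fun t ht s hs => ?_⟩
  have hmem : ∀ r ∈ ball t (min δ 1), r ∈ cthickening 1 (G.U l) := fun r hr =>
    mem_cthickening_of_dist_le r t 1 _ ht ((mem_ball.1 hr).le.trans (min_le_right _ _))
  have htb : t ∈ ball t (min δ 1) := mem_ball_self (by positivity)
  have := Convex.norm_image_sub_le_of_norm_fderiv_le' (𝕜 := ℝ) (f := G.emb l) (C := 1 / 2)
    (s := ball t (min δ 1)) (φ := fderiv ℝ (G.emb l) t)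
    (fun x _ => (hcd.differentiable one_ne_zero) x)
    (fun x hx => by
      rw [← dist_eq_norm]
      exact (h x (hmem x hx) t (hmem t htb) ((mem_ball.1 hx).trans_le (min_le_left _ _))).le)
    (convex_ball _ _) htb (mem_ball.2 hs)
  have h2 := G.isometric_emb l t ht (s - t)
  have h3 := norm_sub_norm_le (fderiv ℝ (G.emb l) t (s - t)) (G.emb l s - G.emb l t)
  rw [norm_sub_rev (fderiv ℝ (G.emb l) t (s - t))] at h3
  linarith

theorem exists_volume_frac_le (G : Geometry n) (l : Fin G.numFrac) : ∃ A : ℝ, 0 ≤ A ∧ ∀ x, ∀ r > 0,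
      volume (G.U l ∩ G.emb l ⁻¹' closedBall x r) ≤ ofReal (A * r ^ n) := by
  obtain ⟨δ, hδ, h⟩ := exists_norm_sub_le_emb G l
  obtain ⟨T, hT, hcov⟩ := Metric.totallyBounded_iff.1 (Metric.isCompact_of_isClosed_isBounded isClosed_closure
    (G.isBounded_U l).closure |>.totallyBounded.subset subset_closure) (δ / 2)
    (by positivity)
  set c := (volume (ball (0 : Euc n) 1)).toReal
  have hc : volume (ball (0 : Euc n) 1) = ofReal c := (ofReal_toReal measure_ball_lt_top.ne).symm
  lift T to Finset (Euc n) using hT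
  refine ⟨T.card * (4 ^ n * c), by positivity, fun x r hr => ?_⟩
  have hsub : G.U l ∩ G.emb l ⁻¹' closedBall x r ⊆
      ⋃ y ∈ T, (G.U l ∩ G.emb l ⁻¹' closedBall x r) ∩ ball y (δ / 2) := by
    intro t ht
    obtain ⟨y, hy, hty⟩ := Set.mem_iUnion₂.1 (hcov ht.1)
    exact Set.mem_iUnion₂.2 ⟨y, hy, ht, hty⟩
  refine (measure_mono hsub).trans ((measure_biUnion_finset_le _ _).trans ?_)
  have hpiece : ∀ y ∈ T, volume ((G.U l ∩ G.emb l ⁻¹' closedBall x r) ∩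
      ball y (δ / 2)) ≤ ofReal (4 ^ n * c * r ^ n) := by
    intro y _
    rcases Set.eq_empty_or_nonempty ((G.U l ∩ G.emb l ⁻¹' closedBall x r) ∩
      ball y (δ / 2)) with he | ⟨t, ht⟩
    · rw [he]; simp
    have hs : (G.U l ∩ G.emb l ⁻¹' closedBall x r) ∩ ball y (δ / 2) ⊆ closedBall t (4 * r) := by
      intro s hs
      have hd : dist s t < δ := by
        linarith [dist_triangle_right s t y, mem_ball.1 hs.2, mem_ball.1 ht.2]
      have h1 := h t ht.1.1 s hd
      rw [mem_closedBall, dist_eq_norm]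
      rw [← dist_eq_norm (G.emb l s)] at h1
      have h4 : dist (G.emb l s) (G.emb l t) ≤ r + r :=
        (dist_triangle_right _ _ x).trans (add_le_add hs.1.2 ht.1.2)
      linarith
    refine (measure_mono hs).trans ?_
    rw [Measure.addHaar_closedBall _ _ (by positivity), hc, ← ofReal_mul (by positivity)]
    refine ofReal_le_ofReal ?_
    have hfr : Module.finrank ℝ (Euc n) = n := finrank_euclideanSpace_fin
    rw [hfr, mul_pow]
    linarith [mul_right_comm ((4 : ℝ) ^ n) (r ^ n) c]
  refine (sum_le_sum hpiece).trans ?_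
  rw [sum_const, nsmul_eq_mul, ← ENNReal.ofReal_natCast, ← ofReal_mul (Nat.cast_nonneg _)]
  exact ofReal_le_ofReal (le_of_eq (by ring))

/-- The measure on bulk and fractures has codimension at most one. -/
theorem exists_mm_closedBall_le (G : Geometry n) : ∃ A : ℝ, 0 ≤ A ∧ ∀ x, ∀ r > 0,
      mm G G.Ω (pos G ⁻¹' closedBall x r) ≤ ofReal (A * r ^ n) := by
  obtain ⟨A, hA, h⟩ := exists_volume_inter_closedBall_le G.isBounded_Ω
  choose A' hA' h' using exists_volume_frac_le G
  refine ⟨A + ∑ l, A' l, by have := sum_nonneg fun l (_ : l ∈ Finset.univ) => hA' l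
                            positivity, fun x r hr => ?_⟩
  have hm : MeasurableSet (pos G ⁻¹' closedBall x r) :=
    measurable_pos G isClosed_closedBall.measurableSet
  rw [← lintegral_indicator_one hm, lintegral_mm, add_mul, Finset.sum_mul,
    ofReal_add (by positivity) (sum_nonneg fun l _ => mul_nonneg (hA' l) (by positivity)),
    ENNReal.ofReal_sum_of_nonneg fun l _ => mul_nonneg (hA' l) (by positivity)]
  refine add_le_add ?_ (sum_le_sum fun l _ => ?_)
  · refine le_trans (le_of_eq ?_) (h x r hr)
    have : (fun x' => (pos G ⁻¹' closedBall x r).indicator (1 : Pts G → ℝ≥0∞)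
        (Sum.inl x')) = (closedBall x r).indicator 1 := rfl
    rw [this, lintegral_indicator_one isClosed_closedBall.measurableSet,
      Measure.restrict_apply isClosed_closedBall.measurableSet, inter_comm]
  · refine le_trans (le_of_eq ?_) (h' l x r hr)
    have hm' : MeasurableSet (G.emb l ⁻¹' closedBall x r) :=
      (continuous_emb G l).measurable isClosed_closedBall.measurableSet
    have : (fun t => (pos G ⁻¹' closedBall x r).indicator (1 : Pts G → ℝ≥0∞)
        (Sum.inr (l, t))) = (G.emb l ⁻¹' closedBall x r).indicator 1 := rfl
    rw [this, lintegral_indicator_one hm', Measure.restrict_apply hm', fracPart_Ω, inter_comm]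

theorem IsTest.fderiv_eq_zero {O : Set (Euc (n + 1))} {f : Euc (n + 1) → ℝ} (hf : IsTest O f)
    {x : Euc (n + 1)} (hx : x ∉ O) : f x = 0 ∧ fderiv ℝ f x = 0 := by
  have h : x ∉ tsupport f := fun h => hx (hf.tsupport_subset h)
  exact ⟨image_eq_zero_of_notMem_tsupport h, fderiv_of_notMem_tsupport ℝ h⟩

theorem lintegral_fderiv_le_gr {G : Geometry n} {R : Set (Euc (n + 1))} (f : Euc (n + 1) → ℝ) :
    ∫⁻ x in R, ‖fderiv ℝ f x‖ₑ ^ 2 ≤ ∫⁻ y, ‖gr (smoothField G f) y‖ₑ ^ 2 ∂mm G R := by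
  rw [lintegral_gr]
  refine le_trans (le_of_eq ?_) le_self_add
  refine lintegral_congr fun x => ?_
  have : ‖(smoothField G f).grad x‖ = ‖fderiv ℝ f x‖ := norm_gradient_eq f x
  rw [← ofReal_norm, ← this, ofReal_norm]

/-- Friedrichs' inequality together with the trace inequality, for test functions. -/
theorem exists_friedrichs_test (G : Geometry n) : ∃ C : ℝ, 0 < C ∧ ∀ f, IsTest G.Ω f →
      ∫⁻ y, ‖vl (smoothField G f) y‖ₑ ^ 2 ∂mm G G.Ω ≤
        ofReal C * ∫⁻ x in G.Ω, ‖fderiv ℝ f x‖ₑ ^ 2 := by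
  obtain ⟨A, hA, hAhl⟩ := exists_mm_closedBall_le G
  obtain ⟨r, hr, hΩ⟩ := G.isBounded_Ω.subset_ball_lt 0 0
  set Q := closedBall (0 : Euc (n + 1)) (2 * r)
  have hQm : MeasurableSet Q := isClosed_closedBall.measurableSet
  set Z := Q \ G.Ω
  have hZm : MeasurableSet Z := hQm.diff G.isOpen_Ω.measurableSet
  have hZt : volume Z ≠ ⊤ := ((measure_mono sdiff_subset).trans_lt
    (isCompact_closedBall _ _).measure_lt_top).ne
  have hZ0 : volume Z ≠ 0 := by
    intro h0
    have h1 : volume Q ≤ volume (ball (0 : Euc (n + 1)) r) := by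
      calc volume Q ≤ volume (Z ∪ G.Ω) := measure_mono fun x hx => by
            by_cases h : x ∈ G.Ω
            · exact Or.inr h
            · exact Or.inl ⟨hx, h⟩
        _ ≤ volume Z + volume G.Ω := measure_union_le _ _
        _ ≤ _ := by rw [h0, zero_add]; exact measure_mono hΩ
    rw [Measure.addHaar_closedBall _ _ (by positivity), Measure.addHaar_ball _ _ hr.le] at h1
    have hb0 : volume (ball (0 : Euc (n + 1)) 1) ≠ 0 := (Metric.measure_ball_pos _ _ one_pos).ne'
    rw [ENNReal.mul_le_mul_iff_left hb0 measure_ball_lt_top.ne,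
      ofReal_le_ofReal_iff (by positivity)] at h1
    have h2 := pow_lt_pow_left₀ (show r < 2 * r by linarith) hr.le
      (show Module.finrank ℝ (Euc (n + 1)) ≠ 0 by simp)
    linarith
  set K := 4 * A * (4 * r) ^ (n + 2)
  set v := (volume Z).toReal
  have hv : 0 < v := ENNReal.toReal_pos hZ0 hZt
  refine ⟨K / v + 1, by positivity, fun f hf => ?_⟩
  set ν := (mm G G.Ω).map (pos G)
  have : IsFiniteMeasure ν := Measure.isFiniteMeasure_map _ _
  have hgc := hf.contDiff.continuous
  have hν : ∀ y, ∀ r > 0, ν (closedBall y r) ≤ ofReal (A * r ^ n) := fun y r hr => by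
    rw [Measure.map_apply (measurable_pos G) isClosed_closedBall.measurableSet]
    exact hAhl y r hr
  have hmain := lintegral_lintegral_sub_sq_le (convex_closedBall _ _) hQm
    (hf.contDiff.of_le (by simp)) ν (D := 4 * r) (by positivity) hA hν fun x hx y hy => by
      linarith [dist_triangle_right x y 0, mem_closedBall.1 hx, mem_closedBall.1 hy]
  have hlow : volume Z * ∫⁻ y, ‖vl (smoothField G f) y‖ₑ ^ 2 ∂mm G G.Ω ≤
      ∫⁻ ξ in Q, ∫⁻ z in Q, ‖f ξ - f z‖ₑ ^ 2 ∂volume ∂ν := by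
    have e1 : ∫⁻ y, ‖vl (smoothField G f) y‖ₑ ^ 2 ∂mm G G.Ω = ∫⁻ ξ in Q, ‖f ξ‖ₑ ^ 2 ∂ν := by
      rw [← lintegral_indicator hQm, lintegral_map
        ((hgc.enorm.measurable.pow_const 2).indicator hQm) (measurable_pos G)]
      refine lintegral_congr fun y => ?_
      rw [vl_smoothField]
      by_cases hy : pos G y ∈ Q
      · rw [indicator_of_mem hy]
      · rw [indicator_of_notMem hy, (hf.fderiv_eq_zero fun h => hy ?_).1]
        · simp
        · exact ball_subset_closedBall ((Metric.ball_subset_ball (by linarith)) (hΩ h))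
    rw [e1, ← lintegral_const_mul _ (hgc.enorm.measurable.pow_const 2)]
    refine lintegral_mono fun ξ => ?_
    calc volume Z * ‖f ξ‖ₑ ^ 2 = ∫⁻ z in Z, ‖f ξ - f z‖ₑ ^ 2 := by
          rw [mul_comm, ← setLIntegral_const]
          refine setLIntegral_congr_fun hZm fun z hz => ?_
          rw [(hf.fderiv_eq_zero hz.2).1, sub_zero]
      _ ≤ _ := lintegral_mono_set sdiff_subset
  have hup : ∫⁻ x in Q, ‖fderiv ℝ f x‖ₑ ^ 2 ≤ ∫⁻ x in G.Ω, ‖fderiv ℝ f x‖ₑ ^ 2 := by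
    rw [← lintegral_indicator hQm, ← lintegral_indicator G.isOpen_Ω.measurableSet]
    refine lintegral_mono fun x => ?_
    by_cases hx : x ∈ G.Ω
    · rw [indicator_of_mem hx]; exact Set.indicator_le_self _ _ _
    · have : ‖fderiv ℝ f x‖ₑ ^ 2 = 0 := by rw [(hf.fderiv_eq_zero hx).2, ← ofReal_norm]; simp
      refine (Set.indicator_le_self _ _ _).trans ?_
      rw [this]; exact zero_le
  have hfin : volume Z * ∫⁻ y, ‖vl (smoothField G f) y‖ₑ ^ 2 ∂mm G G.Ω ≤
      ofReal K * ∫⁻ x in G.Ω, ‖fderiv ℝ f x‖ₑ ^ 2 :=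
    hlow.trans (hmain.trans (by gcongr))
  have hvZ : volume Z = ofReal v := (ofReal_toReal hZt).symm
  rw [hvZ] at hfin
  calc ∫⁻ y, ‖vl (smoothField G f) y‖ₑ ^ 2 ∂mm G G.Ω
      = ofReal v⁻¹ * (ofReal v * ∫⁻ y, ‖vl (smoothField G f) y‖ₑ ^ 2 ∂mm G G.Ω) := by
        rw [← mul_assoc, ← ofReal_mul (by positivity), inv_mul_cancel₀ hv.ne']; simp
    _ ≤ ofReal v⁻¹ * (ofReal K * ∫⁻ x in G.Ω, ‖fderiv ℝ f x‖ₑ ^ 2) := by gcongr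
    _ = ofReal (K / v) * ∫⁻ x in G.Ω, ‖fderiv ℝ f x‖ₑ ^ 2 := by
        rw [← mul_assoc, ← ofReal_mul (by positivity), inv_mul_eq_div]
    _ ≤ _ := by gcongr; linarith

end Dimension

/-! ### Multilinear shape functions -/

section Shape

variable {d : ℕ}

theorem abs_prod_sub_prod_le {ι : Type*} (s : Finset ι) {f g : ι → ℝ}
    (hf : ∀ i ∈ s, 0 ≤ f i ∧ f i ≤ 1) (hg : ∀ i ∈ s, 0 ≤ g i ∧ g i ≤ 1) :
    |∏ i ∈ s, f i - ∏ i ∈ s, g i| ≤ ∑ i ∈ s, |f i - g i| := by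
  classical
  induction s using Finset.induction_on with
  | empty => simp
  | insert a s ha ih =>
    rw [Finset.prod_insert ha, Finset.prod_insert ha, Finset.sum_insert ha]
    have h1 := ih (fun i hi => hf i (mem_insert_of_mem hi)) fun i hi => hg i (mem_insert_of_mem hi)
    have ha1 := hf a (Finset.mem_insert_self _ _)
    have hp0 : 0 ≤ ∏ i ∈ s, g i := prod_nonneg fun i hi => (hg i (mem_insert_of_mem hi)).1
    have hp1 : ∏ i ∈ s, g i ≤ 1 := prod_le_one (fun i hi => (hg i (mem_insert_of_mem hi)).1)
      fun i hi => (hg i (mem_insert_of_mem hi)).2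
    have e : f a * ∏ i ∈ s, f i - g a * ∏ i ∈ s, g i =
        f a * (∏ i ∈ s, f i - ∏ i ∈ s, g i) + (f a - g a) * ∏ i ∈ s, g i := by ring
    rw [e]
    refine (abs_add_le _ _).trans ?_
    rw [abs_mul, abs_mul, abs_of_nonneg ha1.1, abs_of_nonneg hp0]
    linarith [mul_le_mul ha1.2 h1 (abs_nonneg _) zero_le_one,
      mul_le_mul_of_nonneg_left hp1 (abs_nonneg (f a - g a))]

theorem abs_apply_sub_le (ξ η : Euc d) (i : Fin d) : |ξ i - η i| ≤ ‖ξ - η‖ :=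
  PiLp.norm_apply_le (ξ - η) i

theorem shape_factor {b : Fin d → Bool} {ξ : Euc d} (hξ : ξ ∈ refCube d) (i : Fin d) :
    0 ≤ (if b i then ξ i else 1 - ξ i) ∧ (if b i then ξ i else 1 - ξ i) ≤ 1 := by
  have := hξ i
  split_ifs <;> constructor <;> linarith

theorem shape_nonneg (b : Fin d → Bool) {ξ : Euc d} (hξ : ξ ∈ refCube d) : 0 ≤ shape b ξ :=
  prod_nonneg fun i _ => (shape_factor hξ i).1

theorem shape_le_one (b : Fin d → Bool) {ξ : Euc d} (hξ : ξ ∈ refCube d) : shape b ξ ≤ 1 :=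
  prod_le_one (fun i _ => (shape_factor hξ i).1) fun i _ => (shape_factor hξ i).2

theorem abs_shape_sub_le (b : Fin d → Bool) {ξ η : Euc d} (hξ : ξ ∈ refCube d)
    (hη : η ∈ refCube d) : |shape b ξ - shape b η| ≤ d * ‖ξ - η‖ := by
  refine (abs_prod_sub_prod_le _ (fun i _ => shape_factor hξ i) fun i _ => shape_factor hη i).trans ?_
  have : ∀ i ∈ Finset.univ, |(if b i then ξ i else 1 - ξ i) - (if b i then η i else 1 - η i)| ≤
      ‖ξ - η‖ := by
    intro i _
    have := abs_apply_sub_le ξ η i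
    split_ifs
    · exact this
    · rwa [sub_sub_sub_cancel_left, abs_sub_comm]
  simpa using sum_le_sum this

theorem sum_prod_bool (g : Fin d → Bool → ℝ) :
    ∑ b : Fin d → Bool, ∏ i, (if b i then g i true else g i false) =
      ∏ i, (g i true + g i false) := by
  have h := Finset.prod_univ_sum (fun _ : Fin d => (Finset.univ : Finset Bool)) g
  simp only [Fintype.univ_bool, Finset.mem_singleton, reduceCtorEq, not_false_eq_true,
    Finset.sum_insert, Finset.sum_singleton] at h
  rw [h]
  have : Fintype.piFinset (fun _ : Fin d => ({true, false} : Finset Bool)) = Finset.univ := by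
    rw [← Fintype.piFinset_univ]; rfl
  rw [this]
  refine sum_congr rfl fun b _ => Finset.prod_congr rfl fun i _ => ?_
  cases b i <;> rfl

theorem sum_shape (ξ : Euc d) : ∑ b, shape b ξ = 1 := by
  have := sum_prod_bool fun i c => if c then ξ i else 1 - ξ i
  simpa [shape] using this

theorem sum_shape_coord (ξ : Euc d) (i : Fin d) :
    ∑ b : Fin d → Bool, (if b i then shape b ξ else 0) = ξ i := by
  have := sum_prod_bool fun i' c => if c then ξ i' else if i' = i then 0 else 1 - ξ i'
  rw [Finset.prod_eq_single_of_mem i (mem_univ i)] at this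
  · simp only [if_true, Bool.false_eq_true, if_false, add_zero] at this
    rw [← this]
    refine sum_congr rfl fun b _ => ?_
    by_cases hb : b i = true
    · rw [if_pos hb]
      refine Finset.prod_congr rfl fun i' _ => ?_
      by_cases h : b i' = true
      · simp [h]
      · have : i' ≠ i := fun e => h (e ▸ hb)
        simp [h, this]
    · rw [if_neg hb]
      refine (prod_eq_zero (mem_univ i) ?_).symm
      simp [hb]
  · intro i' _ hi'
    simp [hi']

theorem contDiff_shape (b : Fin d → Bool) : ContDiff ℝ ∞ (shape b) := by
  unfold shape
  refine contDiff_prod fun i _ => ?_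
  have : ContDiff ℝ ∞ fun ξ : Euc d => ξ i := (EuclideanSpace.proj (𝕜 := ℝ) i).contDiff
  split_ifs
  · exact this
  · exact contDiff_const.sub this

/-- The corners of the reference cube. -/
def corner (b : Fin d → Bool) : Euc d := WithLp.toLp 2 fun i => if b i then 1 else 0

theorem corner_apply (b : Fin d → Bool) (i : Fin d) : corner b i = if b i then 1 else 0 := rfl

theorem corner_mem (b : Fin d → Bool) : corner b ∈ refCube d := fun i => by
  rw [corner_apply]; split_ifs <;> norm_num

theorem shape_corner (b b' : Fin d → Bool) : shape b (corner b') = if b = b' then 1 else 0 := by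
  unfold shape
  simp only [corner_apply]
  split_ifs with h
  · subst h
    refine Finset.prod_eq_one fun i _ => ?_
    cases b i <;> simp
  · obtain ⟨i, hi⟩ := Function.ne_iff.1 h
    refine prod_eq_zero (mem_univ i) ?_
    cases hb : b i <;> cases hb' : b' i <;> simp_all

theorem isCompact_refCube : IsCompact (refCube d) := by
  have h : refCube d = (EuclideanSpace.equiv (Fin d) ℝ).toHomeomorph ⁻¹' Set.Icc 0 1 := by
    ext ξ
    simp only [refCube, mem_ofPred_eq, mem_preimage, Set.mem_Icc, Pi.le_def]
    exact forall_and
  rw [h]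
  exact (Homeomorph.isCompact_preimage _).2 isCompact_Icc

theorem convex_refCube : Convex ℝ (refCube d) := by
  intro ξ hξ η hη a b ha hb hab i
  have h1 := hξ i
  have h2 := hη i
  simp only [PiLp.add_apply, PiLp.smul_apply, smul_eq_mul]
  constructor <;> nlinarith

/-- The centre of the reference cube. -/
def centre (d : ℕ) : Euc d := WithLp.toLp 2 fun _ => 1 / 2

theorem ball_centre_subset {ξ : Euc d} (hξ : ξ ∈ refCube d) {τ : ℝ} (h1 : τ ≤ 1) :
    closedBall (ξ + τ • (centre d - ξ)) (τ / 2) ⊆ refCube d := by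
  intro η hη i
  rw [mem_closedBall, dist_eq_norm] at hη
  have h2 := (abs_apply_sub_le η (ξ + τ • (centre d - ξ)) i).trans hη
  have h3 := hξ i
  have e : (ξ + τ • (centre d - ξ)) i = ξ i + τ * (1 / 2 - ξ i) := by
    simp [centre]
  rw [e, abs_le] at h2
  constructor <;> nlinarith

theorem closedBall_centre_subset : closedBall (centre d) (1 / 2) ⊆ refCube d := by
  have h := ball_centre_subset (d := d) (corner_mem fun _ => true) le_rfl
  simpa using h

theorem refCube_subset_closure_interior : refCube d ⊆ closure (interior (refCube d)) := by
  have hne : (interior (refCube d)).Nonempty := ⟨centre d, mem_interior.2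
    ⟨_, ball_subset_closedBall.trans closedBall_centre_subset, isOpen_ball,
      mem_ball_self (by norm_num)⟩⟩
  rw [convex_refCube.closure_interior_eq_closure_of_nonempty_interior hne]
  exact subset_closure

theorem norm_sub_le_of_mem_refCube {ξ η : Euc d} (hξ : ξ ∈ refCube d) (hη : η ∈ refCube d) :
    ‖ξ - η‖ ≤ d + 1 := by
  have h : ‖ξ - η‖ ^ 2 ≤ d := by
    rw [EuclideanSpace.norm_sq_eq]
    have : ∀ i ∈ Finset.univ, ‖(ξ - η) i‖ ^ 2 ≤ 1 := fun i _ => by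
      have h1 := hξ i
      have h2 := hη i
      rw [norm_eq_abs, sq_abs, PiLp.sub_apply]
      nlinarith
    simpa using sum_le_sum this
  nlinarith [norm_nonneg (ξ - η), Nat.cast_nonneg (α := ℝ) d]

theorem mem_interior_refCube {ξ : Euc d} (hξ : ξ ∈ refCube d)
    (h : ∀ b : Fin d → Bool, 0 < shape b ξ) : ξ ∈ interior (refCube d) := by
  have h1 : ∀ i, 0 < ξ i ∧ ξ i < 1 := by
    intro i
    constructor
    · refine lt_of_le_of_ne (hξ i).1 fun h0 => (h fun _ => true).ne' ?_
      exact prod_eq_zero (mem_univ i) (by simp [← h0])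
    · refine lt_of_le_of_ne (hξ i).2 fun h0 => (h fun _ => false).ne' ?_
      exact prod_eq_zero (mem_univ i) (by simp [h0])
  have hopen : IsOpen {ξ : Euc d | ∀ i, 0 < ξ i ∧ ξ i < 1} := by
    simp only [Set.ofPred_forall]
    refine isOpen_iInter_of_finite fun i => ?_
    have hc : Continuous fun ξ : Euc d => ξ i := (EuclideanSpace.proj (𝕜 := ℝ) i).continuous
    exact (isOpen_lt continuous_const hc).inter (isOpen_lt hc continuous_const)
  exact mem_interior.2 ⟨_, fun η hη i => ⟨(hη i).1.le, (hη i).2.le⟩, hopen, h1⟩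

end Shape

/-! ### Elements -/

section Elements

variable {n : ℕ} {G : Geometry n} {θ H : ℝ} (T : CoarseMesh G θ H)

/-- The reference map of the element `K_j`. -/
def refMap (j : Fin T.numElem) (ξ : Euc (n + 1)) : Euc (n + 1) :=
  ∑ b, shape b ξ • T.pos (T.vert j b)

theorem refMap_mem {j : Fin T.numElem} {ξ : Euc (n + 1)} (hξ : ξ ∈ refCube (n + 1)) :
    refMap T j ξ ∈ element T j := ⟨ξ, hξ, rfl⟩

theorem contDiff_refMap (j : Fin T.numElem) : ContDiff ℝ ∞ (refMap T j) := by
  unfold refMap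
  exact ContDiff.sum fun b _ => (contDiff_shape b).smul contDiff_const

theorem le_norm_refMap_sub (j : Fin T.numElem) {ξ η : Euc (n + 1)} (hξ : ξ ∈ refCube (n + 1))
    (hη : η ∈ refCube (n + 1)) : H / θ * ‖ξ - η‖ ≤ ‖refMap T j ξ - refMap T j η‖ :=
  (T.bilipschitz j ξ hξ η hη).1

theorem norm_refMap_sub_le (j : Fin T.numElem) {ξ η : Euc (n + 1)} (hξ : ξ ∈ refCube (n + 1))
    (hη : η ∈ refCube (n + 1)) : ‖refMap T j ξ - refMap T j η‖ ≤ θ * H * ‖ξ - η‖ :=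
  (T.bilipschitz j ξ hξ η hη).2

theorem isCompact_element (j : Fin T.numElem) : IsCompact (element T j) :=
  isCompact_refCube.image (contDiff_refMap T j).continuous

theorem iUnion_element : ⋃ j, element T j = closure G.Ω := T.cover

theorem element_subset (j : Fin T.numElem) : element T j ⊆ closure G.Ω := by
  rw [← iUnion_element T]; exact Set.subset_iUnion _ j

theorem exists_mem_element {x : Euc (n + 1)} (hx : x ∈ G.Ω) : ∃ j, x ∈ element T j := by
  have := subset_closure hx
  rw [← iUnion_element T] at this
  exact mem_iUnion.1 this

theorem refMap_corner (j : Fin T.numElem) (b : Fin (n + 1) → Bool) :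
    refMap T j (corner b) = T.pos (T.vert j b) := by
  unfold refMap
  rw [sum_eq_single_of_mem b (mem_univ b)]
  · rw [shape_corner, if_pos rfl, one_smul]
  · intro b' _ hb'
    rw [shape_corner, if_neg hb', zero_smul]

theorem chi_refMap (j : Fin T.numElem) (k : Fin T.numVert) {ξ : Euc (n + 1)}
    (hξ : ξ ∈ refCube (n + 1)) :
    T.chi k (refMap T j ξ) = ∑ b, if T.vert j b = k then shape b ξ else 0 := T.chi_eq j k ξ hξ

section

variable (hθ : 1 ≤ θ) (hH : 0 < H)
include hθ hH

theorem refMap_injOn (j : Fin T.numElem) : Set.InjOn (refMap T j) (refCube (n + 1)) := by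
  intro ξ hξ η hη h
  have h1 := le_norm_refMap_sub T j hξ hη
  rw [h, sub_self, norm_zero] at h1
  have h2 : 0 < H / θ := by positivity
  have h3 : ‖ξ - η‖ ≤ 0 := by
    by_contra h4
    push Not at h4
    linarith [mul_pos h2 h4]
  exact sub_eq_zero.1 (norm_le_zero_iff.1 h3)

theorem vert_injective (j : Fin T.numElem) : Function.Injective (T.vert j) := by
  intro b b' h
  have h1 := refMap_injOn T hθ hH j (corner_mem b) (corner_mem b') (by
    rw [refMap_corner, refMap_corner, h])
  funext i
  have h2 : corner b i = corner b' i := by rw [h1]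
  rw [corner_apply, corner_apply] at h2
  cases hb : b i <;> cases hb' : b' i <;> simp_all

theorem chi_vert_refMap (j : Fin T.numElem) (b : Fin (n + 1) → Bool) {ξ : Euc (n + 1)}
    (hξ : ξ ∈ refCube (n + 1)) : T.chi (T.vert j b) (refMap T j ξ) = shape b ξ := by
  rw [chi_refMap T j _ hξ]
  simp [(vert_injective T hθ hH j).eq_iff]

end

theorem tendsto_slope_refMap (j : Fin T.numElem) (ξ v : Euc (n + 1)) :
    Tendsto (fun t : ℝ => ‖t⁻¹ • (refMap T j (ξ + t • v) - refMap T j ξ)‖)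
      (nhdsWithin 0 {0}ᶜ) (nhds ‖fderiv ℝ (refMap T j) ξ v‖) := by
  have h := ((contDiff_refMap T j).differentiable (by simp) ξ).hasFDerivAt.hasLineDerivAt v
  exact (h.tendsto_slope_zero).norm

theorem eventually_mem_refCube {ξ : Euc (n + 1)} (hξ : ξ ∈ interior (refCube (n + 1)))
    (v : Euc (n + 1)) : ∀ᶠ t : ℝ in nhdsWithin 0 {0}ᶜ, ξ + t • v ∈ refCube (n + 1) := by
  have hc : Continuous fun t : ℝ => ξ + t • v := by fun_prop
  have := hc.continuousAt (x := 0) |>.eventually (p := fun y => y ∈ refCube (n + 1))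
    (by simpa using mem_interior_iff_mem_nhds.1 hξ)
  exact this.filter_mono nhdsWithin_le_nhds

theorem le_norm_fderiv_refMap (j : Fin T.numElem) {ξ : Euc (n + 1)}
    (hξ : ξ ∈ interior (refCube (n + 1))) (v : Euc (n + 1)) :
    H / θ * ‖v‖ ≤ ‖fderiv ℝ (refMap T j) ξ v‖ := by
  refine ge_of_tendsto (tendsto_slope_refMap T j ξ v) ?_
  filter_upwards [eventually_mem_refCube hξ v, self_mem_nhdsWithin] with t ht h0
  have := le_norm_refMap_sub T j ht (interior_subset hξ)
  have h0' : 0 < |t| := abs_pos.2 h0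
  rw [add_sub_cancel_left, norm_smul, norm_eq_abs] at this
  rw [norm_smul, norm_inv, norm_eq_abs, inv_mul_eq_div, le_div_iff₀ h0']
  linarith

theorem norm_fderiv_refMap_le (j : Fin T.numElem) {ξ : Euc (n + 1)}
    (hξ : ξ ∈ interior (refCube (n + 1))) (v : Euc (n + 1)) :
    ‖fderiv ℝ (refMap T j) ξ v‖ ≤ θ * H * ‖v‖ := by
  refine le_of_tendsto (tendsto_slope_refMap T j ξ v) ?_
  filter_upwards [eventually_mem_refCube hξ v, self_mem_nhdsWithin] with t ht h0
  have := norm_refMap_sub_le T j ht (interior_subset hξ)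
  have h0' : 0 < |t| := abs_pos.2 h0
  rw [add_sub_cancel_left, norm_smul, norm_eq_abs] at this
  rw [norm_smul, norm_inv, norm_eq_abs, inv_mul_eq_div, div_le_iff₀ h0']
  linarith

variable (hθ : 1 ≤ θ) (hH : 0 < H)
include hθ hH

theorem map_nhds_refMap (j : Fin T.numElem) {ξ : Euc (n + 1)}
    (hξ : ξ ∈ interior (refCube (n + 1))) :
    Filter.map (refMap T j) (nhds ξ) = nhds (refMap T j ξ) := by
  have hs := ((contDiff_refMap T j).contDiffAt (x := ξ)).hasStrictFDerivAt (by simp)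
  refine hs.map_nhds_eq_of_surj (LinearMap.range_eq_top.2 ?_)
  refine LinearMap.injective_iff_surjective.1 ((injective_iff_map_eq_zero _).2 fun v hv => ?_)
  have h1 := le_norm_fderiv_refMap T j hξ v
  have h2 : fderiv ℝ (refMap T j) ξ v = 0 := hv
  rw [h2, norm_zero] at h1
  have h3 : 0 < H / θ := by positivity
  by_contra h4
  linarith [mul_pos h3 (norm_pos_iff.2 h4)]

theorem isOpen_image_refMap (j : Fin T.numElem) {s : Set (Euc (n + 1))} (hs : IsOpen s)
    (hsub : s ⊆ refCube (n + 1)) : IsOpen (refMap T j '' s) := by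
  rw [isOpen_iff_mem_nhds]
  rintro _ ⟨ξ, hξ, rfl⟩
  rw [← map_nhds_refMap T hθ hH j (mem_interior.2 ⟨s, hsub, hs, hξ⟩)]
  exact Filter.image_mem_map (hs.mem_nhds hξ)

theorem ball_subset_image_refMap (j : Fin T.numElem) {ξ : Euc (n + 1)} {r : ℝ} (hr : 0 < r)
    (hsub : closedBall ξ r ⊆ refCube (n + 1)) :
    ball (refMap T j ξ) (H / θ * r) ⊆ refMap T j '' ball ξ r := by
  have hξ : ξ ∈ refCube (n + 1) := hsub (mem_closedBall_self hr.le)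
  have hbs : ball ξ r ⊆ refCube (n + 1) := ball_subset_closedBall.trans hsub
  have ho := isOpen_image_refMap T hθ hH j isOpen_ball hbs
  have hcl : IsClosed (refMap T j '' closedBall ξ r) :=
    ((isCompact_closedBall ξ r).image (contDiff_refMap T j).continuous).isClosed
  have hpc : IsPreconnected (ball (refMap T j ξ) (H / θ * r)) := (convex_ball _ _).isPreconnected
  refine hpc.subset_left_of_subset_union ho hcl.isOpen_compl ?_ ?_ ?_
  · exact Set.disjoint_compl_right_iff_subset.2 (image_mono ball_subset_closedBall)
  · intro y hy
    by_cases h : y ∈ refMap T j '' closedBall ξ r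
    · obtain ⟨η, hη, rfl⟩ := h
      refine Or.inl ⟨η, ?_, rfl⟩
      have h1 := le_norm_refMap_sub T j (hsub hη) hξ
      rw [mem_ball, dist_eq_norm] at hy ⊢
      have h2 : 0 < H / θ := by positivity
      exact lt_of_mul_lt_mul_left (h1.trans_lt hy) h2.le
    · exact Or.inr h
  · exact ⟨refMap T j ξ, mem_ball_self (by positivity), ξ, mem_ball_self hr, rfl⟩

omit hθ hH in
/-- The image of the open reference cube. -/
def openElement (j : Fin T.numElem) : Set (Euc (n + 1)) := refMap T j '' interior (refCube (n + 1))

theorem isOpen_openElement (j : Fin T.numElem) : IsOpen (openElement T j) :=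
  isOpen_image_refMap T hθ hH j isOpen_interior interior_subset

omit hθ hH in
theorem openElement_subset (j : Fin T.numElem) : openElement T j ⊆ element T j :=
  image_mono interior_subset

theorem element_subset_closure (j : Fin T.numElem) :
    element T j ⊆ closure (interior (element T j)) := by
  refine (image_mono refCube_subset_closure_interior).trans
    ((image_closure_subset_closure_image (contDiff_refMap T j).continuous).trans (closure_mono ?_))
  exact interior_maximal (openElement_subset T j) (isOpen_openElement T hθ hH j)

theorem disjoint_openElement {i j : Fin T.numElem} (hij : i ≠ j) :
    Disjoint (openElement T j) (element T i) := by
  have h : Disjoint (interior (element T j)) (closure (interior (element T i))) :=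
    (T.disjoint j i (Ne.symm hij)).closure_right isOpen_interior
  exact h.mono (interior_maximal (openElement_subset T j) (isOpen_openElement T hθ hH j))
    (element_subset_closure T hθ hH i)

theorem mem_openElement_of_bubble_ne_zero {j : Fin T.numElem} {x : Euc (n + 1)}
    (hx : x ∈ element T j) (h : bubble T j x ≠ 0) : x ∈ openElement T j := by
  obtain ⟨ξ, hξ, rfl⟩ := hx
  refine ⟨ξ, mem_interior_refCube hξ fun b => ?_, rfl⟩
  refine lt_of_le_of_ne (shape_nonneg b hξ) fun h0 => h ?_
  refine prod_eq_zero (mem_univ b) ?_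
  exact (chi_vert_refMap T hθ hH j b hξ).trans h0.symm

theorem ball_subset_openElement (j : Fin T.numElem) :
    ball (refMap T j (centre _)) (H / (2 * θ)) ⊆ openElement T j := by
  have h := ball_subset_image_refMap T hθ hH j (ξ := centre _) (r := 1 / 2) (by norm_num)
    closedBall_centre_subset
  rw [show H / (2 * θ) = H / θ * (1 / 2) by field_simp]
  refine h.trans (image_mono ?_)
  exact interior_maximal (ball_subset_closedBall.trans closedBall_centre_subset) isOpen_ball

theorem disjoint_ball {i j : Fin T.numElem} (hij : i ≠ j) :
    Disjoint (ball (refMap T i (centre _)) (H / (2 * θ)))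
      (ball (refMap T j (centre _)) (H / (2 * θ))) :=
  (disjoint_openElement T hθ hH hij).symm.mono
    ((ball_subset_openElement T hθ hH i).trans (openElement_subset T i))
    (ball_subset_openElement T hθ hH j)

omit hθ hH in
theorem card_mul_pow_le {ι : Type*} (s : Finset ι) {d : ℕ} (c : ι → Euc (d + 1)) {x : Euc (d + 1)}
    {r R : ℝ} (hr : 0 < r) (hR : 0 ≤ R) (hc : ∀ i ∈ s, dist (c i) x ≤ R)
    (hd : ∀ i ∈ s, ∀ j ∈ s, i ≠ j → Disjoint (ball (c i) r) (ball (c j) r)) :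
    s.card * r ^ (d + 1) ≤ (R + r) ^ (d + 1) := by
  have h1 : volume (⋃ i ∈ s, ball (c i) r) ≤ volume (ball x (R + r)) := by
    refine measure_mono (Set.iUnion₂_subset fun i hi y hy => ?_)
    rw [mem_ball] at hy ⊢
    linarith [dist_triangle y (c i) x, hc i hi]
  rw [measure_biUnion_finset (fun i hi j hj hij => hd i hi j hj hij)
    fun i _ => isOpen_ball.measurableSet] at h1
  simp_rw [Measure.addHaar_ball _ _ hr.le] at h1
  have hb0 : volume (ball (0 : Euc (d + 1)) 1) ≠ 0 := (Metric.measure_ball_pos _ _ one_pos).ne'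
  rw [Measure.addHaar_ball volume x (show 0 ≤ R + r by positivity), sum_const, nsmul_eq_mul, ← mul_assoc,
    ENNReal.mul_le_mul_iff_left hb0 measure_ball_lt_top.ne, ← ENNReal.ofReal_natCast,
    ← ofReal_mul (by positivity), ofReal_le_ofReal_iff (by positivity)] at h1
  simpa using h1

omit hθ hH in
theorem dist_le_of_mem_element (hθ : 0 ≤ θ) (hH : 0 ≤ H) {j : Fin T.numElem} {x y : Euc (n + 1)}
    (hx : x ∈ element T j) (hy : y ∈ element T j) : dist x y ≤ θ * H * (n + 2) := by
  obtain ⟨ξ, hξ, rfl⟩ := hx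
  obtain ⟨η, hη, rfl⟩ := hy
  rw [dist_eq_norm]
  refine (norm_refMap_sub_le T j hξ hη).trans ?_
  have := norm_sub_le_of_mem_refCube hξ hη
  push_cast at this
  have h2 : (0:ℝ) ≤ θ * H := by positivity
  nlinarith

omit hθ hH in
theorem centre_mem : centre (n + 1) ∈ refCube (n + 1) :=
  closedBall_centre_subset (mem_closedBall_self (by norm_num))

omit hθ hH in
/-- The bound for the number of elements that meet in a point. -/
def overlap (n : ℕ) (θ : ℝ) : ℝ := (2 * θ ^ 2 * (n + 2) + 1) ^ (n + 1)

open Classical in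
theorem card_elements_le (x : Euc (n + 1)) :
    ((Finset.univ.filter fun j => x ∈ element T j).card : ℝ) ≤ overlap n θ := by
  have h := card_mul_pow_le (Finset.univ.filter fun j => x ∈ element T j)
    (fun j => refMap T j (centre _)) (x := x) (r := H / (2 * θ)) (R := θ * H * (n + 2))
    (by positivity) (by positivity) (fun j hj => dist_le_of_mem_element T (by linarith) hH.le
      (refMap_mem T centre_mem) (Finset.mem_filter.1 hj).2)
    fun i _ j _ hij => disjoint_ball T hθ hH hij
  have e : θ * H * (n + 2) + H / (2 * θ) = (2 * θ ^ 2 * (n + 2) + 1) * (H / (2 * θ)) := by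
    field_simp
  rw [e, mul_pow] at h
  exact le_of_mul_le_mul_right h (by positivity)

theorem meshSize_le {R : ℝ} (hR : G.Ω ⊆ ball 0 R) (j : Fin T.numElem) : H ≤ 2 * R * θ := by
  have hcl : closure G.Ω ⊆ closedBall 0 R :=
    closure_minimal (hR.trans ball_subset_closedBall) isClosed_closedBall
  have h1 := le_norm_refMap_sub T j (corner_mem fun _ => true) (corner_mem fun _ => false)
  have h2 := abs_apply_sub_le (corner fun _ : Fin (n + 1) => true) (corner fun _ => false) 0
  rw [corner_apply, corner_apply] at h2
  norm_num at h2
  have h3 := hcl (element_subset T j (refMap_mem T (corner_mem fun _ => true)))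
  have h4 := hcl (element_subset T j (refMap_mem T (corner_mem fun _ => false)))
  rw [← dist_eq_norm (refMap T j _)] at h1
  have h5 := dist_triangle_right (refMap T j (corner fun _ => true))
    (refMap T j (corner fun _ => false)) 0
  have h6 := mem_closedBall.1 h3
  have h7 := mem_closedBall.1 h4
  have h8 : 0 < H / θ := by positivity
  have h9 : H / θ ≤ 2 * R := by
    linarith [mul_le_mul_of_nonneg_left h2 h8.le]
  rw [div_le_iff₀ (by positivity)] at h9
  exact h9

theorem numElem_le {R : ℝ} (hR0 : 0 < R) (hR : G.Ω ⊆ ball 0 R) :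
    (T.numElem : ℝ) ≤ (4 * R * θ / H) ^ (n + 1) := by
  rcases Nat.eq_zero_or_pos T.numElem with h0 | h0
  · rw [h0]; push_cast; positivity
  have hH2 := meshSize_le T hθ hH hR ⟨0, h0⟩
  have hcl : closure G.Ω ⊆ closedBall 0 R :=
    closure_minimal (hR.trans ball_subset_closedBall) isClosed_closedBall
  have h := card_mul_pow_le Finset.univ
    (fun j => refMap T j (centre _)) (x := 0) (r := H / (2 * θ)) (R := R)
    (by positivity) hR0.le (fun j _ => mem_closedBall.1 (hcl (element_subset T j
      (refMap_mem T centre_mem))))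
    fun i _ j _ hij => disjoint_ball T hθ hH hij
  have h1 : H / (2 * θ) ≤ R := by rw [div_le_iff₀ (by positivity)]; linarith
  have h2 : (R + H / (2 * θ)) ^ (n + 1) ≤ (2 * R) ^ (n + 1) := by gcongr; linarith
  have h3 : (4 * R * θ / H) = 2 * R / (H / (2 * θ)) := by field_simp; ring
  rw [h3, div_pow, le_div_iff₀ (by positivity)]
  simpa using h.trans h2

end Elements

/-! ### Locally Lipschitz functions -/

section LocallyLipschitz

variable {n : ℕ} {E : Type*} [NormedAddCommGroup E] [NormedSpace ℝ E]

/-- `η` has pointwise Lipschitz constant at most `L` on `s`. -/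
def LocLip (s : Set E) (L : ℝ) (η : E → ℝ) : Prop :=
  ∀ x ∈ s, ∀ᶠ y in nhds x, |η y - η x| ≤ L * ‖y - x‖

omit [NormedSpace ℝ E] in
theorem LocLip.continuousAt {s : Set E} {L : ℝ} {η : E → ℝ} (h : LocLip s L η) {x : E}
    (hx : x ∈ s) : ContinuousAt η x := by
  rw [ContinuousAt, tendsto_iff_dist_tendsto_zero]
  have h1 : Tendsto (fun y => L * ‖y - x‖) (nhds x) (nhds 0) := by
    have : Continuous fun y : E => L * ‖y - x‖ := by fun_prop
    simpa using this.tendsto x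
  exact squeeze_zero' (Filter.Eventually.of_forall fun _ => dist_nonneg) (h x hx) h1

theorem LocLip.abs_sub_le {s : Set E} {L : ℝ} {η : E → ℝ} (h : LocLip s L η) {x y : E}
    (hs : segment ℝ x y ⊆ s) : |η y - η x| ≤ L * ‖y - x‖ := by
  set γ : ℝ → E := fun t => x + t • (y - x)
  have hγ : Continuous γ := by fun_prop
  have hmem : ∀ t ∈ Set.Icc (0 : ℝ) 1, γ t ∈ s := fun t ht => hs (by
    rw [segment_eq_image']; exact ⟨t, ht, rfl⟩)
  have key := image_le_of_liminf_slope_right_le_deriv_boundary (a := 0) (b := 1)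
    (f := fun t => |η (γ t) - η x|) (B := fun t => L * ‖y - x‖ * t) (B' := fun _ => L * ‖y - x‖)
    (fun t ht => by
      have := (h.continuousAt (hmem t ht)).comp hγ.continuousAt
      exact ((this.sub continuousAt_const).abs).continuousWithinAt)
    (by simp [γ]) (by fun_prop)
    (fun t _ => by simpa using ((hasDerivAt_id t).const_mul (L * ‖y - x‖)).hasDerivWithinAt)
    (fun t ht r hr => by
      have hev := hγ.continuousAt.eventually (h (γ t) (hmem t ⟨ht.1, ht.2.le⟩))
      refine Filter.Eventually.frequently ?_
      filter_upwards [hev.filter_mono nhdsWithin_le_nhds, self_mem_nhdsWithin] with z hz hzt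
      have hzt' : 0 < z - t := sub_pos.2 hzt
      refine lt_of_le_of_lt ?_ hr
      rw [slope_def_field, div_le_iff₀ hzt']
      have e : γ z - γ t = (z - t) • (y - x) := by simp only [γ]; module
      rw [e, norm_smul, norm_eq_abs, abs_of_pos hzt'] at hz
      have := abs_sub_abs_le_abs_sub (η (γ z) - η x) (η (γ t) - η x)
      rw [sub_sub_sub_cancel_right] at this
      linarith)
    (Set.right_mem_Icc.2 zero_le_one)
  simpa [γ] using key

theorem ae_differentiableAt_of_locally [MeasurableSpace E] [BorelSpace E] [FiniteDimensional ℝ E]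
    {μ : Measure E} [μ.IsAddHaarMeasure] {U : Set E} (hU : IsOpen U) {f : E → ℝ}
    (h : ∀ t ∈ U, ∃ C, ∃ s ∈ nhds t, LipschitzOnWith C f s) :
    ∀ᵐ t ∂μ.restrict U, DifferentiableAt ℝ f t := by
  rw [ae_restrict_iff' hU.measurableSet, ae_iff]
  refine measure_null_of_locally_null _ fun t ht => ?_
  push Not at ht
  obtain ⟨C, s, hs, hlip⟩ := h t ht.1
  obtain ⟨s', hs's, hs'o, hts'⟩ := mem_nhds_iff.1 hs
  refine ⟨s' ∩ {x | ¬(x ∈ U → DifferentiableAt ℝ f x)},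
    Filter.inter_mem (mem_nhdsWithin_of_mem_nhds (hs'o.mem_nhds hts')) self_mem_nhdsWithin, ?_⟩
  have hae := (hlip.mono hs's).ae_differentiableWithinAt_of_mem (μ := μ)
  rw [ae_iff] at hae
  refine measure_mono_null (fun x hx => ?_) hae
  simp only [mem_ofPred_eq, not_forall]
  refine ⟨hx.1, fun hd => hx.2 fun _ => hd.differentiableAt (hs'o.mem_nhds hx.1)⟩

/-- Almost every point of a set is an accumulation point. -/
theorem ae_frequently_mem [MeasurableSpace E] [BorelSpace E] [SecondCountableTopology E]
    {μ : Measure E} [NullSingletonClass μ] (A : Set E) :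
    ∀ᵐ t ∂μ, t ∈ A → ∃ᶠ s in nhdsWithin t {t}ᶜ, s ∈ A := by
  rw [ae_iff]
  refine measure_null_of_locally_null _ fun t ht => ?_
  push Not at ht
  obtain ⟨htA, hf⟩ := ht
  rw [eventually_nhdsWithin_iff] at hf
  refine ⟨_, Filter.inter_mem (mem_nhdsWithin_of_mem_nhds hf) self_mem_nhdsWithin,
    measure_mono_null (fun s hs => ?_) (measure_singleton t)⟩
  by_contra h
  have h2 := hs.2
  simp only [mem_ofPred_eq, not_forall] at h2
  exact hs.1 h h2.1

end LocallyLipschitz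

/-! ### Piecewise Lipschitz functions on the mesh -/

section MeshFunctions

variable {n : ℕ} {G : Geometry n} {θ H : ℝ} (T : CoarseMesh G θ H)

/-- Nearby points lie in a common element. -/
theorem eventually_mem_element {x : Euc (n + 1)} (hx : x ∈ G.Ω) :
    ∀ᶠ y in nhds x, ∃ j, x ∈ element T j ∧ y ∈ element T j := by
  have h1 : ∀ᶠ y in nhds x, ∀ j, x ∉ element T j → y ∉ element T j := by
    rw [Filter.eventually_all]
    intro j
    by_cases h : x ∈ element T j
    · exact Filter.Eventually.of_forall fun y h' => absurd h h'
    · filter_upwards [(isCompact_element T j).isClosed.isOpen_compl.mem_nhds h] with y hy _ using hy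
  filter_upwards [h1, G.isOpen_Ω.mem_nhds hx] with y hy hyΩ
  obtain ⟨j, hj⟩ := exists_mem_element T hyΩ
  exact ⟨j, by_contra fun h => hy j h hj, hj⟩

theorem locLip_of_element {L : ℝ} {η : Euc (n + 1) → ℝ}
    (h : ∀ j, ∀ x ∈ element T j, ∀ y ∈ element T j, |η y - η x| ≤ L * ‖y - x‖) :
    LocLip G.Ω L η := fun x hx => by
  filter_upwards [eventually_mem_element T hx] with y ⟨j, h1, h2⟩ using h j x h1 y h2

/-- The Lipschitz constant of a nodal function. -/
def chiLip (n : ℕ) (θ : ℝ) : ℝ := 2 ^ (n + 1) * (n + 1) * θ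

variable {T}

theorem element_lip_of_refMap (hθ : 1 ≤ θ) (hH : 0 < H) {η : Euc (n + 1) → ℝ} {j : Fin T.numElem}
    (h : ∀ ξ ∈ refCube (n + 1), ∀ ζ ∈ refCube (n + 1),
      |η (refMap T j ζ) - η (refMap T j ξ)| ≤ 2 ^ (n + 1) * (n + 1) * ‖ζ - ξ‖) :
    ∀ x ∈ element T j, ∀ y ∈ element T j, |η y - η x| ≤ chiLip n θ / H * ‖y - x‖ := by
  rintro _ ⟨ξ, hξ, rfl⟩ _ ⟨ζ, hζ, rfl⟩
  refine (h ξ hξ ζ hζ).trans ?_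
  have h1 := le_norm_refMap_sub T j hζ hξ
  have h2 : ‖ζ - ξ‖ ≤ θ / H * ‖refMap T j ζ - refMap T j ξ‖ := by
    have h0 : 0 ≤ θ / H := by positivity
    have := mul_le_mul_of_nonneg_left h1 h0
    have e : θ / H * (H / θ * ‖ζ - ξ‖) = ‖ζ - ξ‖ := by field_simp
    rwa [e] at this
  calc 2 ^ (n + 1) * (n + 1) * ‖ζ - ξ‖
      ≤ 2 ^ (n + 1) * (n + 1) * (θ / H * ‖refMap T j ζ - refMap T j ξ‖) := by gcongr
    _ = chiLip n θ / H * ‖refMap T j ζ - refMap T j ξ‖ := by unfold chiLip; ring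

theorem abs_sum_shape_sub_le (P : (Fin (n + 1) → Bool) → Prop) [DecidablePred P]
    {ξ ζ : Euc (n + 1)} (hξ : ξ ∈ refCube (n + 1)) (hζ : ζ ∈ refCube (n + 1)) :
    |(∑ b, if P b then shape b ζ else 0) - ∑ b, if P b then shape b ξ else 0| ≤
      2 ^ (n + 1) * (n + 1) * ‖ζ - ξ‖ := by
  rw [← sum_sub_distrib]
  refine (Finset.abs_sum_le_sum_abs _ _).trans ?_
  have : ∀ b ∈ Finset.univ, |(if P b then shape b ζ else 0) - if P b then shape b ξ else 0| ≤
      (n + 1) * ‖ζ - ξ‖ := by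
    intro b _
    split_ifs
    · exact_mod_cast abs_shape_sub_le b hζ hξ
    · rw [sub_self, abs_zero]; positivity
  refine (sum_le_sum this).trans (le_of_eq ?_)
  simp [mul_assoc]

variable (T) in
open Classical in
/-- The sum of the nodal functions of a set of vertices. -/
def chiSum (V : Set (Fin T.numVert)) (x : Euc (n + 1)) : ℝ := ∑ k, if k ∈ V then T.chi k x else 0

open Classical in
theorem chiSum_refMap (V : Set (Fin T.numVert)) (j : Fin T.numElem) {ξ : Euc (n + 1)}
    (hξ : ξ ∈ refCube (n + 1)) :
    chiSum T V (refMap T j ξ) = ∑ b, if T.vert j b ∈ V then shape b ξ else 0 := by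
  unfold chiSum
  simp_rw [chi_refMap T j _ hξ]
  have : ∀ k : Fin T.numVert, (if k ∈ V then ∑ b, (if T.vert j b = k then shape b ξ else 0) else 0) =
      ∑ b, if T.vert j b = k then (if k ∈ V then shape b ξ else 0) else 0 := by
    intro k
    split_ifs <;> simp
  simp_rw [this]
  rw [Finset.sum_comm]
  simp

theorem chiSum_singleton (k : Fin T.numVert) : chiSum T {k} = T.chi k := by
  funext x
  simp [chiSum]

theorem chiSum_lip (hθ : 1 ≤ θ) (hH : 0 < H) (V : Set (Fin T.numVert)) (j : Fin T.numElem) :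
    ∀ x ∈ element T j, ∀ y ∈ element T j,
      |chiSum T V y - chiSum T V x| ≤ chiLip n θ / H * ‖y - x‖ := by
  classical
  refine element_lip_of_refMap hθ hH fun ξ hξ ζ hζ => ?_
  rw [chiSum_refMap V j hξ, chiSum_refMap V j hζ]
  exact abs_sum_shape_sub_le _ hξ hζ

theorem chiSum_mem_Icc (V : Set (Fin T.numVert)) {x : Euc (n + 1)} (hx : x ∈ closure G.Ω) :
    0 ≤ chiSum T V x ∧ chiSum T V x ≤ 1 := by
  classical
  rw [← iUnion_element T] at hx
  obtain ⟨j, ξ, hξ, rfl⟩ := mem_iUnion.1 hx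
  have := chiSum_refMap V j hξ
  rw [refMap] at this
  simp only
  rw [this]
  constructor
  · exact sum_nonneg fun b _ => by split_ifs; exacts [shape_nonneg b hξ, le_rfl]
  · rw [← sum_shape ξ]
    exact sum_le_sum fun b _ => by split_ifs; exacts [le_rfl, shape_nonneg b hξ]

theorem chiSum_locLip (hθ : 1 ≤ θ) (hH : 0 < H) (V : Set (Fin T.numVert)) :
    LocLip G.Ω (chiLip n θ / H) (chiSum T V) :=
  locLip_of_element T fun j => chiSum_lip hθ hH V j

theorem chi_locLip (hθ : 1 ≤ θ) (hH : 0 < H) (k : Fin T.numVert) :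
    LocLip G.Ω (chiLip n θ / H) (T.chi k) := by
  rw [← chiSum_singleton k]; exact chiSum_locLip hθ hH _

theorem chi_eq_zero {j : Fin T.numElem} {k : Fin T.numVert} (h : k ∉ Set.range (T.vert j))
    {x : Euc (n + 1)} (hx : x ∈ element T j) : T.chi k x = 0 := by
  obtain ⟨ξ, hξ, rfl⟩ := hx
  refine (chi_refMap T j k hξ).trans (sum_eq_zero fun b _ => ?_)
  rw [if_neg fun e => h ⟨b, e⟩]

/-- The bubble function, extended by zero. -/
def cutBubble (T : CoarseMesh G θ H) (j : Fin T.numElem) : Euc (n + 1) → ℝ :=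
  (element T j).indicator (bubble T j)

theorem bubble_refMap (hθ : 1 ≤ θ) (hH : 0 < H) (j : Fin T.numElem) {ξ : Euc (n + 1)}
    (hξ : ξ ∈ refCube (n + 1)) : bubble T j (refMap T j ξ) = ∏ b, shape b ξ :=
  Finset.prod_congr rfl fun b _ => chi_vert_refMap T hθ hH j b hξ

theorem cutBubble_eq_zero (hθ : 1 ≤ θ) (hH : 0 < H) {j : Fin T.numElem} {x : Euc (n + 1)}
    (hx : x ∉ openElement T j) : cutBubble T j x = 0 := by
  by_cases h : x ∈ element T j
  · rw [cutBubble, indicator_of_mem h]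
    by_contra h'
    exact hx (mem_openElement_of_bubble_ne_zero T hθ hH h h')
  · rw [cutBubble, indicator_of_notMem h]

theorem cutBubble_mem_Icc (hθ : 1 ≤ θ) (hH : 0 < H) (j : Fin T.numElem) (x : Euc (n + 1)) :
    0 ≤ cutBubble T j x ∧ cutBubble T j x ≤ 1 := by
  by_cases h : x ∈ element T j
  · rw [cutBubble, indicator_of_mem h]
    obtain ⟨ξ, hξ, rfl⟩ := h
    have e := bubble_refMap hθ hH j hξ
    rw [refMap] at e
    simp only
    rw [e]
    exact ⟨prod_nonneg fun b _ => shape_nonneg b hξ,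
      prod_le_one (fun b _ => shape_nonneg b hξ) fun b _ => shape_le_one b hξ⟩
  · rw [cutBubble, indicator_of_notMem h]; norm_num

theorem cutBubble_locLip (hθ : 1 ≤ θ) (hH : 0 < H) (j : Fin T.numElem) :
    LocLip G.Ω (chiLip n θ / H) (cutBubble T j) := by
  refine locLip_of_element T fun i => ?_
  rcases eq_or_ne i j with rfl | hij
  · refine element_lip_of_refMap hθ hH fun ξ hξ ζ hζ => ?_
    rw [cutBubble, indicator_of_mem (refMap_mem T hξ), indicator_of_mem (refMap_mem T hζ),
      bubble_refMap hθ hH _ hξ, bubble_refMap hθ hH _ hζ]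
    refine (abs_prod_sub_prod_le _ (fun b _ => ⟨shape_nonneg b hζ, shape_le_one b hζ⟩)
      fun b _ => ⟨shape_nonneg b hξ, shape_le_one b hξ⟩).trans ?_
    refine (sum_le_sum fun b _ => abs_shape_sub_le b hζ hξ).trans (le_of_eq ?_)
    simp [mul_assoc]
  · intro x hx y hy
    have hd := disjoint_openElement T hθ hH hij
    have h0 : ∀ z ∈ element T i, cutBubble T j z = 0 := fun z hz =>
      cutBubble_eq_zero hθ hH fun h => disjoint_left.1 hd h hz
    rw [h0 x hx, h0 y hy, sub_self, abs_zero]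
    have : 0 ≤ chiLip n θ := by unfold chiLip; positivity
    positivity


/-! ### Layers of elements -/

open Classical in
/-- The elements of the oversampled region. -/
def layerSet (T : CoarseMesh G θ H) (j : Fin T.numElem) (t : ℕ) : Finset (Fin T.numElem) :=
  Finset.univ.filter fun i => i ∈ layers T j t

theorem mem_layerSet {j i : Fin T.numElem} {t : ℕ} : i ∈ layerSet T j t ↔ i ∈ layers T j t := by
  simp [layerSet]

theorem layerSet_zero (j : Fin T.numElem) : layerSet T j 0 = {j} := by
  ext i; rw [mem_layerSet, Finset.mem_singleton]; exact Iff.rfl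

theorem mem_layerSet_succ {j i i' : Fin T.numElem} {t : ℕ} (h : i' ∈ layerSet T j t)
    {x : Euc (n + 1)} (hx : x ∈ element T i) (hx' : x ∈ element T i') :
    i ∈ layerSet T j (t + 1) :=
  mem_layerSet.2 ⟨i', mem_layerSet.1 h, x, hx, hx'⟩

theorem pos_vert_mem (j : Fin T.numElem) (b) : T.pos (T.vert j b) ∈ element T j := by
  rw [← refMap_corner]; exact refMap_mem T (corner_mem b)

theorem layerSet_subset (j : Fin T.numElem) (t : ℕ) : layerSet T j t ⊆ layerSet T j (t + 1) :=
  fun i hi => mem_layerSet_succ hi (pos_vert_mem i fun _ => true) (pos_vert_mem i fun _ => true)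

/-- The cut-off function of the region of `t` layers. -/
def cutoff (T : CoarseMesh G θ H) (j : Fin T.numElem) (t : ℕ) : Euc (n + 1) → ℝ :=
  chiSum T {k | ∃ i ∈ layerSet T j t, k ∈ Set.range (T.vert i)}

theorem cutoff_eq_one {j i : Fin T.numElem} {t : ℕ} (hi : i ∈ layerSet T j t) {x : Euc (n + 1)}
    (hx : x ∈ element T i) : cutoff T j t x = 1 := by
  classical
  obtain ⟨ξ, hξ, rfl⟩ := hx
  refine (chiSum_refMap _ i hξ).trans ?_
  rw [← sum_shape ξ]
  exact sum_congr rfl fun b _ => if_pos ⟨i, hi, b, rfl⟩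

theorem cutoff_eq_zero {j i : Fin T.numElem} {t : ℕ} (hi : i ∉ layerSet T j (t + 1))
    {x : Euc (n + 1)} (hx : x ∈ element T i) : cutoff T j t x = 0 := by
  classical
  obtain ⟨ξ, hξ, rfl⟩ := hx
  refine (chiSum_refMap _ i hξ).trans ?_
  refine sum_eq_zero fun b _ => if_neg ?_
  rintro ⟨i', hi', b', hb'⟩
  refine hi (mem_layerSet_succ hi' (pos_vert_mem i b) ?_)
  rw [← hb']
  exact pos_vert_mem i' b'

/-- The union of the elements in `J`. -/
def region (T : CoarseMesh G θ H) (J : Finset (Fin T.numElem)) : Set (Euc (n + 1)) :=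
  ⋃ i ∈ J, element T i

theorem isCompact_region (J : Finset (Fin T.numElem)) : IsCompact (region T J) :=
  J.isCompact_biUnion fun i _ => isCompact_element T i

theorem oversampled_eq (j : Fin T.numElem) (t : ℕ) :
    oversampled T j t = region T (layerSet T j t) := by
  ext x
  simp only [oversampled, region, mem_iUnion, mem_layerSet]

theorem cutoff_locally_const {j : Fin T.numElem} {t : ℕ} {x : Euc (n + 1)} (hx : x ∈ G.Ω)
    (hxT : x ∉ region T (layerSet T j (t + 1) \ layerSet T j t)) :
    ∀ᶠ y in nhds x, cutoff T j t y = cutoff T j t x := by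
  filter_upwards [eventually_mem_element T hx] with y ⟨i, h1, h2⟩
  by_cases hi : i ∈ layerSet T j t
  · rw [cutoff_eq_one hi h1, cutoff_eq_one hi h2]
  · have hi' : i ∉ layerSet T j (t + 1) := fun h => hxT
      (mem_biUnion (mem_sdiff.2 ⟨h, hi⟩) h1)
    rw [cutoff_eq_zero hi' h1, cutoff_eq_zero hi' h2]

theorem mem_interior_of_cutoff_ne_zero {j : Fin T.numElem} {t : ℕ} {x : Euc (n + 1)}
    (hx : x ∈ G.Ω) (h : cutoff T j t x ≠ 0) : x ∈ interior (oversampled T j (t + 1)) := by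
  rw [mem_interior_iff_mem_nhds]
  filter_upwards [eventually_mem_element T hx] with y ⟨i, h1, h2⟩
  rw [oversampled_eq]
  exact mem_biUnion (by_contra fun hi => h (cutoff_eq_zero hi h1)) h2

/-! ### The weight `∑ₖ |∇χₖ|²` -/

/-- The sum of the squares of the gradients of the nodal functions. -/
def meshWeight (T : CoarseMesh G θ H) (y : Pts G) : ℝ := ∑ k, ‖gr (smoothField G (T.chi k)) y‖ ^ 2

theorem meshWeight_nonneg (y : Pts G) : 0 ≤ meshWeight T y := sum_nonneg fun _ _ => by positivity

theorem measurable_meshWeight : Measurable (meshWeight T) :=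
  Finset.measurable_sum _ fun k _ => (measurable_gr_smoothField (T.chi k)).norm.pow_const 2

theorem chiLip_pos (hθ : 1 ≤ θ) : 0 < chiLip n θ := by unfold chiLip; positivity

/-- The constant in the upper bound for the weight. -/
def weightMax (n : ℕ) (θ : ℝ) : ℝ := overlap n θ * 2 ^ (n + 1) * chiLip n θ ^ 2

theorem meshWeight_le (hθ : 1 ≤ θ) (hH : 0 < H) {y : Pts G} (hy : y ∈ legit G) :
    meshWeight T y ≤ weightMax n θ / H ^ 2 := by
  classical
  set J := Finset.univ.filter fun j => pos G y ∈ element T j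
  have hL := chiLip_pos (n := n) hθ
  have hle : ∀ k, ‖gr (smoothField G (T.chi k)) y‖ ≤ chiLip n θ / H := fun k =>
    norm_gr_smoothField_le (by positivity) hy (chi_locLip hθ hH k _ (legit_pos hy))
  have hz : ∀ k, k ∉ J.biUnion (fun j => Finset.univ.image (T.vert j)) →
      gr (smoothField G (T.chi k)) y = 0 := by
    intro k hk
    refine gr_smoothField_eq_zero ?_
    filter_upwards [eventually_mem_element T (legit_pos hy)] with z ⟨j, h1, h2⟩
    have hkj : k ∉ Set.range (T.vert j) := fun ⟨b, hb⟩ => hk (Finset.mem_biUnion.2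
      ⟨j, Finset.mem_filter.2 ⟨mem_univ _, h1⟩, Finset.mem_image.2 ⟨b, mem_univ _, hb⟩⟩)
    rw [chi_eq_zero hkj h1, chi_eq_zero hkj h2]
  unfold meshWeight
  rw [← Finset.sum_subset (subset_univ (J.biUnion fun j => Finset.univ.image (T.vert j)))
    fun k _ hk => by rw [hz k hk]; simp]
  calc ∑ k ∈ J.biUnion (fun j => Finset.univ.image (T.vert j)),
        ‖gr (smoothField G (T.chi k)) y‖ ^ 2
      ≤ ∑ k ∈ J.biUnion (fun j => Finset.univ.image (T.vert j)), (chiLip n θ / H) ^ 2 :=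
        sum_le_sum fun k _ => by gcongr; exact hle k
    _ = ((J.biUnion fun j => Finset.univ.image (T.vert j)).card : ℝ) * (chiLip n θ / H) ^ 2 := by
        simp
    _ ≤ (overlap n θ * 2 ^ (n + 1)) * (chiLip n θ / H) ^ 2 := by
        gcongr
        have h1 : (J.biUnion fun j => Finset.univ.image (T.vert j)).card ≤ J.card * 2 ^ (n + 1) := by
          refine Finset.card_biUnion_le_card_mul _ _ _ fun j _ => ?_
          exact Finset.card_image_le.trans (by simp)
        have h2 := card_elements_le T hθ hH (pos G y)
        calc (((J.biUnion fun j => Finset.univ.image (T.vert j)).card : ℕ) : ℝ)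
            ≤ ((J.card * 2 ^ (n + 1) : ℕ) : ℝ) := by exact_mod_cast h1
          _ = (J.card : ℝ) * 2 ^ (n + 1) := by push_cast; ring
          _ ≤ _ := by gcongr
    _ = _ := by unfold weightMax; field_simp

theorem norm_le_of_abs_apply_le {d : ℕ} {v : Euc (d + 1)} {m : ℝ} (hm : 0 ≤ m)
    (h : ∀ i, |v i| ≤ m) : ‖v‖ ≤ (d + 1) * m := by
  have h1 : ‖v‖ ^ 2 ≤ (d + 1) * m ^ 2 := by
    rw [EuclideanSpace.norm_sq_eq]
    have : ∀ i ∈ Finset.univ, ‖v i‖ ^ 2 ≤ m ^ 2 := fun i _ => by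
      rw [norm_eq_abs]; exact pow_le_pow_left₀ (abs_nonneg _) (h i) 2
    simpa using sum_le_sum this
  refine le_of_sq_le_sq (α := ℝ) ?_ (by positivity)
  have h2 : 0 ≤ (d : ℝ) * (d + 1) * m ^ 2 := by positivity
  nlinarith

/-- The constant in the lower bound for the weight. -/
def weightMin (n : ℕ) (θ : ℝ) : ℝ := (2 ^ (n + 1) * (2 * θ * (n + 1)) ^ 2)⁻¹

theorem overlap_nonneg : 0 ≤ overlap n θ := by unfold overlap; positivity

theorem weightMax_nonneg : 0 ≤ weightMax n θ := by unfold weightMax overlap; positivity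

theorem weightMin_pos (hθ : 1 ≤ θ) : 0 < weightMin n θ := by unfold weightMin; positivity

theorem weight_ge_of_frequently (hθ : 1 ≤ θ) (hH : 0 < H) {E : Type*} [NormedAddCommGroup E]
    [InnerProductSpace ℝ E] [CompleteSpace E] {φ : E → Euc (n + 1)} {t : E} {j : Fin T.numElem}
    (ht : φ t ∈ element T j) (hacc : ∃ᶠ s in nhdsWithin t {t}ᶜ, φ s ∈ element T j)
    (hφ : ∀ᶠ s in nhds t, ‖s - t‖ ≤ 2 * ‖φ s - φ t‖)
    (hd : ∀ k, DifferentiableAt ℝ (fun s => T.chi k (φ s)) t) :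
    weightMin n θ / H ^ 2 ≤ ∑ k, ‖gradient (fun s => T.chi k (φ s)) t‖ ^ 2 := by
  set W := ∑ k, ‖gradient (fun s => T.chi k (φ s)) t‖ ^ 2
  have hW0 : 0 ≤ W := sum_nonneg fun _ _ => by positivity
  set m := √(2 ^ (n + 1) * W)
  have hm : 0 ≤ m := sqrt_nonneg _
  set h : Fin (n + 1) → E → ℝ := fun i s => ∑ b, if b i then T.chi (T.vert j b) (φ s) else 0
  have hder : ∀ i, HasFDerivAt (h i)
      (∑ b, if b i then fderiv ℝ (fun s => T.chi (T.vert j b) (φ s)) t else 0) t := by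
    intro i
    refine HasFDerivAt.fun_sum fun b _ => ?_
    split_ifs
    · exact (hd _).hasFDerivAt
    · exact hasFDerivAt_const _ _
  have hnorm : ∀ i, ‖∑ b, if b i then fderiv ℝ (fun s => T.chi (T.vert j b) (φ s)) t else 0‖ ≤ m := by
    intro i
    refine Real.le_sqrt_of_sq_le ?_
    have h1 : ‖∑ b, if b i then fderiv ℝ (fun s => T.chi (T.vert j b) (φ s)) t else 0‖ ≤
        ∑ b, ‖gradient (fun s => T.chi (T.vert j b) (φ s)) t‖ := by
      refine (norm_sum_le _ _).trans (sum_le_sum fun b _ => ?_)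
      rw [norm_gradient_eq]
      split_ifs
      · exact le_rfl
      · rw [norm_zero]; exact norm_nonneg _
    have h2 := sq_sum_le_card_mul_sum_sq (s := Finset.univ)
      (f := fun b => ‖gradient (fun s => T.chi (T.vert j b) (φ s)) t‖)
    have h3 : ∑ b, ‖gradient (fun s => T.chi (T.vert j b) (φ s)) t‖ ^ 2 ≤ W := by
      have := Finset.sum_image (s := Finset.univ) (g := T.vert j)
        (f := fun k => ‖gradient (fun s => T.chi k (φ s)) t‖ ^ 2)
        (vert_injective T hθ hH j).injOn
      rw [← this]
      exact Finset.sum_le_sum_of_subset_of_nonneg (subset_univ _) fun _ _ _ => by positivity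
    calc _ ≤ (∑ b, ‖gradient (fun s => T.chi (T.vert j b) (φ s)) t‖) ^ 2 :=
          pow_le_pow_left₀ (norm_nonneg _) h1 2
      _ ≤ _ := h2
      _ ≤ _ := by
        rw [card_univ]
        simp only [Fintype.card_pi, Fintype.card_bool, Finset.prod_const, card_univ, Fintype.card_fin]
        push_cast
        gcongr
  have key : ∀ ε > 0, 1 / (2 * θ * H) ≤ (n + 1) * (m + ε) := by
    intro ε hε
    have hev : ∀ᶠ s in nhds t, ∀ i, |h i s - h i t| ≤ (m + ε) * ‖s - t‖ := by
      rw [Filter.eventually_all]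
      intro i
      filter_upwards [(hder i).isLittleO.def hε] with s hs
      rw [norm_eq_abs] at hs
      set D := ∑ b, if b i then fderiv ℝ (fun s => T.chi (T.vert j b) (φ s)) t else 0
      have h1 := D.le_opNorm (s - t)
      have h2 := mul_le_mul_of_nonneg_right (hnorm i) (norm_nonneg (s - t))
      have h3 := abs_add_le (h i s - h i t - D (s - t)) (D (s - t))
      rw [sub_add_cancel] at h3
      rw [norm_eq_abs] at h1
      linarith
    obtain ⟨s, hs, hs1, hs2, hs0⟩ := (hacc.and_eventually
      ((hev.filter_mono nhdsWithin_le_nhds).and ((hφ.filter_mono nhdsWithin_le_nhds).and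
        self_mem_nhdsWithin))).exists
    obtain ⟨ξ, hξ, hξs⟩ := hs
    obtain ⟨ζ, hζ, hζt⟩ := ht
    have hc : ∀ i, |(ξ - ζ) i| ≤ (m + ε) * ‖s - t‖ := by
      intro i
      have e : ∀ {ζ : Euc (n + 1)} {r : E}, ζ ∈ refCube (n + 1) → refMap T j ζ = φ r →
          h i r = ζ i := by
        intro ζ r hζ hr
        simp only [h]
        rw [← sum_shape_coord ζ i]
        refine sum_congr rfl fun b _ => ?_
        rw [← hr, chi_vert_refMap T hθ hH j b hζ]
      rw [PiLp.sub_apply, ← e hξ hξs, ← e hζ hζt]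
      exact hs1 i
    have h1 := norm_le_of_abs_apply_le (by positivity) hc
    have h2 := norm_refMap_sub_le T j hξ hζ
    have h3 : refMap T j ξ - refMap T j ζ = φ s - φ t := by
      rw [show refMap T j ξ = φ s from hξs, show refMap T j ζ = φ t from hζt]
    rw [h3] at h2
    have hst : 0 < ‖s - t‖ := norm_pos_iff.2 (sub_ne_zero.2 hs0)
    have h4 : ‖s - t‖ ≤ 2 * (θ * H * ((n + 1) * ((m + ε) * ‖s - t‖))) := by
      refine hs2.trans ?_
      gcongr
      refine h2.trans ?_
      gcongr
    rw [div_le_iff₀ (by positivity)]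
    have h5 : 1 * ‖s - t‖ ≤ ((n + 1) * (m + ε) * (2 * θ * H)) * ‖s - t‖ := by linarith
    exact le_of_mul_le_mul_right h5 hst
  have hfin : 1 / (2 * θ * H) ≤ (n + 1) * m := by
    refine le_of_forall_pos_le_add fun ε hε => ?_
    have := key (ε / (n + 1)) (by positivity)
    rw [mul_add, mul_div_cancel₀ _ (by positivity)] at this
    exact this
  have hsq := pow_le_pow_left₀ (by positivity) hfin 2
  rw [mul_pow _ m, sq_sqrt (by positivity)] at hsq
  unfold weightMin
  rw [div_le_iff₀ (by positivity), inv_le_iff_one_le_mul₀ (by positivity)]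
  rw [div_pow, one_pow, div_le_iff₀ (by positivity)] at hsq
  nlinarith

theorem exists_lipschitzOnWith_comp {L : ℝ} {η : Euc (n + 1) → ℝ} (hL : 0 ≤ L)
    (h : LocLip G.Ω L η) {E : Type*} [NormedAddCommGroup E] [NormedSpace ℝ E]
    {φ : E → Euc (n + 1)} (hφ : ContDiff ℝ 1 φ) {t : E} (ht : φ t ∈ G.Ω) :
    ∃ C, ∃ s ∈ nhds t, LipschitzOnWith C (fun r => η (φ r)) s := by
  obtain ⟨K, s, hs, hlip⟩ := (hφ.contDiffAt (x := t)).hasStrictFDerivAt one_ne_zero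
    |>.exists_lipschitzOnWith
  obtain ⟨ρ, hρ, hball⟩ := Metric.isOpen_iff.1 G.isOpen_Ω _ ht
  refine ⟨L.toNNReal * K, s ∩ φ ⁻¹' ball (φ t) ρ, Filter.inter_mem hs
    (hφ.continuous.continuousAt.preimage_mem_nhds (ball_mem_nhds _ hρ)), ?_⟩
  refine LipschitzOnWith.comp (g := η) (t := ball (φ t) ρ) ?_
    (hlip.mono inter_subset_left) fun r hr => hr.2
  refine LipschitzOnWith.of_dist_le_mul fun x hx y hy => ?_
  rw [coe_toNNReal _ hL, dist_eq_norm, dist_eq_norm]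
  exact h.abs_sub_le (((convex_ball _ _).segment_subset hy hx).trans hball)

theorem le_meshWeight_bulk (hθ : 1 ≤ θ) (hH : 0 < H) :
    ∀ᵐ x ∂volume.restrict G.Ω, weightMin n θ / H ^ 2 ≤ meshWeight T (Sum.inl x) := by
  have hd : ∀ᵐ x ∂volume.restrict G.Ω, ∀ k, DifferentiableAt ℝ (T.chi k) x := by
    rw [ae_all_iff]
    exact fun k => ae_differentiableAt_of_locally G.isOpen_Ω fun t ht =>
      exists_lipschitzOnWith_comp (by have := chiLip_pos (n := n) hθ; positivity)
        (chi_locLip hθ hH k) contDiff_id ht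
  have hacc : ∀ᵐ x : Euc (n + 1), ∀ j, x ∈ element T j →
      ∃ᶠ s in nhdsWithin x {x}ᶜ, s ∈ element T j :=
    ae_all_iff.2 fun j => ae_frequently_mem _
  filter_upwards [hd, ae_restrict_of_ae hacc, ae_restrict_mem G.isOpen_Ω.measurableSet]
    with x h1 h2 hx
  obtain ⟨j, hj⟩ := exists_mem_element T hx
  have := weight_ge_of_frequently hθ hH (φ := id) hj (h2 j hj)
    (Filter.Eventually.of_forall fun s => by simp only [id]; linarith [norm_nonneg (s - x)]) h1
  unfold meshWeight
  simp_rw [norm_gr_inl]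
  exact this

theorem le_meshWeight_frac (hn : n ≠ 0) (hθ : 1 ≤ θ) (hH : 0 < H) (l : Fin G.numFrac) :
    ∀ᵐ t ∂volume.restrict (G.U l), weightMin n θ / H ^ 2 ≤ meshWeight T (Sum.inr (l, t)) := by
  have : Nonempty (Fin n) := ⟨⟨0, Nat.pos_of_ne_zero hn⟩⟩
  have hd : ∀ᵐ t ∂volume.restrict (G.U l), ∀ k, DifferentiableAt ℝ (fun s => T.chi k (G.emb l s)) t := by
    rw [ae_all_iff]
    exact fun k => ae_differentiableAt_of_locally (G.isOpen_U l) fun t ht =>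
      exists_lipschitzOnWith_comp (by have := chiLip_pos (n := n) hθ; positivity)
        (chi_locLip hθ hH k) (G.contDiff_emb l) (G.mapsTo_emb l ht)
  have hacc : ∀ᵐ t : Euc n, ∀ j, t ∈ G.emb l ⁻¹' element T j →
      ∃ᶠ s in nhdsWithin t {t}ᶜ, s ∈ G.emb l ⁻¹' element T j :=
    ae_all_iff.2 fun j => ae_frequently_mem _
  filter_upwards [hd, ae_restrict_of_ae hacc, ae_restrict_mem (G.isOpen_U l).measurableSet]
    with t h1 h2 ht
  obtain ⟨j, hj⟩ := exists_mem_element T (G.mapsTo_emb l ht)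
  obtain ⟨δ, hδ, hδ'⟩ := exists_norm_sub_le_emb G l
  have := weight_ge_of_frequently hθ hH (φ := G.emb l) hj (h2 j hj)
    (Filter.mem_of_superset (ball_mem_nhds t hδ) fun s hs => hδ' t ht s hs) h1
  unfold meshWeight
  simp_rw [norm_gr_inr]
  exact this

/-- Gradient bounds in terms of the weight. In dimension one the fractures are points and have no
gradients. -/
theorem ae_norm_gr_sq_le (hθ : 1 ≤ θ) (hH : 0 < H) :
    ∀ᵐ y ∂mm G G.Ω, ∀ (w : Scalars G) (a : ℝ), ‖gr w y‖ ≤ chiLip n θ / H * |a| →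
      ‖gr w y‖ ^ 2 ≤ chiLip n θ ^ 2 / weightMin n θ * (meshWeight T y * a ^ 2) := by
  have hpos := weightMin_pos (n := n) hθ
  have key : ∀ y, weightMin n θ / H ^ 2 ≤ meshWeight T y →
      ∀ (w : Scalars G) (a : ℝ), ‖gr w y‖ ≤ chiLip n θ / H * |a| →
      ‖gr w y‖ ^ 2 ≤ chiLip n θ ^ 2 / weightMin n θ * (meshWeight T y * a ^ 2) := by
    intro y hy w a h
    have h1 := pow_le_pow_left₀ (norm_nonneg _) h 2
    rw [mul_pow, sq_abs] at h1
    refine h1.trans ?_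
    calc (chiLip n θ / H) ^ 2 * a ^ 2
        = chiLip n θ ^ 2 / weightMin n θ * (weightMin n θ / H ^ 2 * a ^ 2) := by
          field_simp
      _ ≤ _ := by gcongr
  rw [ae_mm_iff]
  refine ⟨(le_meshWeight_bulk hθ hH).mono fun x hx => key _ hx, fun l => ?_⟩
  rw [fracPart_Ω]
  rcases eq_or_ne n 0 with rfl | hn
  · refine ae_of_all _ fun t w a _ => ?_
    rw [norm_gr_inr, Subsingleton.elim (w.fgrad l t) 0, norm_zero]
    rw [zero_pow two_ne_zero]
    exact mul_nonneg (by positivity) (mul_nonneg (meshWeight_nonneg _) (sq_nonneg a))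
  · exact (le_meshWeight_frac hn hθ hH l).mono fun t ht => key _ ht

end MeshFunctions

/-! ### Multiplication by Lipschitz functions -/

section Mollification

variable {n : ℕ} {E : Type*} [NormedAddCommGroup E] [InnerProductSpace ℝ E] [FiniteDimensional ℝ E]
  [MeasurableSpace E] [BorelSpace E]

theorem abs_normed_convolution_sub_le (φ : ContDiffBump (0 : E)) {h : E → ℝ}
    (hh : AEStronglyMeasurable h volume) {x : E} {c C : ℝ} (hC : 0 ≤ C)
    (hb : ∀ y ∈ ball x φ.rOut, |h y - c| ≤ C) :
    |(convolution (φ.normed volume) h (ContinuousLinearMap.lsmul ℝ ℝ) volume) x - c| ≤ C := by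
  rw [← Real.dist_eq]
  exact dist_convolution_le hC φ.support_normed_eq.subset φ.nonneg_normed φ.integral_normed hh hb

theorem abs_normed_convolution_sub_apply_le (φ : ContDiffBump (0 : E)) {h : E → ℝ}
    (hh : LocallyIntegrable h volume) {x z : E} {C : ℝ} (hC : 0 ≤ C)
    (hb : ∀ y ∈ ball x φ.rOut, |h (y + (z - x)) - h y| ≤ C) :
    |(convolution (φ.normed volume) h (ContinuousLinearMap.lsmul ℝ ℝ) volume) z -
      (convolution (φ.normed volume) h (ContinuousLinearMap.lsmul ℝ ℝ) volume) x| ≤ C := by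
  have hex := φ.hasCompactSupport_normed (μ := volume) |>.convolutionExists_left
    (ContinuousLinearMap.lsmul ℝ ℝ) φ.continuous_normed hh
  have e : (convolution (φ.normed volume) h (ContinuousLinearMap.lsmul ℝ ℝ) volume) z -
      (convolution (φ.normed volume) h (ContinuousLinearMap.lsmul ℝ ℝ) volume) x =
      (convolution (φ.normed volume) (fun y => h (y + (z - x)) - h y)
        (ContinuousLinearMap.lsmul ℝ ℝ) volume) x := by
    rw [convolution_def, convolution_def, convolution_def, ← integral_sub (hex z) (hex x)]
    refine integral_congr_ae (ae_of_all _ fun t => ?_)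
    simp only [ContinuousLinearMap.lsmul_apply, smul_eq_mul]
    rw [show x - t + (z - x) = z - t by abel]
    ring
  rw [e]
  have hm : AEStronglyMeasurable (fun y => h (y + (z - x)) - h y) volume :=
    (hh.aestronglyMeasurable.comp_quasiMeasurePreserving
      (quasiMeasurePreserving_add_right volume (z - x))).sub hh.aestronglyMeasurable
  have := abs_normed_convolution_sub_le φ hm (x := x) (c := 0) hC (by simpa using hb)
  simpa using this

/-- Locally Lipschitz functions are approximated on compact sets by smooth functions that keep the
Lipschitz constants, and vanish near the zeros. -/
theorem exists_smooth_multiplier {Ω K T : Set E} (hΩ : IsOpen Ω) (hK : IsCompact K) (hKΩ : K ⊆ Ω)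
    {η : E → ℝ} {L : ℝ} (hL : 0 ≤ L) (hη : LocLip Ω L η) (h01 : ∀ x ∈ Ω, 0 ≤ η x ∧ η x ≤ 1)
    (hconst : ∀ x ∈ Ω, x ∉ T → ∀ᶠ y in nhds x, η y = η x) {δ : ℝ} (hδ : 0 < δ) :
    ∃ g : E → ℝ, ContDiff ℝ ∞ g ∧ ∀ x ∈ K, |g x| ≤ 1 ∧ |g x - η x| ≤ 2 * δ ∧
      (∀ᶠ z in nhds x, |g z - g x| ≤ L * ‖z - x‖) ∧
      ((∀ y ∈ T, δ < dist y x) → ∀ᶠ z in nhds x, g z = g x) ∧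
      (η x = 0 → ∀ᶠ z in nhds x, g z = 0) := by
  obtain ⟨ρ, hρ, hρΩ⟩ := hK.exists_cthickening_subset_open hΩ hKΩ
  set ε := min (ρ / 2) (min (δ / 2) (δ / (2 * (L + 1)))) with hεdef
  have hε : 0 < ε := by positivity
  have hε1 : 2 * ε ≤ ρ := by have := min_le_left (ρ / 2) (min (δ / 2) (δ / (2 * (L + 1)))); linarith
  have hε2 : 2 * ε ≤ δ := by
    linarith [(min_le_right (ρ / 2) (min (δ / 2) (δ / (2 * (L + 1))))).trans (min_le_left _ _)]
  have hε3 : L * (2 * ε) ≤ δ := by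
    have := (min_le_right (ρ / 2) (min (δ / 2) (δ / (2 * (L + 1))))).trans (min_le_right _ _)
    rw [← hεdef, le_div_iff₀ (by positivity)] at this
    nlinarith
  set K' := cthickening ρ K
  have hK' : IsCompact K' := hK.cthickening
  have hbK : ∀ x ∈ K, ∀ y, dist y x ≤ 2 * ε → y ∈ K' := fun x hx y hy =>
    mem_cthickening_of_dist_le y x ρ K hx (hy.trans hε1)
  set h0 : E → ℝ := fun y => max (η y - δ) 0
  set h : E → ℝ := K'.indicator h0
  have hcont : ContinuousOn h0 K' := fun y hy =>
    ContinuousAt.continuousWithinAt (f := h0)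
      (((hη.continuousAt (hρΩ hy)).sub continuousAt_const).max continuousAt_const)
  have hint : Integrable h volume := by
    rw [integrable_indicator_iff hK'.isClosed.measurableSet]
    exact hcont.integrableOn_compact hK'
  have hloc := hint.locallyIntegrable
  have hbump : (0 : ℝ) < ε / 2 ∧ ε / 2 < ε := ⟨by positivity, by linarith⟩
  set φ : ContDiffBump (0 : E) := ⟨ε / 2, ε, hbump.1, hbump.2⟩
  set g := convolution (φ.normed volume) h (ContinuousLinearMap.lsmul ℝ ℝ) volume
  have hout : φ.rOut = ε := rfl
  have hval : ∀ x ∈ K, ∀ y, dist y x ≤ 2 * ε → h y = h0 y := fun x hx y hy =>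
    indicator_of_mem (hbK x hx y hy) _
  have habs : ∀ x ∈ K, ∀ y, dist y x < 2 * ε → |η y - η x| ≤ δ := fun x hx y hy => by
    have hs : segment ℝ x y ⊆ Ω := fun z hz => hρΩ (hbK x hx z (by
      have hz' := (convex_closedBall x (dist y x)).segment_subset
        (mem_closedBall_self dist_nonneg) (mem_closedBall.2 le_rfl) hz
      exact (mem_closedBall.1 hz').trans hy.le))
    have := hη.abs_sub_le hs
    rw [← dist_eq_norm] at this
    exact this.trans ((mul_le_mul_of_nonneg_left hy.le hL).trans hε3)
  have hlip : ∀ x ∈ K, ∀ M, 0 ≤ M → LocLip (ball x (2 * ε)) M η →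
      ∀ z ∈ ball x ε, |g z - g x| ≤ M * ‖z - x‖ := by
    intro x hx M hM hlipM z hz
    refine abs_normed_convolution_sub_apply_le φ hloc (by positivity) fun y hy => ?_
    rw [hout] at hy
    have hy1 := mem_ball.1 hy
    have hz1 := mem_ball.1 hz
    have hyz : dist (y + (z - x)) x < 2 * ε := by
      have := dist_triangle (y + (z - x)) y x
      rw [show dist (y + (z - x)) y = dist z x by simp [dist_eq_norm]] at this
      linarith
    rw [hval x hx y (by linarith), hval x hx _ hyz.le]
    have h1 := hlipM.abs_sub_le (x := y) (y := y + (z - x))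
      ((convex_ball x (2 * ε)).segment_subset (mem_ball.2 (by linarith)) (mem_ball.2 hyz))
    rw [add_sub_cancel_left] at h1
    refine le_trans ?_ h1
    have := abs_max_sub_max_le_abs (η (y + (z - x)) - δ) (η y - δ) 0
    simpa using this
  refine ⟨g, φ.hasCompactSupport_normed.contDiff_convolution_left _ φ.contDiff_normed hloc,
    fun x hx => ⟨?_, ?_, ?_, fun hT => ?_, fun h0x => ?_⟩⟩
  · have := abs_normed_convolution_sub_le φ hint.aestronglyMeasurable (x := x) (c := 0)
      zero_le_one fun y hy => by
        rw [hout] at hy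
        have hy1 := mem_ball.1 hy
        rw [hval x hx y (by linarith), sub_zero, abs_of_nonneg (le_max_right _ _)]
        have := h01 y (hρΩ (hbK x hx y (by linarith)))
        exact max_le (by linarith) zero_le_one
    simpa using this
  · refine abs_normed_convolution_sub_le φ hint.aestronglyMeasurable (by positivity) fun y hy => ?_
    rw [hout] at hy
    have hy1 := mem_ball.1 hy
    rw [hval x hx y (by linarith)]
    have h1 := habs x hx y (by linarith)
    have h2 := h01 y (hρΩ (hbK x hx y (by linarith)))
    have h3 : |h0 y - η y| ≤ δ := by
      rw [abs_le]
      constructor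
      · have := le_max_left (η y - δ) 0
        linarith
      · have : h0 y ≤ η y := max_le (by linarith) h2.1
        linarith
    have := abs_add_le (h0 y - η y) (η y - η x)
    rw [sub_add_sub_cancel] at this
    linarith
  · filter_upwards [ball_mem_nhds x hε] with z hz
    refine hlip x hx L hL (fun y hy => hη y (hρΩ (hbK x hx y (mem_ball.1 hy).le))) z hz
  · have h1 : LocLip (ball x (2 * ε)) 0 η := fun y hy => by
      have hy1 := mem_ball.1 hy
      have : y ∉ T := fun hyT => by
        linarith [hT y hyT]
      filter_upwards [hconst y (hρΩ (hbK x hx y hy1.le)) this] with z hz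
      rw [hz]; simp
    filter_upwards [ball_mem_nhds x hε] with z hz
    have := hlip x hx 0 le_rfl h1 z hz
    rw [zero_mul] at this
    exact sub_eq_zero.1 (abs_nonpos_iff.1 this)
  · filter_upwards [ball_mem_nhds x hε] with z hz
    have hz1 := mem_ball.1 hz
    have := abs_normed_convolution_sub_le φ hint.aestronglyMeasurable (x := z) (c := 0)
      le_rfl fun y hy => by
        rw [hout] at hy
        have hy1 := mem_ball.1 hy
        have hyx : dist y x < 2 * ε := by have := dist_triangle y z x; linarith
        rw [hval x hx y hyx.le, sub_zero]
        have h2 := habs x hx y hyx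
        rw [h0x, sub_zero] at h2
        have h3 := (abs_le.1 h2).2
        have : h0 y = 0 := max_eq_right (by linarith)
        rw [this, abs_zero]
    rw [sub_zero] at this
    exact abs_nonpos_iff.1 this

end Mollification


section WeakLimits

theorem SemiInner.apply_convex_le {V : Type*} [AddCommGroup V] [Module ℝ V]
    {B : BilinForm ℝ V} (h : SemiInner B) {x y : V} {s t c : ℝ} (hs : 0 ≤ s) (ht : 0 ≤ t)
    (hst : s + t = 1) (hx : B x x ≤ c) (hy : B y y ≤ c) : B (s • x + t • y) (s • x + t • y) ≤ c := by
  have h1 := h.nonneg (x - y)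
  rw [h.apply_sub_sub] at h1
  rw [h.apply_add_add, SemiInner.apply_smul_smul, SemiInner.apply_smul_smul]
  simp only [map_smul, LinearMap.smul_apply, smul_eq_mul]
  obtain rfl : t = 1 - s := by linarith
  nlinarith [mul_nonneg (mul_nonneg hs ht) h1, mul_le_mul_of_nonneg_left hx hs,
    mul_le_mul_of_nonneg_left hy ht]

theorem SemiInner.add {V : Type*} [AddCommGroup V] [Module ℝ V]
    {B B' : BilinForm ℝ V} (h : SemiInner B) (h' : SemiInner B') : SemiInner (B + B') :=
  ⟨fun x y => by simp only [LinearMap.add_apply, h.symm x y, h'.symm x y],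
    fun x => add_nonneg (h.nonneg x) (h'.nonneg x)⟩

variable {n : ℕ} {G : Geometry n} {O : Set (Euc (n + 1))}

theorem ip_convex_le {α F : Type*} [MeasurableSpace α] [NormedAddCommGroup F]
    [InnerProductSpace ℝ F] {μ : Measure α} {f g : α → F} (hf : MemLp f 2 μ) (hg : MemLp g 2 μ)
    {s t c : ℝ} (hs : 0 ≤ s) (ht : 0 ≤ t) (hst : s + t = 1) (h1 : ip μ f f ≤ c)
    (h2 : ip μ g g ≤ c) : ip μ (s • f + t • g) (s • f + t • g) ≤ c :=
  (l2Form_semiInner (μ := μ) (F := F)).apply_convex_le (x := ⟨f, hf⟩) (y := ⟨g, hg⟩) hs ht hst h1 h2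

/-- If the values of fields converge and their gradients are bounded, up to small errors, then a
limit exists, with the same bounds. -/
theorem exists_weak_limit {x : ℕ → Scalars G} (hx : ∀ i, MemClosure G O G.Ω (x i))
    {v : Pts G → ℝ} {a : Pts G → Grd n} (hv : MemLp v 2 (mm G G.Ω))
    (ha : MemLp a 2 (mm G G.Ω)) {k : ℕ → Pts G → Grd n}
    (hk : ∀ i, MemLp (k i) 2 (mm G G.Ω)) {b : ℕ → Pts G → ℝ}
    (hb : ∀ i j, i ≤ j → ∀ y, b j y ≤ b i y) (hb0 : MemLp (b 0) 2 (mm G G.Ω))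
    (hkb : ∀ i, ∀ᵐ y ∂mm G G.Ω, ‖k i y‖ ≤ b i y) {ε : ℕ → ℝ} (hε : Antitone ε)
    (hε0 : Tendsto ε atTop (nhds 0))
    (h1 : ∀ i, ip (mm G G.Ω) (vl (x i) - v) (vl (x i) - v) ≤ ε i)
    (h2 : ∀ i, ip (mm G G.Ω) (gr (x i) - a - k i) (gr (x i) - a - k i) ≤ ε i) :
    ∃ p, MemClosure G O G.Ω p ∧ (∀ᵐ y ∂mm G G.Ω, vl p y = v y) ∧
      ∀ N, ∀ᵐ y ∂mm G G.Ω, ‖gr p y - a y‖ ≤ b N y := by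
  set μ := mm G G.Ω
  have hm := G.isOpen_Ω.measurableSet
  have mv := fun {w} (h : MemClosure G O G.Ω w) => h.memLp_vl hm subset_rfl
  have mg := fun {w} (h : MemClosure G O G.Ω w) => h.memLp_gr hm subset_rfl
  set S := closureSub G O G.Ω hm subset_rfl
  set B := ipForm μ vl S (fun p hp => mv hp) + ipForm μ gr S (fun p hp => mg hp)
  have hB : SemiInner B := (ipForm_semiInner _ _ _).add (ipForm_semiInner _ _ _)
  set X : ℕ → S := fun i => ⟨x i, hx i⟩
  have hBle : ∀ i, B (X i) (X i) ≤
      (2 * ε 0 + 2 * ip μ v v) + (2 * ε 0 + 2 * (2 * ip μ (b 0) (b 0) + 2 * ip μ a a)) := by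
    intro i
    have e1 := ip_add_self_le ((mv (hx i)).sub hv) hv
    have e2 := ip_add_self_le (((mg (hx i)).sub ha).sub (hk i)) ((hk i).add ha)
    have e3 := ip_add_self_le (hk i) ha
    have e4 : ip μ (k i) (k i) ≤ ip μ (b 0) (b 0) := ip_le_of_norm_le hb0 ((hkb i).mono
      fun y hy => (hy.trans (hb 0 i (Nat.zero_le i) y)).trans (le_norm_self _))
    rw [sub_add_cancel] at e1
    rw [show gr (x i) - a - k i + (k i + a) = gr (x i) by abel] at e2
    have e5 := hε (Nat.zero_le i)
    have e6 := h1 i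
    have e7 := h2 i
    have e8 : B (X i) (X i) = ip μ (vl (x i)) (vl (x i)) + ip μ (gr (x i)) (gr (x i)) := rfl
    linarith
  obtain ⟨z, hz, hzc⟩ := hB.exists_cauchy_convexCombination X hBle
  have hBe : ∀ u w : S, B (u - w) (u - w) = ip μ (vl (u - w : Scalars G))
      (vl (u - w : Scalars G)) + ip μ (gr (u - w : Scalars G))
      (gr (u - w : Scalars G)) := fun u w => rfl
  obtain ⟨p, hp, hpv, hpg⟩ := exists_limit_memClosure hm subset_rfl (w := fun i => (z i : _))
    (fun i => (z i).2)
    (fun e he => (hzc e he).imp fun N hN i hi j hj => lt_of_le_of_lt (by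
      rw [hBe]; linarith [ip_self_nonneg (μ := μ) (gr (z i - z j : Scalars G))])
      (hN i hi j hj))
    (fun e he => (hzc e he).imp fun N hN i hi j hj => lt_of_le_of_lt (by
      rw [hBe]; linarith [ip_self_nonneg (μ := μ) (vl (z i - z j : Scalars G))])
      (hN i hi j hj))
  set A : ℕ → Set S := fun N => {w | ip μ (vl (w : Scalars G) - v)
    (vl (w : Scalars G) - v) ≤ ε N ∧ ∃ k', MemLp k' 2 μ ∧ (∀ᵐ y ∂μ, ‖k' y‖ ≤ b N y) ∧
    ip μ (gr (w : Scalars G) - a - k') (gr (w : Scalars G) - a - k') ≤ ε N}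
  have hAc : ∀ N, Convex ℝ (A N) := by
    rintro N w ⟨hw1, k1, hk1, hkb1, hw2⟩ w' ⟨hw1', k2, hk2, hkb2, hw2'⟩ s t hs ht hst
    have hone : ∀ {F : Type} [AddCommGroup F] [Module ℝ F] (f : Pts G → F),
        f = s • f + t • f := fun f => by rw [← add_smul, hst, one_smul]
    refine ⟨?_, s • k1 + t • k2, (hk1.const_smul s).add (hk2.const_smul t), ?_, ?_⟩
    · have := ip_convex_le ((mv w.2).sub hv) ((mv w'.2).sub hv) hs ht hst hw1 hw1'
      convert this using 2 <;>
      · simp only [coe_add, coe_smul, map_add, map_smul]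
        conv_lhs => rw [hone v]
        module
    · filter_upwards [hkb1, hkb2] with y hy1 hy2
      calc ‖s • k1 y + t • k2 y‖ ≤ s * ‖k1 y‖ + t * ‖k2 y‖ := by
            refine (norm_add_le _ _).trans (le_of_eq ?_)
            rw [norm_smul, norm_smul, norm_of_nonneg hs, norm_of_nonneg ht]
        _ ≤ s * b N y + t * b N y := by gcongr
        _ = b N y := by rw [← add_mul, hst, one_mul]
    · have := ip_convex_le (((mg w.2).sub ha).sub hk1) (((mg w'.2).sub ha).sub hk2) hs ht hst
        hw2 hw2'
      convert this using 2 <;>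
      · simp only [coe_add, coe_smul, map_add, map_smul]
        conv_lhs => rw [hone a]
        module
  have hzA : ∀ N, z N ∈ A N := fun N => by
    refine convexHull_min ?_ (hAc N) (hz N)
    rintro _ ⟨i, hi, rfl⟩
    exact ⟨(h1 i).trans (hε hi), k i, hk i, (hkb i).mono fun y hy => hy.trans (hb N i hi y),
      (h2 i).trans (hε hi)⟩
  choose hzA1 k' hk' hkb' hzA2 using hzA
  have hsmall : ∀ e > 0, ∃ N, ∀ i ≥ N, ε i < e := fun e he =>
    Filter.eventually_atTop.1 (hε0.eventually (gt_mem_nhds he))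
  simp only [map_sub] at hpv hpg
  refine ⟨p, hp, ?_, fun N => ?_⟩
  · have := ae_norm_le_of_limit (b := 0) (k := fun _ => 0) (fun i => mv (z i).2) (mv hp) hpv (a := v)
      (Filter.Eventually.of_forall fun i => ae_of_all _ fun y => by simp)
      (fun i => by simpa using (mv (z i).2).sub hv)
      (fun e he => (hsmall e he).imp fun N hN i hi => by
        simpa using (hzA1 i).trans_lt (hN i hi))
    filter_upwards [this] with y hy
    exact sub_eq_zero.1 (norm_le_zero_iff.1 hy)
  · refine ae_norm_le_of_limit (k := k') (fun i => mg (z i).2) (mg hp) hpg ?_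
      (fun i => ((mg (z i).2).sub ha).sub (hk' i))
      (fun e he => (hsmall e he).imp fun N hN i hi => (hzA2 i).trans_lt (hN i hi))
    filter_upwards [Filter.eventually_ge_atTop N] with i hi
    exact (hkb' i).mono fun y hy => hy.trans (hb N i hi y)

end WeakLimits

section Multiplier

variable {n : ℕ} {G : Geometry n} {O R : Set (Euc (n + 1))}

theorem gr_smoothField_mul {f g : Euc (n + 1) → ℝ} (hf : Differentiable ℝ f)
    (hg : Differentiable ℝ g) (y : Pts G) :
    gr (smoothField G (g * f)) y =
      g (pos G y) • gr (smoothField G f) y + f (pos G y) • gr (smoothField G g) y := by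
  have he := fun l => (G.contDiff_emb l).differentiable one_ne_zero
  rcases y with x | ⟨l, t⟩
  · refine WithLp.ofLp_injective 2 (Prod.ext ?_ (by simp))
    show gradient (g * f) x = g x • gradient f x + f x • gradient g x
    simp only [gradient]
    rw [fderiv_mul (hg x) (hf x), map_add, map_smul, map_smul]
  · refine WithLp.ofLp_injective 2 (Prod.ext (by simp) ?_)
    show gradient (fun r => g (G.emb l r) * f (G.emb l r)) t =
      g (G.emb l t) • gradient (fun r => f (G.emb l r)) t +
        f (G.emb l t) • gradient (fun r => g (G.emb l r)) t
    simp only [gradient]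
    rw [fderiv_fun_mul (c := fun r => g (G.emb l r)) (d := fun r => f (G.emb l r))
      ((hg _).comp t (he l t)) ((hf _).comp t (he l t)), map_add, map_smul, map_smul]

theorem ip_smul_norm {α F : Type*} [MeasurableSpace α] [NormedAddCommGroup F]
    [InnerProductSpace ℝ F] {μ : Measure α} (c : ℝ) (u : α → F) :
    ip μ (fun y => c * ‖u y‖) (fun y => c * ‖u y‖) = c ^ 2 * ip μ u u := by
  rw [ip_self, ip_self, ← integral_const_mul]
  refine integral_congr_ae (ae_of_all _ fun y => ?_)
  simp only [norm_eq_abs, sq_abs]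
  ring

theorem ip_indicator {α F : Type*} [MeasurableSpace α] [NormedAddCommGroup F]
    [InnerProductSpace ℝ F] {μ : Measure α} {P : Set α} (hP : MeasurableSet P) (u : α → F) :
    ip μ (P.indicator u) (P.indicator u) = ip (μ.restrict P) u u := by
  rw [ip, ip, ← integral_indicator hP]
  refine integral_congr_ae (ae_of_all _ fun y => ?_)
  by_cases hy : y ∈ P
  · simp only [indicator_of_mem hy]
  · simp only [indicator_of_notMem hy, inner_zero_left]

theorem ip_le_of_norm_le_indicator (hR : MeasurableSet R) (hRΩ : R ⊆ G.Ω) {F : Type*}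
    [NormedAddCommGroup F] [InnerProductSpace ℝ F] {e : Pts G → F}
    {β : Pts G → ℝ} (hβ : MemLp β 2 (mm G R))
    (h : ∀ᵐ y ∂mm G G.Ω, ‖e y‖ ≤ (pos G ⁻¹' R).indicator β y) :
    ip (mm G G.Ω) e e ≤ ip (mm G R) β β := by
  have hP : MeasurableSet (pos G ⁻¹' R) := measurable_pos G hR
  have hmm := mm_eq_restrict (G := G) hR hRΩ
  rw [hmm] at hβ
  rw [hmm, ← ip_indicator hP]
  exact ip_le_of_norm_le ((memLp_indicator_iff_restrict hP).2 hβ)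
    (h.mono fun y hy => hy.trans (le_norm_self _))

/-- The product of a field on `R` with a Lipschitz function that vanishes outside of `R`. -/
theorem exists_mul_memClosure (hR : MeasurableSet R) (hRΩ : R ⊆ G.Ω) {w : Scalars G}
    (hw : MemClosure G G.Ω R w) {η : Euc (n + 1) → ℝ} {L : ℝ} (hL : 0 ≤ L) (hη : LocLip G.Ω L η)
    (h01 : ∀ x ∈ G.Ω, 0 ≤ η x ∧ η x ≤ 1) (hηR : ∀ x ∈ G.Ω, x ∉ R → η x = 0)
    {T : Set (Euc (n + 1))} (hT : IsClosed T)
    (hconst : ∀ x ∈ G.Ω, x ∉ T → ∀ᶠ y in nhds x, η y = η x)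
    (hO : ∀ x ∈ G.Ω, η x ≠ 0 → x ∈ O) :
    ∃ p, MemClosure G (G.Ω ∩ O) G.Ω p ∧
      (∀ᵐ y ∂mm G G.Ω, vl p y = (pos G ⁻¹' R).indicator (fun y => η (pos G y) * vl w y) y) ∧
      ∀ᵐ y ∂mm G G.Ω, ‖gr p y - (pos G ⁻¹' R).indicator (fun y => η (pos G y) • gr w y) y‖ ≤
        (pos G ⁻¹' (R ∩ T)).indicator (fun y => L * ‖vl w y‖) y := by
  have hΩm := G.isOpen_Ω.measurableSet
  have hP : MeasurableSet (pos G ⁻¹' R) := measurable_pos G hR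
  have hin {F : Type} [Zero F] {u : Pts G → F} {y} (h : pos G y ∈ R) :
    (pos G ⁻¹' R).indicator u y = u y := indicator_of_mem (by exact h) u
  have hnin {F : Type} [Zero F] {u : Pts G → F} {y} (h : pos G y ∉ R) :
    (pos G ⁻¹' R).indicator u y = 0 := indicator_of_notMem (by exact h) u
  have hmm := mm_eq_restrict (G := G) hR hRΩ
  have hwv := hw.memLp_vl hR hRΩ
  have hwg := hw.memLp_gr hR hRΩ
  set δ : ℕ → ℝ := fun i => 1 / ((i : ℝ) + 1)
  have hδ0 : ∀ i, 0 < δ i := fun i => by positivity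
  have hδ1 : ∀ i, δ i ≤ 1 := fun i => by
    rw [div_le_one (by positivity)]; linarith [Nat.cast_nonneg (α := ℝ) i]
  have hδa : Antitone δ := fun i j hij => by
    have : (i : ℝ) ≤ j := by exact_mod_cast hij
    exact one_div_le_one_div_of_le (by positivity) (by linarith)
  have hδt : Tendsto δ atTop (nhds 0) := tendsto_one_div_add_atTop_nhds_zero_nat
  choose f hf hfv hfg using fun i => ((memClosure_iff hR hRΩ).1 hw).2 (δ i) (hδ0 i)
  choose g hgc hg1 hgη hgL hgT hg0 using fun i => exists_smooth_multiplier G.isOpen_Ω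
    (hf i).hasCompactSupport (hf i).tsupport_subset hL hη h01 hconst (hδ0 i)
  have hfz : ∀ i x, x ∉ tsupport (f i) → f i x = 0 := fun i x hx => image_eq_zero_of_notMem_tsupport hx
  have hfgz : ∀ i (y : Pts G), pos G y ∉ tsupport (f i) → gr (smoothField G (f i)) y = 0 :=
    fun i y hy => gr_smoothField_eq_zero (by
      filter_upwards [(isClosed_tsupport (f i)).isOpen_compl.mem_nhds hy] with x hx
      rw [hfz i x hx, hfz i _ hy])
  have hx : ∀ i, IsTest (G.Ω ∩ O) (g i * f i) := fun i => by
    refine ⟨(hgc i).mul (hf i).contDiff, (hf i).hasCompactSupport.mul_left, fun x hx => ?_⟩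
    have hxK : x ∈ tsupport (f i) := tsupport_mul_subset_right hx
    have hxΩ := (hf i).tsupport_subset hxK
    refine ⟨hxΩ, hO x hxΩ fun h0 => ?_⟩
    have := hg0 i x hxK h0
    exact notMem_tsupport_iff_eventuallyEq.2 (this.mono fun z hz => by simp [hz]) hx
  have hxm := fun i => (hx i).memClosure (G := G) hΩm subset_rfl
  have hηm : Measurable (G.Ω.indicator η) := by
    classical
    rw [← piecewise_eq_indicator]
    exact ContinuousOn.measurable_piecewise (fun x hx => (hη.continuousAt hx).continuousWithinAt)
      continuousOn_const hΩm
  have hηae : (fun y => η (pos G y)) =ᵐ[mm G R] fun y => G.Ω.indicator η (pos G y) := by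
    filter_upwards [ae_mm_pos_mem hR] with y hy
    rw [indicator_of_mem (hRΩ hy)]
  have hηs : AEStronglyMeasurable (fun y => η (pos G y)) (mm G R) :=
    ((hηm.comp (measurable_pos G)).aestronglyMeasurable).congr hηae.symm
  have hηb : ∀ᵐ y ∂mm G R, |η (pos G y)| ≤ 1 := by
    filter_upwards [ae_mm_pos_mem hR] with y hy
    have := h01 _ (hRΩ hy)
    rw [abs_of_nonneg this.1]; exact this.2
  have hv : MemLp (fun y => η (pos G y) * vl w y) 2 (mm G R) :=
    hwv.of_le (hηs.mul hwv.1) (hηb.mono fun y hy => by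
      rw [norm_mul, norm_eq_abs]; nlinarith [norm_nonneg (vl w y)])
  have ha : MemLp (fun y => η (pos G y) • gr w y) 2 (mm G R) :=
    hwg.of_le (hηs.smul hwg.1) (hηb.mono fun y hy => by
      rw [norm_smul, norm_eq_abs]; nlinarith [norm_nonneg (gr w y)])
  have hkm : ∀ i, MeasurableSet (pos G ⁻¹' tsupport (f i)) := fun i =>
    measurable_pos G (isClosed_tsupport _).measurableSet
  set k : ℕ → Pts G → Grd n := fun i => (pos G ⁻¹' tsupport (f i)).indicator
    fun y => vl w y • gr (smoothField G (g i)) y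
  set c : ℕ → Set (Pts G) := fun i => pos G ⁻¹' cthickening (δ i) T
  have hcm : ∀ i, MeasurableSet (c i) := fun i =>
    measurable_pos G Metric.isClosed_cthickening.measurableSet
  set b : ℕ → Pts G → ℝ := fun i => (c i).indicator fun y => L * ‖vl w y‖
  have hb0 : ∀ i y, 0 ≤ b i y := fun i y => Set.indicator_nonneg (fun y _ => by positivity) y
  have hgrg : ∀ i, ∀ y ∈ legit G, pos G y ∈ tsupport (f i) →
      ‖gr (smoothField G (g i)) y‖ ≤ (cthickening (δ i) T).indicator (fun _ => L) (pos G y) := by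
    intro i y hy hyK
    by_cases h : pos G y ∈ cthickening (δ i) T
    · rw [indicator_of_mem h]
      exact norm_gr_smoothField_le hL hy (hgL i _ hyK)
    · rw [indicator_of_notMem h, gr_smoothField_eq_zero, norm_zero]
      refine hgT i _ hyK fun z hz => ?_
      by_contra hle
      rw [dist_comm] at hle
      exact h (mem_cthickening_of_dist_le _ z _ _ hz (not_lt.1 hle))
  have hkb : ∀ i, ∀ y ∈ legit G, ‖k i y‖ ≤ b i y := by
    intro i y hy
    by_cases hK : pos G y ∈ tsupport (f i)
    · have := hgrg i y hy hK
      simp only [k, b]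
      rw [indicator_of_mem (by exact hK), norm_smul, mul_comm]
      by_cases h : pos G y ∈ cthickening (δ i) T
      · rw [indicator_of_mem h] at this
        rw [indicator_of_mem (by exact h)]
        gcongr
      · rw [indicator_of_notMem h] at this
        rw [indicator_of_notMem (by exact h), le_antisymm this (norm_nonneg _), zero_mul]
    · simp only [k]
      rw [indicator_of_notMem (by exact hK), norm_zero]
      exact hb0 i y
  have hbm : ∀ i, MemLp (b i) 2 (mm G R) := fun i => (hwv.norm.const_mul L).indicator (hcm i)
  have hleg := ae_mm_legit (G := G) hΩm subset_rfl
  have hlegR := ae_mm_legit (G := G) hR hRΩ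
  have hk : ∀ i, MemLp (k i) 2 (mm G R) := fun i => (hbm i).of_le
    ((hwv.1.smul (measurable_gr_smoothField (g i)).aestronglyMeasurable).indicator (hkm i))
    (hlegR.mono fun y hy => (hkb i y hy).trans (le_norm_self _))
  have hind : ∀ {F : Type} [NormedAddCommGroup F] {u : Pts G → F}, MemLp u 2 (mm G R) →
      MemLp ((pos G ⁻¹' R).indicator u) 2 (mm G G.Ω) := fun h =>
    (memLp_indicator_iff_restrict hP).2 (by rwa [hmm] at h)
  set Cv := ip (mm G R) (vl w) (vl w)
  set Cg := ip (mm G R) (gr w) (gr w)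
  set ε : ℕ → ℝ := fun i => (20 * (Cv + Cg + 1) + 10 * L ^ 2) * δ i
  have hCv : 0 ≤ Cv := ip_self_nonneg _
  have hCg : 0 ≤ Cg := ip_self_nonneg _
  have hfmv := fun i => (hf i).memLp_vl (G := G) hR hRΩ
  have hfmg := fun i => (hf i).memLp_gr (G := G) hR hRΩ
  have hfv2 : ∀ i, ip (mm G R) (vl (smoothField G (f i))) (vl (smoothField G (f i))) ≤ 2 * Cv + 2 := by
    intro i
    have := ip_sub_self_le hwv (hwv.sub (hfmv i))
    rw [sub_sub_cancel] at this
    linarith [hfv i, hδ1 i]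
  have hfg2 : ∀ i, ip (mm G R) (gr (smoothField G (f i))) (gr (smoothField G (f i))) ≤ 2 * Cg + 2 := by
    intro i
    have := ip_sub_self_le hwg (hwg.sub (hfmg i))
    rw [sub_sub_cancel] at this
    linarith [hfg i, hδ1 i]
  have hδsq : ∀ i, δ i ^ 2 ≤ δ i := fun i => by nlinarith [hδ0 i, hδ1 i]
  have hout : ∀ i, ∀ y ∈ legit G, pos G y ∉ R →
      f i (pos G y) * g i (pos G y) = 0 ∧ gr (smoothField G (g i * f i)) y = 0 := by
    intro i y hy hyR
    have hη0 := hηR _ (legit_pos hy) hyR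
    by_cases hK : pos G y ∈ tsupport (f i)
    · have h0 := hg0 i _ hK hη0
      refine ⟨by rw [h0.self_of_nhds, mul_zero], gr_smoothField_eq_zero ?_⟩
      filter_upwards [h0] with z hz
      simp [hz, h0.self_of_nhds]
    · refine ⟨by rw [hfz i _ hK, zero_mul], ?_⟩
      rw [gr_smoothField_mul (hf i).differentiable ((hgc i).differentiable (by simp)),
        hfz i _ hK, hfgz i y hK]
      simp
  have h1 : ∀ i, ip (mm G G.Ω) (vl (smoothField G (g i * f i)) -
      (pos G ⁻¹' R).indicator (fun y => η (pos G y) * vl w y))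
      (vl (smoothField G (g i * f i)) -
      (pos G ⁻¹' R).indicator (fun y => η (pos G y) * vl w y)) ≤ ε i := by
    intro i
    have m1 : MemLp (fun y => (2 * δ i) * ‖vl (smoothField G (f i)) y‖) 2 (mm G R) :=
      (hfmv i).norm.const_mul _
    have m2 : MemLp (fun y => 1 * ‖(vl w - vl (smoothField G (f i))) y‖) 2 (mm G R) :=
      (hwv.sub (hfmv i)).norm.const_mul _
    refine (ip_le_of_norm_le_indicator hR hRΩ (m1.add m2) ?_).trans
      ((ip_add_self_le m1 m2).trans ?_)
    · filter_upwards [hleg] with y hy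
      by_cases hyR : pos G y ∈ R
      · rw [Pi.sub_apply, hin hyR, hin hyR]
        simp only [Pi.add_apply, Pi.sub_apply, vl_smoothField, Pi.mul_apply, one_mul]
        have h3 := h01 _ (legit_pos hy)
        by_cases hK : pos G y ∈ tsupport (f i)
        · have e : g i (pos G y) * f i (pos G y) - η (pos G y) * vl w y =
            (g i (pos G y) - η (pos G y)) * f i (pos G y) -
              η (pos G y) * (vl w y - f i (pos G y)) := by ring
          rw [e]
          refine (norm_sub_le _ _).trans ?_
          rw [norm_mul, norm_mul, norm_of_nonneg h3.1]
          have := hgη i _ hK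
          rw [← norm_eq_abs] at this
          linarith [mul_le_mul_of_nonneg_right this (norm_nonneg (f i (pos G y))),
            mul_le_mul_of_nonneg_right h3.2 (norm_nonneg (vl w y - f i (pos G y)))]
        · rw [hfz i _ hK, mul_zero, zero_sub, norm_neg, norm_zero, mul_zero, zero_add, sub_zero,
            norm_mul, norm_of_nonneg h3.1]
          exact mul_le_of_le_one_left (norm_nonneg _) h3.2
      · rw [Pi.sub_apply, hnin hyR,
          hnin hyR, sub_zero, vl_smoothField, Pi.mul_apply, mul_comm,
          (hout i y hy hyR).1, norm_zero]
    · rw [ip_smul_norm, ip_smul_norm, mul_pow]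
      have e1 := hfv2 i
      have e2 := hfv i
      have e3 := hδsq i
      have e4 := hδ0 i
      have e5 : δ i ^ 2 * ip (mm G R) (vl (smoothField G (f i))) (vl (smoothField G (f i))) ≤
          δ i * (2 * Cv + 2) := mul_le_mul e3 e1 (ip_self_nonneg _) e4.le
      simp only [ε]
      have e6 : 0 ≤ L ^ 2 * δ i := by positivity
      nlinarith [mul_nonneg hCv e4.le, mul_nonneg hCg e4.le]
  have h2 : ∀ i, ip (mm G G.Ω) (gr (smoothField G (g i * f i)) -
      (pos G ⁻¹' R).indicator (fun y => η (pos G y) • gr w y) - (pos G ⁻¹' R).indicator (k i))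
      (gr (smoothField G (g i * f i)) -
      (pos G ⁻¹' R).indicator (fun y => η (pos G y) • gr w y) - (pos G ⁻¹' R).indicator (k i)) ≤
      ε i := by
    intro i
    have m1 : MemLp (fun y => (2 * δ i) * ‖gr (smoothField G (f i)) y‖) 2 (mm G R) :=
      (hfmg i).norm.const_mul _
    have m2 : MemLp (fun y => 1 * ‖(gr w - gr (smoothField G (f i))) y‖) 2 (mm G R) :=
      (hwg.sub (hfmg i)).norm.const_mul _
    have m3 : MemLp (fun y => L * ‖(vl w - vl (smoothField G (f i))) y‖) 2 (mm G R) :=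
      (hwv.sub (hfmv i)).norm.const_mul _
    refine (ip_le_of_norm_le_indicator hR hRΩ (m1.add (m2.add m3)) ?_).trans
      ((ip_add_self_le m1 (m2.add m3)).trans ?_)
    · filter_upwards [hleg] with y hy
      by_cases hyR : pos G y ∈ R
      · rw [Pi.sub_apply, Pi.sub_apply, hin hyR,
          hin hyR, hin hyR]
        simp only [Pi.add_apply, Pi.sub_apply, vl_smoothField, one_mul]
        rw [gr_smoothField_mul (hf i).differentiable ((hgc i).differentiable (by simp))]
        have h3 := h01 _ (legit_pos hy)
        by_cases hK : pos G y ∈ tsupport (f i)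
        · have e6 : k i y = vl w y • gr (smoothField G (g i)) y := indicator_of_mem (by exact hK) _
          rw [e6]
          have e : g i (pos G y) • gr (smoothField G (f i)) y +
                f i (pos G y) • gr (smoothField G (g i)) y - η (pos G y) • gr w y -
                vl w y • gr (smoothField G (g i)) y =
              (g i (pos G y) - η (pos G y)) • gr (smoothField G (f i)) y -
                (η (pos G y) • (gr w y - gr (smoothField G (f i)) y) +
                (vl w y - f i (pos G y)) • gr (smoothField G (g i)) y) := by module
          rw [e]
          refine (norm_sub_le _ _).trans (add_le_add ?_ ((norm_add_le _ _).trans (add_le_add ?_ ?_)))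
          · rw [norm_smul]
            exact mul_le_mul_of_nonneg_right (hgη i _ hK) (norm_nonneg _)
          · rw [norm_smul, norm_of_nonneg h3.1]
            exact mul_le_of_le_one_left (norm_nonneg _) h3.2
          · rw [norm_smul, mul_comm]
            exact mul_le_mul_of_nonneg_right (norm_gr_smoothField_le hL hy (hgL i _ hK))
              (norm_nonneg _)
        · have e6 : k i y = 0 := indicator_of_notMem (by exact hK) _
          rw [e6, hfz i _ hK, hfgz i y hK, smul_zero, zero_smul, zero_add, zero_sub, sub_zero,
            norm_neg, norm_zero, mul_zero, zero_add, sub_zero, norm_smul, norm_of_nonneg h3.1]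
          linarith [mul_le_of_le_one_left (norm_nonneg (gr w y)) h3.2,
            mul_nonneg hL (norm_nonneg (vl w y - 0))]
      · rw [Pi.sub_apply, Pi.sub_apply, hnin hyR,
          hnin hyR, hnin hyR, sub_zero,
          sub_zero, (hout i y hy hyR).2, norm_zero]
    · have e0 := ip_add_self_le m2 m3
      rw [ip_smul_norm, ip_smul_norm] at e0
      rw [ip_smul_norm, mul_pow]
      have e1 := hfg2 i
      have e2 := hfv i
      have e2' := hfg i
      have e3 := hδsq i
      have e4 := hδ0 i
      have e5 : δ i ^ 2 * ip (mm G R) (gr (smoothField G (f i))) (gr (smoothField G (f i))) ≤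
          δ i * (2 * Cg + 2) := mul_le_mul e3 e1 (ip_self_nonneg _) e4.le
      have e6 := mul_le_mul_of_nonneg_left e2.le (sq_nonneg L)
      have e7 := mul_nonneg hCv e4.le
      have e8 := mul_nonneg hCg e4.le
      have e9 := mul_nonneg (sq_nonneg L) e4.le
      simp only [ε]
      nlinarith
  obtain ⟨p, hp, hpv, hpg⟩ := exists_weak_limit hxm (hind hv) (hind ha) (fun i => hind (hk i))
    (b := fun i => (pos G ⁻¹' R).indicator (b i)) (fun i j hij y => by
      refine Set.indicator_le_indicator ?_
      exact Set.indicator_le_indicator_of_subset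
        (preimage_mono (Metric.cthickening_mono (hδa hij) T)) (fun y => by positivity) y)
    (hind (hbm 0))
    (fun i => hleg.mono fun y hy => by
      by_cases hyR : pos G y ∈ R
      · rw [hin hyR, hin hyR]
        exact hkb i y hy
      · rw [hnin hyR, hnin hyR, norm_zero])
    (ε := ε) (hδa.const_mul (by positivity)) (by simpa using hδt.const_mul _) h1 h2
  refine ⟨p, hp, hpv, ?_⟩
  filter_upwards [ae_all_iff.2 hpg] with y hy
  by_cases hyT : pos G y ∈ T
  · refine (hy 0).trans (le_of_eq ?_)
    have h3 : pos G y ∈ cthickening (δ 0) T := Metric.self_subset_cthickening T hyT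
    by_cases hyR : pos G y ∈ R
    · rw [hin hyR, indicator_of_mem (by exact ⟨hyR, hyT⟩)]
      exact indicator_of_mem (by exact h3) _
    · rw [hnin hyR, indicator_of_notMem (fun h : y ∈ pos G ⁻¹' (R ∩ T) => hyR h.1)]
  · have h3 : ∃ N, pos G y ∉ cthickening (δ N) T := by
      by_contra! h4
      refine hyT ?_
      rw [← hT.closure_eq, Metric.closure_eq_iInter_cthickening' T (Set.range δ) fun r hr => ?_]
      · rw [Set.mem_iInter₂]
        rintro _ ⟨i, rfl⟩
        exact h4 i
      · obtain ⟨i, hi⟩ := (hδt.eventually (ge_mem_nhds hr)).exists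
        exact ⟨δ i, ⟨i, rfl⟩, hδ0 i, hi⟩
    obtain ⟨N, hN⟩ := h3
    refine (hy N).trans (le_of_eq ?_)
    rw [indicator_of_notMem (fun h : y ∈ pos G ⁻¹' (R ∩ T) => hyT h.2)]
    by_cases hyR : pos G y ∈ R
    · rw [hin hyR]
      exact indicator_of_notMem (by exact hN) _
    · rw [hnin hyR]

end Multiplier

/-! ### The bilinear forms as integrals over bulk and fractures -/

section Density

variable {α M : Type*} [MeasurableSpace α] [AddCommGroup M] [Module ℝ M]

/-- The integral of a bilinear density. -/
def densForm (μ : Measure α) (d : M →ₗ[ℝ] M →ₗ[ℝ] (α → ℝ)) (S : Submodule ℝ M)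
    (h : ∀ p ∈ S, ∀ v ∈ S, Integrable (d p v) μ) : BilinForm ℝ S :=
  LinearMap.mk₂ ℝ (fun p v => ∫ y, d p v y ∂μ) (fun p p' v => by
      simp only [coe_add, map_add, LinearMap.add_apply, Pi.add_apply]
      exact integral_add (h _ p.2 _ v.2) (h _ p'.2 _ v.2))
    (fun c p v => by
      simp only [coe_smul, map_smul, LinearMap.smul_apply, Pi.smul_apply, smul_eq_mul,
        integral_const_mul])
    (fun p v v' => by
      simp only [coe_add, map_add, Pi.add_apply]
      exact integral_add (h _ p.2 _ v.2) (h _ p.2 _ v'.2))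
    (fun c p v => by
      simp only [coe_smul, map_smul, Pi.smul_apply, smul_eq_mul, integral_const_mul])

@[simp] theorem densForm_apply {μ : Measure α} {d : M →ₗ[ℝ] M →ₗ[ℝ] (α → ℝ)} {S : Submodule ℝ M}
    {h : ∀ p ∈ S, ∀ v ∈ S, Integrable (d p v) μ} (p v : S) :
    densForm μ d S h p v = ∫ y, d p v y ∂μ := rfl

theorem densForm_semiInner {μ : Measure α} {d : M →ₗ[ℝ] M →ₗ[ℝ] (α → ℝ)} {S : Submodule ℝ M}
    {h : ∀ p ∈ S, ∀ v ∈ S, Integrable (d p v) μ} (hs : ∀ p v y, d p v y = d v p y)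
    (h0 : ∀ p, ∀ᵐ y ∂μ, 0 ≤ d p p y) : SemiInner (densForm μ d S h) :=
  ⟨fun _ _ => integral_congr_ae (ae_of_all _ fun y => hs _ _ y), fun p => integral_nonneg_of_ae (h0 p)⟩

/-- The integral of a bilinear density, as a function of the first argument. -/
def densLin (μ : Measure α) (d : M →ₗ[ℝ] M →ₗ[ℝ] (α → ℝ)) (S : Submodule ℝ M) (v : M)
    (h : ∀ p ∈ S, Integrable (d p v) μ) : S →ₗ[ℝ] ℝ where
  toFun p := ∫ y, d p v y ∂μ
  map_add' p p' := by
    simp only [coe_add, map_add, LinearMap.add_apply, Pi.add_apply]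
    exact integral_add (h _ p.2) (h _ p'.2)
  map_smul' c p := by
    simp only [coe_smul, map_smul, LinearMap.smul_apply, Pi.smul_apply, smul_eq_mul,
      integral_const_mul, RingHom.id_apply]

end Density

section Forms

variable {n : ℕ} {G : Geometry n} {κmin κmax : ℝ}

/-- The permeability of the continuum `i`, on bulk and fractures. -/
def kap (κ : Permeability G κmin κmax) (i : Fin 2) : Pts G → ℝ :=
  Sum.elim (κ.bulk i) fun q => κ.frac q.1 i (G.emb q.1 q.2)

theorem measurable_kap (κ : Permeability G κmin κmax) (i : Fin 2) : Measurable (kap κ i) := by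
  refine Measurable.sumElim (κ.measurable_bulk i) ?_
  exact measurable_from_prod_countable_right fun l =>
    (κ.measurable_frac l i).comp (continuous_emb G l).measurable

theorem kap_bounds (κ : Permeability G κmin κmax) (i : Fin 2) {y : Pts G}
    (hy : y ∈ legit G) : κmin ≤ kap κ i y ∧ kap κ i y ≤ κmax := by
  rcases y with x | ⟨l, t⟩
  · exact κ.bulk_bounds i x hy
  · exact κ.frac_bounds l i t hy

/-- The indicator function of the bulk. -/
def bulkInd {k : ℕ} : Pt n k → ℝ := Sum.elim (fun _ => 1) fun _ => 0

/-- The density of the energy. -/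
def aDen (κ : Permeability G κmin κmax) (τ : ℝ) : Fields G →ₗ[ℝ] Fields G →ₗ[ℝ] (Pts G → ℝ) :=
  LinearMap.mk₂ ℝ (fun p v y => (∑ i, kap κ i y * ⟪gr (p i) y, gr (v i) y⟫) +
      τ * (bulkInd y * ((vl (p 0) y - vl (p 1) y) * (vl (v 0) y - vl (v 1) y))))
    (fun p p' v => by
      ext y
      simp only [sum_univ_two, Pi.add_apply, map_add, inner_add_left]; ring)
    (fun c p v => by
      ext y
      simp only [sum_univ_two, Pi.smul_apply, map_smul, real_inner_smul_left, smul_eq_mul]; ring)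
    (fun p v v' => by
      ext y
      simp only [sum_univ_two, Pi.add_apply, map_add, inner_add_right]; ring)
    (fun c p v => by
      ext y
      simp only [sum_univ_two, Pi.smul_apply, map_smul, real_inner_smul_right, smul_eq_mul]; ring)

theorem aDen_apply (κ : Permeability G κmin κmax) (τ : ℝ) (p v : Fields G) (y) :
    aDen κ τ p v y = (∑ i, kap κ i y * ⟪gr (p i) y, gr (v i) y⟫) +
      τ * (bulkInd y * ((vl (p 0) y - vl (p 1) y) * (vl (v 0) y - vl (v 1) y))) := rfl

/-- The density of a weighted mass. -/
def sDen (κ : Permeability G κmin κmax) (wt : Pts G → ℝ) :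
    Fields G →ₗ[ℝ] Fields G →ₗ[ℝ] (Pts G → ℝ) :=
  LinearMap.mk₂ ℝ (fun p v y => ∑ i, kap κ i y * wt y * (vl (p i) y * vl (v i) y)) (fun p p' v => by
      ext y
      simp only [sum_univ_two, Pi.add_apply, map_add]; ring)
    (fun c p v => by
      ext y
      simp only [sum_univ_two, Pi.smul_apply, map_smul, smul_eq_mul]; ring)
    (fun p v v' => by
      ext y
      simp only [sum_univ_two, Pi.add_apply, map_add]; ring)
    (fun c p v => by
      ext y
      simp only [sum_univ_two, Pi.smul_apply, map_smul, smul_eq_mul]; ring)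

theorem sDen_apply (κ : Permeability G κmin κmax) (wt : Pts G → ℝ) (p v : Fields G) (y) :
    sDen κ wt p v y = ∑ i, kap κ i y * wt y * (vl (p i) y * vl (v i) y) := rfl

theorem aDen_symm (κ : Permeability G κmin κmax) (τ : ℝ) (p v : Fields G) (y) :
    aDen κ τ p v y = aDen κ τ v p y := by
  simp only [aDen_apply, sum_univ_two]
  rw [real_inner_comm (gr (p 0) y), real_inner_comm (gr (p 1) y)]
  ring

theorem sDen_symm (κ : Permeability G κmin κmax) (wt) (p v : Fields G) (y) :
    sDen κ wt p v y = sDen κ wt v p y := by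
  simp only [sDen_apply, sum_univ_two]
  ring

theorem bulkInd_mem {k : ℕ} (y : Pt n k) : 0 ≤ bulkInd y ∧ bulkInd y ≤ 1 := by
  rcases y with x | q <;> simp [bulkInd]

theorem aDen_self (κ : Permeability G κmin κmax) (τ : ℝ) (p : Fields G) (y) :
    aDen κ τ p p y = (∑ i, kap κ i y * ‖gr (p i) y‖ ^ 2) +
      τ * (bulkInd y * (vl (p 0) y - vl (p 1) y) ^ 2) := by
  simp only [aDen_apply, real_inner_self_eq_norm_sq]
  ring

theorem sDen_self (κ : Permeability G κmin κmax) (wt) (p : Fields G) (y) :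
    sDen κ wt p p y = ∑ i, kap κ i y * wt y * vl (p i) y ^ 2 := by
  simp only [sDen_apply, sq]

theorem aDen_self_nonneg (hκ : 0 ≤ κmin) (κ : Permeability G κmin κmax) {τ : ℝ} (hτ : 0 ≤ τ)
    (p : Fields G) {y} (hy : y ∈ legit G) : 0 ≤ aDen κ τ p p y := by
  rw [aDen_self]
  have hb := (bulkInd_mem y).1
  refine add_nonneg (sum_nonneg fun i _ => ?_) (by positivity)
  have := hκ.trans (kap_bounds κ i hy).1
  positivity

theorem sDen_self_nonneg (hκ : 0 ≤ κmin) (κ : Permeability G κmin κmax) {wt : Pts G → ℝ}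
    (p : Fields G) {y} (hwt : 0 ≤ wt y) (hy : y ∈ legit G) : 0 ≤ sDen κ wt p p y := by
  rw [sDen_self]
  refine sum_nonneg fun i _ => ?_
  have := hκ.trans (kap_bounds κ i hy).1
  positivity

/-- The fields whose values and gradients are square integrable over `R`. -/
def SqI (G : Geometry n) (R : Set (Euc (n + 1))) (p : Fields G) : Prop :=
  ∀ i, MemLp (vl (p i)) 2 (mm G R) ∧ MemLp (gr (p i)) 2 (mm G R)

variable {R : Set (Euc (n + 1))}

theorem ae_kap_le (hκ : 0 ≤ κmin) (κ : Permeability G κmin κmax) (hR : MeasurableSet R)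
    (hRΩ : R ⊆ G.Ω) (i : Fin 2) : ∀ᵐ y ∂mm G R, ‖kap κ i y‖ ≤ κmax := by
  filter_upwards [ae_mm_legit hR hRΩ] with y hy
  have := kap_bounds κ i hy
  rw [norm_of_nonneg (hκ.trans this.1)]
  exact this.2

theorem measurable_bulkInd {k : ℕ} : Measurable (bulkInd : Pt n k → ℝ) :=
  Measurable.sumElim measurable_const measurable_const

theorem integrable_kap_mul (hκ : 0 ≤ κmin) (κ : Permeability G κmin κmax)
    (hR : MeasurableSet R) (hRΩ : R ⊆ G.Ω) {p v : Fields G} (hp : SqI G R p)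
    (hv : SqI G R v) (i) : Integrable (fun y => kap κ i y * ⟪gr (p i) y, gr (v i) y⟫) (mm G R) :=
  (integrable_inner (hp i).2 (hv i).2).bdd_mul
    (measurable_kap κ i).aestronglyMeasurable (ae_kap_le hκ κ hR hRΩ i)

theorem integrable_exchange {p v : Fields G} (hp : SqI G R p) (hv : SqI G R v) :
    Integrable (fun y : Pts G =>
      bulkInd y * ((vl (p 0) y - vl (p 1) y) * (vl (v 0) y - vl (v 1) y))) (mm G R) :=
  (((hp 0).1.sub (hp 1).1).integrable_mul ((hv 0).1.sub (hv 1).1)).bdd_mul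
    measurable_bulkInd.aestronglyMeasurable (c := 1) (ae_of_all _ fun y => by
      rw [norm_of_nonneg (bulkInd_mem y).1]; exact (bulkInd_mem y).2)

theorem integrable_aDen (hκ : 0 ≤ κmin) (κ : Permeability G κmin κmax) (τ : ℝ)
    (hR : MeasurableSet R) (hRΩ : R ⊆ G.Ω) {p v : Fields G} (hp : SqI G R p)
    (hv : SqI G R v) : Integrable (aDen κ τ p v) (mm G R) :=
  (integrable_finsetSum Finset.univ fun i _ => integrable_kap_mul hκ κ hR hRΩ hp hv i).add
    ((integrable_exchange hp hv).const_mul _)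

section

variable (hκ : 0 ≤ κmin) (κ : Permeability G κmin κmax)
  {wt : Pts G → ℝ} (hR : MeasurableSet R) (hRΩ : R ⊆ G.Ω)
  (hwt : AEStronglyMeasurable wt (mm G R)) {C : ℝ} (hwtC : ∀ᵐ y ∂mm G R, ‖wt y‖ ≤ C)
  {p v : Fields G} (hp : ∀ i, MemLp (vl (p i)) 2 (mm G R))
  (hv : ∀ i, MemLp (vl (v i)) 2 (mm G R))

include hκ hR hRΩ hwt hwtC hp hv

theorem integrable_kap_mul_weight (i) :
    Integrable (fun y => kap κ i y * wt y * (vl (p i) y * vl (v i) y)) (mm G R) := by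
  refine ((hp i).integrable_mul (hv i)).bdd_mul
    ((measurable_kap κ i).aestronglyMeasurable.mul hwt) (c := κmax * C) ?_
  filter_upwards [ae_kap_le hκ κ hR hRΩ i, hwtC] with y h1 h2
  rw [norm_mul]
  exact mul_le_mul h1 h2 (norm_nonneg _) ((norm_nonneg _).trans h1)

theorem integrable_sDen : Integrable (sDen κ wt p v) (mm G R) :=
  integrable_finsetSum Finset.univ fun i _ => integrable_kap_mul_weight hκ κ hR hRΩ hwt hwtC hp hv i

theorem integral_sDen : ∫ y, sDen κ wt p v y ∂mm G R =
      ∑ i, ((∫ x in R, κ.bulk i x * wt (Sum.inl x) * ((p i).val x * (v i).val x)) +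
        ∑ l, ∫ t in fracPart G R l, κ.frac l i (G.emb l t) * wt (Sum.inr (l, t)) *
          ((p i).fval l t * (v i).fval l t)) := by
  have h1 := integrable_kap_mul_weight hκ κ hR hRΩ hwt hwtC hp hv
  simp only [sDen_apply]
  rw [integral_finsetSum _ fun i _ => h1 i]
  refine sum_congr rfl fun i _ => ?_
  rw [integral_mm (h1 i)]
  rfl

end

theorem aQForm_eq (hκ : 0 ≤ κmin) (κ : Permeability G κmin κmax) (ρ σ : ℝ)
    (hR : MeasurableSet R) (hRΩ : R ⊆ G.Ω) {p v : Fields G} (hp : SqI G R p)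
    (hv : SqI G R v) : aQForm κ ρ σ R p v = ∫ y, aDen κ (ρ * σ) p v y ∂mm G R := by
  have h1 := integrable_kap_mul hκ κ hR hRΩ hp hv
  have h2 := integrable_exchange hp hv
  simp only [aDen_apply]
  rw [integral_add (integrable_finsetSum _ fun i _ => h1 i) (h2.const_mul _),
    integral_finsetSum _ fun i _ => h1 i, integral_const_mul, integral_mm h2, aQForm]
  congr 1
  · refine sum_congr rfl fun i _ => ?_
    rw [integral_mm (h1 i)]
    simp only [inner_gr_inl, inner_gr_inr]
    rfl
  · have hb : ∀ i, MemLp (p i).val 2 (volume.restrict R) := fun i => (memLp_mm_iff.1 (hp i).1).1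
    have hb' : ∀ i, MemLp (v i).val 2 (volume.restrict R) := fun i => (memLp_mm_iff.1 (hv i).1).1
    have h3 : ∀ i l, Integrable (fun x => ((p i).val x - (p l).val x) * (v i).val x)
        (volume.restrict R) := fun i l => ((hb i).sub (hb l)).integrable_mul (hb' i)
    simp only [qForm, sum_univ_two, bulkInd, Sum.elim_inl, Sum.elim_inr, vl_inl, vl_inr,
      one_mul, zero_mul, integral_zero, Finset.sum_const_zero, add_zero, sub_self, mul_zero, zero_add]
    rw [← mul_add, ← integral_add (h3 0 1) (h3 1 0)]
    congr 1
    refine integral_congr_ae (ae_of_all _ fun x => ?_)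
    simp only
    ring

variable {θ H : ℝ} (T : CoarseMesh G θ H)

theorem ae_meshWeight_le (hθ : 1 ≤ θ) (hH : 0 < H) (hR : MeasurableSet R) (hRΩ : R ⊆ G.Ω) :
    ∀ᵐ y ∂mm G R, ‖meshWeight T y‖ ≤ weightMax n θ / H ^ 2 := by
  filter_upwards [ae_mm_legit hR hRΩ] with y hy
  rw [norm_of_nonneg (meshWeight_nonneg y)]
  exact meshWeight_le hθ hH hy

theorem sForm_eq (hθ : 1 ≤ θ) (hH : 0 < H) (hκ : 0 ≤ κmin) (κ : Permeability G κmin κmax)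
    (hR : MeasurableSet R) (hRΩ : R ⊆ G.Ω) {p v : Fields G}
    (hp : ∀ i, MemLp (vl (p i)) 2 (mm G R)) (hv : ∀ i, MemLp (vl (v i)) 2 (mm G R)) :
    sForm κ T R p v = ∫ y, sDen κ (meshWeight T) p v y ∂mm G R := by
  rw [integral_sDen hκ κ hR hRΩ measurable_meshWeight.aestronglyMeasurable
    (ae_meshWeight_le T hθ hH hR hRΩ) hp hv]
  simp only [meshWeight, norm_gr_inl, norm_gr_inr]
  rfl

theorem meas_cell (j : Fin T.numElem) : MeasurableSet (cell T j) :=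
  (isCompact_element T j).isClosed.measurableSet.inter G.isOpen_Ω.measurableSet

theorem cell_subset (j : Fin T.numElem) : cell T j ⊆ G.Ω := inter_subset_right

/-- The weight of the mass with the bubble function. -/
def bubbleWeight (j : Fin T.numElem) (y : Pts G) : ℝ := meshWeight T y * cutBubble T j (pos G y)

variable {T}

theorem aestronglyMeasurable_bubbleWeight (hθ : 1 ≤ θ) (hH : 0 < H) (j : Fin T.numElem)
    (hR : MeasurableSet R) (hRΩ : R ⊆ G.Ω) :
    AEStronglyMeasurable (bubbleWeight T j) (mm G R) := by
  refine measurable_meshWeight.aestronglyMeasurable.mul ?_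
  have hm : Measurable (G.Ω.indicator (cutBubble T j)) := by
    classical
    rw [← piecewise_eq_indicator]
    exact ContinuousOn.measurable_piecewise
      (fun x hx => ((cutBubble_locLip hθ hH j).continuousAt hx).continuousWithinAt)
      continuousOn_const G.isOpen_Ω.measurableSet
  refine (hm.comp (measurable_pos G)).aestronglyMeasurable.congr ?_
  filter_upwards [ae_mm_pos_mem hR] with y hy
  exact indicator_of_mem (hRΩ hy) _

theorem ae_bubbleWeight_le (hθ : 1 ≤ θ) (hH : 0 < H) (j : Fin T.numElem)
    (hR : MeasurableSet R) (hRΩ : R ⊆ G.Ω) :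
    ∀ᵐ y ∂mm G R, ‖bubbleWeight T j y‖ ≤ weightMax n θ / H ^ 2 := by
  filter_upwards [ae_meshWeight_le T hθ hH hR hRΩ] with y hy
  rw [bubbleWeight, norm_mul]
  have := cutBubble_mem_Icc hθ hH j (pos G y)
  rw [norm_of_nonneg this.1]
  nlinarith [norm_nonneg (meshWeight T y)]

theorem sBubble_eq (hθ : 1 ≤ θ) (hH : 0 < H) (hκ : 0 ≤ κmin) (κ : Permeability G κmin κmax)
    (j : Fin T.numElem) {p : Fields G} (hp : ∀ i, MemLp (vl (p i)) 2 (mm G (cell T j))) :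
    sBubble κ T j p = ∫ y, sDen κ (bubbleWeight T j) p p y ∂mm G (cell T j) := by
  rw [integral_sDen hκ κ (meas_cell T j) (cell_subset T j)
    (aestronglyMeasurable_bubbleWeight hθ hH j (meas_cell T j) (cell_subset T j))
    (ae_bubbleWeight_le hθ hH j (meas_cell T j) (cell_subset T j)) hp hp]
  refine sum_congr rfl fun i _ => congrArg₂ (· + ·) ?_ (sum_congr rfl fun l _ => ?_)
  · refine setIntegral_congr_fun (meas_cell T j) fun x hx => ?_
    have hb : cutBubble T j x = bubble T j x := indicator_of_mem hx.1 _
    simp only [bubbleWeight, meshWeight, norm_gr_inl, pos_inl, hb]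
    show κ.bulk i x * (∑ k, ‖gradient (T.chi k) x‖ ^ 2) * _ =
      κ.bulk i x * ((∑ k, ‖gradient (T.chi k) x‖ ^ 2) * _) * _
    ring
  · refine setIntegral_congr_fun (measurableSet_fracPart (meas_cell T j) l) fun t ht => ?_
    have hb : cutBubble T j (G.emb l t) = bubble T j (G.emb l t) := indicator_of_mem ht.2.1 _
    simp only [bubbleWeight, meshWeight, norm_gr_inr, pos_inr, hb]
    show κ.frac l i (G.emb l t) * (∑ k, ‖gradient (fun r => T.chi k (G.emb l r)) t‖ ^ 2) * _ =
      κ.frac l i (G.emb l t) * ((∑ k, ‖gradient (fun r => T.chi k (G.emb l r)) t‖ ^ 2) * _) * _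
    ring

end Forms

/-! ### Subcubes of the reference cube -/

section Subcube

variable {d N : ℕ}

theorem volume_image_le {f : Euc d → Euc d} {s : Set (Euc d)} {K : NNReal}
    (h : LipschitzOnWith K f s) : volume (f '' s) ≤ (K : ℝ≥0∞) ^ d * volume s := by
  have e := Measure.isAddLeftInvariant_eq_smul (volume : Measure (Euc d))
    (Measure.hausdorffMeasure (d : ℝ))
  have h1 := h.hausdorffMeasure_image_le (d := d) (Nat.cast_nonneg d)
  rw [ENNReal.rpow_natCast] at h1
  rw [e, Measure.smul_apply, Measure.smul_apply, ENNReal.smul_def, smul_eq_mul,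
    ENNReal.smul_def, smul_eq_mul]
  calc _ ≤ _ := mul_le_mul_right h1 _
    _ = _ := by ring

/-- The subcube with index `k` of side `1 / N`. -/
def subcube (k : Fin d → Fin N) : Set (Euc d) :=
  WithLp.ofLp ⁻¹' Set.Icc (fun i => (k i : ℝ) / N) fun i => ((k i : ℝ) + 1) / N

/-- The open subcube with index `k` of side `1 / N`. -/
def openSubcube (k : Fin d → Fin N) : Set (Euc d) :=
  WithLp.ofLp ⁻¹' Set.pi univ fun i => Set.Ioo ((k i : ℝ) / N) (((k i : ℝ) + 1) / N)

theorem mem_subcube {k : Fin d → Fin N} {ξ : Euc d} :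
    ξ ∈ subcube k ↔ ∀ i, (k i : ℝ) / N ≤ ξ i ∧ ξ i ≤ ((k i : ℝ) + 1) / N := by
  simp only [subcube, mem_preimage, Set.mem_Icc, Pi.le_def]
  exact forall_and.symm

theorem subcube_ae_eq (k : Fin d → Fin N) : openSubcube k =ᵐ[volume] subcube k :=
  (PiLp.volume_preserving_ofLp (Fin d)).quasiMeasurePreserving.preimage_ae_eq
    (Measure.univ_pi_Ioo_ae_eq_Icc)

theorem measurableSet_openSubcube (k : Fin d → Fin N) : MeasurableSet (openSubcube k) :=
  (PiLp.volume_preserving_ofLp (Fin d)).measurable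
    (MeasurableSet.univ_pi fun _ => measurableSet_Ioo)

theorem disjoint_openSubcube (hN : 0 < N) {k k' : Fin d → Fin N} (h : k ≠ k') :
    Disjoint (openSubcube k) (openSubcube k') := by
  rw [disjoint_left]
  intro ξ h1 h2
  obtain ⟨i, hi⟩ := Function.ne_iff.1 h
  obtain ⟨a1, a2⟩ := h1 i (Set.mem_univ i)
  obtain ⟨b1, b2⟩ := h2 i (Set.mem_univ i)
  have hN' : (0 : ℝ) < N := Nat.cast_pos.2 hN
  have h3 := a1.trans b2
  have h4 := b1.trans a2
  rw [div_lt_div_iff_of_pos_right hN'] at h3 h4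
  norm_cast at h3 h4
  exact hi (Fin.ext (by omega))

theorem subcube_subset (k : Fin d → Fin N) : subcube k ⊆ refCube d := by
  intro ξ hξ i
  obtain ⟨h1, h2⟩ := mem_subcube.1 hξ i
  have hN : 0 < N := (Nat.zero_le _).trans_lt (k i).2
  have hN' : (0 : ℝ) < N := Nat.cast_pos.2 hN
  refine ⟨le_trans (by positivity) h1, h2.trans ?_⟩
  rw [div_le_one hN']
  exact_mod_cast (k i).2

theorem isCompact_subcube (k : Fin d → Fin N) : IsCompact (subcube k) :=
  isCompact_refCube.of_isClosed_subset
    (isClosed_Icc.preimage (EuclideanSpace.equiv (Fin d) ℝ).continuous) (subcube_subset k)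

theorem convex_subcube (k : Fin d → Fin N) : Convex ℝ (subcube k) := by
  intro ξ hξ η hη a b ha hb hab
  rw [mem_subcube] at *
  intro i
  obtain ⟨h1, h2⟩ := hξ i
  obtain ⟨h3, h4⟩ := hη i
  simp only [PiLp.add_apply, PiLp.smul_apply, smul_eq_mul]
  obtain rfl : b = 1 - a := by linarith
  constructor <;> nlinarith

theorem volume_subcube (k : Fin d → Fin N) : volume (subcube k) = ofReal ((N : ℝ)⁻¹ ^ d) := by
  rw [subcube, (PiLp.volume_preserving_ofLp (Fin d)).measure_preimage
    measurableSet_Icc.nullMeasurableSet, Real.volume_Icc_pi,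
    ofReal_pow (by positivity)]
  simp only [← sub_div, add_sub_cancel_left, one_div, Finset.prod_const, card_univ,
    Fintype.card_fin]

theorem dist_le_of_mem_subcube {k : Fin (d + 1) → Fin N} {ξ η : Euc (d + 1)} (hξ : ξ ∈ subcube k)
    (hη : η ∈ subcube k) : dist ξ η ≤ (d + 1) * (N : ℝ)⁻¹ := by
  rw [dist_eq_norm]
  refine norm_le_of_abs_apply_le (by positivity) fun i => ?_
  obtain ⟨h1, h2⟩ := mem_subcube.1 hξ i
  obtain ⟨h3, h4⟩ := mem_subcube.1 hη i
  rw [add_div, one_div] at h2 h4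
  rw [PiLp.sub_apply, abs_le]
  constructor <;> linarith

theorem refCube_subset_iUnion_subcube (hN : 0 < N) :
    refCube d ⊆ ⋃ k : Fin d → Fin N, subcube k := by
  intro ξ hξ
  have hN' : (0 : ℝ) < N := Nat.cast_pos.2 hN
  have h : ∀ i, ∃ m : Fin N, (m : ℝ) / N ≤ ξ i ∧ ξ i ≤ ((m : ℝ) + 1) / N := by
    intro i
    obtain ⟨h0, h1⟩ := hξ i
    rcases h1.eq_or_lt with h1 | h1
    · refine ⟨⟨N - 1, by omega⟩, ?_⟩
      have : ((N - 1 : ℕ) : ℝ) = N - 1 := by rw [Nat.cast_sub hN, Nat.cast_one]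
      rw [h1, div_le_iff₀ hN', le_div_iff₀ hN']
      simp only [this]
      constructor <;> linarith
    · have h2 : 0 ≤ ξ i * N := by positivity
      refine ⟨⟨⌊ξ i * N⌋₊, ?_⟩, ?_⟩
      · rw [Nat.floor_lt h2]; nlinarith
      · rw [div_le_iff₀ hN', le_div_iff₀ hN']
        exact ⟨Nat.floor_le h2, (Nat.lt_floor_add_one _).le⟩
  choose k hk using h
  exact mem_iUnion.2 ⟨k, mem_subcube.2 hk⟩

theorem sum_lintegral_subcube_le (hN : 0 < N) (h : Euc d → ℝ≥0∞) :
    ∑ k : Fin d → Fin N, ∫⁻ ξ in subcube k, h ξ ≤ ∫⁻ ξ in refCube d, h ξ := by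
  calc ∑ k : Fin d → Fin N, ∫⁻ ξ in subcube k, h ξ
      = ∑ k : Fin d → Fin N, ∫⁻ ξ in openSubcube k, h ξ :=
        sum_congr rfl fun k _ => (setLIntegral_congr (subcube_ae_eq k)).symm
    _ = ∫⁻ ξ in ⋃ k ∈ (Finset.univ : Finset (Fin d → Fin N)), openSubcube k, h ξ :=
        (lintegral_biUnion_finset (fun k _ k' _ hk => disjoint_openSubcube hN hk)
          (fun k _ => measurableSet_openSubcube k) h).symm
    _ ≤ ∫⁻ ξ in refCube d, h ξ := by
        refine lintegral_mono_set (Set.iUnion₂_subset fun k _ => ?_)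
        refine Set.Subset.trans (fun ξ hξ => ?_) (subcube_subset k)
        exact mem_subcube.2 fun i => ⟨(hξ i (Set.mem_univ i)).1.le, (hξ i (Set.mem_univ i)).2.le⟩

theorem lintegral_le_sum_subcube (hN : 0 < N) (ν : Measure (Euc d)) (hν : ν (refCube d)ᶜ = 0)
    (h : Euc d → ℝ≥0∞) :
    ∫⁻ ξ, h ξ ∂ν ≤ ∑ k : Fin d → Fin N, ∫⁻ ξ in subcube k, h ξ ∂ν := by
  have h1 : ν.restrict (⋃ k : Fin d → Fin N, subcube k) = ν :=
    Measure.restrict_eq_self_of_ae_mem (by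
      filter_upwards [compl_mem_ae_iff.2 hν] with ξ hξ
      exact refCube_subset_iUnion_subcube hN (not_not.1 hξ))
  calc ∫⁻ ξ, h ξ ∂ν = ∫⁻ ξ in ⋃ k : Fin d → Fin N, subcube k, h ξ ∂ν := by rw [h1]
    _ ≤ ∑' k : Fin d → Fin N, ∫⁻ ξ in subcube k, h ξ ∂ν := lintegral_iUnion_le _ _
    _ = _ := tsum_fintype _

end Subcube

section CellPullback

variable {n : ℕ} {G : Geometry n} {θ H : ℝ} {T : CoarseMesh G θ H}

variable (T) in
/-- The image under the reference map of Lebesgue measure on `Q`. -/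
def pushVol (j : Fin T.numElem) (Q : Set (Euc (n + 1))) : Measure (Euc (n + 1)) :=
  (volume.restrict Q).map (refMap T j)

theorem lipschitzOnWith_invFunOn_refMap (hθ : 1 ≤ θ) (hH : 0 < H) (j : Fin T.numElem) :
    LipschitzOnWith (Real.toNNReal (θ / H)) (invFunOn (refMap T j) (refCube (n + 1)))
      (element T j) := by
  have hg : ∀ ξ ∈ refCube (n + 1), invFunOn (refMap T j) (refCube (n + 1)) (refMap T j ξ) = ξ :=
    fun ξ hξ => (refMap_injOn T hθ hH j).leftInvOn_invFunOn hξ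
  refine LipschitzOnWith.of_dist_le_mul ?_
  rintro _ ⟨ξ, hξ, rfl⟩ _ ⟨η, hη, rfl⟩
  change dist (invFunOn (refMap T j) (refCube (n + 1)) (refMap T j ξ))
    (invFunOn (refMap T j) (refCube (n + 1)) (refMap T j η)) ≤
      _ * dist (refMap T j ξ) (refMap T j η)
  rw [hg ξ hξ, hg η hη, coe_toNNReal _ (by positivity), dist_eq_norm, dist_eq_norm]
  have := le_norm_refMap_sub T j hξ hη
  rw [div_mul_eq_mul_div, div_le_iff₀ (by positivity)] at this
  rw [div_mul_eq_mul_div, le_div_iff₀ hH]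
  linarith

theorem pushVol_le (hθ : 1 ≤ θ) (hH : 0 < H) (j : Fin T.numElem) {Q : Set (Euc (n + 1))}
    (hQ : Q ⊆ refCube (n + 1)) :
    pushVol T j Q ≤ ofReal ((θ / H) ^ (n + 1)) • volume.restrict (element T j) := by
  have hm : Measurable (refMap T j) := (contDiff_refMap T j).continuous.measurable
  refine Measure.le_iff.2 fun B hB => ?_
  rw [pushVol, Measure.map_apply hm hB, Measure.restrict_apply (hm hB), Measure.smul_apply,
    smul_eq_mul, Measure.restrict_apply hB]
  have hsub : refMap T j ⁻¹' B ∩ Q ⊆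
      invFunOn (refMap T j) (refCube (n + 1)) '' (B ∩ element T j) := fun ξ hξ =>
    ⟨refMap T j ξ, ⟨hξ.1, refMap_mem T (hQ hξ.2)⟩,
      (refMap_injOn T hθ hH j).leftInvOn_invFunOn (hQ hξ.2)⟩
  refine (measure_mono hsub).trans ((volume_image_le
    ((lipschitzOnWith_invFunOn_refMap hθ hH j).mono inter_subset_right)).trans_eq ?_)
  rw [ofReal_pow (by positivity)]
  rfl

/-- Poincaré's inequality on the subcubes of an element, bulk and fractures. -/
theorem exists_cell_estimate_test (G : Geometry n) (hθ : 1 ≤ θ) :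
    ∃ C : ℝ, 0 < C ∧ ∀ (H : ℝ) (_ : 0 < H) (T : CoarseMesh G θ H) (j : Fin T.numElem) (N : ℕ),
      0 < N → ∃ K : ℝ, 0 ≤ K ∧ ∀ f, IsTest G.Ω f →
        ∫⁻ y, ‖vl (smoothField G f) y‖ₑ ^ 2 ∂mm G (cell T j) ≤
          ofReal (C * H / N) * (∫⁻ x in cell T j, ‖fderiv ℝ f x‖ₑ ^ 2) +
          ofReal K * ∑ k : Fin (n + 1) → Fin N,
            ‖∫ x, f x ∂(pushVol T j (subcube k)).restrict G.Ω‖ₑ ^ 2 := by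
  obtain ⟨A, hA0, hA⟩ := exists_mm_closedBall_le G
  set C₀ : ℝ := 8 * A * (2 * θ) ^ n * (n + 1) ^ (n + 2) * θ ^ 2 * θ ^ (n + 1) with hC₀
  have hC₀0 : 0 ≤ C₀ := by positivity
  refine ⟨C₀ + 1, by positivity, fun H hH T j N hN => ?_⟩
  have hN' : (0 : ℝ) < N := Nat.cast_pos.2 hN
  have hcm := meas_cell T j
  have hcs := cell_subset T j
  have hFm : Measurable (refMap T j) := (contDiff_refMap T j).continuous.measurable
  set g : Euc (n + 1) → Euc (n + 1) :=
    (element T j).indicator (invFunOn (refMap T j) (refCube (n + 1))) with hg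
  have hgm : Measurable g := by
    classical
    rw [hg, ← piecewise_eq_indicator]
    exact (lipschitzOnWith_invFunOn_refMap hθ hH j).continuousOn.measurable_piecewise
      continuousOn_const (isCompact_element T j).measurableSet
  have hgmem : ∀ x ∈ element T j, g x ∈ refCube (n + 1) ∧ refMap T j (g x) = x := by
    intro x hx
    rw [hg, indicator_of_mem hx]
    exact ⟨Function.invFunOn_mem hx, Function.invFunOn_eq hx⟩
  have : IsFiniteMeasure (mm G (cell T j)) := isFiniteMeasure_of_le _ (mm_le hcm hcs)
  set ν : Measure (Euc (n + 1)) := (mm G (cell T j)).map (fun y => g (pos G y)) with hν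
  have hgp : Measurable fun y => g (pos G y) := hgm.comp (measurable_pos G)
  have : IsFiniteMeasure ν := Measure.isFiniteMeasure_map _ _
  have hνQ : ν (refCube (n + 1))ᶜ = 0 := by
    rw [hν, Measure.map_apply hgp isCompact_refCube.measurableSet.compl]
    refine measure_mono_null (fun y hy => ?_) (ae_mm_pos_mem hcm)
    exact fun h => hy (hgmem _ h.1).1
  have hball : ∀ ξ, ∀ r > 0, ν (closedBall ξ r) ≤ ofReal (A * (2 * θ * H) ^ n * r ^ n) := by
    intro ξ r hr
    rw [hν, Measure.map_apply hgp isClosed_closedBall.measurableSet]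
    by_cases hex : ∃ y₀, pos G y₀ ∈ cell T j ∧ g (pos G y₀) ∈ closedBall ξ r
    · obtain ⟨y₀, h0, h0'⟩ := hex
      calc mm G (cell T j) ((fun y => g (pos G y)) ⁻¹' closedBall ξ r)
          ≤ mm G (cell T j) (pos G ⁻¹' closedBall (pos G y₀) (2 * θ * H * r)) := by
            refine measure_mono_ae ?_
            filter_upwards [ae_mm_pos_mem hcm] with y hy hyB
            have h1 := norm_refMap_sub_le T j (hgmem _ hy.1).1 (hgmem _ h0.1).1
            rw [(hgmem _ hy.1).2, (hgmem _ h0.1).2] at h1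
            have h2 : ‖g (pos G y) - g (pos G y₀)‖ ≤ 2 * r := by
              rw [← dist_eq_norm]
              have := dist_triangle_right (g (pos G y)) (g (pos G y₀)) ξ
              have h3 : dist (g (pos G y)) ξ ≤ r := hyB
              have h4 : dist (g (pos G y₀)) ξ ≤ r := h0'
              linarith
            change dist _ _ ≤ _
            rw [dist_eq_norm]
            refine h1.trans ?_
            have : θ * H * ‖g (pos G y) - g (pos G y₀)‖ ≤ θ * H * (2 * r) := by gcongr
            linarith
        _ ≤ mm G G.Ω (pos G ⁻¹' closedBall (pos G y₀) (2 * θ * H * r)) := mm_le hcm hcs _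
        _ ≤ _ := hA _ _ (by positivity)
        _ = _ := by rw [mul_pow (2 * θ * H), mul_assoc A]
    · push Not at hex
      have : mm G (cell T j) ((fun y => g (pos G y)) ⁻¹' closedBall ξ r) = 0 := by
        refine measure_mono_null (fun y hy => ?_) (ae_mm_pos_mem hcm)
        exact fun h => hex y h hy
      rw [this]; exact zero_le
  refine ⟨2 * (ν univ).toReal * ((N : ℝ) ^ (n + 1)) ^ 2, by positivity, fun f hf => ?_⟩
  have hF1 : ContDiff ℝ 1 (fun ξ => f (refMap T j ξ)) :=
    (hf.contDiff.comp (contDiff_refMap T j)).of_le (by simp)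
  have hvolinv : ∀ k : Fin (n + 1) → Fin N,
      (volume (subcube k))⁻¹ = ofReal ((N : ℝ) ^ (n + 1)) := by
    intro k
    rw [volume_subcube, ← ENNReal.ofReal_inv_of_pos (by positivity), inv_pow, inv_inv]
  have h1 : ∫⁻ y, ‖vl (smoothField G f) y‖ₑ ^ 2 ∂mm G (cell T j) =
      ∫⁻ ξ, ‖f (refMap T j ξ)‖ₑ ^ 2 ∂ν := by
    rw [hν, lintegral_map (hF1.continuous.measurable.enorm.pow_const 2) hgp]
    refine lintegral_congr_ae ?_
    filter_upwards [ae_mm_pos_mem hcm] with y hy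
    rw [vl_smoothField, (hgmem _ hy.1).2]
  have hgrad : ∀ k : Fin (n + 1) → Fin N,
      ∫⁻ ξ in subcube k, ‖fderiv ℝ (fun ξ => f (refMap T j ξ)) ξ‖ₑ ^ 2 ≤
        ofReal ((θ * H) ^ 2) * ∫⁻ ξ in subcube k, ‖fderiv ℝ f (refMap T j ξ)‖ₑ ^ 2 := by
    intro k
    rw [← lintegral_const_mul' _ _ ENNReal.ofReal_ne_top, ← setLIntegral_congr (subcube_ae_eq k),
      ← setLIntegral_congr (subcube_ae_eq k)]
    refine setLIntegral_mono' (measurableSet_openSubcube k) fun ξ hξ => ?_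
    have hint : ξ ∈ interior (refCube (n + 1)) := by
      refine mem_interior.2 ⟨openSubcube k, fun η hη => subcube_subset k ?_, ?_, hξ⟩
      · exact mem_subcube.2 fun i => ⟨(hη i (Set.mem_univ i)).1.le, (hη i (Set.mem_univ i)).2.le⟩
      · exact (isOpen_set_pi Set.finite_univ fun _ _ => isOpen_Ioo).preimage
          (EuclideanSpace.equiv (Fin (n + 1)) ℝ).continuous
    rw [← ofReal_norm, ← ofReal_norm, ← ofReal_pow (norm_nonneg _),
      ← ofReal_pow (norm_nonneg _), ← ofReal_mul (by positivity), ← mul_pow]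
    refine ofReal_le_ofReal (pow_le_pow_left₀ (norm_nonneg _) ?_ 2)
    have hd1 : DifferentiableAt ℝ f (refMap T j ξ) := hf.differentiable _
    have hd2 : DifferentiableAt ℝ (refMap T j) ξ := (contDiff_refMap T j).differentiable (by simp) _
    have hcomp : fderiv ℝ (fun ξ => f (refMap T j ξ)) ξ =
      (fderiv ℝ f (refMap T j ξ)).comp (fderiv ℝ (refMap T j) ξ) := fderiv_comp ξ hd1 hd2
    rw [hcomp, mul_comm]
    refine (ContinuousLinearMap.opNorm_comp_le _ _).trans ?_
    refine mul_le_mul_of_nonneg_left ?_ (norm_nonneg _)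
    exact ContinuousLinearMap.opNorm_le_bound _ (by positivity) (norm_fderiv_refMap_le T j hint)
  have hmean : ∀ k : Fin (n + 1) → Fin N, ∫ ξ in subcube k, f (refMap T j ξ) =
      ∫ x, f x ∂(pushVol T j (subcube k)).restrict G.Ω := by
    intro k
    rw [setIntegral_eq_integral_of_forall_compl_eq_zero fun x hx => (hf.fderiv_eq_zero hx).1,
      pushVol, integral_map hFm.aemeasurable hf.contDiff.continuous.aestronglyMeasurable]
  have hsum : ∑ k : Fin (n + 1) → Fin N, ∫⁻ ξ in subcube k, ‖fderiv ℝ f (refMap T j ξ)‖ₑ ^ 2 ≤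
      ofReal ((θ / H) ^ (n + 1)) * ∫⁻ x in cell T j, ‖fderiv ℝ f x‖ₑ ^ 2 := by
    have hfd : Measurable fun x => ‖fderiv ℝ f x‖ₑ ^ 2 := by
      exact (hf.contDiff.continuous_fderiv (by simp)).measurable.enorm.pow_const 2
    refine (sum_lintegral_subcube_le hN _).trans ?_
    rw [← lintegral_map hfd hFm]
    refine (lintegral_mono' (pushVol_le hθ hH j le_rfl) le_rfl).trans_eq ?_
    rw [lintegral_smul_measure, smul_eq_mul]
    congr 1
    have : (fun x => ‖fderiv ℝ f x‖ₑ ^ 2) = G.Ω.indicator fun x => ‖fderiv ℝ f x‖ₑ ^ 2 := by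
      refine (Set.indicator_eq_self.2 fun x hx => ?_).symm
      by_contra hxΩ
      refine hx ?_
      change ‖fderiv ℝ f x‖ₑ ^ 2 = 0
      have h0 : ‖fderiv ℝ f x‖ = 0 := by rw [(hf.fderiv_eq_zero hxΩ).2, norm_zero]
      rw [← ofReal_norm, h0, ENNReal.ofReal_zero]
      exact zero_pow two_ne_zero
    conv_lhs => rw [this]
    rw [lintegral_indicator G.isOpen_Ω.measurableSet, Measure.restrict_restrict
      G.isOpen_Ω.measurableSet, inter_comm, cell]
  have hk : ∀ k : Fin (n + 1) → Fin N, ∫⁻ ξ in subcube k, ‖f (refMap T j ξ)‖ₑ ^ 2 ∂ν ≤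
      ofReal (2 * (N : ℝ) ^ (n + 1) *
        (4 * (A * (2 * θ * H) ^ n) * ((n + 1) * (N : ℝ)⁻¹) ^ (n + 2)) * (θ * H) ^ 2) *
        (∫⁻ ξ in subcube k, ‖fderiv ℝ f (refMap T j ξ)‖ₑ ^ 2) +
      ofReal (2 * (ν univ).toReal * ((N : ℝ) ^ (n + 1)) ^ 2) *
        ‖∫ x, f x ∂(pushVol T j (subcube k)).restrict G.Ω‖ₑ ^ 2 := by
    intro k
    refine (lintegral_sq_le_average (convex_subcube k) (isCompact_subcube k) ?_ hF1 ν
      (D := (n + 1) * (N : ℝ)⁻¹) (by positivity) (by positivity) hball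
      fun x hx y hy => dist_le_of_mem_subcube hx hy).trans ?_
    · rw [volume_subcube]; simpa using pow_pos (inv_pos.2 hN') _
    rw [hvolinv, hmean k]
    refine add_le_add ?_ ?_
    · refine (mul_le_mul_right (mul_le_mul_right (mul_le_mul_right (hgrad k) _) _) _).trans_eq ?_
      set Z : ℝ := 4 * (A * (2 * θ * H) ^ n) * ((n + 1) * (N : ℝ)⁻¹) ^ (n + 2)
      rw [ofReal_mul (p := 2 * (N : ℝ) ^ (n + 1) * Z) (by positivity),
        ofReal_mul (p := 2 * (N : ℝ) ^ (n + 1)) (by positivity), ofReal_mul (p := 2) (by positivity), ENNReal.ofReal_ofNat]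
      ring
    · rw [ofReal_mul (by positivity), ofReal_mul (by positivity),
        ENNReal.ofReal_ofNat, ofReal_toReal (measure_ne_top _ _), mul_pow,
        ← ofReal_pow (by positivity)]
      exact (by ring : _ = _).le
  calc ∫⁻ y, ‖vl (smoothField G f) y‖ₑ ^ 2 ∂mm G (cell T j)
      ≤ ∑ k : Fin (n + 1) → Fin N, ∫⁻ ξ in subcube k, ‖f (refMap T j ξ)‖ₑ ^ 2 ∂ν := by
        rw [h1]; exact lintegral_le_sum_subcube hN ν hνQ _
    _ ≤ _ := sum_le_sum fun k _ => hk k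
    _ ≤ _ := by
        rw [sum_add_distrib, ← mul_sum, ← mul_sum]
        gcongr ?_ + _
        refine (mul_le_mul_right hsum _).trans ?_
        rw [← mul_assoc, ← ofReal_mul (by positivity)]
        gcongr
        have : 2 * (N : ℝ) ^ (n + 1) *
          (4 * (A * (2 * θ * H) ^ n) * ((n + 1) * (N : ℝ)⁻¹) ^ (n + 2)) * (θ * H) ^ 2 *
            (θ / H) ^ (n + 1) = C₀ * H / N := by
          rw [hC₀]
          simp only [mul_pow, div_pow, inv_pow]
          field_simp
          ring
        rw [this]
        gcongr
        linarith

/-- The functional which integrates over the image of the subcube with index `k`. -/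
def subMean (T : CoarseMesh G θ H) (j : Fin T.numElem) {N : ℕ} (k : Fin (n + 1) → Fin N)
    (w : Scalars G) : ℝ :=
  ∫ x, w.val x ∂(pushVol T j (subcube k)).restrict G.Ω

instance (j : Fin T.numElem) {N : ℕ} (k : Fin (n + 1) → Fin N) :
    IsFiniteMeasure (pushVol T j (subcube k)) := by
  have : IsFiniteMeasure (volume.restrict (subcube k)) :=
    ⟨by rw [Measure.restrict_apply_univ]; exact (isCompact_subcube k).measure_lt_top⟩
  exact Measure.isFiniteMeasure_map _ _

theorem subMean_smul (j : Fin T.numElem) {N : ℕ} (k : Fin (n + 1) → Fin N) (c : ℝ)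
    (w : Scalars G) : subMean T j k (c • w) = c * subMean T j k w :=
  integral_const_mul _ _

theorem ip_bulk_le {R : Set (Euc (n + 1))} {w : Scalars G} (hw : MemLp (vl w) 2 (mm G R)) :
    ip (volume.restrict R) w.val w.val ≤ ip (mm G R) (vl w) (vl w) := by
  rw [← ofReal_le_ofReal_iff (ip_self_nonneg _), ofReal_ip_self (f := w.val) (memLp_mm_iff.1 hw).1,
    ofReal_ip_self hw, lintegral_vl]
  exact le_self_add

section

variable (hθ : 1 ≤ θ) (hH : 0 < H) (j : Fin T.numElem) {N : ℕ} (k : Fin (n + 1) → Fin N) {w : Scalars G}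
  (hw : MemLp (vl w) 2 (mm G (cell T j)))

include hθ hH

theorem pushVol_restrict_le : (pushVol T j (subcube k)).restrict G.Ω ≤
      ofReal ((θ / H) ^ (n + 1)) • volume.restrict (cell T j) := by
  refine (Measure.restrict_mono le_rfl (pushVol_le hθ hH j (subcube_subset k))).trans_eq ?_
  rw [Measure.restrict_smul, Measure.restrict_restrict G.isOpen_Ω.measurableSet, inter_comm, cell]

include hw

theorem memLp_pushVol :
    MemLp w.val 2 ((pushVol T j (subcube k)).restrict G.Ω) :=
  (memLp_mm_iff.1 hw).1.of_measure_le_smul ENNReal.ofReal_ne_top (pushVol_restrict_le hθ hH j k)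

theorem subMean_add {w'} (hw' : MemLp (vl w') 2 (mm G (cell T j))) :
    subMean T j k (w + w') = subMean T j k w + subMean T j k w' :=
  integral_add ((memLp_pushVol hθ hH j k hw).integrable one_le_two)
    ((memLp_pushVol hθ hH j k hw').integrable one_le_two)

theorem subMean_sq_le_bulk :
    subMean T j k w ^ 2 ≤ (θ / H) ^ (n + 1) * ((pushVol T j (subcube k)).real univ) *
      ip (volume.restrict (cell T j)) w.val w.val := by
  have hm := memLp_pushVol hθ hH j k hw
  set lam := (pushVol T j (subcube k)).restrict G.Ω
  have h1 : ‖∫ x, w.val x ∂lam‖ₑ ^ 2 ≤ lam univ * ∫⁻ x, ‖w.val x‖ₑ ^ 2 ∂lam :=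
    (pow_le_pow_left₀ zero_le (enorm_integral_le_lintegral_enorm _) 2).trans
      (sq_lintegral_le hm.1.enorm)
  have h2 : ∫⁻ x, ‖w.val x‖ₑ ^ 2 ∂lam ≤ ofReal ((θ / H) ^ (n + 1)) *
      ∫⁻ x in cell T j, ‖w.val x‖ₑ ^ 2 := by
    refine (lintegral_mono' (pushVol_restrict_le hθ hH j k) le_rfl).trans ?_
    rw [lintegral_smul_measure, smul_eq_mul]
  have h3 : lam univ ≤ ofReal ((pushVol T j (subcube k)).real univ) := by
    rw [ofReal_measureReal]
    exact Measure.restrict_le_self _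
  rw [← ofReal_ip_self (f := w.val) (memLp_mm_iff.1 hw).1] at h2
  have h4 := h1.trans (mul_le_mul' h3 h2)
  have h5 := ip_self_nonneg (μ := volume.restrict (cell T j)) w.val
  rw [enorm_sq_eq_ofReal, ← ofReal_mul (by positivity), ← ofReal_mul
    (by positivity), ofReal_le_ofReal_iff (mul_nonneg (by positivity)
      (mul_nonneg (by positivity) h5)), norm_eq_abs, sq_abs] at h4
  calc _ ≤ _ := h4
    _ = _ := by ring

theorem subMean_sq_le :
    subMean T j k w ^ 2 ≤ (θ / H) ^ (n + 1) * ((pushVol T j (subcube k)).real univ) *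
      ip (mm G (cell T j)) (vl w) (vl w) :=
  (subMean_sq_le_bulk hθ hH j k hw).trans
    (mul_le_mul_of_nonneg_left (ip_bulk_le hw) (by positivity))

end

/-- An inequality between quadratic quantities passes from test functions to their closure. -/
theorem MemClosure.le_of_test {O R : Set (Euc (n + 1))} (hR : MeasurableSet R) (hRΩ : R ⊆ G.Ω)
    {a : ℝ} (ha : 0 ≤ a) {K : Scalars G → ℝ} {B : ℝ} (hB : 0 ≤ B)
    (hK : ∀ w w', MemLp (vl w) 2 (mm G R) → MemLp (vl w') 2 (mm G R) →
      K w ≤ 2 * K w' + B * ip (mm G R) (vl w' - vl w) (vl w' - vl w))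
    (h : ∀ f, IsTest O f → ip (mm G R) (vl (smoothField G f)) (vl (smoothField G f)) ≤
      a * ip (mm G R) (gr (smoothField G f)) (gr (smoothField G f)) + K (smoothField G f))
    {w : Scalars G} (hw : MemClosure G O R w) :
    ip (mm G R) (vl w) (vl w) ≤ 4 * a * ip (mm G R) (gr w) (gr w) + 4 * K w := by
  obtain ⟨⟨hv, hg⟩, happ⟩ := (memClosure_iff hR hRΩ).1 hw
  refine le_of_forall_pos_le_add fun ε hε => ?_
  obtain ⟨f, hf, h1, h2⟩ := happ (ε / (2 + 4 * a + 2 * B)) (by positivity)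
  set δ := ε / (2 + 4 * a + 2 * B)
  have hδ : (2 + 4 * a + 2 * B) * δ = ε := by
    simp only [δ]; field_simp
  have hfv := hf.memLp_vl hR hRΩ
  have hfg := hf.memLp_gr hR hRΩ
  have h3 := ip_add_self_le (hv.sub hfv) hfv
  have h4 := ip_sub_self_le hg (hg.sub hfg)
  rw [sub_add_cancel] at h3
  rw [sub_sub_cancel] at h4
  nlinarith [h f hf, hK (smoothField G f) w hfv hv]

/-- Poincaré's inequality on the subcubes of an element, bulk and fractures. -/
theorem exists_cell_estimate (G : Geometry n) (hθ : 1 ≤ θ) :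
    ∃ C : ℝ, 0 < C ∧ ∀ (H : ℝ) (_ : 0 < H) (T : CoarseMesh G θ H) (j : Fin T.numElem) (N : ℕ),
      0 < N → ∃ K : ℝ, 0 ≤ K ∧ ∀ w, MemClosure G G.Ω (cell T j) w →
        ip (mm G (cell T j)) (vl w) (vl w) ≤ C * H / N * ip (mm G (cell T j)) (gr w) (gr w) +
          K * ∑ k : Fin (n + 1) → Fin N, subMean T j k w ^ 2 := by
  obtain ⟨C, hC, h⟩ := exists_cell_estimate_test (n := n) G hθ
  refine ⟨4 * C, by positivity, fun H hH T j N hN => ?_⟩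
  obtain ⟨K, hK, h⟩ := h H hH T j N hN
  refine ⟨4 * K, by positivity, fun w hw => ?_⟩
  have hcm := meas_cell T j
  have hcs := cell_subset T j
  set B : ℝ := K * ∑ k : Fin (n + 1) → Fin N,
    2 * ((θ / H) ^ (n + 1) * ((pushVol T j (subcube k)).real univ))
  have key := hw.le_of_test hcm hcs (a := C * H / N) (by positivity)
    (K := fun w => K * ∑ k : Fin (n + 1) → Fin N, subMean T j k w ^ 2) (B := B) (by positivity)
    (fun w w' hw hw' => ?_) (fun f hf => ?_)
  · calc _ ≤ _ := key
      _ = _ := by ring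
  · have hB : 2 * (K * ∑ k : Fin (n + 1) → Fin N, subMean T j k w' ^ 2) +
        B * ip (mm G (cell T j)) (vl w' - vl w) (vl w' - vl w) =
        K * ∑ k : Fin (n + 1) → Fin N, (2 * subMean T j k w' ^ 2 +
          2 * ((θ / H) ^ (n + 1) * ((pushVol T j (subcube k)).real univ)) *
            ip (mm G (cell T j)) (vl w' - vl w) (vl w' - vl w)) := by
      rw [sum_add_distrib, ← mul_sum, ← Finset.sum_mul]
      ring
    rw [hB]
    refine mul_le_mul_of_nonneg_left (sum_le_sum fun k _ => ?_) hK
    have h1 : subMean T j k w' = subMean T j k w + subMean T j k (w' - w) := by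
      rw [← subMean_add hθ hH j k hw (by rw [map_sub]; exact hw'.sub hw), add_sub_cancel]
    have h2 := subMean_sq_le hθ hH j k (w := w' - w) (by rw [map_sub]; exact hw'.sub hw)
    rw [map_sub] at h2
    rw [eq_sub_of_add_eq h1.symm]
    nlinarith [sq_nonneg (subMean T j k w' + subMean T j k (w' - w))]
  · have h1 := (h f hf).trans (add_le_add_left (mul_le_mul_right
      (lintegral_fderiv_le_gr (G := G) f) _) _)
    have h2 : ∀ k : Fin (n + 1) → Fin N, ‖∫ x, f x ∂(pushVol T j (subcube k)).restrict G.Ω‖ₑ ^ 2 =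
          ofReal (subMean T j k (smoothField G f) ^ 2) := by
      intro k
      rw [enorm_sq_eq_ofReal, norm_eq_abs, sq_abs]
      rfl
    rw [sum_congr rfl fun k _ => h2 k, ← ENNReal.ofReal_sum_of_nonneg
      fun k _ => sq_nonneg _, ← ofReal_ip_self (hf.memLp_vl hcm hcs),
      ← ofReal_ip_self (hf.memLp_gr hcm hcs), ← ofReal_mul (by positivity),
      ← ofReal_mul hK, ← ofReal_add (mul_nonneg (by positivity) (ip_self_nonneg _)) (by positivity),
      ofReal_le_ofReal_iff (add_nonneg (mul_nonneg (by positivity) (ip_self_nonneg _))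
        (by positivity))] at h1
    exact h1

/-- Friedrichs' inequality, bulk and fractures. -/
theorem exists_friedrichs (G : Geometry n) : ∃ C : ℝ, 0 < C ∧ ∀ w, MemClosure G G.Ω G.Ω w →
    ip (mm G G.Ω) (vl w) (vl w) ≤ C * ip (mm G G.Ω) (gr w) (gr w) := by
  obtain ⟨C, hC, h⟩ := exists_friedrichs_test G
  have hm := G.isOpen_Ω.measurableSet
  refine ⟨4 * C, by positivity, fun w hw => ?_⟩
  have key := hw.le_of_test hm subset_rfl hC.le (K := fun _ => 0) (B := 0) le_rfl
    (fun _ _ _ _ => by simp) (fun f hf => ?_)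
  · simpa using key
  · have h1 := (h f hf).trans (mul_le_mul_right (lintegral_fderiv_le_gr (G := G) f) _)
    rw [← ofReal_ip_self (hf.memLp_vl hm subset_rfl), ← ofReal_ip_self (hf.memLp_gr hm subset_rfl),
      ← ofReal_mul hC.le, ofReal_le_ofReal_iff (mul_nonneg hC.le (ip_self_nonneg _))] at h1
    simpa using h1

end CellPullback

/-! ### The spectral gap of a pair of forms, abstractly -/

section SpectralGap

variable {V : Type*} [AddCommGroup V] [Module ℝ V] {a s : BilinForm ℝ V}

/-- Finitely many independent vectors have a nontrivial combination in the kernel of fewer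
functionals. -/
theorem exists_combination {ι : Type*} [Fintype ι] {m : ℕ} (ℓ : ι → V →ₗ[ℝ] ℝ) (b : Fin m → V)
    (h : Fintype.card ι < m) : ∃ c : Fin m → ℝ, c ≠ 0 ∧ ∀ q, ℓ q (∑ k, c k • b k) = 0 := by
  have h1 := LinearMap.ker_ne_bot_of_finrank_lt
    (f := (LinearMap.pi ℓ).comp (Fintype.linearCombination ℝ b)) (by simpa using h)
  obtain ⟨c, hc, hc0⟩ := Submodule.exists_mem_ne_zero_of_ne_bot h1
  refine ⟨c, hc0, fun q => ?_⟩
  have := congrFun (LinearMap.mem_ker.1 hc) q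
  simpa [Fintype.linearCombination_apply] using this

theorem apply_combination {m : ℕ} {b : Fin m → V} (B : BilinForm ℝ V)
    (hB : ∀ k k', k ≠ k' → B (b k) (b k') = 0) (c : Fin m → ℝ) :
    B (∑ k, c k • b k) (∑ k, c k • b k) = ∑ k, c k ^ 2 * B (b k) (b k) := by
  rw [map_sum B, LinearMap.sum_apply]
  refine sum_congr rfl fun k _ => ?_
  rw [map_sum, sum_eq_single_of_mem k (mem_univ k) fun k' _ hk' => by
    simp [hB k k' (Ne.symm hk')]]
  simp only [map_smul, LinearMap.smul_apply, smul_eq_mul]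
  ring

theorem combination_pos (hs : SemiInner s) {m : ℕ} {b : Fin m → V}
    (hsb : ∀ k k', k ≠ k' → s (b k) (b k') = 0) (hs0 : ∀ k, s (b k) (b k) ≠ 0)
    {c : Fin m → ℝ} (hc : c ≠ 0) : 0 < s (∑ k, c k • b k) (∑ k, c k • b k) := by
  rw [apply_combination s hsb]
  obtain ⟨k, hk⟩ := Function.ne_iff.1 hc
  refine Finset.sum_pos' (fun k _ => mul_nonneg (sq_nonneg _) (hs.nonneg _)) ⟨k, mem_univ k, ?_⟩
  have := (hs.nonneg (b k)).lt_of_ne (hs0 k).symm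
  have : 0 < c k ^ 2 := by
    have : c k ≠ 0 := hk
    positivity
  positivity

/-- The number of vectors with small Rayleigh quotient is bounded by the number of functionals. -/
theorem card_le_of_rayleigh_le (hs : SemiInner s) {ι : Type*} [Fintype ι] (ℓ : ι → V →ₗ[ℝ] ℝ)
    {ε K M : ℝ} (hcomp : ∀ p, s p p ≤ ε * a p p + K * ∑ q, ℓ q p ^ 2) (hε : 0 ≤ ε) (hM : ε * M < 1)
    {m : ℕ} {b : Fin m → V} (hab : ∀ k k', k ≠ k' → a (b k) (b k') = 0)
    (hsb : ∀ k k', k ≠ k' → s (b k) (b k') = 0) (hs0 : ∀ k, s (b k) (b k) ≠ 0)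
    (hle : ∀ k, a (b k) (b k) ≤ M * s (b k) (b k)) : m ≤ Fintype.card ι := by
  by_contra hlt
  obtain ⟨c, hc, hℓ⟩ := exists_combination ℓ b (not_le.1 hlt)
  set p := ∑ k, c k • b k
  have h1 : 0 < s p p := combination_pos hs hsb hs0 hc
  have h2 : a p p ≤ M * s p p := by
    simp only [p]
    rw [apply_combination a hab, apply_combination s hsb, mul_sum]
    refine sum_le_sum fun k _ => ?_
    nlinarith [mul_le_mul_of_nonneg_left (hle k) (sq_nonneg (c k))]
  have h3 := hcomp p
  simp only [hℓ, ne_eq, OfNat.ofNat_ne_zero, not_false_eq_true, zero_pow, Finset.sum_const_zero,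
    mul_zero, add_zero] at h3
  nlinarith [mul_le_mul_of_nonneg_left h2 hε]

/-- If the Rayleigh quotient is at least `Λ` on the complement of `m` vectors, it is at least `Λ`
somewhere on the span of `m + 1` orthogonal vectors. -/
theorem gap_le_of_rayleigh_le (hs : SemiInner s) {m : ℕ} {φ : Fin m → V} {Λ M : ℝ}
    (hgap : ∀ p, (∀ k, s p (φ k) = 0) → Λ * s p p ≤ a p p) {b : Fin (m + 1) → V}
    (hab : ∀ k k', k ≠ k' → a (b k) (b k') = 0)
    (hsb : ∀ k k', k ≠ k' → s (b k) (b k') = 0) (hs0 : ∀ k, s (b k) (b k) ≠ 0)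
    (hle : ∀ k, a (b k) (b k) ≤ M * s (b k) (b k)) : Λ ≤ M := by
  obtain ⟨c, hc, hℓ⟩ := exists_combination (fun k : Fin m => s.flip (φ k)) b (by simp)
  set p := ∑ k, c k • b k
  have h1 : 0 < s p p := combination_pos hs hsb hs0 hc
  have h2 : a p p ≤ M * s p p := by
    simp only [p]
    rw [apply_combination a hab, apply_combination s hsb, mul_sum]
    refine sum_le_sum fun k _ => ?_
    nlinarith [mul_le_mul_of_nonneg_left (hle k) (sq_nonneg (c k))]
  exact le_of_mul_le_mul_right ((hgap p hℓ).trans h2) h1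

variable {ι : Type*} [Fintype ι] {ℓ : ι → V →ₗ[ℝ] ℝ}

/-- A sequence whose Rayleigh quotients converge to their infimum has a Cauchy subsequence. -/
theorem exists_minimizer (ha : SemiInner a) (hs : SemiInner s)
    (hcomplete : FormComplete (a + s) univ) {C ε K μ : ℝ} (hε : 0 ≤ ε)
    (hμ0 : 0 ≤ μ) (hεμ : 2 * (ε * μ) ≤ 1)
    (hℓ : ∀ q p, ℓ q p ^ 2 ≤ C * (a p p + s p p))
    (hcomp : ∀ p, s p p ≤ ε * a p p + K * ∑ q, ℓ q p ^ 2) {S : Submodule ℝ V}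
    (hμ : ∀ p ∈ S, μ * s p p ≤ a p p)
    (hinf : ∀ δ > 0, ∃ p ∈ S, s p p = 1 ∧ a p p < μ + δ) :
    ∃ w, s w w = 1 ∧ a w w ≤ μ ∧ ∀ φ, (∀ p ∈ S, s p φ = 0) → s w φ = 0 := by
  choose x hxS hx1 hxa using fun i : ℕ => hinf (1 / ((i : ℝ) + 1)) Nat.one_div_pos_of_nat
  have hle1 : ∀ i : ℕ, 1 / ((i : ℝ) + 1) ≤ 1 := fun i => by
    rw [div_le_one (by positivity)]; linarith [Nat.cast_nonneg (α := ℝ) i]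
  have hC : ∀ i q, ℓ q (x i) ^ 2 ≤ |C| * (μ + 2) := by
    intro i q
    refine (hℓ q (x i)).trans ?_
    have h1 : 0 ≤ a (x i) (x i) + s (x i) (x i) := add_nonneg (ha.nonneg _) (hs.nonneg _)
    refine (mul_le_mul_of_nonneg_right (le_abs_self C) h1).trans ?_
    refine mul_le_mul_of_nonneg_left ?_ (abs_nonneg C)
    have := hxa i; have := hle1 i; rw [hx1]; linarith
  have hbd : Bornology.IsBounded (Set.range fun i q => ℓ q (x i)) := by
    refine (Metric.isBounded_closedBall (x := (0 : ι → ℝ)) (r := √(|C| * (μ + 2)))).subset ?_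
    rintro _ ⟨i, rfl⟩
    rw [mem_closedBall_zero_iff, pi_norm_le_iff_of_nonneg (sqrt_nonneg _)]
    exact fun q => Real.abs_le_sqrt (hC i q)
  obtain ⟨z, -, g, hg, hlim⟩ := tendsto_subseq_of_bounded hbd fun i => Set.mem_range_self i
  have hdiff : ∀ i j, a (x i - x j) (x i - x j) ≤
      4 * (1 / ((i : ℝ) + 1)) + 4 * (1 / ((j : ℝ) + 1)) + 2 * μ * K * ∑ q, ℓ q (x i - x j) ^ 2 := by
    intro i j
    have h1 := hμ _ (S.add_mem (hxS i) (hxS j))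
    rw [ha.apply_add_add, hs.apply_add_add, hx1, hx1] at h1
    have h2 := hcomp (x i - x j)
    have h3 := ha.apply_sub_sub (x i) (x j)
    have h4 := hs.apply_sub_sub (x i) (x j)
    rw [hx1, hx1] at h4
    have h5 := hxa i
    have h6 := hxa j
    have h7 : μ * s (x i - x j) (x i - x j) ≤ 1 / 2 * a (x i - x j) (x i - x j) +
        μ * (K * ∑ q, ℓ q (x i - x j) ^ 2) := by
      nlinarith [mul_le_mul_of_nonneg_left h2 hμ0, ha.nonneg (x i - x j)]
    nlinarith
  have hsdiff : ∀ i j, a (x i - x j) (x i - x j) + s (x i - x j) (x i - x j) ≤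
      (1 + ε) * (4 * (1 / ((i : ℝ) + 1)) + 4 * (1 / ((j : ℝ) + 1))) +
        ((1 + ε) * (2 * μ * K) + K) * ∑ q, (ℓ q (x i) - ℓ q (x j)) ^ 2 := by
    intro i j
    have h1 := hdiff i j
    have h2 := hcomp (x i - x j)
    have h3 := mul_le_mul_of_nonneg_left h1 hε
    have h4 : ∑ q, ℓ q (x i - x j) ^ 2 = ∑ q, (ℓ q (x i) - ℓ q (x j)) ^ 2 := by
      simp only [map_sub]
    rw [← h4]
    linarith
  have hcauchy : ∀ δ > 0, ∃ N, ∀ i ≥ N, ∀ j ≥ N,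
      (a + s) (x (g i) - x (g j)) (x (g i) - x (g j)) < δ := by
    intro δ hδ
    have h1 : Tendsto (fun r : ℕ × ℕ =>
        (1 + ε) * (4 * (1 / (((g r.1 : ℕ) : ℝ) + 1)) + 4 * (1 / (((g r.2 : ℕ) : ℝ) + 1))) +
        ((1 + ε) * (2 * μ * K) + K) * ∑ q, (ℓ q (x (g r.1)) - ℓ q (x (g r.2))) ^ 2)
        (atTop ×ˢ atTop) (nhds
          ((1 + ε) * (4 * 0 + 4 * 0) + ((1 + ε) * (2 * μ * K) + K) * ∑ q, (z q - z q) ^ 2)) := by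
      have hz : Tendsto (fun i => 1 / (((g i : ℕ) : ℝ) + 1)) atTop (nhds 0) :=
        tendsto_one_div_add_atTop_nhds_zero_nat.comp hg.tendsto_atTop
      have hq : ∀ q, Tendsto (fun i => ℓ q (x (g i))) atTop (nhds (z q)) := fun q =>
        ((continuous_apply q).tendsto z).comp hlim
      refine Filter.Tendsto.add (Filter.Tendsto.const_mul _ (Filter.Tendsto.add
        ((hz.comp Filter.tendsto_fst).const_mul _) ((hz.comp Filter.tendsto_snd).const_mul _)))
        (Filter.Tendsto.const_mul _ (tendsto_finsetSum _ fun q _ => Filter.Tendsto.pow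
          (Filter.Tendsto.sub ((hq q).comp Filter.tendsto_fst) ((hq q).comp Filter.tendsto_snd)) 2))
    rw [Filter.prod_atTop_atTop_eq] at h1
    have h2 := h1.eventually (gt_mem_nhds (show _ < δ by simpa using hδ))
    obtain ⟨N, hN⟩ := Filter.eventually_atTop.1 h2
    refine ⟨max N.1 N.2, fun i hi j hj => ?_⟩
    exact (hsdiff _ _).trans_lt (hN (i, j) ⟨(le_max_left _ _).trans hi, (le_max_right _ _).trans hj⟩)
  obtain ⟨w, -, hw⟩ := hcomplete (fun i => x (g i)) (fun _ => Set.mem_univ _) hcauchy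
  have hwa : ∀ δ > 0, ∃ i : ℕ, 1 / ((g i : ℝ) + 1) < δ ∧ √(a (w - x (g i)) (w - x (g i))) < δ ∧
      √(s (w - x (g i)) (w - x (g i))) < δ := by
    intro δ hδ
    obtain ⟨N, hN⟩ := hw (δ ^ 2) (by positivity)
    obtain ⟨M, hM⟩ := exists_nat_one_div_lt hδ
    have h1 := hN (max N M) (le_max_left _ _)
    rw [LinearMap.add_apply, LinearMap.add_apply] at h1
    rw [SemiInner.apply_sub_comm (B := a), SemiInner.apply_sub_comm (B := s)] at h1
    refine ⟨max N M, ?_, ?_, ?_⟩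
    · refine lt_of_le_of_lt (Nat.one_div_le_one_div ?_) hM
      exact (le_max_right N M).trans (hg.id_le _)
    · rw [Real.sqrt_lt' hδ]; linarith [hs.nonneg (w - x (g (max N M)))]
    · rw [Real.sqrt_lt' hδ]; linarith [ha.nonneg (w - x (g (max N M)))]
  refine ⟨w, ?_, ?_, fun φ hφ => ?_⟩
  · have h1 : √(s w w) = 1 := by
      refine le_antisymm (le_of_forall_pos_le_add fun δ hδ => ?_)
        (le_of_forall_pos_le_add fun δ hδ => ?_)
      · obtain ⟨i, -, -, hi⟩ := hwa δ hδ
        have := hs.sqrt_apply_add_le (x (g i)) (w - x (g i))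
        rw [add_sub_cancel, hx1, Real.sqrt_one] at this
        linarith
      · obtain ⟨i, -, -, hi⟩ := hwa δ hδ
        have := hs.sqrt_apply_add_le w (x (g i) - w)
        rw [add_sub_cancel, hx1, Real.sqrt_one, SemiInner.apply_sub_comm (B := s)] at this
        linarith
    rwa [Real.sqrt_eq_one] at h1
  · have h1 : √(a w w) ≤ √μ := by
      refine le_of_forall_pos_le_add fun δ hδ => ?_
      have hδ' : 0 < min (δ / 2) ((δ / 2) ^ 2) := by positivity
      obtain ⟨i, h1, h2, -⟩ := hwa _ hδ'
      have h3 := ha.sqrt_apply_add_le (x (g i)) (w - x (g i))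
      rw [add_sub_cancel] at h3
      have h4 : √(a (x (g i)) (x (g i))) ≤ √μ + δ / 2 := by
        rw [sqrt_le_left (by positivity)]
        nlinarith [hxa (g i), h1.trans_le (min_le_right _ _), sq_sqrt hμ0, sqrt_nonneg μ]
      linarith [h2.trans_le (min_le_left _ _)]
    exact (Real.sqrt_le_sqrt_iff hμ0).1 h1
  · by_contra hne
    obtain ⟨i, -, -, hi⟩ := hwa (|s w φ| / (√(s φ φ) + 1)) (by positivity)
    have h1 := hs.abs_apply_le (w - x (g i)) φ
    have h3 : s (w - x (g i)) φ = s w φ := by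
      rw [map_sub, LinearMap.sub_apply, hφ _ (hxS _), sub_zero]
    rw [h3] at h1
    have h2 : 0 < |s w φ| := abs_pos.2 hne
    rw [lt_div_iff₀ (by positivity)] at hi
    nlinarith [sqrt_nonneg (s φ φ), sqrt_nonneg (s (w - x (g i)) (w - x (g i)))]

/-- On the orthogonal complement of the first eigenvectors, the Rayleigh quotient is at least the
next eigenvalue. -/
theorem spectral_gap (ha : SemiInner a) (hs : SemiInner s)
    (hcomplete : FormComplete (a + s) univ) {lam : ℕ → ℝ} {φ : ℕ → V} (hmono : Monotone lam)
    (heig : ∀ k v, a (φ k) v = lam k * s (φ k) v) (hne : ∀ k, s (φ k) (φ k) ≠ 0)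
    (horth : ∀ k k', k ≠ k' → s (φ k) (φ k') = 0)
    (hex : ∀ μ w, (∀ v, a w v = μ * s w v) → (∀ k, s w (φ k) = 0) → s w w = 0) (L : ℕ)
    {C ε K : ℝ} (hε : 0 ≤ ε) (hεL : 2 * (ε * lam L) ≤ 1)
    (hℓ : ∀ q p, ℓ q p ^ 2 ≤ C * (a p p + s p p))
    (hcomp : ∀ p, s p p ≤ ε * a p p + K * ∑ q, ℓ q p ^ 2) {p : V}
    (hp : ∀ k < L, s p (φ k) = 0) : lam L * s p p ≤ a p p := by
  by_contra hlt
  rw [not_le] at hlt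
  let S : Submodule ℝ V := ⨅ k : Fin L, LinearMap.ker (s.flip (φ k))
  have hmem : ∀ q, q ∈ S ↔ ∀ k < L, s q (φ k) = 0 := by
    intro q
    simp only [S, Submodule.mem_iInf, LinearMap.mem_ker]
    exact ⟨fun h k hk => h ⟨k, hk⟩, fun h k => h k k.2⟩
  set Q : Set ℝ := {r | ∃ q ∈ S, s q q = 1 ∧ a q q = r}
  have hnorm : ∀ q ∈ S, s q q ≠ 0 → a q q / s q q ∈ Q := by
    intro q hq h0
    have h1 : 0 < s q q := (hs.nonneg q).lt_of_ne (Ne.symm h0)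
    refine ⟨(√(s q q))⁻¹ • q, S.smul_mem _ hq, ?_, ?_⟩ <;>
    rw [SemiInner.apply_smul_smul, inv_pow, sq_sqrt h1.le]
    · field_simp
    · field_simp
  have hQb : BddBelow Q := ⟨0, by rintro _ ⟨q, -, -, rfl⟩; exact ha.nonneg q⟩
  have hsp : s p p ≠ 0 := by
    intro h0
    rw [h0, mul_zero] at hlt
    exact absurd (ha.nonneg p) (not_le.2 hlt)
  have hpS : p ∈ S := (hmem p).2 hp
  have hQne : Q.Nonempty := ⟨_, hnorm p hpS hsp⟩
  set μ := sInf Q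
  have hμ0 : 0 ≤ μ := le_csInf hQne (by rintro _ ⟨q, -, -, rfl⟩; exact ha.nonneg q)
  have hμL : μ < lam L := by
    refine (csInf_le hQb (hnorm p hpS hsp)).trans_lt ?_
    rwa [div_lt_iff₀ ((hs.nonneg p).lt_of_ne (Ne.symm hsp))]
  have hμS : ∀ q ∈ S, μ * s q q ≤ a q q := by
    intro q hq
    by_cases h0 : s q q = 0
    · rw [h0, mul_zero]; exact ha.nonneg q
    · rw [← le_div_iff₀ ((hs.nonneg q).lt_of_ne (Ne.symm h0))]
      exact csInf_le hQb (hnorm q hq h0)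
  obtain ⟨w, hw1, hwa, hwφ⟩ := exists_minimizer ha hs hcomplete hε hμ0
    (by nlinarith) hℓ hcomp hμS fun δ hδ => by
      obtain ⟨_, ⟨q, hq, hq1, rfl⟩, hlt⟩ := exists_lt_of_csInf_lt hQne (lt_add_of_pos_right μ hδ)
      exact ⟨q, hq, hq1, hlt⟩
  have hwS : w ∈ S := (hmem w).2 fun k hk => hwφ _ fun q hq => (hmem q).1 hq k hk
  have hwμ : a w w = μ := le_antisymm hwa (by simpa [hw1] using hμS w hwS)
  have hb : SemiInner ((a - μ • s).restrict S) :=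
    ⟨fun x y => by simp [LinearMap.BilinForm.restrict_apply, ha.symm (x : V), hs.symm (x : V)],
      fun x => by
        have := hμS x x.2
        simpa [LinearMap.BilinForm.restrict_apply] using this⟩
  have hortho : ∀ v ∈ S, a w v = μ * s w v := by
    intro v hv
    have h1 := hb.apply_eq_zero_of_self (x := ⟨w, hwS⟩)
      (by simp [LinearMap.BilinForm.restrict_apply, hw1, hwμ]) ⟨v, hv⟩
    simp only [LinearMap.BilinForm.restrict_apply, LinearMap.sub_apply, LinearMap.smul_apply,
      smul_eq_mul, LinearMap.domRestrict_apply] at h1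
    linarith
  have hlow : ∀ k, a w (φ k) = lam k * s w (φ k) := fun k => by
    rw [ha.symm, heig, hs.symm]
  have hall : ∀ v, a w v = μ * s w v := by
    intro v
    set z := ∑ k ∈ Finset.range L, (s v (φ k) / s (φ k) (φ k)) • φ k
    have hz : v - z ∈ S := by
      rw [hmem]
      intro k hk
      simp only [z]
      rw [map_sub, LinearMap.sub_apply, map_sum, LinearMap.sum_apply,
        sum_eq_single_of_mem k (Finset.mem_range.2 hk) fun i _ hi => by
          simp [horth i k hi]]
      simp only [map_smul, LinearMap.smul_apply, smul_eq_mul]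
      rw [div_mul_cancel₀ _ (hne k), sub_self]
    have hz0 : ∀ B : BilinForm ℝ V, (∀ k < L, B w (φ k) = 0) → B w z = 0 := by
      intro B hB
      simp only [z]
      rw [map_sum]
      refine sum_eq_zero fun k hk => ?_
      rw [map_smul, hB k (Finset.mem_range.1 hk), smul_zero]
    have h1 := hortho _ hz
    have hsw : ∀ k < L, s w (φ k) = 0 := (hmem w).1 hwS
    rw [map_sub, map_sub, hz0 s hsw, hz0 a fun k hk => by rw [hlow, hsw k hk, mul_zero], sub_zero,
      sub_zero] at h1
    exact h1
  have h0 := hex μ w hall fun k => by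
    by_cases hk : k < L
    · exact (hmem w).1 hwS k hk
    · have h1 := hlow k
      rw [hall] at h1
      have h2 : (lam k - μ) * s w (φ k) = 0 := by linarith
      rcases mul_eq_zero.1 h2 with h3 | h3
      · have := hmono (not_lt.1 hk); linarith
      · exact h3
  rw [hw1] at h0
  exact one_ne_zero h0

/-- Minimisers under linear constraints. -/
theorem exists_constrained_minimal {B : BilinForm ℝ V} (hB : SemiInner B)
    (hcomplete : FormComplete B univ) {Q : Type*} (f : Q → V →ₗ[ℝ] ℝ) (C : Q → ℝ)
    (hf : ∀ q v, f q v ^ 2 ≤ C q * B v v) (p : V) :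
    ∃ g, (∀ q, f q g = f q p) ∧ ∀ v, (∀ q, f q v = 0) → B g v = 0 := by
  obtain ⟨g, hg, hmin⟩ := hB.exists_minimal (C := {g | ∀ q, f q g = f q p}) ⟨p, fun _ => rfl⟩
    (fun x hx y hy q => by
      rw [map_smul, map_add, hx q, hy q, smul_eq_mul]; ring)
    (fun x hx hc => by
      obtain ⟨y, -, hy⟩ := hcomplete x (fun _ => Set.mem_univ _) hc
      refine ⟨y, fun q => ?_, hy⟩
      by_contra hne
      have h1 : 0 < (f q p - f q y) ^ 2 := by
        have : f q p - f q y ≠ 0 := sub_ne_zero.2 (Ne.symm hne)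
        positivity
      obtain ⟨N, hN⟩ := hy ((f q p - f q y) ^ 2 / (|C q| + 1)) (by positivity)
      have h2 := hN N le_rfl
      have h3 := hf q (x N - y)
      rw [map_sub, hx N q] at h3
      rw [lt_div_iff₀ (by positivity)] at h2
      have h4 := hB.nonneg (x N - y)
      nlinarith [le_abs_self (C q)])
  refine ⟨g, hg, fun v hv => hB.apply_eq_zero_of_forall_le fun t => hmin _ fun q => ?_⟩
  rw [map_add, map_smul, hv q, smul_zero, add_zero, hg q]

/-- Riesz representation. -/
theorem exists_riesz {B : BilinForm ℝ V} (hB : SemiInner B)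
    (hcomplete : FormComplete B univ) (f : V →ₗ[ℝ] ℝ) {C : ℝ}
    (hf : ∀ v, f v ^ 2 ≤ C * B v v) : ∃ z, ∀ v, B z v = f v := by
  by_cases h0 : ∀ p, f p = 0
  · exact ⟨0, fun v => by simp [h0]⟩
  push Not at h0
  obtain ⟨p, hp⟩ := h0
  obtain ⟨g, hg, hmin⟩ := exists_constrained_minimal hB hcomplete (fun _ : Unit => f) (fun _ => C)
    (fun _ => hf) p
  have hgp : f g = f p := hg ()
  have hg0 : B g g ≠ 0 := by
    intro h
    have h1 := hf g
    rw [h, mul_zero, hgp] at h1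
    have : 0 < f p ^ 2 := by positivity
    linarith
  refine ⟨(f p / B g g) • g, fun v => ?_⟩
  have h1 := hmin (v - (f v / f p) • g) fun _ => by
    rw [map_sub, map_smul, hgp, smul_eq_mul, div_mul_cancel₀ _ hp, sub_self]
  rw [map_sub, map_smul, sub_eq_zero, smul_eq_mul] at h1
  rw [map_smul, LinearMap.smul_apply, smul_eq_mul, h1]
  field_simp

end SpectralGap

/-! ### Energy and mass of fields -/

section Energy

variable {n : ℕ} {G : Geometry n} {κmin κmax : ℝ} {R O : Set (Euc (n + 1))}

/-- The fields whose components lie in the closure of the test functions in `O`. -/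
def fieldSub (G : Geometry n) (O R : Set (Euc (n + 1))) (hR : MeasurableSet R)
    (hRΩ : R ⊆ G.Ω) : Submodule ℝ (Fields G) :=
  Submodule.pi univ fun _ => closureSub G O R hR hRΩ

theorem mem_fieldSub {hR : MeasurableSet R} {hRΩ : R ⊆ G.Ω} {p : Fields G} :
    p ∈ fieldSub G O R hR hRΩ ↔ ∀ i, MemClosure G O R (p i) := by
  simp [fieldSub, Submodule.mem_pi, mem_closureSub]

theorem sqI_of_mem {hR : MeasurableSet R} {hRΩ : R ⊆ G.Ω} {p : Fields G}
    (hp : p ∈ fieldSub G O R hR hRΩ) : SqI G R p := fun i =>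
  ⟨(mem_fieldSub.1 hp i).memLp_vl hR hRΩ, (mem_fieldSub.1 hp i).memLp_gr hR hRΩ⟩

/-- The energy over `R`. -/
def eng (κ : Permeability G κmin κmax) (τ : ℝ) (R : Set (Euc (n + 1))) (p : Fields G) :
    ℝ := ∫ y, aDen κ τ p p y ∂mm G R

/-- The weighted mass over `R`. -/
def mas (κ : Permeability G κmin κmax) (wt : Pts G → ℝ) (R : Set (Euc (n + 1)))
    (p : Fields G) : ℝ := ∫ y, sDen κ wt p p y ∂mm G R

/-- The squared norm of the values. -/
def valSq (G : Geometry n) (R : Set (Euc (n + 1))) (p : Fields G) : ℝ :=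
  ∑ i, ip (mm G R) (vl (p i)) (vl (p i))

/-- The squared norm of the gradients. -/
def gradSq (G : Geometry n) (R : Set (Euc (n + 1))) (p : Fields G) : ℝ :=
  ∑ i, ip (mm G R) (gr (p i)) (gr (p i))

theorem valSq_nonneg (p : Fields G) : 0 ≤ valSq G R p := sum_nonneg fun _ _ => ip_self_nonneg _

theorem gradSq_nonneg (p : Fields G) : 0 ≤ gradSq G R p := sum_nonneg fun _ _ => ip_self_nonneg _

theorem integrable_vl_sq {p : Fields G} (hp : SqI G R p) (i : Fin 2) :
    Integrable (fun y => vl (p i) y ^ 2) (mm G R) := by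
  simpa only [norm_eq_abs, sq_abs] using integrable_norm_sq (hp i).1

theorem valSq_eq {p : Fields G} (hp : SqI G R p) :
    valSq G R p = ∫ y, ∑ i, vl (p i) y ^ 2 ∂mm G R := by
  rw [integral_finsetSum _ fun i _ => integrable_vl_sq hp i, valSq]
  simp only [ip_self, norm_eq_abs, sq_abs]

theorem gradSq_eq {p : Fields G} (hp : SqI G R p) :
    gradSq G R p = ∫ y, ∑ i, ‖gr (p i) y‖ ^ 2 ∂mm G R := by
  rw [integral_finsetSum _ fun i _ => integrable_norm_sq (hp i).2, gradSq]
  simp only [ip_self]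

section

variable (hκ : 0 < κmin) (κ : Permeability G κmin κmax) {τ : ℝ} (hτ : 0 ≤ τ)
  (hR : MeasurableSet R) (hRΩ : R ⊆ G.Ω)

include hκ hτ hR hRΩ

theorem le_eng {p : Fields G} (hp : SqI G R p) : κmin * gradSq G R p ≤ eng κ τ R p := by
  rw [gradSq_eq hp, ← integral_const_mul, eng]
  refine integral_mono_ae ((integrable_finsetSum _ fun i _ =>
    integrable_norm_sq (hp i).2).const_mul _) (integrable_aDen hκ.le κ τ hR hRΩ hp hp) ?_
  filter_upwards [ae_mm_legit hR hRΩ] with y hy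
  rw [aDen_self, mul_sum]
  have h1 : 0 ≤ τ * (bulkInd y * (vl (p 0) y - vl (p 1) y) ^ 2) := by
    have := (bulkInd_mem y).1
    positivity
  have h2 : ∑ i, κmin * ‖gr (p i) y‖ ^ 2 ≤ ∑ i, kap κ i y * ‖gr (p i) y‖ ^ 2 :=
    sum_le_sum fun i _ =>
      mul_le_mul_of_nonneg_right (kap_bounds κ i hy).1 (sq_nonneg _)
  linarith

theorem eng_le {p : Fields G} (hp : SqI G R p) :
    eng κ τ R p ≤ κmax * gradSq G R p + 2 * τ * valSq G R p := by
  have hg := integrable_finsetSum Finset.univ fun i _ => integrable_norm_sq (hp i).2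
  have hv := integrable_finsetSum Finset.univ fun i _ => integrable_vl_sq hp i
  rw [gradSq_eq hp, valSq_eq hp, ← integral_const_mul, ← integral_const_mul,
    ← integral_add (hg.const_mul _) (hv.const_mul _), eng]
  refine integral_mono_ae (integrable_aDen hκ.le κ τ hR hRΩ hp hp)
    ((hg.const_mul _).add (hv.const_mul _)) ?_
  filter_upwards [ae_mm_legit hR hRΩ] with y hy
  rw [aDen_self]
  have h2 : ∑ i, kap κ i y * ‖gr (p i) y‖ ^ 2 ≤ κmax * ∑ i, ‖gr (p i) y‖ ^ 2 := by
    rw [mul_sum]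
    exact sum_le_sum fun i _ =>
      mul_le_mul_of_nonneg_right (kap_bounds κ i hy).2 (sq_nonneg _)
  have h3 : bulkInd y * (vl (p 0) y - vl (p 1) y) ^ 2 ≤ 2 * ∑ i, vl (p i) y ^ 2 := by
    rw [sum_univ_two]
    obtain ⟨h4, h5⟩ := bulkInd_mem y
    have : bulkInd y * (vl (p 0) y - vl (p 1) y) ^ 2 ≤ 1 * (vl (p 0) y - vl (p 1) y) ^ 2 :=
      mul_le_mul_of_nonneg_right h5 (sq_nonneg _)
    nlinarith [sq_nonneg (vl (p 0) y + vl (p 1) y)]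
  linarith [mul_le_mul_of_nonneg_left h3 hτ]

theorem eng_nonneg (p : Fields G) : 0 ≤ eng κ τ R p := by
  refine integral_nonneg_of_ae ?_
  filter_upwards [ae_mm_legit hR hRΩ] with y hy
  exact aDen_self_nonneg hκ.le κ hτ p hy

end

/-- The energy form. -/
def engForm (hκ : 0 < κmin) (κ : Permeability G κmin κmax) (τ : ℝ)
    (hR : MeasurableSet R) (hRΩ : R ⊆ G.Ω) (S : Submodule ℝ (Fields G)) (hS : ∀ p ∈ S, SqI G R p) :
    BilinForm ℝ S :=
  densForm (mm G R) (aDen κ τ) S fun _ hp _ hv =>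
    integrable_aDen hκ.le κ τ hR hRΩ (hS _ hp) (hS _ hv)

section

variable (hκ : 0 < κmin) (κ : Permeability G κmin κmax) {τ : ℝ} (hτ : 0 ≤ τ)
  (hR : MeasurableSet R) (hRΩ : R ⊆ G.Ω) {S : Submodule ℝ (Fields G)} (hS : ∀ p ∈ S, SqI G R p)

include hτ in
theorem engForm_semiInner : SemiInner (engForm hκ κ τ hR hRΩ S hS) :=
  densForm_semiInner (fun p v y => aDen_symm κ τ p v y) fun p => by
    filter_upwards [ae_mm_legit hR hRΩ] with y hy
    exact aDen_self_nonneg hκ.le κ hτ p hy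

theorem engForm_apply (p v : S) :
    engForm hκ κ τ hR hRΩ S hS p v = ∫ y, aDen κ τ p v y ∂mm G R := rfl

theorem engForm_self (p : S) : engForm hκ κ τ hR hRΩ S hS p p = eng κ τ R p := rfl

end

variable {θ H : ℝ} (T : CoarseMesh G θ H)

theorem mas_nonneg (hκ : 0 < κmin) (κ : Permeability G κmin κmax)
    (hR : MeasurableSet R) (hRΩ : R ⊆ G.Ω) (p : Fields G) : 0 ≤ mas κ (meshWeight T) R p := by
  refine integral_nonneg_of_ae ?_
  filter_upwards [ae_mm_legit hR hRΩ] with y hy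
  exact sDen_self_nonneg hκ.le κ p (meshWeight_nonneg y) hy

variable (hθ : 1 ≤ θ) (hH : 0 < H) (hκ : 0 < κmin) (κ : Permeability G κmin κmax)
  (hR : MeasurableSet R) (hRΩ : R ⊆ G.Ω)

section

include hθ hH hκ hR hRΩ

theorem integrable_mas {p v : Fields G} (hp : SqI G R p) (hv : SqI G R v) :
    Integrable (sDen κ (meshWeight T) p v) (mm G R) :=
  integrable_sDen hκ.le κ hR hRΩ measurable_meshWeight.aestronglyMeasurable
    (ae_meshWeight_le T hθ hH hR hRΩ) (fun i => (hp i).1) fun i => (hv i).1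

theorem mas_le (hκ' : 0 ≤ κmax) {p : Fields G} (hp : SqI G R p) :
    mas κ (meshWeight T) R p ≤ κmax * (weightMax n θ / H ^ 2) * valSq G R p := by
  rw [valSq_eq hp, ← integral_const_mul, mas]
  refine integral_mono_ae (integrable_mas T hθ hH hκ κ hR hRΩ hp hp)
    ((integrable_finsetSum Finset.univ fun i _ => integrable_vl_sq hp i).const_mul _) ?_
  filter_upwards [ae_mm_legit hR hRΩ] with y hy
  rw [sDen_self, mul_sum]
  exact sum_le_sum fun i _ => mul_le_mul_of_nonneg_right
    (mul_le_mul (kap_bounds κ i hy).2 (meshWeight_le hθ hH hy) (meshWeight_nonneg y) hκ')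
    (sq_nonneg _)

theorem le_mas {p : Fields G} (hp : SqI G R p) :
    κmin * (weightMin n θ / H ^ 2) * ∑ i, ip (volume.restrict R) (p i).val (p i).val ≤
      mas κ (meshWeight T) R p := by
  have hint := integrable_mas T hθ hH hκ κ hR hRΩ hp hp
  have hv : ∀ i, MemLp (p i).val 2 (volume.restrict R) := fun i => (memLp_mm_iff.1 (hp i).1).1
  have hnn := ae_mm_iff.1 (ae_mm_legit hR hRΩ)
  have hi : Integrable (fun x => sDen κ (meshWeight T) p p (Sum.inl x)) (volume.restrict R) := by
    have h := hint
    rw [mm, integrable_add_measure, (measurableEmbedding_bulk).integrable_map_iff] at h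
    exact h.1
  rw [mas, integral_mm hint]
  refine le_add_of_le_of_nonneg ?_ (sum_nonneg fun l _ => integral_nonneg_of_ae ?_)
  · simp only [ip_self, norm_eq_abs, sq_abs]
    have hv2 : ∀ i, Integrable (fun x => (p i).val x ^ 2) (volume.restrict R) := fun i => by
      simpa only [norm_eq_abs, sq_abs] using integrable_norm_sq (hv i)
    rw [← integral_finsetSum _ fun i _ => hv2 i, ← integral_const_mul]
    refine integral_mono_ae ((integrable_finsetSum _ fun i _ => hv2 i).const_mul _) hi ?_
    filter_upwards [hnn.1, ae_restrict_of_ae_restrict_of_subset hRΩ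
      (le_meshWeight_bulk (T := T) hθ hH)] with x hx hw
    rw [sDen_self, mul_sum]
    refine sum_le_sum fun i _ => mul_le_mul_of_nonneg_right ?_ (sq_nonneg _)
    exact mul_le_mul (kap_bounds κ i hx).1 hw (by have := weightMin_pos (n := n) hθ; positivity)
      (hκ.le.trans (kap_bounds κ i hx).1)
  · filter_upwards [hnn.2 l] with t ht
    exact sDen_self_nonneg hκ.le κ p (meshWeight_nonneg _) ht

end

/-- The mass form. -/
def masForm (S : Submodule ℝ (Fields G)) (hS : ∀ p ∈ S, SqI G R p) : BilinForm ℝ S :=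
  densForm (mm G R) (sDen κ (meshWeight T)) S fun _ hp _ hv =>
    integrable_mas T hθ hH hκ κ hR hRΩ (hS _ hp) (hS _ hv)

variable {S : Submodule ℝ (Fields G)} (hS : ∀ p ∈ S, SqI G R p)

theorem masForm_semiInner : SemiInner (masForm T hθ hH hκ κ hR hRΩ S hS) :=
  densForm_semiInner (fun p v y => sDen_symm κ _ p v y) fun p => by
    filter_upwards [ae_mm_legit hR hRΩ] with y hy
    exact sDen_self_nonneg hκ.le κ p (meshWeight_nonneg y) hy

theorem masForm_apply (p v : S) :
    masForm T hθ hH hκ κ hR hRΩ S hS p v = ∫ y, sDen κ (meshWeight T) p v y ∂mm G R := rfl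

theorem masForm_self (p : S) :
    masForm T hθ hH hκ κ hR hRΩ S hS p p = mas κ (meshWeight T) R p := rfl

end Energy

section Complete

variable {n : ℕ} {G : Geometry n} {R O : Set (Euc (n + 1))}

/-- A form which is equivalent to the norm is complete. -/
theorem formComplete_of_le {hR : MeasurableSet R} {hRΩ : R ⊆ G.Ω}
    {B : BilinForm ℝ (fieldSub G O R hR hRΩ)} {c C : ℝ} (hc : 0 < c)
    (h1 : ∀ p : fieldSub G O R hR hRΩ, c * (valSq G R p + gradSq G R p) ≤ B p p)
    (h2 : ∀ p : fieldSub G O R hR hRΩ, B p p ≤ C * (valSq G R p + gradSq G R p)) : FormComplete B univ := by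
  intro x _ hx
  have hle : ∀ (i : Fin 2) (p : Fields G), ip (mm G R) (vl (p i)) (vl (p i)) ≤ valSq G R p ∧
      ip (mm G R) (gr (p i)) (gr (p i)) ≤ gradSq G R p := fun i p =>
    ⟨single_le_sum (f := fun i => ip (mm G R) (vl (p i)) (vl (p i)))
      (fun _ _ => ip_self_nonneg _) (mem_univ i),
      single_le_sum (f := fun i => ip (mm G R) (gr (p i)) (gr (p i)))
      (fun _ _ => ip_self_nonneg _) (mem_univ i)⟩
  have hsmall : ∀ ε > 0, ∃ N, ∀ k ≥ N, ∀ l ≥ N, valSq G R (x k - x l : Fields G) < ε ∧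
      gradSq G R (x k - x l : Fields G) < ε := by
    intro ε hε
    obtain ⟨N, hN⟩ := hx (c * ε) (by positivity)
    refine ⟨N, fun k hk l hl => ?_⟩
    have h3 := (h1 (x k - x l)).trans_lt (hN k hk l hl)
    have h4 := lt_of_mul_lt_mul_left h3 hc.le
    have h5 := valSq_nonneg (R := R) (x k - x l : Fields G)
    have h6 := gradSq_nonneg (R := R) (x k - x l : Fields G)
    rw [coe_sub] at h4
    constructor <;> linarith
  have hlim := fun i : Fin 2 => exists_limit_memClosure hR hRΩ
    (w := fun k => (x k : Fields G) i) (fun k => mem_fieldSub.1 (x k).2 i)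
    (fun ε hε => by
      obtain ⟨N, hN⟩ := hsmall ε hε
      exact ⟨N, fun k hk l hl => (hle i (x k - x l : Fields G)).1.trans_lt (hN k hk l hl).1⟩)
    (fun ε hε => by
      obtain ⟨N, hN⟩ := hsmall ε hε
      exact ⟨N, fun k hk l hl => (hle i (x k - x l : Fields G)).2.trans_lt (hN k hk l hl).2⟩)
  choose w hw hwv hwg using hlim
  refine ⟨⟨w, mem_fieldSub.2 hw⟩, Set.mem_univ _, fun ε hε => ?_⟩
  have hδ : 0 < ε / (4 * (|C| + 1)) := by positivity
  choose N1 hN1 using fun i => hwv i _ hδ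
  choose N2 hN2 using fun i => hwg i _ hδ
  refine ⟨max (max (N1 0) (N1 1)) (max (N2 0) (N2 1)), fun k hk => ?_⟩
  simp only [ge_iff_le, max_le_iff] at hk
  have h3 := h2 (x k - ⟨w, mem_fieldSub.2 hw⟩)
  have h4 : valSq G R (x k - w : Fields G) + gradSq G R (x k - w : Fields G) < ε / (|C| + 1) := by
    rw [valSq, gradSq, sum_univ_two, sum_univ_two]
    have a1 := hN1 0 k hk.1.1
    have a2 := hN1 1 k hk.1.2
    have a3 := hN2 0 k hk.2.1
    have a4 := hN2 1 k hk.2.2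
    have a5 : 4 * (ε / (4 * (|C| + 1))) = ε / (|C| + 1) := by field_simp
    simp only [Pi.sub_apply]
    linarith
  rw [coe_sub] at h3
  have h5 := valSq_nonneg (R := R) (x k - w : Fields G)
  have h6 := gradSq_nonneg (R := R) (x k - w : Fields G)
  rw [lt_div_iff₀ (by positivity)] at h4
  refine h3.trans_lt ?_
  change C * (valSq G R (x k - w : Fields G) + gradSq G R (x k - w : Fields G)) < ε
  nlinarith [le_abs_self C]

end Complete

/-! ### The spectral gap on an element -/

section LocalGap

variable {n : ℕ} {G : Geometry n} {κmin κmax θ H : ℝ}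

theorem Permeability.min_le_max (κ : Permeability G κmin κmax) (h : G.Ω.Nonempty) :
    κmin ≤ κmax := by
  obtain ⟨x, hx⟩ := h
  exact (κ.bulk_bounds 0 x hx).1.trans (κ.bulk_bounds 0 x hx).2

theorem nonempty_of_elem {T : CoarseMesh G θ H} (j : Fin T.numElem) : G.Ω.Nonempty := by
  rw [← closure_nonempty_iff]
  exact ⟨_, element_subset T j (refMap_mem T (centre_mem (n := n)))⟩

/-- The fields on an element. -/
abbrev cellSub (T : CoarseMesh G θ H) (j : Fin T.numElem) : Submodule ℝ (Fields G) :=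
  fieldSub G G.Ω (cell T j) (meas_cell T j) (cell_subset T j)

/-- The mean over the subcube `q.2` of the component `q.1`. -/
def subLin (hθ : 1 ≤ θ) (hH : 0 < H) (T : CoarseMesh G θ H) (j : Fin T.numElem) {N : ℕ}
    (q : Fin 2 × (Fin (n + 1) → Fin N)) : cellSub T j →ₗ[ℝ] ℝ where
  toFun p := subMean T j q.2 (p.1 q.1)
  map_add' p p' := subMean_add hθ hH j q.2 (sqI_of_mem p.2 q.1).1 (sqI_of_mem p'.2 q.1).1
  map_smul' c p := subMean_smul j q.2 c _

theorem exists_valSq_le (G : Geometry n) (hθ : 1 ≤ θ) : ∃ C : ℝ, 0 < C ∧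
    ∀ (H : ℝ) (hH : 0 < H) (T : CoarseMesh G θ H) (j : Fin T.numElem) (N : ℕ), 0 < N →
      ∃ K : ℝ, 0 ≤ K ∧ ∀ p : cellSub T j, valSq G (cell T j) p ≤ C * H / N * gradSq G (cell T j) p +
          K * ∑ q : Fin 2 × (Fin (n + 1) → Fin N), subLin hθ hH T j q p ^ 2 := by
  obtain ⟨C, hC, h⟩ := exists_cell_estimate (n := n) G hθ
  refine ⟨C, hC, fun H hH T j N hN => ?_⟩
  obtain ⟨K, hK, h⟩ := h H hH T j N hN
  refine ⟨K, hK, fun p => ?_⟩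
  rw [valSq, gradSq, Fintype.sum_prod_type, mul_sum, mul_sum, ← sum_add_distrib]
  exact sum_le_sum fun i _ => h _ (mem_fieldSub.1 p.2 i)

variable (hθ : 1 ≤ θ) (hH : 0 < H) (hκ : 0 < κmin) (κ : Permeability G κmin κmax) {τ : ℝ}
  (hτ : 0 ≤ τ)

/-- The mass on an element is compact relative to the energy. -/
theorem exists_mas_le (G : Geometry n) (hθ : 1 ≤ θ) : ∃ C : ℝ, 0 < C ∧
    ∀ (H : ℝ) (hH : 0 < H) (T : CoarseMesh G θ H) (j : Fin T.numElem) (κmin κmax : ℝ)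
      (_ : 0 < κmin) (κ : Permeability G κmin κmax) (τ : ℝ) (_ : 0 ≤ τ) (N : ℕ), 0 < N →
      ∃ K : ℝ, 0 ≤ K ∧ ∀ p : cellSub T j, mas κ (meshWeight T) (cell T j) p ≤
        C * κmax / (H * κmin * N) * eng κ τ (cell T j) p +
          K * ∑ q : Fin 2 × (Fin (n + 1) → Fin N), subLin hθ hH T j q p ^ 2 := by
  obtain ⟨C, hC, h⟩ := exists_valSq_le (n := n) G hθ
  refine ⟨C * (weightMax n θ + 1), ?_, fun H hH T j κmin κmax hκ κ τ hτ N hN => ?_⟩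
  · have := weightMax_nonneg (n := n) (θ := θ)
    positivity
  have hW := weightMax_nonneg (n := n) (θ := θ)
  obtain ⟨K, hK, h⟩ := h H hH T j N hN
  have hκ' : 0 < κmax := hκ.trans_le (κ.min_le_max (nonempty_of_elem j))
  have hN' : (0 : ℝ) < N := Nat.cast_pos.2 hN
  refine ⟨κmax * (weightMax n θ / H ^ 2) * K, by positivity, fun p => ?_⟩
  have hp := sqI_of_mem p.2
  have h1 := mas_le T hθ hH hκ κ (meas_cell T j) (cell_subset T j) hκ'.le hp
  have h2 := le_eng hκ κ hτ (meas_cell T j) (cell_subset T j) hp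
  have h3 : C * H / N * gradSq G (cell T j) p ≤ C * H / N * (eng κ τ (cell T j) p / κmin) := by
    refine mul_le_mul_of_nonneg_left ?_ (by positivity)
    rw [le_div_iff₀ hκ]; linarith
  have h4 := mul_le_mul_of_nonneg_left ((h p).trans (add_le_add_left h3 _))
    (show 0 ≤ κmax * (weightMax n θ / H ^ 2) by positivity)
  have h5 := eng_nonneg hκ κ hτ (meas_cell T j) (cell_subset T j) p
  have h6 : κmax * (weightMax n θ / H ^ 2) * (C * H / N * (eng κ τ (cell T j) p / κmin)) ≤
      C * (weightMax n θ + 1) * κmax / (H * κmin * N) * eng κ τ (cell T j) p := by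
    have : κmax * (weightMax n θ / H ^ 2) * (C * H / N * (eng κ τ (cell T j) p / κmin)) =
      C * weightMax n θ * κmax / (H * κmin * N) * eng κ τ (cell T j) p := by
        field_simp
    rw [this]
    gcongr
    linarith
  rw [mul_add, ← mul_assoc _ K] at h4
  linarith

include hκ hτ in
/-- Energy and mass control the norm on an element. -/
theorem exists_le_eng_add_mas (T : CoarseMesh G θ H) (j : Fin T.numElem) : ∃ C : ℝ, 0 < C ∧
    (∀ p : cellSub T j, valSq G (cell T j) p + gradSq G (cell T j) p ≤
      C * (eng κ τ (cell T j) p + mas κ (meshWeight T) (cell T j) p)) ∧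
    ∀ (N : ℕ) (q : Fin 2 × (Fin (n + 1) → Fin N)), ∃ C' : ℝ, ∀ p : cellSub T j,
      subLin hθ hH T j q p ^ 2 ≤ C' * mas κ (meshWeight T) (cell T j) p := by
  have hm := weightMin_pos (n := n) hθ
  have hsub : ∀ (N : ℕ) (q : Fin 2 × (Fin (n + 1) → Fin N)), ∃ C' : ℝ, 0 ≤ C' ∧
      ∀ p : cellSub T j, subLin hθ hH T j q p ^ 2 ≤ C' * mas κ (meshWeight T) (cell T j) p := by
    intro N q
    set A := (θ / H) ^ (n + 1) * ((pushVol T j (subcube q.2)).real univ)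
    have hA : 0 ≤ A := by positivity
    refine ⟨A * (κmin * (weightMin n θ / H ^ 2))⁻¹, by positivity, fun p => ?_⟩
    have h1 := subMean_sq_le_bulk hθ hH j q.2 (sqI_of_mem p.2 q.1).1
    have h2 := le_mas T hθ hH hκ κ (meas_cell T j) (cell_subset T j) (sqI_of_mem p.2)
    have h3 := single_le_sum (f := fun i => ip (volume.restrict (cell T j)) (p.1 i).val (p.1 i).val)
      (fun _ _ => ip_self_nonneg _) (mem_univ q.1)
    have h4 : 0 < κmin * (weightMin n θ / H ^ 2) := by positivity
    refine h1.trans ?_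
    rw [mul_assoc A]
    refine mul_le_mul_of_nonneg_left (h3.trans ?_) hA
    rw [← div_eq_inv_mul, le_div_iff₀ h4]
    linarith
  obtain ⟨C, hC, h⟩ := exists_valSq_le (n := n) G hθ
  obtain ⟨K, hK, h⟩ := h H hH T j 1 one_pos
  choose C' hC' hsub using hsub
  refine ⟨C * H / κmin + 1 / κmin + K * ∑ q, C' 1 q, ?_, fun p => ?_, fun N q => ⟨C' N q, hsub N q⟩⟩
  · have : 0 ≤ K * ∑ q, C' 1 q := mul_nonneg hK (sum_nonneg fun q _ => hC' 1 q)
    positivity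
  · have h2 := le_eng hκ κ hτ (meas_cell T j) (cell_subset T j) (sqI_of_mem p.2)
    have hE := eng_nonneg hκ κ hτ (meas_cell T j) (cell_subset T j) p
    have hM := mas_nonneg T hκ κ (meas_cell T j) (cell_subset T j) p
    have h3 : gradSq G (cell T j) p ≤ 1 / κmin * eng κ τ (cell T j) p := by
      rw [← mul_le_mul_iff_right₀ hκ]
      refine h2.trans_eq ?_
      field_simp
    have h4 := h p
    have h5 : ∑ q : Fin 2 × (Fin (n + 1) → Fin 1), subLin hθ hH T j q p ^ 2 ≤
        (∑ q, C' 1 q) * mas κ (meshWeight T) (cell T j) p := by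
      rw [Finset.sum_mul]
      exact sum_le_sum fun q _ => hsub 1 q p
    have h6 := mul_le_mul_of_nonneg_left h5 hK
    have h7 : C * H / ((1 : ℕ) : ℝ) * gradSq G (cell T j) p ≤
        C * H / κmin * eng κ τ (cell T j) p := by
      rw [Nat.cast_one, div_one]
      refine (mul_le_mul_of_nonneg_left h3 (by positivity)).trans_eq ?_
      ring
    have h8 : 0 ≤ K * ∑ q, C' 1 q := mul_nonneg hK (sum_nonneg fun q _ => hC' 1 q)
    have h9 : 0 ≤ C * H / κmin + 1 / κmin := by positivity
    nlinarith [mul_nonneg h8 hE, mul_nonneg h9 hM]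

theorem memVOn_iff {T : CoarseMesh G θ H} {j : Fin T.numElem} {p : Fields G} :
    MemVOn G (cell T j) p ↔ p ∈ cellSub T j := mem_fieldSub.symm

variable {ρ σ : ℝ} (hρ : 0 ≤ ρ) (hσ : 0 ≤ σ) {T : CoarseMesh G θ H} {j : Fin T.numElem}
  {lam : ℕ → ℝ} {φ : ℕ → Fields G}

/-- The energy form on an element. -/
abbrev cellEng (hκ : 0 < κmin) (κ : Permeability G κmin κmax) (τ : ℝ) (T : CoarseMesh G θ H)
    (j : Fin T.numElem) : BilinForm ℝ (cellSub T j) :=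
  engForm hκ κ τ (meas_cell T j) (cell_subset T j) (cellSub T j) fun _ => sqI_of_mem

/-- The mass form on an element. -/
abbrev cellMas (hθ : 1 ≤ θ) (hH : 0 < H) (hκ : 0 < κmin) (κ : Permeability G κmin κmax)
    (T : CoarseMesh G θ H) (j : Fin T.numElem) : BilinForm ℝ (cellSub T j) :=
  masForm T hθ hH hκ κ (meas_cell T j) (cell_subset T j) (cellSub T j) fun _ => sqI_of_mem

theorem aQForm_cell (p v : cellSub T j) :
    aQForm κ ρ σ (cell T j) p v = cellEng hκ κ (ρ * σ) T j p v :=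
  aQForm_eq hκ.le κ ρ σ (meas_cell T j) (cell_subset T j) (sqI_of_mem p.2) (sqI_of_mem v.2)

include hθ hH hκ in
theorem sForm_cell (p v : cellSub T j) : sForm κ T (cell T j) p v = cellMas hθ hH hκ κ T j p v :=
  sForm_eq T hθ hH hκ.le κ (meas_cell T j) (cell_subset T j)
    (fun i => (sqI_of_mem p.2 i).1) fun i => (sqI_of_mem v.2 i).1

include hθ hH hκ hρ hσ in
/-- The spectral gap on an element. -/
theorem local_gap (hE : IsEigenSequence κ ρ σ T j lam φ) (L : ℕ) (p : cellSub T j)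
    (hp : ∀ k < L, sForm κ T (cell T j) p (φ k) = 0) :
    lam L * mas κ (meshWeight T) (cell T j) p ≤ eng κ (ρ * σ) (cell T j) p := by
  have hτ : 0 ≤ ρ * σ := mul_nonneg hρ hσ
  have hφ : ∀ k, φ k ∈ cellSub T j := fun k => memVOn_iff.1 (hE.eigen k).1
  have hκ' : 0 < κmax := hκ.trans_le (κ.min_le_max (nonempty_of_elem j))
  have hcm := meas_cell T j
  have hcs := cell_subset T j
  have ha : SemiInner (cellEng hκ κ (ρ * σ) T j) := engForm_semiInner hκ κ hτ hcm hcs _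
  have hs : SemiInner (cellMas hθ hH hκ κ T j) := masForm_semiInner T hθ hH hκ κ hcm hcs _
  obtain ⟨C, hC, hctl, hℓ⟩ := exists_le_eng_add_mas hθ hH hκ κ hτ T j
  have hcomplete : FormComplete (cellEng hκ κ (ρ * σ) T j + cellMas hθ hH hκ κ T j) univ := by
    refine formComplete_of_le (c := C⁻¹)
      (C := κmax + 2 * (ρ * σ) + κmax * (weightMax n θ / H ^ 2)) (by positivity)
      (fun p => ?_) (fun p => ?_)
    · rw [inv_mul_le_iff₀ hC]
      exact hctl p
    · have h1 := eng_le hκ κ hτ hcm hcs (sqI_of_mem p.2)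
      have h2 := mas_le T hθ hH hκ κ hcm hcs hκ'.le (sqI_of_mem p.2)
      have h3 := valSq_nonneg (R := cell T j) p.1
      have h4 := gradSq_nonneg (R := cell T j) p.1
      change eng κ (ρ * σ) (cell T j) p + mas κ (meshWeight T) (cell T j) p ≤ _
      have hW : 0 ≤ κmax * (weightMax n θ / H ^ 2) := by
        unfold weightMax overlap; positivity
      nlinarith [mul_nonneg hκ'.le h3, mul_nonneg hτ h4, mul_nonneg hW h4]
  obtain ⟨C₁, hC₁, hmas⟩ := exists_mas_le (n := n) G hθ
  obtain ⟨N, hN⟩ := exists_nat_gt (2 * (C₁ * κmax / (H * κmin) * |lam L|))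
  have hN' : (0 : ℝ) < N := lt_of_le_of_lt (by positivity) hN
  obtain ⟨K, hK, hmas⟩ := hmas H hH T j κmin κmax hκ κ (ρ * σ) hτ N (Nat.cast_pos.1 hN')
  choose C' hC' using hℓ N
  refine spectral_gap (φ := fun k => ⟨φ k, hφ k⟩) (lam := lam) ha hs hcomplete hE.monotone
    (fun k v => ?_) (fun k => ?_) (fun k k' hk => ?_) (fun μ w hw hwφ => ?_) L
    (ℓ := subLin hθ hH T j (N := N)) (C := ∑ q, |C' q|)
    (ε := C₁ * κmax / (H * κmin * N)) (K := K) (by positivity) ?_ (fun q p => ?_)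
    (fun p => hmas p) (p := p) fun k hk => ?_
  · rw [← aQForm_cell, ← sForm_cell hθ hH hκ]
    exact (hE.eigen k).2 v (memVOn_iff.2 v.2)
  · rw [← sForm_cell hθ hH hκ]
    exact hE.ne_zero k
  · rw [← sForm_cell hθ hH hκ]
    exact hE.orthogonal k k' hk
  · rw [← sForm_cell hθ hH hκ]
    refine hE.exhaustive μ w ⟨memVOn_iff.2 w.2, fun v hv => ?_⟩ fun k => ?_
    · have := hw ⟨v, memVOn_iff.1 hv⟩
      rwa [← aQForm_cell, ← sForm_cell hθ hH hκ] at this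
    · have := hwφ k
      rwa [← sForm_cell hθ hH hκ] at this
  · have h1 : C₁ * κmax / (H * κmin * N) * lam L ≤ C₁ * κmax / (H * κmin * N) * |lam L| :=
      mul_le_mul_of_nonneg_left (le_abs_self _) (by positivity)
    have h2 : 2 * (C₁ * κmax / (H * κmin * N) * |lam L|) =
        2 * (C₁ * κmax / (H * κmin) * |lam L|) / N := by field_simp
    have h3 : 2 * (C₁ * κmax / (H * κmin) * |lam L|) / N ≤ 1 := by
      rw [div_le_one hN']; exact hN.le
    linarith
  · refine (hC' q p).trans ?_
    have h1 := eng_nonneg hκ κ hτ hcm hcs p.1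
    have h2 := mas_nonneg T hκ κ hcm hcs p.1
    have h3 : C' q ≤ ∑ q, |C' q| := (le_abs_self _).trans
      (single_le_sum (f := fun q => |C' q|) (fun _ _ => abs_nonneg _) (mem_univ q))
    have h4 : 0 ≤ ∑ q, |C' q| := sum_nonneg fun _ _ => abs_nonneg _
    change C' q * mas κ (meshWeight T) (cell T j) p ≤ (∑ q, |C' q|) *
      (eng κ (ρ * σ) (cell T j) p + mas κ (meshWeight T) (cell T j) p)
    nlinarith [mul_le_mul_of_nonneg_right h3 h2, mul_nonneg h4 h1]
  · rw [← sForm_cell hθ hH hκ]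
    exact hp k hk

/-- The number of small eigenvalues on an element. -/
theorem exists_card_le (G : Geometry n) (hθ : 1 ≤ θ) : ∃ C : ℝ, 0 < C ∧
    ∀ (H : ℝ) (_ : 0 < H) (T : CoarseMesh G θ H) (j : Fin T.numElem) (κmin κmax ρ σ : ℝ)
      (_ : 0 < κmin) (κ : Permeability G κmin κmax) (_ : 0 ≤ ρ) (_ : 0 ≤ σ) (lam : ℕ → ℝ)
      (φ : ℕ → Fields G) (_ : IsEigenSequence κ ρ σ T j lam φ) (M : ℝ) (_ : 0 ≤ M)
      (L : ℕ) (_ : ∀ k < L, lam k ≤ M), (L : ℝ) ≤ 2 * (C * κmax * M / (H * κmin) + 2) ^ (n + 1) := by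
  obtain ⟨C, hC, h⟩ := exists_mas_le (n := n) G hθ
  refine ⟨C, hC, fun H hH T j κmin κmax ρ σ hκ κ hρ hσ lam φ hE M hM L hL => ?_⟩
  have hτ : 0 ≤ ρ * σ := mul_nonneg hρ hσ
  have hφ : ∀ k, φ k ∈ cellSub T j := fun k => memVOn_iff.1 (hE.eigen k).1
  have hκ' : 0 < κmax := hκ.trans_le (κ.min_le_max (nonempty_of_elem j))
  set X := C * κmax * M / (H * κmin)
  have hX : 0 ≤ X := by positivity
  set N := ⌊X⌋₊ + 1
  have hN : X < N := by simpa [N] using Nat.lt_floor_add_one X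
  have hN2 : (N : ℝ) ≤ X + 1 := by
    simp only [N, Nat.cast_add, Nat.cast_one]; linarith [Nat.floor_le hX]
  have hN' : (0 : ℝ) < N := hX.trans_lt hN
  obtain ⟨K, -, h⟩ := h H hH T j κmin κmax hκ κ (ρ * σ) hτ N (Nat.succ_pos _)
  have hs : SemiInner (cellMas hθ hH hκ κ T j) :=
    masForm_semiInner T hθ hH hκ κ (meas_cell T j) (cell_subset T j) _
  have heig : ∀ k v, cellEng hκ κ (ρ * σ) T j ⟨φ k, hφ k⟩ v =
      lam k * cellMas hθ hH hκ κ T j ⟨φ k, hφ k⟩ v := fun k v => by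
    rw [← aQForm_cell, ← sForm_cell hθ hH hκ]
    exact (hE.eigen k).2 v (memVOn_iff.2 v.2)
  have horth : ∀ k k', k ≠ k' → cellMas hθ hH hκ κ T j ⟨φ k, hφ k⟩ ⟨φ k', hφ k'⟩ = 0 :=
    fun k k' hk => by
      rw [← sForm_cell hθ hH hκ]
      exact hE.orthogonal k k' hk
  have key := card_le_of_rayleigh_le (a := cellEng hκ κ (ρ * σ) T j) (m := L) hs
    (subLin hθ hH T j (N := N)) (fun p => h p) (by positivity) (M := M) ?_
    (b := fun k => ⟨φ k, hφ k⟩) (fun k k' hk => ?_) (fun k k' hk => ?_) (fun k => ?_) fun k => ?_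
  · simp only [Fintype.card_prod, Fintype.card_fin, Fintype.card_fun] at key
    calc (L : ℝ) ≤ ((2 * N ^ (n + 1) : ℕ) : ℝ) := Nat.cast_le.2 key
      _ = 2 * (N : ℝ) ^ (n + 1) := by push_cast; ring
      _ ≤ _ := by gcongr; linarith
  · have : C * κmax / (H * κmin * N) * M = X / N := by simp only [X]; field_simp
    rw [this, div_lt_one hN']
    exact hN
  · rw [heig, horth _ _ (fun h => hk (Fin.ext h)), mul_zero]
  · exact horth _ _ fun h => hk (Fin.ext h)
  · rw [← sForm_cell hθ hH hκ]
    exact hE.ne_zero k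
  · rw [heig]
    exact mul_le_mul_of_nonneg_right (hL k k.2) (hs.nonneg _)

end LocalGap

/-! ### Localization of integrals, supports, and products with cut-off functions -/

section Localize

variable {n : ℕ} {G : Geometry n} {κmin κmax θ H : ℝ} {R O : Set (Euc (n + 1))}

theorem integral_mm_eq_indicator (hR : MeasurableSet R) (hRΩ : R ⊆ G.Ω) (d : Pts G → ℝ) :
    ∫ y, d y ∂mm G R = ∫ y, (pos G ⁻¹' R).indicator d y ∂mm G G.Ω := by
  rw [mm_eq_restrict hR hRΩ, integral_indicator (measurable_pos G hR)]

theorem integrable_indicator_pos (hR : MeasurableSet R) {d : Pts G → ℝ}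
    (hd : Integrable d (mm G G.Ω)) : Integrable ((pos G ⁻¹' R).indicator d) (mm G G.Ω) :=
  hd.indicator (measurable_pos G hR)

theorem ae_mm_mono (hR : MeasurableSet R) (hRΩ : R ⊆ G.Ω) {P : Pts G → Prop}
    (h : ∀ᵐ y ∂mm G G.Ω, P y) : ∀ᵐ y ∂mm G R, P y ∧ pos G y ∈ R :=
  Filter.Eventually.and (Measure.absolutelyContinuous_of_le (mm_le hR hRΩ) |>.ae_le h)
    (ae_mm_pos_mem hR)

theorem smoothField_eq_zero {f : Euc (n + 1) → ℝ} {y : Pts G} (hy : pos G y ∉ tsupport f) :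
    vl (smoothField G f) y = 0 ∧ gr (smoothField G f) y = 0 := by
  have h := notMem_tsupport_iff_eventuallyEq.1 hy
  refine ⟨by rw [vl_smoothField]; exact h.eq_of_nhds, gr_smoothField_eq_zero ?_⟩
  filter_upwards [h] with x hx
  rw [hx, h.eq_of_nhds]; rfl

/-- An element of the closure of the test functions in `O` vanishes off `O`. -/
theorem MemClosure.ae_eq_zero (hO : IsOpen O) {w : Scalars G} (h : MemClosure G O G.Ω w) :
    ∀ᵐ y ∂mm G G.Ω, pos G y ∉ O → vl w y = 0 ∧ gr w y = 0 := by
  have hm := G.isOpen_Ω.measurableSet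
  obtain ⟨⟨hv, hg⟩, happ⟩ := (memClosure_iff hm subset_rfl).1 h
  have hA : MeasurableSet (pos G ⁻¹' Oᶜ) := measurable_pos G hO.measurableSet.compl
  have hzero : ∀ f, IsTest O f → ∀ y ∈ pos G ⁻¹' Oᶜ,
      vl (smoothField G f) y = 0 ∧ gr (smoothField G f) y = 0 :=
    fun f hf y hy => smoothField_eq_zero fun h => hy (hf.tsupport_subset h)
  have key : ∀ {F : Type} [NormedAddCommGroup F] [InnerProductSpace ℝ F]
      (D : Scalars G →ₗ[ℝ] (Pts G → F)), MemLp (D w) 2 (mm G G.Ω) →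
      (∀ ε > 0, ∃ f, IsTest O f ∧ MemLp (D (smoothField G f)) 2 (mm G G.Ω) ∧
        (∀ y ∈ pos G ⁻¹' Oᶜ, D (smoothField G f) y = 0) ∧
        ip (mm G G.Ω) (D w - D (smoothField G f)) (D w - D (smoothField G f)) < ε) →
      ∀ᵐ y ∂mm G G.Ω, pos G y ∉ O → D w y = 0 := by
    intro F _ _ D hD hε
    have h1 : ∫⁻ y in pos G ⁻¹' Oᶜ, ‖D w y‖ₑ ^ 2 ∂mm G G.Ω = 0 := by
      refine le_antisymm (ENNReal.le_of_forall_pos_le_add fun ε hε' _ => ?_) zero_le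
      obtain ⟨f, -, hfm, hf0, hfε⟩ := hε ε hε'
      rw [zero_add]
      calc ∫⁻ y in pos G ⁻¹' Oᶜ, ‖D w y‖ₑ ^ 2 ∂mm G G.Ω
          = ∫⁻ y in pos G ⁻¹' Oᶜ, ‖(D w - D (smoothField G f)) y‖ₑ ^ 2 ∂mm G G.Ω :=
            setLIntegral_congr_fun hA fun y hy => by
              simp only [Pi.sub_apply, hf0 y hy, sub_zero]
        _ ≤ ∫⁻ y, ‖(D w - D (smoothField G f)) y‖ₑ ^ 2 ∂mm G G.Ω := setLIntegral_le_lintegral _ _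
        _ = ofReal (ip (mm G G.Ω) (D w - D (smoothField G f))
              (D w - D (smoothField G f))) := (ofReal_ip_self (hD.sub hfm)).symm
        _ ≤ ofReal ε := ofReal_le_ofReal hfε.le
        _ = ε := ENNReal.ofReal_coe_nnreal
    rw [lintegral_eq_zero_iff' (hD.1.restrict.enorm.pow_const 2)] at h1
    have h2 := (ae_restrict_iff' hA).1 h1
    filter_upwards [h2] with y hy hyO
    simpa using hy hyO
  have hv0 := key vl hv fun ε hε => by
    obtain ⟨f, hf, h1, -⟩ := happ ε hε
    exact ⟨f, hf, hf.memLp_vl hm subset_rfl, fun y hy => (hzero f hf y hy).1, h1⟩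
  have hg0 := key gr hg fun ε hε => by
    obtain ⟨f, hf, -, h1⟩ := happ ε hε
    exact ⟨f, hf, hf.memLp_gr hm subset_rfl, fun y hy => (hzero f hf y hy).2, h1⟩
  filter_upwards [hv0, hg0] with y h1 h2 hy
  exact ⟨h1 hy, h2 hy⟩

theorem disjoint_interior_element {T : CoarseMesh G θ H} (hθ : 1 ≤ θ) (hH : 0 < H)
    {i j : Fin T.numElem} (hij : i ≠ j) : Disjoint (interior (element T j)) (element T i) := by
  have h1 : Disjoint (interior (element T j)) (interior (element T i)) := T.disjoint j i hij.symm
  exact (h1.closure_right isOpen_interior).mono_right (element_subset_closure T hθ hH i)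

/-- The constant in the estimate of products with cut-off functions. -/
def cutConst (n : ℕ) (θ : ℝ) : ℝ := chiLip n θ ^ 2 / weightMin n θ

theorem cutConst_nonneg (hθ : 1 ≤ θ) : 0 ≤ cutConst n θ := by
  have := weightMin_pos (n := n) hθ
  unfold cutConst; positivity

section Pointwise

variable {κ : Permeability G κmin κmax} {T : CoarseMesh G θ H} {τ c b : ℝ} {y : Pts G}
  {χ p : Fields G}

/-- The energy density of a product. -/
theorem aDen_cut_le (hκ : 0 < κmin) (hτ : 0 ≤ τ) (hy : y ∈ legit G)
    (hv : ∀ i, vl (χ i) y = c * vl (p i) y)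
    (hg : ∀ i, ‖gr (χ i - c • p i) y‖ ^ 2 ≤ b * (meshWeight T y * vl (p i) y ^ 2)) :
    aDen κ τ χ χ y ≤ 2 * c ^ 2 * aDen κ τ p p y + 2 * b * sDen κ (meshWeight T) p p y := by
  have h1 : ∀ i, kap κ i y * ‖gr (χ i) y‖ ^ 2 ≤ 2 * c ^ 2 * (kap κ i y * ‖gr (p i) y‖ ^ 2) +
      2 * b * (kap κ i y * meshWeight T y * vl (p i) y ^ 2) := by
    intro i
    have hk := hκ.le.trans (kap_bounds κ i hy).1
    have h2 : gr (χ i) y = gr (χ i - c • p i) y + c • gr (p i) y := by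
      simp only [map_sub, map_smul, Pi.sub_apply, Pi.smul_apply, sub_add_cancel]
    have h3 : ‖gr (χ i) y‖ ≤ ‖gr (χ i - c • p i) y‖ + |c| * ‖gr (p i) y‖ := by
      rw [h2]
      refine (norm_add_le _ _).trans_eq ?_
      rw [norm_smul, norm_eq_abs]
    have h4 : ‖gr (χ i) y‖ ^ 2 ≤ 2 * ‖gr (χ i - c • p i) y‖ ^ 2 +
        2 * (c ^ 2 * ‖gr (p i) y‖ ^ 2) := by
      have := pow_le_pow_left₀ (norm_nonneg _) h3 2
      have h5 : (|c| * ‖gr (p i) y‖) ^ 2 = c ^ 2 * ‖gr (p i) y‖ ^ 2 := by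
        rw [mul_pow, sq_abs]
      nlinarith [sq_nonneg (‖gr (χ i - c • p i) y‖ - |c| * ‖gr (p i) y‖)]
    have h5 := mul_le_mul_of_nonneg_left (h4.trans (add_le_add_left
      (mul_le_mul_of_nonneg_left (hg i) zero_le_two) _)) hk
    calc _ ≤ _ := h5
      _ = _ := by ring
  rw [aDen_self, aDen_self, sDen_self]
  have h2 := sum_le_sum fun i (_ : i ∈ Finset.univ) => h1 i
  rw [sum_add_distrib, ← mul_sum, ← mul_sum] at h2
  have h3 : τ * (bulkInd y * (vl (χ 0) y - vl (χ 1) y) ^ 2) ≤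
      2 * c ^ 2 * (τ * (bulkInd y * (vl (p 0) y - vl (p 1) y) ^ 2)) := by
    have h4 : 0 ≤ c ^ 2 * (τ * (bulkInd y * (vl (p 0) y - vl (p 1) y) ^ 2)) := by
      have := (bulkInd_mem y).1
      positivity
    rw [hv, hv]
    nlinarith
  linarith

/-- The energy density of a product, tested with the factor. -/
theorem le_aDen_cut (hκ : 0 < κmin) (hτ : 0 ≤ τ) (hy : y ∈ legit G) (hc : 0 ≤ c)
    (hv : ∀ i, vl (χ i) y = c * vl (p i) y)
    (hg : ∀ i, ‖gr (χ i - c • p i) y‖ ^ 2 ≤ b * (meshWeight T y * vl (p i) y ^ 2)) :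
    -(aDen κ τ p p y + b * sDen κ (meshWeight T) p p y) ≤ aDen κ τ p χ y := by
  have h1 : ∀ i, -(kap κ i y * ‖gr (p i) y‖ ^ 2) -
      b * (kap κ i y * meshWeight T y * vl (p i) y ^ 2) ≤ kap κ i y * ⟪gr (p i) y, gr (χ i) y⟫ := by
    intro i
    have hk := hκ.le.trans (kap_bounds κ i hy).1
    have h2 : gr (χ i) y = gr (χ i - c • p i) y + c • gr (p i) y := by
      simp only [map_sub, map_smul, Pi.sub_apply, Pi.smul_apply, sub_add_cancel]
    have h3 := neg_le_of_abs_le (abs_real_inner_le_norm (gr (p i) y) (gr (χ i - c • p i) y))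
    have h4 : -(‖gr (p i) y‖ ^ 2) - b * (meshWeight T y * vl (p i) y ^ 2) ≤
        ⟪gr (p i) y, gr (χ i) y⟫ := by
      rw [h2, inner_add_right, real_inner_smul_right, real_inner_self_eq_norm_sq]
      have := hg i
      nlinarith [sq_nonneg (‖gr (p i) y‖ - ‖gr (χ i - c • p i) y‖), sq_nonneg ‖gr (p i) y‖,
        sq_nonneg ‖gr (χ i - c • p i) y‖, mul_nonneg hc (sq_nonneg ‖gr (p i) y‖)]
    have h5 := mul_le_mul_of_nonneg_left h4 hk
    calc _ = _ := by ring
      _ ≤ _ := h5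
  rw [aDen_self, sDen_self, aDen_apply]
  have h2 := sum_le_sum fun i (_ : i ∈ Finset.univ) => h1 i
  rw [sum_sub_distrib, Finset.sum_neg_distrib, ← mul_sum] at h2
  have hb := (bulkInd_mem y).1
  have h3 : 0 ≤ τ * (bulkInd y * ((vl (p 0) y - vl (p 1) y) * (vl (χ 0) y - vl (χ 1) y))) := by
    rw [hv, hv, ← mul_sub, mul_left_comm _ c]
    have := mul_self_nonneg (vl (p 0) y - vl (p 1) y)
    positivity
  have h4 : 0 ≤ τ * (bulkInd y * (vl (p 0) y - vl (p 1) y) ^ 2) := by positivity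
  linarith

theorem sDen_cut (wt : Pts G → ℝ) (hv : ∀ i, vl (χ i) y = c * vl (p i) y) :
    sDen κ wt χ χ y = c ^ 2 * sDen κ wt p p y := by
  rw [sDen_self, sDen_self, mul_sum]
  refine sum_congr rfl fun i _ => ?_
  rw [hv]; ring

theorem sDen_cut_left (wt : Pts G → ℝ) (v : Fields G)
    (hv : ∀ i, vl (χ i) y = c * vl (p i) y) : sDen κ wt χ v y = c * sDen κ wt p v y := by
  rw [sDen_apply, sDen_apply, mul_sum]
  refine sum_congr rfl fun i _ => ?_
  rw [hv]; ring

end Pointwise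

end Localize

/-! ### Local lifts of constraints -/

section Lift

theorem exists_lift {V : Type*} [AddCommGroup V] [Module ℝ V] {a b s : BilinForm ℝ V}
    (hs : SemiInner s) {m : ℕ} {φ : Fin m → V} {lam : Fin m → ℝ} {M : ℝ} (hM : 0 < M)
    (horth : ∀ k k', k ≠ k' → s (φ k) (φ k') = 0) (hne : ∀ k, s (φ k) (φ k) ≠ 0)
    (heig : ∀ k v, a (φ k) v = lam k * s (φ k) v) (hlam : ∀ k, lam k ≤ M)
    (hb : ∀ d : Fin m → ℝ, s (∑ k, d k • φ k) (∑ k, d k • φ k) ≤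
      M * b (∑ k, d k • φ k) (∑ k, d k • φ k)) (g : V) :
    ∃ d : Fin m → ℝ, (∀ k, b (∑ k, d k • φ k) (φ k) = s g (φ k)) ∧
      s (∑ k, d k • φ k) (∑ k, d k • φ k) ≤ M ^ 2 * s g g ∧
      a (∑ k, d k • φ k) (∑ k, d k • φ k) ≤ M ^ 3 * s g g := by
  set Φ : (Fin m → ℝ) →ₗ[ℝ] V := Fintype.linearCombination ℝ φ
  have hΦ : ∀ d, ∑ k, d k • φ k = Φ d := fun d => (Fintype.linearCombination_apply ℝ φ d).symm
  simp only [hΦ] at hb ⊢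
  have hcomb : ∀ (B : BilinForm ℝ V) (v : V) (d : Fin m → ℝ),
      B v (Φ d) = ∑ k, d k * B v (φ k) := fun B v d => by
    rw [← hΦ, map_sum]; simp only [map_smul, smul_eq_mul]
  have hsφ : ∀ d k, s (φ k) (Φ d) = d k * s (φ k) (φ k) := fun d k => by
    rw [hcomb, sum_eq_single_of_mem k (mem_univ k) fun i _ hi => by
      rw [horth _ _ (Ne.symm hi), mul_zero]]
  let A : (Fin m → ℝ) →ₗ[ℝ] (Fin m → ℝ) := LinearMap.pi fun k => (b.flip (φ k)).comp Φ
  have hA : ∀ d k, A d k = b (Φ d) (φ k) := fun d k => rfl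
  have hinj : Function.Injective A := by
    refine (injective_iff_map_eq_zero A).2 fun d hd => ?_
    have h1 : s (Φ d) (Φ d) ≤ 0 := by
      refine (hb d).trans_eq ?_
      rw [hcomb b, sum_eq_zero, mul_zero]
      intro k _
      rw [← hA, hd, Pi.zero_apply, mul_zero]
    ext k
    have h2 := hs.cauchy_schwarz (φ k) (Φ d)
    rw [le_antisymm h1 (hs.nonneg _), mul_zero, hsφ] at h2
    exact (mul_eq_zero.1 (pow_eq_zero_iff two_ne_zero |>.1 (le_antisymm h2 (sq_nonneg _)))).resolve_right
      (hne k)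
  obtain ⟨d, hd⟩ := (LinearMap.injective_iff_surjective.1 hinj) fun k => s g (φ k)
  have hd' : ∀ k, b (Φ d) (φ k) = s g (φ k) := fun k => by rw [← hA, hd]
  have h1 : s (Φ d) (Φ d) ≤ M * s g (Φ d) := by
    refine (hb d).trans_eq ?_
    rw [hcomb b, hcomb s]
    simp only [hd']
  have h2 : s (Φ d) (Φ d) ≤ M ^ 2 * s g g := by
    have h3 := hs.cauchy_schwarz g (Φ d)
    have h4 := pow_le_pow_left₀ (hs.nonneg _) h1 2
    rw [mul_pow] at h4
    have h5 : s (Φ d) (Φ d) * s (Φ d) (Φ d) ≤ M ^ 2 * s g g * s (Φ d) (Φ d) := by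
      nlinarith [mul_le_mul_of_nonneg_left h3 (sq_nonneg M)]
    rcases (hs.nonneg (Φ d)).eq_or_lt with h6 | h6
    · rw [← h6]; exact mul_nonneg (sq_nonneg M) (hs.nonneg g)
    · exact le_of_mul_le_mul_right h5 h6
  refine ⟨d, hd', h2, ?_⟩
  have h3 : a (Φ d) (Φ d) ≤ M * s (Φ d) (Φ d) := by
    have h4 : ∀ B : BilinForm ℝ V, B (Φ d) (Φ d) = ∑ k, d k * B (φ k) (Φ d) := fun B => by
      have h5 : B (Φ d) = ∑ k, d k • B (φ k) := by rw [← hΦ, map_sum B]; simp only [map_smul]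
      rw [h5, LinearMap.sum_apply]
      simp only [LinearMap.smul_apply, smul_eq_mul]
    rw [h4 a, h4 s, mul_sum]
    refine sum_le_sum fun k _ => ?_
    rw [heig, hsφ]
    linarith [mul_le_mul_of_nonneg_right (hlam k) (mul_nonneg (sq_nonneg (d k)) (hs.nonneg (φ k)))]
  nlinarith [mul_le_mul_of_nonneg_left h2 hM.le]

variable {n : ℕ} {G : Geometry n} {κmin κmax θ H : ℝ}

/-- Products of fields with cut-off functions on the scale of the mesh. -/
theorem exists_cut_field (hθ : 1 ≤ θ) (hH : 0 < H) (T : CoarseMesh G θ H)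
    {R : Set (Euc (n + 1))} (hR : MeasurableSet R) (hRΩ : R ⊆ G.Ω)
    {p : Fields G} (hp : ∀ i, MemClosure G G.Ω R (p i)) {η : Euc (n + 1) → ℝ}
    (hη : LocLip G.Ω (chiLip n θ / H) η) (h01 : ∀ x ∈ G.Ω, 0 ≤ η x ∧ η x ≤ 1)
    (hηR : ∀ x ∈ G.Ω, x ∉ R → η x = 0) {K O : Set (Euc (n + 1))} (hK : IsClosed K)
    (hconst : ∀ x ∈ G.Ω, x ∉ K → ∀ᶠ y in nhds x, η y = η x) (hO : ∀ x ∈ G.Ω, η x ≠ 0 → x ∈ O) :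
    ∃ χ : Fields G, (∀ i, MemClosure G (G.Ω ∩ O) G.Ω (χ i)) ∧ ∀ᵐ y ∂mm G G.Ω,
      (pos G y ∉ R → ∀ i, vl (χ i) y = 0 ∧ gr (χ i) y = 0) ∧
      (pos G y ∈ R → (∀ i, vl (χ i) y = η (pos G y) * vl (p i) y) ∧
        (∀ i, ‖gr (χ i - η (pos G y) • p i) y‖ ^ 2 ≤
          cutConst n θ * (meshWeight T y * vl (p i) y ^ 2)) ∧
        (pos G y ∉ K → ∀ i, gr (χ i) y = η (pos G y) • gr (p i) y)) := by
  have hL : 0 ≤ chiLip n θ / H := div_nonneg (by unfold chiLip; positivity) hH.le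
  choose χ h1 h2 h3 using fun i => exists_mul_memClosure hR hRΩ (hp i) hL hη h01 hηR hK hconst hO
  refine ⟨χ, h1, ?_⟩
  filter_upwards [ae_all_iff.2 h2, ae_all_iff.2 h3, ae_norm_gr_sq_le (T := T) hθ hH]
    with y hy2 hy3 hy4
  refine ⟨fun hy i => ?_, fun hy => ⟨fun i => ?_, fun i => hy4 _ _ ?_, fun hyK i => ?_⟩⟩
  · have h5 := hy2 i
    have h6 := hy3 i
    rw [indicator_of_notMem (show y ∉ pos G ⁻¹' R from hy)] at h5 h6
    rw [indicator_of_notMem (show y ∉ pos G ⁻¹' (R ∩ K) from fun h => hy h.1), sub_zero] at h6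
    exact ⟨h5, norm_le_zero_iff.1 h6⟩
  · have h5 := hy2 i
    rwa [indicator_of_mem (show y ∈ pos G ⁻¹' R from hy)] at h5
  · have h6 := hy3 i
    rw [indicator_of_mem (show y ∈ pos G ⁻¹' R from hy)] at h6
    simp only [map_sub, map_smul, Pi.sub_apply, Pi.smul_apply]
    refine h6.trans (Set.indicator_le_self' (fun _ _ => by positivity) y)
  · have h6 := hy3 i
    rw [indicator_of_mem (show y ∈ pos G ⁻¹' R from hy),
      indicator_of_notMem (show y ∉ pos G ⁻¹' (R ∩ K) from fun h => hyK h.2)] at h6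
    exact sub_eq_zero.1 (norm_le_zero_iff.1 h6)

variable (hθ : 1 ≤ θ) (hH : 0 < H) (hκ : 0 < κmin) (κ : Permeability G κmin κmax)
  {ρ σ : ℝ} (hρ : 0 ≤ ρ) (hσ : 0 ≤ σ) {T : CoarseMesh G θ H} {j : Fin T.numElem}
  {lam : ℕ → ℝ} {φ : ℕ → Fields G}

/-- The norm of the local lifts. -/
def liftConst (n : ℕ) (θ M : ℝ) : ℝ := 2 * M ^ 3 + 2 * cutConst n θ * M ^ 2

include hθ hH hκ hρ hσ in
theorem exists_cell_lift (hE : IsEigenSequence κ ρ σ T j lam φ) {M : ℝ} (hM : 0 < M) {L : ℕ}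
    (hlam : ∀ k < L, lam k ≤ M)
    (hπ : ∀ ν ∈ auxSpace L φ, sForm κ T (cell T j) ν ν ≤ M * sBubble κ T j ν)
    (p : cellSub T j) : ∃ w : Fields G,
      (∀ i, MemClosure G (G.Ω ∩ interior (element T j)) G.Ω (w i)) ∧
      (∀ k < L, ∫ y, sDen κ (meshWeight T) w (φ k) y ∂mm G (cell T j) =
        ∫ y, sDen κ (meshWeight T) p (φ k) y ∂mm G (cell T j)) ∧
      eng κ (ρ * σ) G.Ω w ≤ liftConst n θ M * mas κ (meshWeight T) (cell T j) p := by
  have hcm := meas_cell T j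
  have hcs := cell_subset T j
  have hΩm := G.isOpen_Ω.measurableSet
  have hτ : 0 ≤ ρ * σ := mul_nonneg hρ hσ
  have hint : ∀ p ∈ cellSub T j, ∀ v ∈ cellSub T j,
      Integrable (sDen κ (bubbleWeight T j) p v) (mm G (cell T j)) := fun p hp v hv =>
    integrable_sDen hκ.le κ hcm hcs (aestronglyMeasurable_bubbleWeight hθ hH j hcm hcs)
      (ae_bubbleWeight_le hθ hH j hcm hcs) (fun i => (sqI_of_mem hp i).1)
      fun i => (sqI_of_mem hv i).1
  set b : BilinForm ℝ (cellSub T j) :=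
    densForm (mm G (cell T j)) (sDen κ (bubbleWeight T j)) (cellSub T j) hint with hb
  set φ' : Fin L → cellSub T j := fun k => ⟨φ k, memVOn_iff.1 (hE.eigen k).1⟩
  obtain ⟨d, hd1, hd2, hd3⟩ := exists_lift (a := cellEng hκ κ (ρ * σ) T j) (b := b)
    (s := cellMas hθ hH hκ κ T j) (masForm_semiInner _ _ _ _ _ _ _ _) (φ := φ')
    (lam := fun k => lam k) hM
    (fun k k' hk => by
      rw [← sForm_cell]; exact hE.orthogonal k k' fun h => hk (Fin.ext h))
    (fun k => by rw [← sForm_cell]; exact hE.ne_zero k)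
    (fun k v => by
      rw [← sForm_cell, ← aQForm_cell]; exact (hE.eigen k).2 v (memVOn_iff.2 v.2))
    (fun k => hlam k k.2)
    (fun d => by
      rw [← sForm_cell, hb, densForm_apply, ← sBubble_eq hθ hH hκ.le κ j
        fun i => (sqI_of_mem (∑ k, d k • φ' k).2 i).1]
      refine hπ _ ?_
      rw [Submodule.coe_sum]
      exact sum_mem fun k _ => Submodule.smul_mem _ _
        (Submodule.subset_span ⟨k, k.2, rfl⟩)) p
  set ν := ∑ k, d k • φ' k
  have hνI := sqI_of_mem ν.2
  obtain ⟨w, hwm, hw⟩ := exists_cut_field hθ hH T hcm hcs (mem_fieldSub.1 ν.2)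
    (η := cutBubble T j) (cutBubble_locLip hθ hH j)
    (fun x _ => cutBubble_mem_Icc hθ hH j x)
    (fun x hx hxR => cutBubble_eq_zero hθ hH fun h => hxR ⟨openElement_subset T j h, hx⟩)
    (K := univ) (O := interior (element T j)) isClosed_univ (fun x _ h => absurd trivial h)
    (fun x _ h => by_contra fun h' => h (cutBubble_eq_zero hθ hH fun h'' =>
      h' (interior_maximal (openElement_subset T j) (isOpen_openElement T hθ hH j) h'')))
  refine ⟨w, hwm, fun k hk => ?_, ?_⟩
  · have h1 := hd1 ⟨k, hk⟩
    rw [masForm_apply, hb, densForm_apply] at h1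
    refine Eq.trans (integral_congr_ae ?_) h1
    filter_upwards [ae_mm_mono hcm hcs hw] with y ⟨hy, hyc⟩
    rw [sDen_cut_left _ _ (hy.2 hyc).1, sDen_apply, sDen_apply, mul_sum]
    refine sum_congr rfl fun i _ => ?_
    rw [bubbleWeight]; ring
  · have h1 : eng κ (ρ * σ) G.Ω w ≤ ∫ y, (2 * aDen κ (ρ * σ) ν ν y +
        2 * cutConst n θ * sDen κ (meshWeight T) ν ν y) ∂mm G (cell T j) := by
      have hwI : SqI G G.Ω w := fun i => ⟨(hwm i).memLp_vl hΩm subset_rfl,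
        (hwm i).memLp_gr hΩm subset_rfl⟩
      have hint' := ((integrable_aDen hκ.le κ (ρ * σ) hcm hcs hνI hνI).const_mul 2).add
        ((integrable_mas T hθ hH hκ κ hcm hcs hνI hνI).const_mul (2 * cutConst n θ))
      rw [integral_mm_eq_indicator hcm hcs]
      refine integral_mono_ae (integrable_aDen hκ.le κ _ hΩm subset_rfl hwI hwI) ?_ ?_
      · rw [integrable_indicator_iff (measurable_pos G hcm), IntegrableOn, ← mm_eq_restrict hcm hcs]
        exact hint'
      · filter_upwards [hw, ae_mm_legit hΩm subset_rfl] with y hy hyl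
        by_cases hyc : y ∈ pos G ⁻¹' cell T j
        · rw [indicator_of_mem hyc]
          have h2 := aDen_cut_le hκ hτ hyl (hy.2 hyc).1 (hy.2 hyc).2.1 (κ := κ)
          have h3 := cutBubble_mem_Icc hθ hH j (pos G y)
          have h4 := aDen_self_nonneg hκ.le κ hτ ν hyl
          have h5 : cutBubble T j (pos G y) ^ 2 ≤ 1 := pow_le_one₀ h3.1 h3.2
          nlinarith
        · rw [indicator_of_notMem hyc, aDen_self]
          simp [(hy.1 hyc _).1, (hy.1 hyc _).2]
    rw [integral_add ((integrable_aDen hκ.le κ (ρ * σ) hcm hcs hνI hνI).const_mul 2)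
      ((integrable_mas T hθ hH hκ κ hcm hcs hνI hνI).const_mul (2 * cutConst n θ)),
      integral_const_mul, integral_const_mul] at h1
    rw [engForm_self, masForm_self] at hd3
    rw [masForm_self, masForm_self] at hd2
    have hc := cutConst_nonneg (n := n) hθ
    have h2 := mul_le_mul_of_nonneg_left hd2 (mul_nonneg zero_le_two hc)
    refine h1.trans ?_
    change 2 * eng κ (ρ * σ) (cell T j) ν + 2 * cutConst n θ * mas κ (meshWeight T) (cell T j) ν ≤ _
    unfold liftConst
    linarith

end Lift

/-! ### The multiscale problem as a localized problem -/

section Problem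

variable {n : ℕ} {G : Geometry n} {κmin κmax θ H : ℝ} {R R' O : Set (Euc (n + 1))}

/-- The energy space. -/
abbrev globSub (G : Geometry n) : Submodule ℝ (Fields G) :=
  fieldSub G G.Ω G.Ω G.isOpen_Ω.measurableSet subset_rfl

theorem SqI.restrict {p : Fields G} (hp : SqI G G.Ω p) (hR : MeasurableSet R)
    (hRΩ : R ⊆ G.Ω) : SqI G R p := fun i =>
  ⟨(hp i).1.mono_measure (mm_le hR hRΩ), (hp i).2.mono_measure (mm_le hR hRΩ)⟩

theorem sqI_restrict (hR : MeasurableSet R) (hRΩ : R ⊆ G.Ω) : ∀ p ∈ globSub G, SqI G R p :=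
  fun _ hp => (sqI_of_mem hp).restrict hR hRΩ

theorem mem_cellSub {T : CoarseMesh G θ H} {p : Fields G} (hp : p ∈ globSub G)
    (j : Fin T.numElem) : p ∈ cellSub T j :=
  mem_fieldSub.2 fun i => (mem_fieldSub.1 hp i).restrict (cell_subset T j)

theorem eng_mono (hκ : 0 < κmin) (κ : Permeability G κmin κmax) {τ : ℝ} (hτ : 0 ≤ τ)
    (hR : MeasurableSet R) (hR' : MeasurableSet R') (h : R ⊆ R') (hRΩ : R' ⊆ G.Ω)
    {p : Fields G} (hp : SqI G G.Ω p) : eng κ τ R p ≤ eng κ τ R' p := by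
  have hpR := hp.restrict hR' hRΩ
  refine integral_mono_measure ?_ ?_ (integrable_aDen hκ.le κ τ hR' hRΩ hpR hpR)
  · rw [mm_eq_restrict hR (h.trans hRΩ), mm_eq_restrict hR' hRΩ]
    exact Measure.restrict_mono (preimage_mono h) le_rfl
  · filter_upwards [ae_mm_legit hR' hRΩ] with y hy
    exact aDen_self_nonneg hκ.le κ hτ p hy

theorem exists_le_eng (G : Geometry n) : ∃ C : ℝ, 0 < C ∧ ∀ (κmin κmax τ : ℝ) (_ : 0 < κmin)
    (κ : Permeability G κmin κmax) (_ : 0 ≤ τ), ∀ p ∈ globSub G,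
      valSq G G.Ω p + gradSq G G.Ω p ≤ C / κmin * eng κ τ G.Ω p := by
  obtain ⟨C, hC, h⟩ := exists_friedrichs G
  refine ⟨C + 1, by linarith, fun κmin κmax τ hκ κ hτ p hp => ?_⟩
  have h1 : valSq G G.Ω p ≤ C * gradSq G G.Ω p := by
    rw [valSq, gradSq, mul_sum]
    exact sum_le_sum fun i _ => h _ (mem_fieldSub.1 hp i)
  have h2 := le_eng hκ κ hτ G.isOpen_Ω.measurableSet subset_rfl (sqI_of_mem hp)
  rw [div_mul_eq_mul_div, le_div_iff₀ hκ]
  nlinarith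

/-- The energy on `Ω`. -/
abbrev globEng (hκ : 0 < κmin) (κ : Permeability G κmin κmax) (τ : ℝ) : BilinForm ℝ (globSub G) :=
  engForm hκ κ τ G.isOpen_Ω.measurableSet subset_rfl (globSub G) fun _ => sqI_of_mem

theorem globEng_complete (hκ : 0 < κmin) (κ : Permeability G κmin κmax) {τ : ℝ} (hτ : 0 ≤ τ) :
    FormComplete (globEng hκ κ τ) univ := by
  obtain ⟨C, hC, h⟩ := exists_le_eng G
  refine formComplete_of_le (c := κmin / C) (C := |κmax| + 2 * τ) (by positivity) (fun p => ?_)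
    fun p => ?_
  · rw [engForm_self, div_mul_eq_mul_div, div_le_iff₀ hC]
    have h1 := mul_le_mul_of_nonneg_left (h κmin κmax τ hκ κ hτ p p.2) hκ.le
    refine h1.trans_eq ?_
    field_simp
  · rw [engForm_self]
    refine (eng_le hκ κ hτ G.isOpen_Ω.measurableSet subset_rfl (sqI_of_mem p.2)).trans ?_
    nlinarith [valSq_nonneg (R := G.Ω) p.1, gradSq_nonneg (R := G.Ω) p.1,
      le_abs_self κmax, abs_nonneg κmax]

theorem valSq_mono (hR : MeasurableSet R) (hRΩ : R ⊆ G.Ω) {p : Fields G}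
    (hp : SqI G G.Ω p) : valSq G R p ≤ valSq G G.Ω p := by
  rw [valSq_eq hp, valSq_eq (hp.restrict hR hRΩ)]
  exact integral_mono_measure (mm_le hR hRΩ)
    (ae_of_all _ fun y => sum_nonneg fun i _ => sq_nonneg (vl (p i) y))
    (integrable_finsetSum _ fun i _ => integrable_vl_sq hp i)

/-- The assumptions on the local spectral problems. -/
structure Admissible (κ : Permeability G κmin κmax) (ρ σ : ℝ) (T : CoarseMesh G θ H)
    (L : Fin T.numElem → ℕ) (lam : Fin T.numElem → ℕ → ℝ)
    (φ : Fin T.numElem → ℕ → Fields G) (Λ M : ℝ) : Prop where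
  one_le : 1 ≤ θ
  H_pos : 0 < H
  κmin_pos : 0 < κmin
  ρ_nonneg : 0 ≤ ρ
  σ_nonneg : 0 ≤ σ
  Λ_pos : 0 < Λ
  M_pos : 0 < M
  eigen : ∀ j, IsEigenSequence κ ρ σ T j (lam j) (φ j)
  Λ_le : ∀ j, Λ ≤ lam j (L j)
  lam_le : ∀ j, ∀ k < L j, lam j k ≤ M
  bubble : ∀ j, ∀ ν ∈ auxSpace (L j) (φ j), sForm κ T (cell T j) ν ν ≤ M * sBubble κ T j ν

/-- The fields supported in `O`. -/
def suppSub (G : Geometry n) (O : Set (Euc (n + 1))) : Submodule ℝ (globSub G) :=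
  (fieldSub G (G.Ω ∩ O) G.Ω G.isOpen_Ω.measurableSet subset_rfl).comap (globSub G).subtype

theorem mem_suppSub {w : globSub G} :
    w ∈ suppSub G O ↔ ∀ i, MemClosure G (G.Ω ∩ O) G.Ω (w.1 i) := by
  rw [suppSub, Submodule.mem_comap]; exact mem_fieldSub

theorem mem_globSub_of_supp {w : Fields G}
    (h : ∀ i, MemClosure G (G.Ω ∩ O) G.Ω (w i)) : w ∈ globSub G :=
  mem_fieldSub.2 fun i => (h i).mono inter_subset_left

theorem ae_eq_zero_of_mem_suppSub (hO : IsOpen O) {w : globSub G} (hw : w ∈ suppSub G O) :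
    ∀ᵐ y ∂mm G G.Ω, pos G y ∉ O → ∀ i, vl (w.1 i) y = 0 ∧ gr (w.1 i) y = 0 := by
  filter_upwards [ae_all_iff.2 fun i =>
    (mem_suppSub.1 hw i).ae_eq_zero (G.isOpen_Ω.inter hO)] with y hy hyO i
  exact hy i fun h => hyO h.2

variable {κ : Permeability G κmin κmax} {ρ σ : ℝ} {T : CoarseMesh G θ H}
  {L : Fin T.numElem → ℕ} {lam : Fin T.numElem → ℕ → ℝ}
  {φ : Fin T.numElem → ℕ → Fields G} {Λ M : ℝ}

namespace Admissible

variable (A : Admissible κ ρ σ T L lam φ Λ M)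
include A

theorem τ_nonneg : 0 ≤ ρ * σ := mul_nonneg A.ρ_nonneg A.σ_nonneg

theorem mem_cell (j : Fin T.numElem) (k : ℕ) : φ j k ∈ cellSub T j :=
  memVOn_iff.1 ((A.eigen j).eigen k).1

theorem integrable_constraint {j : Fin T.numElem} (k : ℕ) {p : Fields G} (hp : p ∈ globSub G) :
    Integrable (sDen κ (meshWeight T) p (φ j k)) (mm G (cell T j)) :=
  integrable_mas T A.one_le A.H_pos A.κmin_pos κ (meas_cell T j) (cell_subset T j)
    (sqI_of_mem (mem_cellSub hp j)) (sqI_of_mem (A.mem_cell j k))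

/-- The constraints on the cell `j`. -/
def constr (j : Fin T.numElem) (k : ℕ) : globSub G →ₗ[ℝ] ℝ :=
  densLin (mm G (cell T j)) (sDen κ (meshWeight T)) (globSub G) (φ j k)
    fun _ hp => A.integrable_constraint k hp

theorem constr_apply (j : Fin T.numElem) (k : ℕ) (p : globSub G) :
    A.constr j k p = ∫ y, sDen κ (meshWeight T) p (φ j k) y ∂mm G (cell T j) := rfl

theorem constr_eq (j : Fin T.numElem) (k : ℕ) (p : globSub G) :
    A.constr j k p = sForm κ T (cell T j) p (φ j k) :=
  (sForm_cell A.one_le A.H_pos A.κmin_pos κ ⟨p, mem_cellSub p.2 j⟩ ⟨_, A.mem_cell j k⟩).symm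

theorem exists_constr_sq_le (j : Fin T.numElem) (k : ℕ) : ∃ C : ℝ, ∀ p : globSub G,
    A.constr j k p ^ 2 ≤ C * globEng A.κmin_pos κ (ρ * σ) p p := by
  obtain ⟨C, hC, h⟩ := exists_le_eng G
  have hcm := meas_cell T j
  have hcs := cell_subset T j
  have hκ := A.κmin_pos
  have hκ' := hκ.le.trans (κ.min_le_max (nonempty_of_elem j))
  set B := cellMas A.one_le A.H_pos hκ κ T j
  have hB : SemiInner B := masForm_semiInner T A.one_le A.H_pos hκ κ hcm hcs _
  set v : cellSub T j := ⟨φ j k, A.mem_cell j k⟩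
  have hw : 0 ≤ κmax * (weightMax n θ / H ^ 2) := by have := weightMax_nonneg (n := n) (θ := θ); positivity
  refine ⟨κmax * (weightMax n θ / H ^ 2) * (C / κmin) * B v v, fun p => ?_⟩
  have hpI := sqI_of_mem p.2
  refine (hB.cauchy_schwarz ⟨p, mem_cellSub p.2 j⟩ v).trans ?_
  rw [mul_right_comm _ (B v v)]
  refine mul_le_mul_of_nonneg_right ?_ (hB.nonneg v)
  rw [mul_assoc, masForm_self, engForm_self]
  refine (mas_le T A.one_le A.H_pos hκ κ hcm hcs hκ' (hpI.restrict hcm hcs)).trans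
    (mul_le_mul_of_nonneg_left ?_ hw)
  exact (valSq_mono hcm hcs hpI).trans ((le_add_of_nonneg_right (gradSq_nonneg _)).trans
    (h κmin κmax (ρ * σ) hκ κ A.τ_nonneg p p.2))

theorem gap {j : Fin T.numElem} {p : globSub G} (h : ∀ k < L j, A.constr j k p = 0) :
    Λ * mas κ (meshWeight T) (cell T j) p ≤ eng κ (ρ * σ) (cell T j) p := by
  have h1 := local_gap A.one_le A.H_pos A.κmin_pos κ A.ρ_nonneg A.σ_nonneg (A.eigen j) (L j)
    ⟨p, mem_cellSub p.2 j⟩ fun k hk => (A.constr_eq j k p).symm.trans (h k hk)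
  exact (mul_le_mul_of_nonneg_right (A.Λ_le j) (mas_nonneg T A.κmin_pos κ
    (meas_cell T j) (cell_subset T j) _)).trans h1

theorem constr_of_loc {i i' : Fin T.numElem} {w : globSub G}
    (hw : w ∈ suppSub G (interior (element T i))) (hi : i' ≠ i) (k : ℕ) :
    A.constr i' k w = 0 := by
  rw [constr_apply]
  refine integral_eq_zero_of_ae ?_
  filter_upwards [ae_mm_mono (meas_cell T i') (cell_subset T i')
    (ae_eq_zero_of_mem_suppSub isOpen_interior hw)] with y ⟨hy, hyc⟩
  have h1 := hy (Set.disjoint_right.1 (disjoint_interior_element A.one_le A.H_pos hi) hyc.1)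
  simp [sDen_apply, h1]

theorem glob_apply_loc {i : Fin T.numElem} {w : globSub G}
    (hw : w ∈ suppSub G (interior (element T i))) (p : globSub G) :
    globEng A.κmin_pos κ (ρ * σ) p w = ∫ y, aDen κ (ρ * σ) p w y ∂mm G (cell T i) := by
  rw [engForm_apply, integral_mm_eq_indicator (meas_cell T i) (cell_subset T i)]
  refine integral_congr_ae ?_
  filter_upwards [ae_eq_zero_of_mem_suppSub isOpen_interior hw,
    ae_mm_legit G.isOpen_Ω.measurableSet subset_rfl] with y hy hyl
  by_cases hyc : y ∈ pos G ⁻¹' cell T i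
  · rw [indicator_of_mem hyc]
  · rw [indicator_of_notMem hyc]
    have h1 := hy fun h => hyc ⟨interior_subset h, legit_pos hyl⟩
    simp [aDen_apply, h1]

theorem orth_loc {i i' : Fin T.numElem} {w w' : globSub G}
    (hw : w ∈ suppSub G (interior (element T i))) (hw' : w' ∈ suppSub G (interior (element T i')))
    (hi : i ≠ i') : globEng A.κmin_pos κ (ρ * σ) w w' = 0 := by
  rw [A.glob_apply_loc hw']
  refine integral_eq_zero_of_ae ?_
  filter_upwards [ae_mm_mono (meas_cell T i') (cell_subset T i')
    (ae_eq_zero_of_mem_suppSub isOpen_interior hw)] with y ⟨hy, hyc⟩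
  have h1 := hy (Set.disjoint_right.1 (disjoint_interior_element A.one_le A.H_pos hi.symm) hyc.1)
  simp [aDen_apply, h1]

/-- The localized problem of the multiscale basis functions. -/
def problem : LocalizedProblem (globSub G) (Fin T.numElem) (fun j => Fin (L j) → ℝ) where
  a := globEng A.κmin_pos κ (ρ * σ)
  e j := engForm A.κmin_pos κ (ρ * σ) (meas_cell T j) (cell_subset T j) (globSub G)
    (sqI_restrict (meas_cell T j) (cell_subset T j))
  s j := masForm T A.one_le A.H_pos A.κmin_pos κ (meas_cell T j) (cell_subset T j)
    (globSub G) (sqI_restrict (meas_cell T j) (cell_subset T j))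
  c j := LinearMap.pi fun k => A.constr j k
  loc j := suppSub G (interior (element T j))
  Λ := Λ
  D := liftConst n θ M
  C₁ := 1 + 2 * cutConst n θ
  N₀ := overlap n θ
  Λ_pos := A.Λ_pos
  D_nonneg := by
    have := cutConst_nonneg (n := n) A.one_le; have := A.M_pos
    unfold liftConst; positivity
  C₁_nonneg := by have := cutConst_nonneg (n := n) A.one_le; positivity
  N₀_nonneg := overlap_nonneg
  a_semi := engForm_semiInner _ _ A.τ_nonneg _ _ _
  e_semi _ := engForm_semiInner _ _ A.τ_nonneg _ _ _
  gap j p h := by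
    rw [masForm_self, engForm_self]
    exact A.gap fun k hk => congrFun h ⟨k, hk⟩
  lift j p := by
    obtain ⟨w, hw, h1, h2⟩ := exists_cell_lift A.one_le A.H_pos A.κmin_pos κ A.ρ_nonneg
      A.σ_nonneg (A.eigen j) A.M_pos (A.lam_le j) (A.bubble j) ⟨p, mem_cellSub p.2 j⟩
    refine ⟨⟨w, mem_globSub_of_supp hw⟩, mem_suppSub.2 hw, funext fun k => h1 k k.2, ?_⟩
    rw [masForm_self, engForm_self]
    exact h2
  constraint_loc _ _ hw _ hi := funext fun k => A.constr_of_loc hw hi k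
  apply_loc _ _ hw p := A.glob_apply_loc hw p
  orth_loc _ _ hw _ _ hw' hi := A.orth_loc hw hw' hi
  glob p := by
    choose C hC using fun q : Σ j, Fin (L j) => A.exists_constr_sq_le q.1 q.2
    obtain ⟨g, h1, h2⟩ := exists_constrained_minimal
      (engForm_semiInner A.κmin_pos κ A.τ_nonneg _ _ _) (globEng_complete A.κmin_pos κ A.τ_nonneg)
      (fun q : Σ j, Fin (L j) => A.constr q.1 q.2) C hC p
    exact ⟨g, fun j => funext fun k => h1 ⟨j, k⟩, fun v hv => h2 v fun q => congrFun (hv q.1) q.2⟩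

end Admissible

end Problem

/-! ### Layers of elements -/

section Layers

variable {n : ℕ} {G : Geometry n} {κmin κmax θ H : ℝ} {T : CoarseMesh G θ H}

/-- The sum over the cells of `J` of the restrictions of `d`. -/
def cellSum (T : CoarseMesh G θ H) (J : Finset (Fin T.numElem)) (d : Pts G → ℝ)
    (y : Pts G) : ℝ := ∑ i ∈ J, (pos G ⁻¹' cell T i).indicator d y

variable {J : Finset (Fin T.numElem)} {d : Pts G → ℝ} {y : Pts G}

theorem integrable_cellSum (hd : Integrable d (mm G G.Ω)) : Integrable (cellSum T J d) (mm G G.Ω) :=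
  integrable_finsetSum _ fun i _ => integrable_indicator_pos (meas_cell T i) hd

theorem sum_integral_cell (hd : Integrable d (mm G G.Ω)) :
    ∑ i ∈ J, ∫ y, d y ∂mm G (cell T i) = ∫ y, cellSum T J d y ∂mm G G.Ω := by
  simp only [cellSum]
  rw [integral_finsetSum _ fun i _ => integrable_indicator_pos (meas_cell T i) hd]
  exact sum_congr rfl fun i _ =>
    integral_mm_eq_indicator (meas_cell T i) (cell_subset T i) d

theorem cellSum_nonneg (hy : 0 ≤ d y) : 0 ≤ cellSum T J d y :=
  sum_nonneg fun _ _ => indicator_apply_nonneg fun _ => hy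

theorem le_cellSum (hy : 0 ≤ d y) {i : Fin T.numElem} (hi : i ∈ J) (hyi : pos G y ∈ cell T i) :
    d y ≤ cellSum T J d y := by
  have := single_le_sum (f := fun i => (pos G ⁻¹' cell T i).indicator d y)
    (fun i _ => indicator_apply_nonneg fun _ => hy) hi
  rwa [indicator_of_mem (show y ∈ pos G ⁻¹' cell T i from hyi)] at this

theorem cellSum_eq_zero (h : ∀ i ∈ J, pos G y ∉ cell T i) : cellSum T J d y = 0 :=
  sum_eq_zero fun i hi =>
    indicator_of_notMem (show y ∉ pos G ⁻¹' cell T i from h i hi) _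

theorem cellSum_le (hθ : 1 ≤ θ) (hH : 0 < H) (hy : 0 ≤ d y) :
    cellSum T J d y ≤ overlap n θ * d y := by
  classical
  refine le_trans ?_ (mul_le_mul_of_nonneg_right (card_elements_le T hθ hH (pos G y)) hy)
  rw [← nsmul_eq_mul, ← sum_const, Finset.sum_filter]
  refine (Finset.sum_le_sum_of_subset_of_nonneg (subset_univ J) fun i _ _ =>
    indicator_apply_nonneg fun _ => hy).trans (sum_le_sum fun i _ => ?_)
  rw [indicator_apply]
  by_cases h : pos G y ∈ element T i
  · rw [if_pos h]; split_ifs <;> simp [hy]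
  · rw [if_neg h, if_neg fun h' => h h'.1]

theorem measurableSet_outside (J : Finset (Fin T.numElem)) : MeasurableSet (G.Ω \ region T J) :=
  G.isOpen_Ω.measurableSet.diff (isCompact_region J).measurableSet

theorem region_mono {J' : Finset (Fin T.numElem)} (h : J ⊆ J') : region T J ⊆ region T J' :=
  Set.biUnion_subset_biUnion_left h

theorem layerSet_mono (j : Fin T.numElem) : Monotone (layerSet T j) :=
  monotone_nat_of_le_succ (layerSet_subset j)

variable {κ : Permeability G κmin κmax} {ρ σ : ℝ} {L : Fin T.numElem → ℕ}
  {lam : Fin T.numElem → ℕ → ℝ} {φ : Fin T.numElem → ℕ → Fields G} {Λ M : ℝ}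

namespace Admissible

variable (A : Admissible κ ρ σ T L lam φ Λ M)
include A

theorem ring_le (j : Fin T.numElem) (t : ℕ) (p : globSub G) :
    ∑ i ∈ layerSet T j (t + 2) \ layerSet T j (t + 1), eng κ (ρ * σ) (cell T i) p ≤
      overlap n θ * (eng κ (ρ * σ) (G.Ω \ region T (layerSet T j t)) p -
        eng κ (ρ * σ) (G.Ω \ region T (layerSet T j (t + 2))) p) := by
  classical
  have hm := G.isOpen_Ω.measurableSet
  have hD := integrable_aDen A.κmin_pos.le κ (ρ * σ) hm subset_rfl (sqI_of_mem p.2) (sqI_of_mem p.2)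
  have hI := fun t => integrable_indicator_pos (measurableSet_outside (layerSet T j t)) hD
  simp only [eng]
  rw [sum_integral_cell hD, integral_mm_eq_indicator (measurableSet_outside _) sdiff_subset,
    integral_mm_eq_indicator (measurableSet_outside _) sdiff_subset,
    ← integral_sub (hI _) (hI _), ← integral_const_mul]
  refine integral_mono_ae (integrable_cellSum hD) (((hI _).sub (hI _)).const_mul _) ?_
  filter_upwards [ae_mm_legit hm subset_rfl] with y hy
  have hd := aDen_self_nonneg A.κmin_pos.le κ A.τ_nonneg p.1 hy
  have hN : 0 ≤ overlap n θ := by unfold overlap; positivity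
  have hmono := region_mono (T := T) (layerSet_mono j (Nat.le_add_right t 2))
  have hyΩ := legit_pos hy
  simp only [indicator_apply, mem_preimage, Set.mem_sdiff, hyΩ, true_and]
  by_cases h : ∃ i ∈ layerSet T j (t + 2) \ layerSet T j (t + 1), pos G y ∈ cell T i
  · obtain ⟨i, hi, hyi⟩ := h
    rw [mem_sdiff] at hi
    have h1 : pos G y ∈ region T (layerSet T j (t + 2)) := mem_biUnion hi.1 hyi.1
    have h2 : pos G y ∉ region T (layerSet T j t) := fun h => by
      obtain ⟨i', hi', h'⟩ := Set.mem_iUnion₂.1 h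
      exact hi.2 (mem_layerSet_succ hi' hyi.1 h')
    rw [if_pos h2, if_neg (not_not.2 h1), sub_zero]
    exact cellSum_le A.one_le A.H_pos hd
  · rw [cellSum_eq_zero fun i hi hyi => h ⟨i, hi, hyi⟩]
    refine mul_nonneg hN (sub_nonneg.2 ?_)
    by_cases h2 : pos G y ∈ region T (layerSet T j (t + 2))
    · rw [if_neg (not_not.2 h2)]; split_ifs <;> [exact le_rfl; exact hd]
    · rw [if_pos h2, if_pos fun h3 => h2 (hmono h3)]

/-- The cut-off of a field around the element `j`. -/
theorem exists_layer_cut (j : Fin T.numElem) (t : ℕ) (p : globSub G) :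
    ∃ χ ∈ suppSub G (interior (oversampled T j (t + 1))), ∀ᵐ y ∂mm G G.Ω, (∀ i, vl (χ.1 i) y =
        cutoff T j t (pos G y) * vl (p.1 i) y) ∧
      (∀ i, ‖gr (χ.1 i - cutoff T j t (pos G y) • p.1 i) y‖ ^ 2
        ≤ cutConst n θ * (meshWeight T y * vl (p.1 i) y ^ 2)) ∧
      (pos G y ∉ region T (layerSet T j (t + 1) \ layerSet T j t) → ∀ i, gr (χ.1 i) y =
          cutoff T j t (pos G y) • gr (p.1 i) y) := by
  have hm := G.isOpen_Ω.measurableSet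
  obtain ⟨χ, h1, h2⟩ := exists_cut_field A.one_le A.H_pos T hm subset_rfl (mem_fieldSub.1 p.2)
    (η := cutoff T j t) (chiSum_locLip A.one_le A.H_pos _)
    (fun x hx => chiSum_mem_Icc _ (subset_closure hx)) (fun x hx h => absurd hx h)
    (isCompact_region (layerSet T j (t + 1) \ layerSet T j t)).isClosed
    (fun x hx => cutoff_locally_const hx) (fun x hx => mem_interior_of_cutoff_ne_zero hx)
  refine ⟨⟨χ, mem_globSub_of_supp h1⟩, mem_suppSub.2 h1, ?_⟩
  filter_upwards [h2, ae_mm_legit hm subset_rfl] with y hy hyl using hy.2 (legit_pos hyl)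

theorem cut_estimates (j : Fin T.numElem) (t : ℕ) (p : globSub G) :
    ∃ χ ∈ suppSub G (interior (oversampled T j (t + 1))),
      (∀ i ∈ layerSet T j t, ∀ k, A.constr i k χ = A.constr i k p) ∧
      (∀ i, i ∉ layerSet T j (t + 1) → ∀ k, A.constr i k χ = 0) ∧
      (∀ i, mas κ (meshWeight T) (cell T i) χ ≤ mas κ (meshWeight T) (cell T i) p) ∧
      (∀ i, mas κ (meshWeight T) (cell T i) ↑(p - χ) ≤ mas κ (meshWeight T) (cell T i) p) ∧
      eng κ (ρ * σ) (G.Ω \ region T (layerSet T j (t + 1))) p ≤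
        globEng A.κmin_pos κ (ρ * σ) p (p - χ) + (1 + 2 * cutConst n θ) *
          ∑ i ∈ layerSet T j (t + 1) \ layerSet T j t,
            (eng κ (ρ * σ) (cell T i) p + mas κ (meshWeight T) (cell T i) p) ∧
      globEng A.κmin_pos κ (ρ * σ) (p - χ) (p - χ) ≤
        2 * eng κ (ρ * σ) (G.Ω \ region T (layerSet T j t)) p + (1 + 2 * cutConst n θ) *
          ∑ i ∈ layerSet T j (t + 1) \ layerSet T j t, mas κ (meshWeight T) (cell T i) p := by
  classical
  obtain ⟨χ, hχ, hae⟩ := A.exists_layer_cut j t p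
  set D := layerSet T j (t + 1) \ layerSet T j t
  have hm := G.isOpen_Ω.measurableSet
  have hκ := A.κmin_pos
  have hpI := sqI_of_mem p.2
  have hc := cutConst_nonneg (n := n) A.one_le
  have h01 : ∀ y ∈ legit G, 0 ≤ cutoff T j t (pos G y) ∧ cutoff T j t (pos G y) ≤ 1 := fun y hy =>
    chiSum_mem_Icc _ (subset_closure (legit_pos hy))
  have hcI := fun (i : Fin T.numElem) {q : Fields G} (hq : q ∈ globSub G) =>
    sqI_restrict (meas_cell T i) (cell_subset T i) q hq
  have hmint := fun (i : Fin T.numElem) {q : Fields G} (hq : q ∈ globSub G) =>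
    integrable_mas T A.one_le A.H_pos hκ κ (meas_cell T i) (cell_subset T i) (hcI i hq) (hcI i hq)
  have hD := integrable_aDen hκ.le κ (ρ * σ) hm subset_rfl hpI hpI
  have hS := integrable_mas T A.one_le A.H_pos hκ κ hm subset_rfl hpI hpI
  have hpχ := fun i y (h : vl (χ.1 i) y = cutoff T j t (pos G y) * vl (p.1 i) y) =>
    show vl ((p - χ).1 i) y = (1 - cutoff T j t (pos G y)) * vl (p.1 i) y by
      rw [coe_sub, Pi.sub_apply, map_sub, Pi.sub_apply, h]; ring
  have hgχ := fun i y (h : ‖gr (χ.1 i - cutoff T j t (pos G y) • p.1 i) y‖ ^ 2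
        ≤ cutConst n θ * (meshWeight T y * vl (p.1 i) y ^ 2)) =>
    show ‖gr ((p - χ).1 i - (1 - cutoff T j t (pos G y)) • p.1 i) y‖ ^ 2
        ≤ cutConst n θ * (meshWeight T y * vl (p.1 i) y ^ 2) by
      refine le_of_eq_of_le ?_ h
      rw [← norm_neg, ← Pi.neg_apply, ← map_neg]
      congr 4
      rw [coe_sub, Pi.sub_apply, sub_smul, one_smul]; abel_nf
  have hex := fun i y (h : gr (χ.1 i) y = cutoff T j t (pos G y) • gr (p.1 i) y) =>
    show gr ((p - χ).1 i) y = (1 - cutoff T j t (pos G y)) • gr (p.1 i) y by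
      rw [coe_sub, Pi.sub_apply, map_sub, Pi.sub_apply, h, sub_smul, one_smul]
  refine ⟨χ, hχ, fun i hi k => integral_congr_ae ?_, fun i hi k => integral_eq_zero_of_ae ?_,
    fun i => integral_mono_ae (hmint i χ.2) (hmint i p.2) ?_,
    fun i => integral_mono_ae (hmint i (p - χ).2) (hmint i p.2) ?_, ?_, ?_⟩
  · filter_upwards [ae_mm_mono (meas_cell T i) (cell_subset T i) hae] with y ⟨hy, hyc⟩
    rw [sDen_cut_left _ _ hy.1, cutoff_eq_one hi hyc.1, one_mul]
  · filter_upwards [ae_mm_mono (meas_cell T i) (cell_subset T i) hae] with y ⟨hy, hyc⟩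
    rw [sDen_cut_left _ _ hy.1, cutoff_eq_zero hi hyc.1, zero_mul]; rfl
  · filter_upwards [ae_mm_mono (meas_cell T i) (cell_subset T i) hae,
      ae_mm_legit (meas_cell T i) (cell_subset T i)] with y ⟨hy, hyc⟩ hyl
    rw [sDen_cut _ hy.1]
    exact mul_le_of_le_one_left (sDen_self_nonneg hκ.le κ _ (meshWeight_nonneg y) hyl)
      (pow_le_one₀ (h01 y hyl).1 (h01 y hyl).2)
  · filter_upwards [ae_mm_mono (meas_cell T i) (cell_subset T i) hae,
      ae_mm_legit (meas_cell T i) (cell_subset T i)] with y ⟨hy, hyc⟩ hyl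
    rw [sDen_cut _ fun i => hpχ i y (hy.1 i)]
    exact mul_le_of_le_one_left (sDen_self_nonneg hκ.le κ _ (meshWeight_nonneg y) hyl)
      (pow_le_one₀ (by linarith [(h01 y hyl).2]) (by linarith [(h01 y hyl).1]))
  · have hDS : Integrable (fun y => (1 + 2 * cutConst n θ) *
        (cellSum T D (aDen κ (ρ * σ) p p) y + cellSum T D (sDen κ (meshWeight T) p p) y))
        (mm G G.Ω) := ((integrable_cellSum hD).add (integrable_cellSum hS)).const_mul _
    have hX : Integrable (fun y => aDen κ (ρ * σ) p (p - χ : globSub G) y) (mm G G.Ω) :=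
      integrable_aDen hκ.le κ _ hm subset_rfl hpI (sqI_of_mem (p - χ).2)
    simp only [eng, mas, sum_add_distrib]
    rw [sum_integral_cell hD, sum_integral_cell hS, engForm_apply,
      ← integral_add (integrable_cellSum hD) (integrable_cellSum hS), ← integral_const_mul,
      ← integral_add hX hDS, integral_mm_eq_indicator (measurableSet_outside _) sdiff_subset]
    refine integral_mono_ae (integrable_indicator_pos (measurableSet_outside _) hD) (hX.add hDS) ?_
    filter_upwards [hae, ae_mm_legit hm subset_rfl] with y hy hyl
    have hd := aDen_self_nonneg hκ.le κ A.τ_nonneg p.1 hyl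
    have hs := sDen_self_nonneg hκ.le κ p.1 (meshWeight_nonneg (T := T) y) hyl
    have hyΩ := legit_pos hyl
    by_cases hK : pos G y ∈ region T D
    · obtain ⟨i, hi, hyi⟩ := Set.mem_iUnion₂.1 hK
      have h1 := le_cellSum hd hi (show pos G y ∈ cell T i from ⟨hyi, hyΩ⟩)
      have h2 := le_cellSum hs hi (show pos G y ∈ cell T i from ⟨hyi, hyΩ⟩)
      have h3 := le_aDen_cut hκ A.τ_nonneg hyl (by linarith [(h01 y hyl).2])
        (fun i => hpχ i y (hy.1 i)) (fun i => hgχ i y (hy.2.1 i)) (κ := κ)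
      rw [indicator_of_notMem fun h => h.2 (mem_biUnion (mem_sdiff.1 hi).1 hyi)]
      nlinarith
    · have h1 : aDen κ (ρ * σ) p (p - χ : globSub G) y =
          (1 - cutoff T j t (pos G y)) * aDen κ (ρ * σ) p p y := by
        simp only [aDen_apply, hpχ _ y (hy.1 _), hex _ y (hy.2.2 hK _), real_inner_smul_right,
          mul_add, mul_sum]
        congr 1
        · exact sum_congr rfl fun _ _ => by ring
        · ring
      have h2 := cellSum_nonneg (T := T) (J := layerSet T j (t + 1) \ layerSet T j t) hd
      have h3 := cellSum_nonneg (T := T) (J := layerSet T j (t + 1) \ layerSet T j t) hs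
      have h4 : (pos G ⁻¹' (G.Ω \ region T (layerSet T j (t + 1)))).indicator
          (aDen κ (ρ * σ) p p) y ≤ aDen κ (ρ * σ) p (p - χ : globSub G) y := by
        rw [h1, indicator_apply]
        split_ifs with h
        · obtain ⟨i, hi⟩ := exists_mem_element T hyΩ
          rw [cutoff_eq_zero (fun h' => h.2 (mem_biUnion h' hi)) hi, sub_zero, one_mul]
        · exact mul_nonneg (by linarith [(h01 y hyl).2]) hd
      nlinarith
  · have hI : Integrable (fun y => 2 * (pos G ⁻¹' (G.Ω \ region T (layerSet T j t))).indicator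
        (aDen κ (ρ * σ) p p) y) (mm G G.Ω) :=
      (integrable_indicator_pos (measurableSet_outside _) hD).const_mul _
    have hS' : Integrable (fun y => (1 + 2 * cutConst n θ) *
        cellSum T D (sDen κ (meshWeight T) p p) y)
        (mm G G.Ω) := (integrable_cellSum hS).const_mul _
    simp only [eng, mas]
    rw [sum_integral_cell hS, engForm_apply,
      integral_mm_eq_indicator (measurableSet_outside _) sdiff_subset, ← integral_const_mul,
      ← integral_const_mul, ← integral_add hI hS']
    refine integral_mono_ae (integrable_aDen hκ.le κ _ hm subset_rfl (sqI_of_mem (p - χ).2)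
      (sqI_of_mem (p - χ).2)) (hI.add hS') ?_
    filter_upwards [hae, ae_mm_legit hm subset_rfl] with y hy hyl
    have hd := aDen_self_nonneg hκ.le κ A.τ_nonneg p.1 hyl
    have hs := sDen_self_nonneg hκ.le κ p.1 (meshWeight_nonneg (T := T) y) hyl
    have hyΩ := legit_pos hyl
    have h5 : (1 - cutoff T j t (pos G y)) ^ 2 * aDen κ (ρ * σ) p p y ≤
        (pos G ⁻¹' (G.Ω \ region T (layerSet T j t))).indicator (aDen κ (ρ * σ) p p) y := by
      rw [indicator_apply]
      split_ifs with h
      · exact mul_le_of_le_one_left hd (pow_le_one₀ (by linarith [(h01 y hyl).2])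
          (by linarith [(h01 y hyl).1]))
      · obtain ⟨i, hi, hyi⟩ := Set.mem_iUnion₂.1 (not_not.1 fun h' => h ⟨hyΩ, h'⟩)
        rw [cutoff_eq_one hi hyi, sub_self]; simp
    by_cases hK : pos G y ∈ region T D
    · obtain ⟨i, hi, hyi⟩ := Set.mem_iUnion₂.1 hK
      have h2 := le_cellSum hs hi (show pos G y ∈ cell T i from ⟨hyi, hyΩ⟩)
      have h3 := aDen_cut_le hκ A.τ_nonneg hyl (fun i => hpχ i y (hy.1 i))
        (fun i => hgχ i y (hy.2.1 i)) (κ := κ)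
      nlinarith
    · have h1 : aDen κ (ρ * σ) (p - χ : globSub G) (p - χ : globSub G) y =
          (1 - cutoff T j t (pos G y)) ^ 2 * aDen κ (ρ * σ) p p y := by
        simp only [aDen_apply, hpχ _ y (hy.1 _), hex _ y (hy.2.2 hK _), real_inner_smul_right,
          real_inner_smul_left, mul_add, mul_sum]
        congr 1
        · exact sum_congr rfl fun _ _ => by ring
        · ring
      nlinarith [cellSum_nonneg (T := T) (J := layerSet T j (t + 1) \ layerSet T j t) hs,
        mul_nonneg (sq_nonneg (1 - cutoff T j t (pos G y))) hd]

/-- The layers of elements around the element `j`. -/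
def layering (j : Fin T.numElem) : A.problem.Layering (layerSet T j)
    (fun t => suppSub G (interior (oversampled T j t))) where
  o t p := eng κ (ρ * σ) (G.Ω \ region T (layerSet T j t)) p
  o_nonneg _ _ := eng_nonneg A.κmin_pos κ A.τ_nonneg (measurableSet_outside _) sdiff_subset _
  o_zero_le p := eng_mono A.κmin_pos κ A.τ_nonneg (measurableSet_outside _)
    G.isOpen_Ω.measurableSet sdiff_subset subset_rfl (sqI_of_mem p.2)
  o_succ_le t p := eng_mono A.κmin_pos κ A.τ_nonneg (measurableSet_outside _)
    (measurableSet_outside _) (Set.sdiff_subset_sdiff_right (region_mono (layerSet_subset j t)))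
    sdiff_subset (sqI_of_mem p.2)
  mono := layerSet_subset j
  loc_le t i hi w hw := mem_suppSub.2 fun k => (mem_suppSub.1 hw k).mono
    (Set.inter_subset_inter_right _ (interior_mono (by
      rw [oversampled_eq]; exact Set.subset_biUnion_of_mem (u := fun i => element T i) hi)))
  cut t p := by
    obtain ⟨χ, h0, h1, h2, h3, h4, h5, h6⟩ := A.cut_estimates j t p
    exact ⟨χ, h0, fun i hi => funext fun k => h1 i hi k, fun i hi => funext fun k => h2 i hi k,
      h3, h4, h5, h6⟩
  ring_le := A.ring_le j

end Admissible

end Layers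

/-! ### An upper bound for the eigenvalues -/

section Bumps

variable {n : ℕ} {G : Geometry n} {κmin κmax θ H : ℝ}

theorem exists_ball_subset_cell (hθ : 1 ≤ θ) {x₀ : Euc (n + 1)} (hx₀ : x₀ ∈ G.Ω) :
    ∃ c : ℝ, 0 < c ∧ ∀ (H : ℝ) (_ : 0 < H) (T : CoarseMesh G θ H),
      ∃ j z, ball z (c * H) ⊆ cell T j := by
  obtain ⟨r, hr, hball⟩ := Metric.isOpen_iff.1 G.isOpen_Ω x₀ hx₀
  obtain ⟨R, hR0, hR⟩ := G.isBounded_Ω.subset_ball_lt 0 0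
  have hθ0 : 0 < θ := by linarith
  set m : ℝ := θ * (2 * R * θ) * (n + 2) with hm
  have hm0 : 0 < m := by positivity
  set τ := min 1 (r / (2 * m))
  have hτ : 0 < τ := lt_min one_pos (by positivity)
  have hτm : m * τ ≤ r / 2 := by
    calc m * τ ≤ m * (r / (2 * m)) := mul_le_mul_of_nonneg_left (min_le_right _ _) hm0.le
      _ = r / 2 := by field_simp
  refine ⟨τ / (2 * θ), by positivity, fun H hH T => ?_⟩
  obtain ⟨j, ξ, hξ, hξx⟩ := exists_mem_element T hx₀
  have hH2 := meshSize_le T hθ hH hR j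
  have hsub := ball_centre_subset hξ (τ := τ) (min_le_left _ _)
  set η := ξ + τ • (centre (n + 1) - ξ)
  have hη : η ∈ refCube (n + 1) := hsub (mem_closedBall_self (by positivity))
  have hHτ : H * τ * (θ * (n + 2)) ≤ r / 2 := by
    refine le_trans ?_ hτm
    calc H * τ * (θ * (n + 2)) ≤ 2 * R * θ * τ * (θ * (n + 2)) := by gcongr
      _ = m * τ := by rw [hm]; ring
  have e : τ / (2 * θ) * H = H / θ * (τ / 2) := by ring
  have h1 := ball_subset_image_refMap T hθ hH j (half_pos hτ) hsub
  refine ⟨j, refMap T j η, fun x hx => ⟨?_, hball ?_⟩⟩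
  · rw [e] at hx
    obtain ⟨ζ, hζ, rfl⟩ := h1 hx
    exact refMap_mem T (hsub (ball_subset_closedBall hζ))
  · have h2 : dist (refMap T j η) x₀ ≤ r / 2 := by
      rw [show x₀ = refMap T j ξ from hξx.symm, dist_eq_norm]
      refine (norm_refMap_sub_le T j hη hξ).trans (le_trans ?_ hHτ)
      have h3 : ‖η - ξ‖ ≤ τ * (n + 2) := by
        simp only [η, add_sub_cancel_left, norm_smul, norm_eq_abs, abs_of_pos hτ]
        have := norm_sub_le_of_mem_refCube (centre_mem (n := n)) hξ
        push_cast at this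
        exact mul_le_mul_of_nonneg_left (by linarith) hτ.le
      calc θ * H * ‖η - ξ‖ ≤ θ * H * (τ * (n + 2)) := by gcongr
        _ = _ := by ring
    have h3 : τ / (2 * θ) * H ≤ r / 2 := by
      refine le_trans ?_ hHτ
      rw [div_mul_eq_mul_div, div_le_iff₀ (by positivity)]
      have h4 : 1 ≤ θ * (n + 2) * (2 * θ) := by
        have : (0 : ℝ) ≤ n := n.cast_nonneg
        nlinarith [mul_nonneg this (mul_nonneg hθ0.le hθ0.le)]
      nlinarith [mul_pos hH hτ]
    rw [mem_ball] at hx ⊢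
    linarith [dist_triangle x (refMap T j η) x₀]

theorem exists_bump (d : ℕ) : ∃ K : ℝ, 0 < K ∧ ∀ (c : Euc d) (δ : ℝ), 0 < δ →
    ∃ f : Euc d → ℝ, ContDiff ℝ ∞ f ∧ HasCompactSupport f ∧
      tsupport f ⊆ closedBall c (3 / 2 * δ) ∧ (∀ x ∈ closedBall c δ, f x = 1) ∧
      ∀ x y, |f x - f y| ≤ K / δ * ‖x - y‖ := by
  let b : ContDiffBump (0 : Euc d) := ⟨1, 3 / 2, by norm_num, by norm_num⟩
  obtain ⟨K, hK⟩ := (b.contDiff (n := 1)).lipschitzWith_of_hasCompactSupport b.hasCompactSupport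
    one_ne_zero
  refine ⟨K + 1, by positivity, fun c δ hδ => ?_⟩
  have hsupp : Function.support (fun x => b (δ⁻¹ • (x - c))) ⊆ closedBall c (3 / 2 * δ) := by
    intro x hx
    have h1 : δ⁻¹ • (x - c) ∈ Function.support b := hx
    rw [b.support_eq, mem_ball_zero_iff, norm_smul, norm_eq_abs, abs_of_pos (inv_pos.2 hδ),
      inv_mul_lt_iff₀ hδ] at h1
    rw [mem_closedBall, dist_eq_norm, mul_comm]
    exact h1.le
  refine ⟨fun x => b (δ⁻¹ • (x - c)), b.contDiff.comp (by fun_prop),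
    HasCompactSupport.of_support_subset_isCompact (isCompact_closedBall _ _) hsupp,
    closure_minimal hsupp isClosed_closedBall, fun x hx => ?_, fun x y => ?_⟩
  · refine b.one_of_mem_closedBall ?_
    rw [mem_closedBall_zero_iff, norm_smul, norm_eq_abs, abs_of_pos (inv_pos.2 hδ),
      inv_mul_le_iff₀ hδ]
    change ‖x - c‖ ≤ δ * 1
    rwa [mul_one, ← dist_eq_norm]
  · have h1 := hK.dist_le_mul (δ⁻¹ • (x - c)) (δ⁻¹ • (y - c))
    rw [Real.dist_eq, dist_eq_norm, ← smul_sub, sub_sub_sub_cancel_right, norm_smul,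
      norm_eq_abs, abs_of_pos (inv_pos.2 hδ)] at h1
    refine h1.trans ?_
    rw [← mul_assoc, ← div_eq_mul_inv]
    gcongr
    linarith

/-- The pair of a smooth function with itself. -/
def diagField (G : Geometry n) (f : Euc (n + 1) → ℝ) : Fields G := fun _ => smoothField G f

variable {T : CoarseMesh G θ H} {j : Fin T.numElem} {f g : Euc (n + 1) → ℝ}

theorem diagField_mem (hf : IsTest G.Ω f) : diagField G f ∈ cellSub T j :=
  mem_fieldSub.2 fun _ => hf.memClosure (meas_cell T j) (cell_subset T j)

variable (hθ : 1 ≤ θ) (hH : 0 < H) (hκ : 0 < κmin) (κ : Permeability G κmin κmax) {τ : ℝ}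

theorem aDen_diagField_of_disjoint (h : Disjoint (tsupport f) (tsupport g)) (y) :
    aDen κ τ (diagField G f) (diagField G g) y = 0 := by
  by_cases hy : pos G y ∈ tsupport f
  · simp [aDen_apply, diagField, smoothField_eq_zero (disjoint_left.1 h hy)]
  · simp [aDen_apply, diagField, smoothField_eq_zero hy]

theorem sDen_diagField_of_disjoint (wt) (h : Disjoint (tsupport f) (tsupport g)) (y) :
    sDen κ wt (diagField G f) (diagField G g) y = 0 := by
  by_cases hy : pos G y ∈ tsupport f
  · simp [sDen_apply, diagField, smoothField_eq_zero (disjoint_left.1 h hy)]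
  · simp [sDen_apply, diagField, smoothField_eq_zero hy]

include hκ in
theorem eng_diagField_le (hκ' : 0 ≤ κmax) (hf : IsTest G.Ω f) {K r A : ℝ} (hK : 0 ≤ K) {c : Euc (n + 1)}
    (hsupp : tsupport f ⊆ closedBall c r) (hlip : ∀ x y, |f x - f y| ≤ K * ‖x - y‖)
    (hA : 0 ≤ A) (hm : mm G G.Ω (pos G ⁻¹' closedBall c r) ≤ ofReal A) :
    eng κ τ (cell T j) (diagField G f) ≤ 2 * κmax * K ^ 2 * A := by
  have hcm := meas_cell T j
  have hcs := cell_subset T j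
  have hB : MeasurableSet (pos G ⁻¹' closedBall c r) :=
    measurable_pos G isClosed_closedBall.measurableSet
  have hm' := (mm_le hcm hcs (pos G ⁻¹' closedBall c r)).trans hm
  have hI := sqI_of_mem (diagField_mem (T := T) (j := j) hf)
  calc eng κ τ (cell T j) (diagField G f)
      ≤ ∫ y, (pos G ⁻¹' closedBall c r).indicator (fun _ => 2 * κmax * K ^ 2) y
          ∂mm G (cell T j) := by
        refine integral_mono_ae (integrable_aDen hκ.le κ τ hcm hcs hI hI) ?_ ?_
        · exact (integrable_indicator_iff hB).2
            (integrableOn_const (hm'.trans_lt ENNReal.ofReal_lt_top).ne)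
        · filter_upwards [ae_mm_legit hcm hcs] with y hy
          by_cases hyB : y ∈ pos G ⁻¹' closedBall c r
          · rw [indicator_of_mem hyB, aDen_self]
            simp only [diagField, sub_self, sum_univ_two]
            have h1 := norm_gr_smoothField_le hK hy (Filter.Eventually.of_forall fun x =>
              hlip x (pos G y))
            have h2 := pow_le_pow_left₀ (norm_nonneg _) h1 2
            have h3 : ∀ i, kap κ i y * ‖gr (smoothField G f) y‖ ^ 2 ≤ κmax * K ^ 2 := fun i =>
              mul_le_mul (kap_bounds κ i hy).2 h2 (sq_nonneg _) hκ'
            linarith [h3 0, h3 1]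
          · rw [indicator_of_notMem hyB, aDen_self]
            simp [diagField, smoothField_eq_zero fun h => hyB (hsupp h)]
    _ = 2 * κmax * K ^ 2 * (mm G (cell T j)).real (pos G ⁻¹' closedBall c r) := by
        rw [integral_indicator hB, setIntegral_const, smul_eq_mul, mul_comm]
    _ ≤ _ := by
        refine mul_le_mul_of_nonneg_left ?_ (by positivity)
        exact ENNReal.toReal_le_of_le_ofReal hA hm'

include hθ hH hκ in
theorem le_mas_diagField (hf : IsTest G.Ω f) {c : Euc (n + 1)} {δ : ℝ}
    (hc : closedBall c δ ⊆ cell T j) (h1 : ∀ x ∈ closedBall c δ, f x = 1) :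
    2 * κmin * (weightMin n θ / H ^ 2) * volume.real (closedBall c δ) ≤
      mas κ (meshWeight T) (cell T j) (diagField G f) := by
  have hcm := meas_cell T j
  have hI := sqI_of_mem (diagField_mem (T := T) (j := j) hf)
  have hw := weightMin_pos (n := n) hθ
  refine le_trans ?_ (le_mas T hθ hH hκ κ hcm (cell_subset T j) hI)
  have h2 : volume.real (closedBall c δ) ≤ ip (volume.restrict (cell T j)) f f := by
    have h3 : IntegrableOn (fun x => ‖f x‖ ^ 2) (cell T j) :=
      (integrable_norm_sq (hf.contDiff.continuous.memLp_of_hasCompactSupport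
        hf.hasCompactSupport (p := 2) (μ := volume))).integrableOn
    rw [ip_self]
    calc volume.real (closedBall c δ) = ∫ x in closedBall c δ, ‖f x‖ ^ 2 := by
          rw [setIntegral_congr_fun (g := fun _ => (1 : ℝ)) isClosed_closedBall.measurableSet
            fun x hx => by simp [h1 x hx]]
          simp
      _ ≤ ∫ x in cell T j, ‖f x‖ ^ 2 :=
          setIntegral_mono_set h3 (ae_of_all _ fun x => sq_nonneg _) hc.eventuallyLE
  simp only [diagField, sum_univ_two]
  have h3 : 0 ≤ κmin * (weightMin n θ / H ^ 2) := by positivity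
  calc _ = κmin * (weightMin n θ / H ^ 2) * (volume.real (closedBall c δ) +
        volume.real (closedBall c δ)) := by ring
    _ ≤ _ := mul_le_mul_of_nonneg_left (add_le_add h2 h2) h3

/-- Some element has eigenvalues that grow at most polynomially. -/
theorem exists_eigenvalue_le (hθ : 1 ≤ θ) (hne : G.Ω.Nonempty) : ∃ C : ℝ, 0 < C ∧
    ∀ (H : ℝ) (_ : 0 < H) (T : CoarseMesh G θ H), ∃ j : Fin T.numElem, ∀ (κmin κmax ρ σ : ℝ)
      (_ : 0 < κmin) (κ : Permeability G κmin κmax) (_ : 0 ≤ ρ) (_ : 0 ≤ σ) (lam : ℕ → ℝ)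
      (φ : ℕ → Fields G) (_ : IsEigenSequence κ ρ σ T j lam φ) (L : ℕ),
      lam L ≤ C * κmax * (L + 1) ^ 3 / (κmin * H) := by
  obtain ⟨x₀, hx₀⟩ := hne
  obtain ⟨c, hc, hcork⟩ := exists_ball_subset_cell (n := n) hθ hx₀
  obtain ⟨K, hK, hbump⟩ := exists_bump (n + 1)
  obtain ⟨A, hA, hmm⟩ := exists_mm_closedBall_le G
  have hw := weightMin_pos (n := n) hθ
  set v := volume.real (closedBall (0 : Euc (n + 1)) 1)
  have hv : 0 < v := ENNReal.toReal_pos (Metric.measure_closedBall_pos _ _ one_pos).ne'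
    measure_closedBall_lt_top.ne
  refine ⟨64 * (K ^ 2 * (A * (3 / 2) ^ n) / (weightMin n θ * v * c ^ 3)) + 1, by positivity,
    fun H hH T => ?_⟩
  obtain ⟨j, z, hz⟩ := hcork H hH T
  refine ⟨j, fun κmin κmax ρ σ hκ κ hρ hσ lam φ hE L => ?_⟩
  have hκ' : 0 < κmax := hκ.trans_le (κ.min_le_max ⟨x₀, hx₀⟩)
  set δ := c * H / (4 * (L + 1)) with hδ
  have hδ0 : 0 < δ := by positivity
  have h4 : 4 * δ * (L + 1) = c * H := by rw [hδ]; field_simp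
  set e : Euc (n + 1) := EuclideanSpace.single 0 1
  have he : ‖e‖ = 1 := by simp [e]
  let pt : Fin (L + 1) → Euc (n + 1) := fun k => z + (4 * δ * k) • e
  have hpt : ∀ k, closedBall (pt k) (3 / 2 * δ) ⊆ cell T j := fun k x hx => hz <| by
    have h5 : dist (pt k) z = 4 * δ * k := by
      simp only [pt, dist_eq_norm, add_sub_cancel_left, norm_smul, he, mul_one, norm_eq_abs]
      exact abs_of_nonneg (by positivity)
    have h6 : (k : ℝ) ≤ L := Nat.cast_le.2 (Nat.lt_succ_iff.1 k.2)
    rw [mem_closedBall] at hx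
    rw [mem_ball]
    nlinarith [dist_triangle x (pt k) z, mul_le_mul_of_nonneg_left h6 hδ0.le]
  have hpt' : ∀ k k', k ≠ k' → Disjoint (closedBall (pt k) (3 / 2 * δ))
      (closedBall (pt k') (3 / 2 * δ)) := fun k k' hk => by
    refine Metric.closedBall_disjoint_closedBall ?_
    have h5 : dist (pt k) (pt k') = 4 * δ * |(k : ℝ) - k'| := by
      simp only [pt, dist_eq_norm, add_sub_add_left_eq_sub, ← sub_smul, norm_smul, he, mul_one,
        norm_eq_abs, ← mul_sub, abs_mul, abs_of_pos hδ0]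
      norm_num
    have h6 : (1 : ℝ) ≤ |(k : ℝ) - k'| := by
      have h7 : (k : ℤ) - (k' : ℤ) ≠ 0 := fun h => hk (Fin.ext (by omega))
      exact_mod_cast Int.one_le_abs h7
    rw [h5]
    nlinarith
  choose f hf1 hf2 hf3 hf4 hf5 using fun k => hbump (pt k) δ hδ0
  have htest : ∀ k, IsTest G.Ω (f k) := fun k =>
    ⟨hf1 k, hf2 k, (hf3 k).trans ((hpt k).trans (cell_subset T j))⟩
  have hdis : ∀ k k', k ≠ k' → Disjoint (tsupport (f k)) (tsupport (f k')) := fun k k' hk =>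
    (hpt' k k' hk).mono (hf3 k) (hf3 k')
  have hs : SemiInner (cellMas hθ hH hκ κ T j) :=
    masForm_semiInner T hθ hH hκ κ (meas_cell T j) (cell_subset T j) _
  have hvol : ∀ k, volume.real (closedBall (pt k) δ) = δ ^ (n + 1) * v := fun k => by
    rw [measureReal_def, Measure.addHaar_closedBall' _ _ hδ0.le, ENNReal.toReal_mul,
      ENNReal.toReal_ofReal (by positivity), finrank_euclideanSpace, Fintype.card_fin]
    rfl
  have hlow := fun k => le_mas_diagField hθ hH hκ κ (htest k)
    ((Metric.closedBall_subset_closedBall (by linarith)).trans (hpt k)) (hf4 k)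
  have hlow0 : 0 < 2 * κmin * (weightMin n θ / H ^ 2) * (δ ^ (n + 1) * v) := by positivity
  refine (gap_le_of_rayleigh_le (a := cellEng hκ κ (ρ * σ) T j) hs (m := L)
    (φ := fun k => ⟨φ k, memVOn_iff.1 (hE.eigen k).1⟩)
    (b := fun k => ⟨diagField G (f k), diagField_mem (htest k)⟩)
    (M := 64 * (K ^ 2 * (A * (3 / 2) ^ n) / (weightMin n θ * v * c ^ 3)) *
      (κmax * (L + 1) ^ 3 / (κmin * H))) (fun p hp => ?_) (fun k k' hk => ?_)
    (fun k k' hk => ?_) (fun k => ?_) fun k => ?_).trans ?_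
  · refine local_gap hθ hH hκ κ hρ hσ hE L p fun k hk => ?_
    exact (sForm_cell hθ hH hκ κ p ⟨φ k, memVOn_iff.1 (hE.eigen k).1⟩).trans (hp ⟨k, hk⟩)
  · exact integral_eq_zero_of_ae (ae_of_all _ (aDen_diagField_of_disjoint κ (hdis k k' hk)))
  · exact integral_eq_zero_of_ae (ae_of_all _ (sDen_diagField_of_disjoint κ _ (hdis k k' hk)))
  · have h5 := hlow k
    rw [hvol] at h5
    exact (hlow0.trans_le h5).ne'
  · have h5 := hlow k
    rw [hvol] at h5
    have h6 := eng_diagField_le (T := T) (j := j) (τ := ρ * σ) hκ κ hκ'.le (htest k) (by positivity)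
      (hf3 k) (hf5 k) (by positivity) (hmm (pt k) (3 / 2 * δ) (by positivity))
    refine h6.trans (le_trans (le_of_eq ?_) (mul_le_mul_of_nonneg_left h5 (by positivity)))
    have h7 : (L + 1 : ℝ) = c * H / (4 * δ) := by rw [← h4]; field_simp
    rw [h7]
    field_simp
    ring
  · rw [← mul_div_assoc, mul_assoc _ κmax]
    have h5 : 0 ≤ κmax * (L + 1 : ℝ) ^ 3 := by positivity
    gcongr
    linarith

end Bumps

/-! ### Approximation by multiscale basis functions -/

section Approximation

variable {n : ℕ} {G : Geometry n} {κmin κmax θ H : ℝ}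

/-- The squared norm in the bulk. -/
def bulkSq (G : Geometry n) (p : Fields G) : ℝ := ∑ i, ip (volume.restrict G.Ω) (p i).val (p i).val

theorem bulkSq_le_valSq {p : Fields G} (hp : SqI G G.Ω p) : bulkSq G p ≤ valSq G G.Ω p :=
  sum_le_sum fun i _ => ip_bulk_le (hp i).1

theorem sum_integral_mul_sq_le {f : Fin 2 → Euc (n + 1) → ℝ}
    (hf : ∀ i, MemLp (f i) 2 (volume.restrict G.Ω)) {p : Fields G} (hp : SqI G G.Ω p) :
    (∑ i, ∫ x in G.Ω, f i x * (p i).val x) ^ 2 ≤ l2Norm G f ^ 2 * bulkSq G p := by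
  set μ := volume.restrict G.Ω
  have hv : ∀ i, MemLp (p i).val 2 μ := fun i => (memLp_mm_iff.1 (hp i).1).1
  have h0 : ∀ i, ∫ x in G.Ω, f i x * (p i).val x = ip μ (f i) (p i).val := fun i =>
    integral_congr_ae (ae_of_all _ fun x => by simp [mul_comm])
  have h1 : l2Norm G f ^ 2 = ∑ i, ip μ (f i) (f i) := by
    rw [l2Norm, sq_sqrt (sum_nonneg fun i _ => integral_nonneg fun x => sq_nonneg _)]
    simp only [ip_self, norm_eq_abs, sq_abs, μ]
  have h2 : |∑ i, ∫ x in G.Ω, f i x * (p i).val x| ≤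
      ∑ i, √(ip μ (f i) (f i)) * √(ip μ (p i).val (p i).val) := by
    refine (Finset.abs_sum_le_sum_abs _ _).trans (sum_le_sum fun i _ => ?_)
    rw [h0]
    exact abs_ip_le (hf i) (hv i)
  rw [← sq_abs]
  refine (pow_le_pow_left₀ (abs_nonneg _) h2 2).trans
    ((Finset.sum_mul_sq_le_sq_mul_sq _ _ _).trans_eq ?_)
  rw [h1, bulkSq]
  simp only [sq_sqrt (ip_self_nonneg _), μ]

section Cover

variable (hθ : 1 ≤ θ) (hH : 0 < H) (hκ : 0 < κmin) (κ : Permeability G κmin κmax)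
  (T : CoarseMesh G θ H) {d : Pts G → ℝ}

theorem integral_le_sum_cell (hd : Integrable d (mm G G.Ω)) (h0 : ∀ y ∈ legit G, 0 ≤ d y) :
    ∫ y, d y ∂mm G G.Ω ≤ ∑ j, ∫ y, d y ∂mm G (cell T j) := by
  rw [sum_integral_cell hd]
  refine integral_mono_ae hd (integrable_cellSum hd) ?_
  filter_upwards [ae_mm_legit G.isOpen_Ω.measurableSet subset_rfl] with y hy
  obtain ⟨j, hj⟩ := exists_mem_element T (legit_pos hy)
  exact le_cellSum (h0 y hy) (mem_univ j) ⟨hj, legit_pos hy⟩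

include hθ hH in
theorem sum_cell_le (hd : Integrable d (mm G G.Ω)) (h0 : ∀ y ∈ legit G, 0 ≤ d y) :
    ∑ j, ∫ y, d y ∂mm G (cell T j) ≤ overlap n θ * ∫ y, d y ∂mm G G.Ω := by
  rw [sum_integral_cell hd, ← integral_const_mul]
  refine integral_mono_ae (integrable_cellSum hd) (hd.const_mul _) ?_
  filter_upwards [ae_mm_legit G.isOpen_Ω.measurableSet subset_rfl] with y hy
  exact cellSum_le hθ hH (h0 y hy)

end Cover

variable {κ : Permeability G κmin κmax} {ρ σ : ℝ} {T : CoarseMesh G θ H}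
  {L : Fin T.numElem → ℕ} {lam : Fin T.numElem → ℕ → ℝ}
  {φ : Fin T.numElem → ℕ → Fields G} {Λ M : ℝ}

namespace Admissible

variable (A : Admissible κ ρ σ T L lam φ Λ M)
include A

theorem mono {Λ' : ℝ} (h : 0 < Λ') (h' : Λ' ≤ Λ) : Admissible κ ρ σ T L lam φ Λ' M :=
  { A with Λ_pos := h, Λ_le := fun j => h'.trans (A.Λ_le j) }

theorem aQForm_glob (p v : globSub G) : aQForm κ ρ σ G.Ω p v = globEng A.κmin_pos κ (ρ * σ) p v :=
  aQForm_eq A.κmin_pos.le κ ρ σ G.isOpen_Ω.measurableSet subset_rfl (sqI_of_mem p.2)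
    (sqI_of_mem v.2)

theorem semiInner : SemiInner (globEng A.κmin_pos κ (ρ * σ)) :=
  engForm_semiInner A.κmin_pos κ A.τ_nonneg _ _ _

/-- The approximation property of the constraints. -/
theorem bulkSq_le {p : globSub G} (hp : ∀ j, ∀ k < L j, A.constr j k p = 0) :
    bulkSq G p ≤ overlap n θ / weightMin n θ * (H ^ 2 / (κmin * Λ)) *
      globEng A.κmin_pos κ (ρ * σ) p p := by
  have hm := G.isOpen_Ω.measurableSet
  have hpI := sqI_of_mem p.2
  have hκ := A.κmin_pos
  have hH := A.H_pos
  have hΛ := A.Λ_pos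
  have hw := weightMin_pos (n := n) A.one_le
  have h1 := le_mas T A.one_le hH hκ κ hm subset_rfl hpI
  have h2 : mas κ (meshWeight T) G.Ω p ≤ ∑ j, mas κ (meshWeight T) (cell T j) p :=
    integral_le_sum_cell T (integrable_mas T A.one_le hH hκ κ hm subset_rfl hpI hpI)
      fun y hy => sDen_self_nonneg hκ.le κ _ (meshWeight_nonneg y) hy
  have h3 : Λ * ∑ j, mas κ (meshWeight T) (cell T j) p ≤ ∑ j, eng κ (ρ * σ) (cell T j) p := by
    rw [mul_sum]
    exact sum_le_sum fun j _ => A.gap (hp j)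
  have h4 : ∑ j, eng κ (ρ * σ) (cell T j) p ≤ overlap n θ * eng κ (ρ * σ) G.Ω p :=
    sum_cell_le A.one_le hH T (integrable_aDen hκ.le κ _ hm subset_rfl hpI hpI)
      fun y hy => aDen_self_nonneg hκ.le κ A.τ_nonneg _ hy
  have h5 := (mul_le_mul_of_nonneg_left (h1.trans h2) hΛ.le).trans (h3.trans h4)
  rw [engForm_self, show overlap n θ / weightMin n θ * (H ^ 2 / (κmin * Λ)) *
    eng κ (ρ * σ) G.Ω p = overlap n θ * eng κ (ρ * σ) G.Ω p /
      (Λ * (κmin * (weightMin n θ / H ^ 2))) by field_simp, le_div_iff₀ (by positivity), mul_comm,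
      mul_assoc]
  exact h5

variable {m : ℕ} {ψ : Fin T.numElem → ℕ → Fields G}
  (hψ : ∀ j, ∀ k < L j, IsLocalBasis κ ρ σ T L φ m j k (ψ j k))

include hψ in
omit A in
theorem basis_mem (j : Fin T.numElem) {k : ℕ} (hk : k < L j) : ψ j k ∈ globSub G :=
  mem_globSub_of_supp (hψ j k hk).mem

include hψ in
omit A in
theorem msSpace_le : msSpace L ψ ≤ globSub G :=
  Submodule.span_le.2 (by rintro w ⟨j, k, hk, rfl⟩; exact basis_mem hψ j hk)

include hψ in
/-- The Galerkin property of the localized basis functions. -/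
theorem basis_apply (j : Fin T.numElem) {k : ℕ} (hk : k < L j) {v : globSub G}
    (hv : v ∈ suppSub G (interior (oversampled T j m)))
    (hv0 : ∀ i, ∀ k < L i, A.constr i k v = 0) :
    globEng A.κmin_pos κ (ρ * σ) ⟨ψ j k, basis_mem hψ j hk⟩ v = 0 := by
  have hb := hψ j k hk
  refine A.semiInner.apply_eq_zero_of_forall_le fun t => ?_
  rw [← A.aQForm_glob, ← A.aQForm_glob]
  refine hb.minimal _ (mem_suppSub.1 (add_mem (mem_suppSub.2 hb.mem) (Submodule.smul_mem _ t hv)))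
    fun i k' hk' => ?_
  rw [← A.constr_eq, map_add, map_smul, hv0 i k' hk', smul_zero, add_zero, A.constr_eq]
  exact hb.orthogonal i k' hk'

include hψ in
theorem exists_ms_approx {r : ℕ} (hr : 2 * r + 2 ≤ m) (u : globSub G) :
    ∃ w g : globSub G, w.1 ∈ msSpace L ψ ∧ (∀ j, ∀ k < L j, A.constr j k (u - g) = 0) ∧
      globEng A.κmin_pos κ (ρ * σ) g (u - g) = 0 ∧
      globEng A.κmin_pos κ (ρ * σ) (g - w) (g - w) ≤
        T.numElem * (A.problem.prefactor * A.problem.rate ^ r * liftConst n θ M *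
          ∑ j, mas κ (meshWeight T) (cell T j) u) := by
  set b : ∀ j, Fin (L j) → globSub G := fun j k => ⟨ψ j k, basis_mem hψ j k.2⟩
  set q : Fin T.numElem → globSub G := fun j => ∑ k : Fin (L j), A.constr j k u • b j k
  have hcb : ∀ i (k' : Fin (L i)) j (k : Fin (L j)),
      A.constr i k' (b j k) = if i = j ∧ (k' : ℕ) = k then 1 else 0 := fun i k' j k => by
    rw [A.constr_eq]; exact (hψ j k k.2).orthogonal i k' k'.2
  have hcq : ∀ i (k' : Fin (L i)) j, A.constr i k' (q j) = ∑ k : Fin (L j), A.constr j k u *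
      if i = j ∧ (k' : ℕ) = k then 1 else 0 := fun i k' j => by
    simp only [q, map_sum, map_smul, smul_eq_mul, hcb]
  have hqv : ∀ j, ∀ v ∈ suppSub G (interior (oversampled T j m)),
      (∀ i, A.problem.c i v = 0) → A.problem.a (q j) v = 0 := fun j v hv hv0 => by
    simp only [q]
    rw [map_sum A.problem.a, LinearMap.sum_apply]
    refine sum_eq_zero fun k _ => ?_
    rw [map_smul, LinearMap.smul_apply]
    exact smul_eq_zero_of_right _ (A.basis_apply hψ j k.2 hv fun i k' hk' => congrFun (hv0 i) ⟨k', hk'⟩)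
  obtain ⟨g, hg1, hg2, hg3⟩ := LocalizedProblem.exists_global_approximation (P := A.problem)
    A.layering (fun j => layerSet_zero j) hr u q
    (fun j => sum_mem fun k _ => Submodule.smul_mem _ _ (mem_suppSub.2 (hψ j k k.2).mem))
    (fun j => funext fun k' => by
      refine (hcq j k' j).trans ?_
      rw [sum_eq_single_of_mem k' (mem_univ _) fun k _ hk => by
        rw [if_neg fun h => hk (Fin.ext h.2.symm), mul_zero], if_pos ⟨rfl, rfl⟩, mul_one]
      rfl)
    (fun j i hi => funext fun k' => by
      refine (hcq i k' j).trans (sum_eq_zero fun k _ => ?_)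
      rw [if_neg fun h => hi h.1, mul_zero])
    hqv
  have hug : ∀ i, A.problem.c i (u - g) = 0 := fun i => by rw [map_sub, hg1, sub_self]
  refine ⟨∑ j, q j, g, ?_, fun j k hk => congrFun (hug j) ⟨k, hk⟩, hg2 _ hug, ?_⟩
  · rw [Submodule.coe_sum]
    refine sum_mem fun j _ => ?_
    simp only [q, Submodule.coe_sum]
    exact sum_mem fun k _ => Submodule.smul_mem _ _ (Submodule.subset_span ⟨j, k, k.2, rfl⟩)
  · rwa [Fintype.card_fin] at hg3

end Admissible

end Approximation

/-! ### The number of layers -/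

section Constants

variable {n : ℕ} {G : Geometry n} {κmin κmax θ H : ℝ}

/-- The decay rate of the multiscale basis functions. -/
def decayRate (n : ℕ) (θ Λ M : ℝ) : ℝ :=
  (√(liftConst n θ M / Λ) + (1 + 2 * cutConst n θ) * (1 + Λ⁻¹)) * overlap n θ /
    (1 + (√(liftConst n θ M / Λ) + (1 + 2 * cutConst n θ) * (1 + Λ⁻¹)) * overlap n θ)

/-- The prefactor of the decay estimate of the multiscale basis functions. -/
def decayPrefactor (n : ℕ) (θ Λ M : ℝ) : ℝ :=
  4 + 2 * (1 + 2 * cutConst n θ + liftConst n θ M) * overlap n θ / Λ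

theorem decayRate_mem (hθ : 1 ≤ θ) {Λ M : ℝ} (hΛ : 0 < Λ) :
    0 ≤ decayRate n θ Λ M ∧ decayRate n θ Λ M < 1 := by
  have h1 := cutConst_nonneg (n := n) hθ
  have h2 := overlap_nonneg (n := n) (θ := θ)
  have h3 : 0 ≤ (√(liftConst n θ M / Λ) + (1 + 2 * cutConst n θ) * (1 + Λ⁻¹)) * overlap n θ := by
    positivity
  unfold decayRate
  exact ⟨by positivity, by rw [div_lt_one (by linarith)]; linarith⟩

theorem exists_decay_le {q B : ℝ} (hq : 0 ≤ q) (hq1 : q < 1) (hB : 0 ≤ B) (s : ℕ) :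
    ∃ c₀ : ℝ, 0 < c₀ ∧ ∀ (X : ℝ) (m : ℕ), c₀ * max 1 (Real.log X) ≤ m →
      B * max 1 X ^ s * q ^ ((m - 2) / 2) ≤ 1 := by
  set q' := max q (1 / 2)
  have hq'0 : 0 < q' := lt_max_of_lt_right (by norm_num)
  have hγ : 0 < -Real.log q' := neg_pos.2 (Real.log_neg hq'0 (max_lt hq1 (by norm_num)))
  refine ⟨3 + 2 * (s + B) / -Real.log q', by positivity, fun X m hm => ?_⟩
  set γ := -Real.log q' with hγ'
  set ℓ := max 1 (Real.log X)
  have hℓ : 1 ≤ ℓ := le_max_left _ _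
  set r := (m - 2) / 2
  have h1 : (m : ℝ) ≤ 2 * r + 3 := by
    have : m ≤ 2 * r + 3 := by omega
    exact_mod_cast this
  have h2 : (s + B) * ℓ ≤ γ * r := by
    have h3 : 2 * (s + B) / γ * ℓ ≤ 2 * r := by nlinarith
    have h4 := mul_le_mul_of_nonneg_left h3 hγ.le
    have h5 : γ * (2 * (s + B) / γ * ℓ) = 2 * ((s + B) * ℓ) := by field_simp
    linarith
  have hX : max 1 X ≤ Real.exp ℓ := by
    refine max_le (Real.one_le_exp (by linarith)) ?_
    rcases le_or_gt X 0 with h | h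
    · exact h.trans (Real.exp_pos _).le
    · rw [← Real.exp_log h]; exact Real.exp_le_exp.2 (le_max_right _ _)
  have hB' : B ≤ Real.exp (B * ℓ) := by
    nlinarith [Real.add_one_le_exp (B * ℓ)]
  have hqr : q ^ r ≤ Real.exp (-(γ * r)) := by
    refine (pow_le_pow_left₀ hq (le_max_left q (1 / 2)) r).trans_eq ?_
    rw [hγ', neg_mul, neg_neg, mul_comm, Real.exp_nat_mul, Real.exp_log hq'0]
  calc B * max 1 X ^ s * q ^ r
      ≤ Real.exp (B * ℓ) * Real.exp ℓ ^ s * Real.exp (-(γ * r)) := by gcongr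
    _ = Real.exp ((s + B) * ℓ - γ * r) := by
        rw [← Real.exp_nat_mul, ← Real.exp_add, ← Real.exp_add]; ring_nf
    _ ≤ 1 := Real.exp_le_one_iff.2 (by linarith)

theorem exists_poly_le (hθ : 1 ≤ θ) (hne : G.Ω.Nonempty) (hκ : 0 < κmin) {M : ℝ} (hM : 0 < M) :
    ∃ (B : ℝ) (s : ℕ), 0 ≤ B ∧ ∀ (H : ℝ) (T : CoarseMesh G θ H) (κmax ρ σ : ℝ)
      (κ : Permeability G κmin κmax) (L : Fin T.numElem → ℕ) (lam : Fin T.numElem → ℕ → ℝ)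
      (φ : Fin T.numElem → ℕ → Fields G) (Λ : ℝ), Admissible κ ρ σ T L lam φ Λ M →
      T.numElem * (κmax / H ^ 2) * (κmin * Λ / H ^ 2) ≤ B * max 1 (κmax / H) ^ s := by
  obtain ⟨R, hR0, hR⟩ := G.isBounded_Ω.subset_ball_lt 0 0
  obtain ⟨C, hC, hcard⟩ := exists_card_le (n := n) G hθ
  obtain ⟨E, hE, heig⟩ := exists_eigenvalue_le (n := n) hθ hne
  have hθ0 : 0 < θ := by linarith
  set a := 4 * R * θ / κmin
  set b := C * M / κmin + 2
  have ha : 0 < a := by positivity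
  have hb : 1 ≤ b := by
    have : 0 < C * M / κmin := by positivity
    linarith
  refine ⟨a ^ (n + 1) * κmin⁻¹ ^ 3 * (E * 27 * (b ^ (n + 1)) ^ 3),
    (n + 1) + 5 + 3 * (n + 1), by positivity, fun H T κmax ρ σ κ L lam φ Λ A => ?_⟩
  have hH := A.H_pos
  have hκm := κ.min_le_max hne
  have hκ' : 0 < κmax := hκ.trans_le hκm
  set Y := max 1 (κmax / H)
  have hY : 1 ≤ Y := le_max_left _ _
  have hXY : κmax / H ≤ Y := le_max_right _ _
  have hHi : H⁻¹ ≤ κmin⁻¹ * Y := by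
    rw [← div_eq_inv_mul, le_div_iff₀ hκ, ← div_eq_inv_mul]
    exact (div_le_div_of_nonneg_right hκm hH.le).trans hXY
  have hnum : (T.numElem : ℝ) ≤ (a * Y) ^ (n + 1) := by
    refine (numElem_le T hθ hH hR0 hR).trans (pow_le_pow_left₀ (by positivity) ?_ _)
    calc 4 * R * θ / H = 4 * R * θ * H⁻¹ := by ring
      _ ≤ 4 * R * θ * (κmin⁻¹ * Y) := by gcongr
      _ = a * Y := by simp only [a]; ring
  obtain ⟨j, hj⟩ := heig H hH T
  have hL : (L j : ℝ) + 1 ≤ 3 * (b * Y) ^ (n + 1) := by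
    have h1 := hcard H hH T j κmin κmax ρ σ hκ κ A.ρ_nonneg A.σ_nonneg (lam j) (φ j) (A.eigen j) M
      hM.le (L j) (A.lam_le j)
    have h2 : C * κmax * M / (H * κmin) + 2 ≤ b * Y := by
      have h3 : C * κmax * M / (H * κmin) = C * M / κmin * (κmax / H) := by field_simp
      have h4 : C * M / κmin * (κmax / H) ≤ C * M / κmin * Y := by gcongr
      simp only [b]
      linarith
    have h3 : (C * κmax * M / (H * κmin) + 2) ^ (n + 1) ≤ (b * Y) ^ (n + 1) :=
      pow_le_pow_left₀ (by positivity) h2 _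
    have h4 : 1 ≤ (b * Y) ^ (n + 1) := one_le_pow₀ (one_le_mul_of_one_le_of_one_le hb hY)
    linarith
  have hΛ : κmin * Λ ≤ E * Y * (3 * (b * Y) ^ (n + 1)) ^ 3 := by
    have h1 := (A.Λ_le j).trans (hj κmin κmax ρ σ hκ κ A.ρ_nonneg A.σ_nonneg (lam j) (φ j)
      (A.eigen j) (L j))
    calc κmin * Λ ≤ κmin * (E * κmax * (L j + 1) ^ 3 / (κmin * H)) := by gcongr
      _ = E * (κmax / H) * (L j + 1) ^ 3 := by field_simp
      _ ≤ _ := by gcongr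
  have hΛ0 : 0 ≤ κmin * Λ := mul_nonneg hκ.le A.Λ_pos.le
  calc T.numElem * (κmax / H ^ 2) * (κmin * Λ / H ^ 2)
      = T.numElem * (κmax / H) * H⁻¹ ^ 3 * (κmin * Λ) := by field_simp
    _ ≤ (a * Y) ^ (n + 1) * Y * (κmin⁻¹ * Y) ^ 3 * (E * Y * (3 * (b * Y) ^ (n + 1)) ^ 3) := by
        gcongr
    _ = _ := by
        simp only [mul_pow, pow_add]
        ring

theorem exists_layers_bound (hθ : 1 ≤ θ) (hne : G.Ω.Nonempty) (hκ : 0 < κmin) {Λ₀ M : ℝ}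
    (hΛ₀ : 0 < Λ₀) (hM : 0 < M) {K : ℝ} (hK : 0 ≤ K) :
    ∃ c₀ : ℝ, 0 < c₀ ∧ ∀ (H : ℝ) (T : CoarseMesh G θ H) (κmax ρ σ : ℝ)
      (κ : Permeability G κmin κmax) (L : Fin T.numElem → ℕ) (lam : Fin T.numElem → ℕ → ℝ)
      (φ : Fin T.numElem → ℕ → Fields G) (Λ : ℝ), Admissible κ ρ σ T L lam φ Λ M →
      ∀ m : ℕ, c₀ * max 1 (Real.log (κmax / H)) ≤ m →
        T.numElem * (decayPrefactor n θ Λ₀ M * decayRate n θ Λ₀ M ^ ((m - 2) / 2) *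
          liftConst n θ M * (K * (κmax / H ^ 2))) ≤ H ^ 2 / (κmin * Λ) := by
  obtain ⟨B, s, hB, hpoly⟩ := exists_poly_le (G := G) hθ hne hκ hM
  have hq := decayRate_mem (n := n) (M := M) hθ hΛ₀
  have hc := cutConst_nonneg (n := n) hθ
  have hN := overlap_nonneg (n := n) (θ := θ)
  have hD : 0 ≤ liftConst n θ M := by unfold liftConst; positivity
  have hP : 0 ≤ decayPrefactor n θ Λ₀ M := by unfold decayPrefactor; positivity
  set W := decayPrefactor n θ Λ₀ M * liftConst n θ M * K
  have hW : 0 ≤ W := by positivity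
  obtain ⟨c₀, hc₀, h⟩ := exists_decay_le hq.1 hq.2 (mul_nonneg hW hB) s
  refine ⟨c₀, hc₀, fun H T κmax ρ σ κ L lam φ Λ A m hm => ?_⟩
  have hH := A.H_pos
  have hΛ := A.Λ_pos
  set Q := decayRate n θ Λ₀ M ^ ((m - 2) / 2)
  have hQ : 0 ≤ Q := pow_nonneg hq.1 _
  have h1 := mul_le_mul_of_nonneg_left (hpoly H T κmax ρ σ κ L lam φ Λ A) (mul_nonneg hW hQ)
  have h2 := h (κmax / H) m hm
  rw [le_div_iff₀ (by positivity)]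
  calc _ = W * Q * (T.numElem * (κmax / H ^ 2) * (κmin * Λ / H ^ 2)) * H ^ 2 := by
        simp only [W]; field_simp
    _ ≤ 1 * H ^ 2 := by
        refine mul_le_mul_of_nonneg_right (h1.trans (le_of_eq_of_le ?_ h2)) (sq_nonneg H)
        ring
    _ = H ^ 2 := one_mul _

variable {κ : Permeability G κmin κmax} {ρ σ : ℝ} {T : CoarseMesh G θ H}
  {L : Fin T.numElem → ℕ} {lam : Fin T.numElem → ℕ → ℝ}
  {φ : Fin T.numElem → ℕ → Fields G} {Λ M : ℝ} {m : ℕ}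
  {ψ : Fin T.numElem → ℕ → Fields G}

/-- The constant in the error estimate. -/
def errorConst (n : ℕ) (θ : ℝ) : ℝ := 2 * (overlap n θ / weightMin n θ) + 2

theorem memLp_val (p : globSub G) (i : Fin 2) : MemLp (p.1 i).val 2 (volume.restrict G.Ω) :=
  (memLp_mm_iff.1 (sqI_of_mem p.2 i).1).1

/-- The bulk values of a component. -/
def valLin (i : Fin 2) : Fields G →ₗ[ℝ] (Euc (n + 1) → ℝ) where
  toFun p := (p i).val
  map_add' _ _ := rfl
  map_smul' _ _ := rfl

/-- The bulk `L²` inner product with a field. -/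
def bulkLin (e : globSub G) : globSub G →ₗ[ℝ] ℝ :=
  ∑ i, ipForm (volume.restrict G.Ω) (valLin i) (globSub G) (fun p hp => memLp_val ⟨p, hp⟩ i) e

theorem bulkLin_apply (e v : globSub G) : bulkLin e v =
    ∑ i, ∫ x in G.Ω, (e.1 i).val x * (v.1 i).val x := by
  rw [bulkLin, LinearMap.sum_apply]
  refine sum_congr rfl fun i _ => integral_congr_ae (ae_of_all _ fun x => ?_)
  exact mul_comm _ _

theorem bulkLin_self (e : globSub G) : bulkLin e e = l2Norm G (fun i => (e.1 i).val) ^ 2 := by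
  rw [bulkLin_apply, l2Norm, sq_sqrt (sum_nonneg fun i _ =>
    integral_nonneg fun x => sq_nonneg _)]
  simp only [sq]

theorem one_le_errorConst (hθ : 1 ≤ θ) : 1 ≤ errorConst n θ := by
  have := overlap_nonneg (n := n) (θ := θ)
  have := weightMin_pos (n := n) hθ
  have : 0 ≤ overlap n θ / weightMin n θ := by positivity
  unfold errorConst; linarith

variable (A : Admissible κ ρ σ T L lam φ Λ M) {Λ₀ : ℝ} (hΛ₀ : 0 < Λ₀)
  (hΛ : Λ₀ ≤ Λ) (hψ : ∀ j, ∀ k < L j, IsLocalBasis κ ρ σ T L φ m j k (ψ j k)) (hm : 2 ≤ m)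
  {C : ℝ} (hC : 0 ≤ C) (hF : ∀ p ∈ globSub G,
    valSq G G.Ω p + gradSq G G.Ω p ≤ C / κmin * eng κ (ρ * σ) G.Ω p)
  (hlayers : T.numElem * (decayPrefactor n θ Λ₀ M * decayRate n θ Λ₀ M ^ ((m - 2) / 2) *
    liftConst n θ M * (overlap n θ * weightMax n θ * (C / κmin) ^ 2 * (κmax / H ^ 2))) ≤
      H ^ 2 / (κmin * Λ)) (hne : G.Ω.Nonempty)

include A hΛ₀ hΛ hψ hm hC hF hlayers hne

/-- The best approximation for a square integrable right-hand side. -/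
theorem Admissible.exists_approx {u : globSub G} {F : ℝ}
    (hu : ∀ v, globEng A.κmin_pos κ (ρ * σ) u v ^ 2 ≤ F ^ 2 * bulkSq G v) :
    ∃ w : globSub G, w.1 ∈ msSpace L ψ ∧ globEng A.κmin_pos κ (ρ * σ) (u - w) (u - w) ≤
        errorConst n θ * (H ^ 2 / (κmin * Λ)) * F ^ 2 := by
  have hκ := A.κmin_pos
  have hH := A.H_pos
  have hΩ := G.isOpen_Ω.measurableSet
  have hκ' := hκ.le.trans (κ.min_le_max hne)
  have hN := overlap_nonneg (n := n) (θ := θ)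
  have hW : 0 ≤ weightMax n θ := by unfold weightMax; positivity
  set a := globEng (G := G) A.κmin_pos κ (ρ * σ)
  have cancel : ∀ {x y : ℝ}, 0 ≤ x → 0 ≤ y → x ^ 2 ≤ y * x → x ≤ y := fun {x y} hx hy h => by
    rcases hx.eq_or_lt with rfl | hx
    · exact hy
    · exact le_of_mul_le_mul_right (by linarith) hx
  set A₀ := A.mono hΛ₀ hΛ
  have hD := A₀.problem.D_nonneg
  obtain ⟨w, g, hw, hcg, hg, hgw⟩ := A₀.exists_ms_approx hψ
    (show 2 * ((m - 2) / 2) + 2 ≤ m by omega) u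
  refine ⟨w, hw, ?_⟩
  have h1 : a (u - g) (u - g) ≤ F ^ 2 * (overlap n θ / weightMin n θ * (H ^ 2 / (κmin * Λ))) := by
    have h2 : a (u - g) (u - g) = a u (u - g) := by
      rw [a.map_sub u g, LinearMap.sub_apply]
      exact (congrArg _ hg).trans (sub_zero _)
    have h3 := A.bulkSq_le (p := u - g) hcg
    have h4 := weightMin_pos (n := n) A.one_le
    have h5 := A.Λ_pos
    refine cancel (A.semiInner.nonneg _) (by positivity) ?_
    rw [mul_assoc]
    refine le_trans ?_ (mul_le_mul_of_nonneg_left h3 (sq_nonneg F))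
    rw [h2]
    exact hu _
  have h2 : ∑ j, mas κ (meshWeight T) (cell T j) u ≤
      overlap n θ * weightMax n θ * (C / κmin) ^ 2 * (κmax / H ^ 2) * F ^ 2 := by
    have huI := sqI_of_mem u.2
    have h3 := hF u u.2
    have hv := valSq_nonneg (R := G.Ω) u.1
    have hg := gradSq_nonneg (R := G.Ω) u.1
    have h4 : a u u ≤ F ^ 2 * (C / κmin) := by
      refine cancel (A.semiInner.nonneg _) (by positivity) ((hu u).trans ?_)
      rw [mul_assoc]
      refine mul_le_mul_of_nonneg_left ?_ (sq_nonneg F)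
      exact (bulkSq_le_valSq huI).trans ((le_add_of_nonneg_right hg).trans h3)
    have h5 : valSq G G.Ω u ≤ C / κmin * (F ^ 2 * (C / κmin)) :=
      ((le_add_of_nonneg_right hg).trans h3).trans (mul_le_mul_of_nonneg_left h4 (by positivity))
    have h6 : ∑ j, mas κ (meshWeight T) (cell T j) u ≤ overlap n θ * mas κ (meshWeight T) G.Ω u :=
      sum_cell_le A.one_le hH T (integrable_mas T A.one_le hH hκ κ hΩ subset_rfl huI huI)
        fun y hy => sDen_self_nonneg hκ.le κ _ (meshWeight_nonneg y) hy
    have h7 := mas_le T A.one_le hH hκ κ hΩ subset_rfl hκ' huI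
    calc _ ≤ overlap n θ * (κmax * (weightMax n θ / H ^ 2) *
          (C / κmin * (F ^ 2 * (C / κmin)))) := by
          refine h6.trans (mul_le_mul_of_nonneg_left (h7.trans ?_) hN)
          exact mul_le_mul_of_nonneg_left h5 (by positivity)
      _ = _ := by ring
  have h3 : a (g - w) (g - w) ≤ H ^ 2 / (κmin * Λ) * F ^ 2 := by
    refine hgw.trans (le_trans ?_ (mul_le_mul_of_nonneg_right hlayers (sq_nonneg F)))
    rw [mul_assoc (T.numElem : ℝ), mul_assoc (_ * liftConst n θ M)]
    refine mul_le_mul_of_nonneg_left (mul_le_mul_of_nonneg_left h2 ?_) (Nat.cast_nonneg _)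
    exact mul_nonneg (mul_nonneg A₀.problem.prefactor_nonneg
      (pow_nonneg A₀.problem.rate_nonneg _)) hD
  have h4 := A.semiInner.apply_add_le (u - g) (g - w)
  rw [sub_add_sub_cancel] at h4
  refine h4.trans ?_
  unfold errorConst
  linarith

/-- The error of the multiscale Galerkin projection. -/
theorem Admissible.error_le {u r : Fields G}
    {f : Fin 2 → Euc (n + 1) → ℝ} (hu : IsOperatorImage κ ρ σ u f)
    (hr : IsProjection κ ρ σ (msSpace L ψ) u r) :
    aQForm κ ρ σ G.Ω (u - r) (u - r) ≤ errorConst n θ * (H ^ 2 / (κmin * Λ)) * l2Norm G f ^ 2 ∧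
      l2Norm G (fun i => (u i - r i).val) ≤ errorConst n θ * (H ^ 2 / (κmin * Λ)) * l2Norm G f := by
  have hκ := A.κmin_pos
  have hΛ' := A.Λ_pos
  set a := globEng (G := G) A.κmin_pos κ (ρ * σ)
  have ha : SemiInner a := A.semiInner
  set U : globSub G := ⟨u, mem_fieldSub.2 hu.mem⟩
  set e : globSub G := U - ⟨r, msSpace_le hψ hr.1⟩
  set F := l2Norm G f
  set F' := l2Norm G (fun i => (u i - r i).val)
  set E := errorConst n θ * (H ^ 2 / (κmin * Λ))
  have hE : 0 ≤ E := by
    have := one_le_errorConst (n := n) A.one_le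
    positivity
  have hF0 : 0 ≤ F := sqrt_nonneg _
  have hF'0 : 0 ≤ F' := sqrt_nonneg _
  have horth : ∀ v : globSub G, v.1 ∈ msSpace L ψ → a e v = 0 := fun v hv => by
    rw [show a e v = a U v - a ⟨r, msSpace_le hψ hr.1⟩ v by simp [e], ← A.aQForm_glob,
      ← A.aQForm_glob, sub_eq_zero]
    exact (hr.2 v hv).symm
  have hrhs : ∀ v : globSub G, a U v ^ 2 ≤ F ^ 2 * bulkSq G v := fun v => by
    rw [← A.aQForm_glob, ← hu.eq v (mem_fieldSub.1 v.2)]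
    exact sum_integral_mul_sq_le hu.memLp (sqI_of_mem v.2)
  obtain ⟨w, hw, hUw⟩ := A.exists_approx hΛ₀ hΛ hψ hm hC hF hlayers hne hrhs
  have hen : a e e ≤ E * F ^ 2 := by
    refine (ha.apply_sub_le_of_orthogonal (z := w) ?_).trans hUw
    exact horth _ (sub_mem (S := Submodule ℝ (Fields G)) (x := r) hr.1 hw)
  refine ⟨(A.aQForm_glob e e).trans_le hen, ?_⟩
  have hℓ : ∀ v : globSub G, bulkLin e v ^ 2 ≤ F' ^ 2 * bulkSq G v := fun v => by
    rw [bulkLin_apply]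
    exact sum_integral_mul_sq_le (memLp_val e) (sqI_of_mem v.2)
  obtain ⟨z, hz⟩ := exists_riesz ha (globEng_complete A.κmin_pos κ A.τ_nonneg) (bulkLin e)
    (C := F' ^ 2 * (C / κmin)) fun v => by
      refine (hℓ v).trans ?_
      rw [mul_assoc, engForm_self]
      exact mul_le_mul_of_nonneg_left ((bulkSq_le_valSq (sqI_of_mem v.2)).trans
        ((le_add_of_nonneg_right (gradSq_nonneg _)).trans (hF v v.2))) (sq_nonneg _)
  obtain ⟨w', hw', hzw⟩ := A.exists_approx hΛ₀ hΛ hψ hm hC hF hlayers hne (u := z) (F := F')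
    fun v => by rw [hz]; exact hℓ v
  have h1 : F' ^ 2 = a (z - w') e := by
    rw [a.map_sub z w', LinearMap.sub_apply, ha.symm w' e, horth w' hw', sub_zero, hz, bulkLin_self]
    rfl
  have h2 : (F' ^ 2) ^ 2 ≤ E * F' ^ 2 * (E * F ^ 2) := by
    rw [h1]
    refine (ha.cauchy_schwarz _ _).trans ?_
    rw [← h1]
    exact mul_le_mul hzw hen (ha.nonneg _) (by positivity)
  rcases hF'0.eq_or_lt with h0 | h0
  · rw [← h0]; positivity
  · refine le_of_sq_le_sq ?_ (by positivity)
    refine le_of_mul_le_mul_right ?_ (pow_pos h0 2)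
    linarith

end Constants

end DualContinuum

end

open DualContinuum in
theorem lemma4 (n : ℕ) (G : Geometry n) (θ : ℝ) (hθ : 1 ≤ θ) :
    -- `C` depends on the domain with its fractures and on the mesh regularity only
    ∃ C : ℝ, 0 < C ∧
    -- `c₀`, the constant in the condition on `m`, depends also on the lower bound of the
    -- permeabilities, on the exchange coefficients, and on the spectral bounds `Λ₀` and `M`
    ∀ κmin ρ σ Λ₀ M : ℝ, 0 < κmin → 0 ≤ ρ → 0 ≤ σ → 0 < Λ₀ → 0 < M →
    ∃ c₀ : ℝ, 0 < c₀ ∧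
    ∀ (H : ℝ) (_ : 0 < H) (T : CoarseMesh G θ H)
      (κmax : ℝ) (κ : Permeability G κmin κmax)
      (L : Fin T.numElem → ℕ) (lam : Fin T.numElem → ℕ → ℝ)
      (φ : Fin T.numElem → ℕ → Field n G.numFrac)
      (_ : ∀ j, IsEigenSequence κ ρ σ T j (lam j) (φ j))
      -- `Λ` is the minimum over the elements of the first eigenvalue that is left out
      (Λ : ℝ) (_ : IsLeast (Set.range fun j => lam j (L j)) Λ) (_ : Λ₀ ≤ Λ)
      -- `λ_max ≤ M` and `C_π ≤ M`
      (_ : ∀ j, ∀ k < L j, lam j k ≤ M)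
      (_ : ∀ j, ∀ ν ∈ auxSpace (L j) (φ j),
        sForm κ T (cell T j) ν ν ≤ M * sBubble κ T j ν)
      (m : ℕ) (_ : 2 ≤ m) (_ : c₀ * max 1 (Real.log (κmax / H)) ≤ m)
      (ψ : Fin T.numElem → ℕ → Field n G.numFrac)
      (_ : ∀ j, ∀ k < L j, IsLocalBasis κ ρ σ T L φ m j k (ψ j k))
      (u : Field n G.numFrac) (f : Fin 2 → Euc (n + 1) → ℝ) (_ : IsOperatorImage κ ρ σ u f)
      (r : Field n G.numFrac) (_ : IsProjection κ ρ σ (msSpace L ψ) u r),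
      aQNorm κ ρ σ (u - r) ≤
          C * H * κmin ^ (-(1 / 2) : ℝ) * Λ ^ (-(1 / 2) : ℝ) * l2Norm G f ∧
        l2Norm G (fun i => (u i - r i).val) ≤
          C * H ^ 2 * κmin⁻¹ * Λ⁻¹ * l2Norm G f := by
  refine ⟨errorConst n θ, one_pos.trans_le (one_le_errorConst hθ),
    fun κmin ρ σ Λ₀ M hκ hρ hσ hΛ₀ hM => ?_⟩
  by_cases hne : G.Ω.Nonempty
  swap
  · refine ⟨1, one_pos, ?_⟩
    intro H _ T κmax κ L lam φ _ Λ hΛ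
    exact absurd (nonempty_of_elem hΛ.1.choose) hne
  obtain ⟨C, hC, hF⟩ := exists_le_eng G
  obtain ⟨c₀, hc₀, hlayers⟩ := exists_layers_bound hθ hne hκ hΛ₀ hM
    (K := overlap n θ * weightMax n θ * (C / κmin) ^ 2) (by unfold weightMax overlap; positivity)
  refine ⟨c₀, hc₀, ?_⟩
  intro H hH T κmax κ L lam φ hE Λ hΛ hΛ₀Λ hlam hπ m hm hmc ψ hψ u f hu r hr
  have hΛ' : 0 < Λ := hΛ₀.trans_le hΛ₀Λ
  have A : Admissible κ ρ σ T L lam φ Λ M :=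
    ⟨hθ, hH, hκ, hρ, hσ, hΛ', hM, hE, fun j => hΛ.2 ⟨j, rfl⟩, hlam, hπ⟩
  obtain ⟨h1, h2⟩ := A.error_le hΛ₀ hΛ₀Λ hψ hm hC.le
    (hF κmin κmax (ρ * σ) hκ κ (mul_nonneg hρ hσ)) (hlayers H T κmax ρ σ κ L lam φ Λ A m hmc)
    hne hu hr
  have h3 := one_le_errorConst (n := n) hθ
  have h4 : 0 ≤ l2Norm G f := Real.sqrt_nonneg _
  refine ⟨?_, h2.trans_eq (by field_simp)⟩
  rw [aQNorm, Real.rpow_neg hκ.le, Real.rpow_neg hΛ'.le, ← Real.sqrt_eq_rpow,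
    ← Real.sqrt_eq_rpow]
  refine Real.sqrt_le_iff.2 ⟨by positivity, h1.trans ?_⟩
  rw [mul_pow, mul_pow, mul_pow, mul_pow, inv_pow, inv_pow, Real.sq_sqrt hκ.le,
    Real.sq_sqrt hΛ'.le]
  refine mul_le_mul_of_nonneg_right ?_ (sq_nonneg _)
  calc errorConst n θ * (H ^ 2 / (κmin * Λ)) ≤ errorConst n θ ^ 2 * (H ^ 2 / (κmin * Λ)) :=
        mul_le_mul_of_nonneg_right (le_self_pow₀ h3 two_ne_zero) (by positivity)
    _ = _ := by field_simp
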